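/- Let $S\subset\mathbb P^3_{\mathbb R}$ be the surface $w^2=x^2+y^2+z^2$ and let $\pi\colon S\dashrightarrow\mathbb P^1$, $\pi(w:x:y:z)=(w:z)$. Let $\mathrm{Aut}(S(\mathbb R))$ be the group of birational maps $g\colon S\dashrightarrow S$ defined over $\mathbb R$ such that $g$ and $g^{-1}$ are defined at every real point of $S$; let $\mathrm{Aut}(S(\mathbb R),\pi)$ be the subgroup of those $g$ with $\pi g=\alpha\pi$ for some $\alpha\in\mathrm{Aut}(\mathbb P^1_{\mathbb R})$, and $\mathrm{Aut}(S(\mathbb R)/\pi)$ the subgroup of those with $\pi g=\pi$. In the chart $w=1$ let $\psi\colon S_{\mathbb C}\dashrightarrow\mathbb A^2_{\mathbb C}$ be the birational map $(x,y,z)\mapsto(t,z)=(x-\mathbf i y,z)$. Identify $S_{\mathbb C}$ with $\mathbb P^1\times\mathbb P^1$ by $(w:x:y:z)\mapsto((w+z:y+\mathbf i x),(w+z:y-\mathbf i x))$. For $\mu\in\mathbb C\setminus\{\pm1\}$ with $|\mu|=1$ let $X=X(\mu)$ be the real Del Pezzo surface of degree $4$ obtained by blowing up in $S$ the points $p=(1:0)(0:1)$,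 $\bar p=(0:1)(1:0)$, $q=(1:1)(1:\mu)$, $\bar q=(1:\bar\mu)(1:1)$. Let $f,\bar f$ be the classes of bidegree $(1,0)$, $(0,1)$. The ten conic bundle structures of $X_{\mathbb C}$ form the five ordered pairs $P_1=(f+\bar f-E_p-E_{\bar p},\ f+\bar f-E_q-E_{\bar q})$, $P_2=(f+\bar f-E_p-E_q,\ f+\bar f-E_{\bar p}-E_{\bar q})$, $P_3=(f+\bar f-E_p-E_{\bar q},\ f+\bar f-E_{\bar p}-E_q)$, $P_4=(f,\ -K_X-f)$, $P_5=(\bar f,\ -K_X-\bar f)$. (1) There is a unique automorphism $g_1$ of $X$ (defined over $\mathbb R$) that fixes both members of $P_1$, exchanges $P_2$ with $P_3$ preserving the order of the members, and exchanges $P_4$ with $P_5$ reversing the order; and a unique automorphism $g_2$ of $X$ that fixes both members of $P_1$ and exchanges $P_2$ with $P_3$ and $P_4$ with $P_5$, reversing the order in both cases. As birational maps of $S$, they are the involutions $g_1'(\mu)\in\mathrm{Aut}(S(\mathbb R)/\pi)$ and $g_2'(\mu)\in\mathrm{Aut}(S(\mathbb R),\pi)\setminus\mathrm{Aut}(S(\mathbb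 R)/\pi)$ given in the coordinates $(t,z)$ by $$g_1'(\mu)\colon(t,z)\dashrightarrow\left(\frac{-2\mathbf i\mu t+(1+\mu)(1-z^2)}{\mu(2\mathbf i+(1+\mu)t)},\ z\right),$$ $$g_2'(\mu)\colon(t,z)\dashrightarrow\left(\frac{(1-z^2)(\mathbf i t(1+\mu)-2)}{-2\mu t-\mathbf i(1+\mu)(1-z^2)},\ -z\right).$$ Moreover some automorphism $c$ of $X$ that lies in $\mathrm{Aut}(S(\mathbb R))$ exchanges the two members of $P_1$ and satisfies $cg_1c^{-1}=g_2$. (Thus $g_1'(\mu)$ and $g_2'(\mu)$ describe the action of $g_1$ with respect to the first and the second of its two invariant real conic bundles.) (2) For $\mu,\mu'\in\mathbb C\setminus\{\pm1\}$ with $|\mu|=|\mu'|=1$ the following are equivalent: (a) $g_1'(\mu)$ and $g_1'(\mu')$ are conjugate in $\mathrm{Aut}(S(\mathbb R),\pi)$; (b) $g_2'(\mu)$ and $g_2'(\mu')$ are conjugate in $\mathrm{Aut}(S(\mathbb R),\pi)$; (c) $\mu'=\mu$ or $\mu'=\mu^{-1}$. (3) Let $g\in\mathrm{Aut}(S(\mathbb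 R)/\pi)$ have order $2$, and let $\mathrm{Fix}(g)\subset S_{\mathbb C}$ be its curve of fixed points, that is, the closure of the set of the fixed points of $g$ in the general fibres of $\pi$. If $\mathrm{Fix}(g)$ is an irreducible rational curve (over $\mathbb C$) without real points, then $g$ is conjugate in $\mathrm{Aut}(S(\mathbb R),\pi)$ to $g_1'(\mu)$ for some $\mu\in\mathbb C\setminus\{\pm1\}$ with $|\mu|=1$. -/

import Mathlib

open MvPolynomial
open scoped TensorProduct

namespace SphereBir

noncomputable section

/-! ### The sphere, its function field and its birational self-maps -/

/-- The polynomial `x² + y² + z² - 1`: the equation, in the chart `w = 1`, of the real surface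
`S ⊂ ℙ³` given by `w² = x² + y² + z²`. -/
def spherePoly : MvPolynomial (Fin 3) ℝ := X 0 ^ 2 + X 1 ^ 2 + X 2 ^ 2 - 1

theorem spherePoly_irreducible : Irreducible spherePoly := by
  rw [← MulEquiv.irreducible_iff (finSuccEquiv ℝ 2)]
  have hP : finSuccEquiv ℝ 2 spherePoly =
      Polynomial.X ^ 2 + Polynomial.C (X 0 ^ 2 + X 1 ^ 2 - 1 : MvPolynomial (Fin 2) ℝ) := by
    have h1 : finSuccEquiv ℝ 2 (X 1) = Polynomial.C (X 0) := finSuccEquiv_X_succ (j := 0)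
    have h2 : finSuccEquiv ℝ 2 (X 2) = Polynomial.C (X 1) := finSuccEquiv_X_succ (j := 1)
    simp only [spherePoly, map_sub, map_add, map_pow, map_one, finSuccEquiv_X_zero, h1, h2]
    ring
  rw [hP]
  have hm : (Polynomial.X ^ 2 +
      Polynomial.C (X 0 ^ 2 + X 1 ^ 2 - 1 : MvPolynomial (Fin 2) ℝ)).Monic :=
    Polynomial.monic_X_pow_add_C _ (by norm_num)
  have hd : (Polynomial.X ^ 2 +
      Polynomial.C (X 0 ^ 2 + X 1 ^ 2 - 1 : MvPolynomial (Fin 2) ℝ)).natDegree = 2 :=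
    Polynomial.natDegree_X_pow_add_C
  rw [hm.irreducible_iff_roots_eq_zero_of_degree_le_three (by omega) (by omega)]
  refine Multiset.eq_zero_of_forall_notMem fun r hr => ?_
  have h := (Polynomial.mem_roots'.1 hr).2
  simp only [Polynomial.IsRoot.def, Polynomial.eval_add, Polynomial.eval_pow, Polynomial.eval_X,
    Polynomial.eval_C] at h
  have h' := congrArg (eval (fun _ => (2 : ℝ))) h
  simp only [map_add, map_sub, map_pow, eval_X, map_one, map_zero] at h'
  nlinarith [sq_nonneg (eval (fun _ => (2 : ℝ)) r)]

/-- The coordinate ring `ℝ[x,y,z]/(x² + y² + z² - 1)` of the affine part of `S`. -/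
abbrev CoordRing : Type := MvPolynomial (Fin 3) ℝ ⧸ Ideal.span {spherePoly}

instance : (Ideal.span {spherePoly}).IsPrime :=
  (Ideal.span_singleton_prime spherePoly_irreducible.ne_zero).2 spherePoly_irreducible.prime

/-- The function field `ℝ(S)`. -/
abbrev FunField : Type := FractionRing CoordRing

/-- A polynomial in `x, y, z`, viewed as a rational function on `S`. -/
def toFun : MvPolynomial (Fin 3) ℝ →ₐ[ℝ] FunField :=
  (IsScalarTower.toAlgHom ℝ CoordRing FunField).comp (Ideal.Quotient.mkₐ ℝ _)

/-- The coordinate functions `x`, `y`, `z` on `S`. -/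
def xS : FunField := toFun (X 0)
def yS : FunField := toFun (X 1)
def zS : FunField := toFun (X 2)

/-- `Bir(S)`. A birational self-map `g` of `S` is represented by its pull-back `f ↦ f ∘ g` on
rational functions, an `ℝ`-automorphism of `ℝ(S)`; thus `g (toFun (X i))` is the `i`-th affine
coordinate of the map `g`. (The product of pull-backs is the pull-back of the composition in the
opposite order; this does not affect subgroups, orders or conjugacy.) -/
abbrev Bir : Type := FunField ≃ₐ[ℝ] FunField

/-! ### Birational diffeomorphisms -/

/-- The real points `S(ℝ)`, all of which lie in the chart `w = 1`. -/
def realPoints : Set (Fin 3 → ℝ) := {p | p 0 ^ 2 + p 1 ^ 2 + p 2 ^ 2 = 1}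

/-- The rational function `f` lies in the local ring of `S` at the real point `p`. -/
def RegularAt (p : Fin 3 → ℝ) (f : FunField) : Prop :=
  ∃ N D : MvPolynomial (Fin 3) ℝ, eval p D ≠ 0 ∧ f * toFun D = toFun N

/-- The rational map `g` is defined at every real point of `S`. (The image of a real point is a
real point, hence lies in the chart `w = 1`; so `g` is defined at `p` exactly when its three affine
coordinates are regular at `p`.) -/
def DefinedAtReal (g : Bir) : Prop :=
  ∀ p ∈ realPoints, ∀ i : Fin 3, RegularAt p (g (toFun (X i)))

/-- The rational function `f` is regular at `p`, with value `r`. -/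
def HasValue (p : Fin 3 → ℝ) (f : FunField) (r : ℝ) : Prop :=
  ∃ N D : MvPolynomial (Fin 3) ℝ, eval p D ≠ 0 ∧ f * toFun D = toFun N ∧ eval p N = r * eval p D

theorem toFun_eq_zero {F : MvPolynomial (Fin 3) ℝ} (h : toFun F = 0) {p : Fin 3 → ℝ}
    (hp : p ∈ realPoints) : eval p F = 0 := by
  have h1 : (Ideal.Quotient.mk (Ideal.span {spherePoly}) F : CoordRing) = 0 :=
    IsFractionRing.injective CoordRing FunField (by rw [map_zero]; exact h)
  rw [Ideal.Quotient.eq_zero_iff_mem, Ideal.mem_span_singleton] at h1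
  obtain ⟨G, rfl⟩ := h1
  have : eval p spherePoly = 0 := by
    simp only [spherePoly, map_add, map_sub, map_pow, eval_X, map_one]
    have : p 0 ^ 2 + p 1 ^ 2 + p 2 ^ 2 = 1 := hp
    linarith
  rw [map_mul, this, zero_mul]

theorem HasValue.unique {p : Fin 3 → ℝ} (hp : p ∈ realPoints) {f : FunField} {r r' : ℝ}
    (h : HasValue p f r) (h' : HasValue p f r') : r = r' := by
  obtain ⟨N, D, hD, hf, hr⟩ := h
  obtain ⟨N', D', hD', hf', hr'⟩ := h'
  have h0 : toFun (N * D' - N' * D) = 0 := by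
    rw [map_sub, map_mul, map_mul, ← hf, ← hf']; ring
  have h1 := toFun_eq_zero h0 hp
  rw [map_sub, map_mul, map_mul, hr, hr'] at h1
  have h2 : (r - r') * (eval p D * eval p D') = 0 := by linarith
  rcases mul_eq_zero.1 h2 with h3 | h3
  · linarith
  · exact absurd h3 (mul_ne_zero hD hD')

theorem HasValue.add {p : Fin 3 → ℝ} {f f' : FunField} {r r' : ℝ}
    (h : HasValue p f r) (h' : HasValue p f' r') : HasValue p (f + f') (r + r') := by
  obtain ⟨N, D, hD, hf, hr⟩ := h
  obtain ⟨N', D', hD', hf', hr'⟩ := h'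
  refine ⟨N * D' + N' * D, D * D', by rw [map_mul]; exact mul_ne_zero hD hD', ?_, ?_⟩
  · rw [map_add, map_mul, map_mul, map_mul, ← hf, ← hf']; ring
  · simp only [map_add, map_mul, hr, hr']; ring

theorem HasValue.mul {p : Fin 3 → ℝ} {f f' : FunField} {r r' : ℝ}
    (h : HasValue p f r) (h' : HasValue p f' r') : HasValue p (f * f') (r * r') := by
  obtain ⟨N, D, hD, hf, hr⟩ := h
  obtain ⟨N', D', hD', hf', hr'⟩ := h'
  refine ⟨N * N', D * D', by rw [map_mul]; exact mul_ne_zero hD hD', ?_, ?_⟩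
  · rw [map_mul, map_mul, ← hf, ← hf']; ring
  · simp only [map_mul, hr, hr']; ring

/-- A rational map that is defined at all real points maps each real point `p` to a real
point `q`. -/
theorem DefinedAtReal.exists_image {g : Bir} (hg : DefinedAtReal g) {p : Fin 3 → ℝ}
    (hp : p ∈ realPoints) :
    ∃ q ∈ realPoints, ∀ F : MvPolynomial (Fin 3) ℝ, HasValue p (g (toFun F)) (eval q F) := by
  have hX : ∀ i, ∃ r, HasValue p (g (toFun (X i))) r := fun i => by
    obtain ⟨N, D, hD, hf⟩ := hg p hp i
    exact ⟨eval p N / eval p D, N, D, hD, hf, by field_simp⟩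
  choose q hq using hX
  have key : ∀ F : MvPolynomial (Fin 3) ℝ, HasValue p (g (toFun F)) (eval q F) := fun F => by
    induction F using MvPolynomial.induction_on with
    | C a =>
      refine ⟨C a, 1, by simp, ?_, by simp⟩
      have : toFun (C a) = algebraMap ℝ FunField a := toFun.commutes a
      rw [this, AlgEquiv.commutes, map_one, mul_one]
    | add F G hF hG => simpa only [map_add] using hF.add hG
    | mul_X F i hF => simpa only [map_mul, eval_X] using hF.mul (hq i)
  refine ⟨q, ?_, key⟩
  have hS : toFun spherePoly = 0 := by
    have : (Ideal.Quotient.mk (Ideal.span {spherePoly}) spherePoly : CoordRing) = 0 :=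
      Ideal.Quotient.eq_zero_iff_mem.2 (Ideal.mem_span_singleton_self _)
    change algebraMap CoordRing FunField (Ideal.Quotient.mk _ spherePoly) = 0
    rw [this, map_zero]
  have h0 := key spherePoly
  rw [hS, map_zero] at h0
  have h1 : HasValue p (0 : FunField) 0 := ⟨0, 1, by simp, by simp, by simp⟩
  have h2 := h0.unique hp h1
  simp only [spherePoly, map_add, map_sub, map_pow, eval_X, map_one] at h2
  change q 0 ^ 2 + q 1 ^ 2 + q 2 ^ 2 = 1
  linarith

theorem DefinedAtReal.mul {g h : Bir} (hg : DefinedAtReal g) (hh : DefinedAtReal h) :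
    DefinedAtReal (g * h) := by
  intro p hp i
  obtain ⟨q, hq, key⟩ := hg.exists_image hp
  obtain ⟨N, D, hD, hf⟩ := hh q hq i
  obtain ⟨N₁, D₁, hD₁, hf₁, -⟩ := key N
  obtain ⟨N₂, D₂, hD₂, hf₂, hr₂⟩ := key D
  refine ⟨N₁ * D₂, D₁ * N₂, ?_, ?_⟩
  · rw [map_mul, hr₂]
    exact mul_ne_zero hD₁ (mul_ne_zero hD hD₂)
  · have hf' : g (h (toFun (X i))) * g (toFun D) = g (toFun N) := by rw [← map_mul, hf]
    rw [AlgEquiv.mul_apply, map_mul, map_mul, ← hf₁, ← hf₂, ← hf']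
    ring

theorem DefinedAtReal.one : DefinedAtReal 1 := fun _ _ i =>
  ⟨X i, 1, by simp, by simp⟩

/-- `Aut(S(ℝ))`: the birational maps `g` of `S` such that `g` and `g⁻¹` are defined at every real
point. -/
def autReal : Subgroup Bir where
  carrier := {g | DefinedAtReal g ∧ DefinedAtReal g⁻¹}
  mul_mem' := fun {g h} hg hh => ⟨hg.1.mul hh.1, by rw [mul_inv_rev]; exact hh.2.mul hg.2⟩
  one_mem' := ⟨DefinedAtReal.one, by rw [inv_one]; exact DefinedAtReal.one⟩
  inv_mem' := fun {g} hg => ⟨hg.2, by rw [inv_inv]; exact hg.1⟩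

/-! ### The fibration `π : (w : x : y : z) ↦ (w : z)` -/

/-- `g` preserves the fibration `π`: there is a real automorphism `z ↦ (a z + b) / (c z + d)` of
`ℙ¹` such that `π g` is the composition of `π` and this automorphism. -/
def PreservesPi (g : Bir) : Prop :=
  ∃ a b c d : ℝ, a * d - b * c ≠ 0 ∧
    g zS * (algebraMap ℝ FunField c * zS + algebraMap ℝ FunField d) =
      algebraMap ℝ FunField a * zS + algebraMap ℝ FunField b

/-- `Aut(S(ℝ), π)`. -/
def autRealPi : Subgroup Bir where
  carrier := {g | g ∈ autReal ∧ PreservesPi g}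
  mul_mem' := by
    rintro g h ⟨hg, a, b, c, d, hdet, hz⟩ ⟨hh, a', b', c', d', hdet', hz'⟩
    refine ⟨mul_mem hg hh, a' * a + b' * c, a' * b + b' * d, c' * a + d' * c, c' * b + d' * d,
      ?_, ?_⟩
    · have : (a' * a + b' * c) * (c' * b + d' * d) - (a' * b + b' * d) * (c' * a + d' * c) =
          (a' * d' - b' * c') * (a * d - b * c) := by ring
      rw [this]
      exact mul_ne_zero hdet' hdet
    · have h1 := congrArg g hz'
      simp only [map_mul, map_add, AlgEquiv.commutes] at h1
      rw [AlgEquiv.mul_apply]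
      simp only [map_mul, map_add]
      linear_combination (algebraMap ℝ FunField c * zS + algebraMap ℝ FunField d) * h1 +
        (algebraMap ℝ FunField a' - g (h zS) * algebraMap ℝ FunField c') * hz
  one_mem' := ⟨one_mem _, 1, 0, 0, 1, by norm_num, by simp⟩
  inv_mem' := by
    rintro g ⟨hg, a, b, c, d, hdet, hz⟩
    refine ⟨inv_mem hg, d, -b, -c, a, ?_, ?_⟩
    · intro h
      exact hdet (by linarith)
    · have h1 := congrArg (g⁻¹ : Bir) hz
      have h2 : (g⁻¹ : Bir) (g zS) = zS := by
        rw [← AlgEquiv.mul_apply, inv_mul_cancel, AlgEquiv.one_apply]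
      simp only [map_mul, map_add, AlgEquiv.commutes, h2] at h1
      simp only [map_neg]
      linear_combination -h1

/-- `Aut(S(ℝ)/π)`: the elements `g` of `Aut(S(ℝ), π)` with `π g = π`. -/
def autRealOverPi : Subgroup Bir where
  carrier := {g | g ∈ autRealPi ∧ g zS = zS}
  mul_mem' := fun {g h} hg hh =>
    ⟨mul_mem hg.1 hh.1, by rw [AlgEquiv.mul_apply, hh.2, hg.2]⟩
  one_mem' := ⟨one_mem _, rfl⟩
  inv_mem' := fun {g} hg => ⟨inv_mem hg.1, by
    conv_lhs => rw [← hg.2]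
    rw [← AlgEquiv.mul_apply, inv_mul_cancel, AlgEquiv.one_apply]⟩

/-- `g` and `g'` are conjugate by an element of `Aut(S(ℝ), π)`. -/
def ConjInAutRealPi (g g' : Bir) : Prop := ∃ h ∈ autRealPi, h * g * h⁻¹ = g'

/-! ### Complexification and the explicit involutions -/

/-- The function field `ℂ(S) = ℂ ⊗ ℝ(S)` of the complex surface `S_ℂ`. -/
abbrev CFunField : Type := ℂ ⊗[ℝ] FunField

/-- The pull-back by `g` on the rational functions on `S_ℂ`. -/
def baseChange (g : Bir) : CFunField →ₐ[ℂ] CFunField :=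
  Algebra.TensorProduct.map (AlgHom.id ℂ ℂ) (g : FunField →ₐ[ℝ] FunField)

/-- A complex constant, as a rational function on `S_ℂ`. -/
def const (c : ℂ) : CFunField := algebraMap ℂ CFunField c

/-- The coordinate functions `x`, `y`, `z` on `S_ℂ`. -/
def xC : CFunField := (1 : ℂ) ⊗ₜ[ℝ] xS
def yC : CFunField := (1 : ℂ) ⊗ₜ[ℝ] yS
def zC : CFunField := (1 : ℂ) ⊗ₜ[ℝ] zS

/-- The function `t = x - i y`; the birational map `ψ : S_ℂ ⇢ 𝔸²` is `(x, y, z) ⇢ (t, z)`. -/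
def tC : CFunField := xC - const Complex.I * yC

/-- `g` is the map `g₁'(μ)` given in the coordinates `(t, z)` by
`(t, z) ⇢ ((-2iμt + (1+μ)(1-z²)) / (μ(2i + (1+μ)t)), z)`. -/
def IsG₁' (μ : ℂ) (g : Bir) : Prop :=
  baseChange g tC * (const μ * (2 * const Complex.I + (1 + const μ) * tC)) =
      -2 * const Complex.I * const μ * tC + (1 + const μ) * (1 - zC ^ 2) ∧
    baseChange g zC = zC

/-- `g` is the map `g₂'(μ)` given in the coordinates `(t, z)` by
`(t, z) ⇢ ((1-z²)(it(1+μ) - 2) / (-2μt - i(1+μ)(1-z²)), -z)`. -/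
def IsG₂' (μ : ℂ) (g : Bir) : Prop :=
  baseChange g tC * (-2 * const μ * tC - const Complex.I * (1 + const μ) * (1 - zC ^ 2)) =
      (1 - zC ^ 2) * (const Complex.I * tC * (1 + const μ) - 2) ∧
    baseChange g zC = -zC

/-! ### The Del Pezzo surface of degree `4`

`S_ℂ` is identified with `ℙ¹ × ℙ¹` by
`(w : x : y : z) ↦ ((w + z : y + i x), (w + z : y - i x))`, and `X = X(μ)` is the blow-up of the
four points `p = (1:0)(0:1)`, `p̄ = (0:1)(1:0)`, `q = (1:1)(1:μ)`, `q̄ = (1:μ̄)(1:1)`. -/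

/-- Homogeneous coordinates `(r : s)(u : v)` of a point of `ℙ¹ × ℙ¹`. -/
structure BiPoint where
  r : ℂ
  s : ℂ
  u : ℂ
  v : ℂ

/-- The four blown-up points. -/
def ptP : BiPoint := ⟨1, 0, 0, 1⟩
def ptPbar : BiPoint := ⟨0, 1, 1, 0⟩
def ptQ (μ : ℂ) : BiPoint := ⟨1, 1, 1, μ⟩
def ptQbar (μ : ℂ) : BiPoint := ⟨1, (starRingEnd ℂ) μ, 1, 1⟩

/-- The value of the form `∑ c i j r^(a-i) s^i u^(b-j) v^j` of bidegree `(a, b)`. -/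
def biform {A : Type} [CommRing A] [Algebra ℂ A] (a b : ℕ) (c : ℕ → ℕ → ℂ) (r s u v : A) : A :=
  ∑ i ∈ Finset.range (a + 1), ∑ j ∈ Finset.range (b + 1),
    algebraMap ℂ A (c i j) * (r ^ (a - i) * s ^ i * (u ^ (b - j) * v ^ j))

/-- The complete linear system `|a f + b f̄ - ∑_{P ∈ T} E_P|`: the forms of bidegree `(a, b)` that
vanish at the points of `T`. Here `f`, `f̄` are the classes of bidegree `(1, 0)`, `(0, 1)`, and a
form is written as a function on `S_ℂ` by inserting `r = u = 1 + z`, `s = y + i x`,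
`v = y - i x`. -/
def linSys (a b : ℕ) (T : Set BiPoint) : Submodule ℂ CFunField :=
  Submodule.span ℂ {F | ∃ c : ℕ → ℕ → ℂ,
    (∀ P ∈ T, biform a b c P.r P.s P.u P.v = 0) ∧
    F = biform a b c (1 + zC) (yC + const Complex.I * xC) (1 + zC) (yC - const Complex.I * xC)}

/-- The pull-backs by `g` of the members of the linear system `W` are the members of `V`; that is,
`g` carries `V` to `W`. A linear system is a space of sections of a line bundle, so its functions
matter only up to a common nonzero factor. -/
def Carries (g : Bir) (V W : Submodule ℂ CFunField) : Prop :=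
  ∃ l : CFunFieldˣ,
    W.map (baseChange g).toLinearMap = V.map (LinearMap.mulLeft ℂ (l : CFunField))

/-- `g` is an automorphism of the Del Pezzo surface `X(μ)`. The surface is embedded in `ℙ⁴` by its
anticanonical system `|-K_X| = |2f + 2f̄ - E_p - E_p̄ - E_q - E_q̄|`, so `g` lifts to an automorphism
of `X(μ)` exactly when it preserves this system. -/
def IsDelPezzoAut (μ : ℂ) (g : Bir) : Prop :=
  Carries g (linSys 2 2 {ptP, ptPbar, ptQ μ, ptQbar μ})
    (linSys 2 2 {ptP, ptPbar, ptQ μ, ptQbar μ})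

/-- The ten conic bundle structures on `X(μ)`, arranged in five pairs `P₁, …, P₅` such that the two
classes in each pair have sum `-K_X`. -/
def conicBundle (μ : ℂ) : Fin 5 → Fin 2 → Submodule ℂ CFunField :=
  ![![linSys 1 1 {ptP, ptPbar}, linSys 1 1 {ptQ μ, ptQbar μ}],
    ![linSys 1 1 {ptP, ptQ μ}, linSys 1 1 {ptPbar, ptQbar μ}],
    ![linSys 1 1 {ptP, ptQbar μ}, linSys 1 1 {ptPbar, ptQ μ}],
    ![linSys 1 0 ∅, linSys 1 2 {ptP, ptPbar, ptQ μ, ptQbar μ}],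
    ![linSys 0 1 ∅, linSys 2 1 {ptP, ptPbar, ptQ μ, ptQbar μ}]]

/-- `g` acts on the conic bundles by sending the pair with index `i` to the pair with index `σ i`,
where the order of the two members is kept if `e i = 0` and exchanged if `e i = 1`. -/
def ActsOnBundles (μ : ℂ) (g : Bir) (σ : Fin 5 → Fin 5) (e : Fin 5 → Fin 2) : Prop :=
  ∀ i k, Carries g (conicBundle μ i k) (conicBundle μ (σ i) (k + e i))

/-- `g` is the automorphism `g₁` of `X(μ)`: it preserves both members of `P₁`, it exchanges `P₂`
with `P₃` keeping the order of the members, and `P₄` with `P₅` reversing the order. -/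
def IsDelPezzoG₁ (μ : ℂ) (g : Bir) : Prop :=
  IsDelPezzoAut μ g ∧ ActsOnBundles μ g ![0, 2, 1, 4, 3] ![0, 0, 0, 1, 1]

/-- `g` is the automorphism `g₂` of `X(μ)`: it preserves both members of `P₁` and exchanges `P₂`
with `P₃` and `P₄` with `P₅`, reversing the order of the members in both cases. -/
def IsDelPezzoG₂ (μ : ℂ) (g : Bir) : Prop :=
  IsDelPezzoAut μ g ∧ ActsOnBundles μ g ![0, 2, 1, 4, 3] ![0, 1, 1, 1, 1]

/-! ### The curve of fixed points -/

/-- `P` is a complex point of (the affine part of) `S` at which `g` is defined and which is fixed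
by `g`. -/
def IsFixedPoint (g : Bir) (P : Fin 3 → ℂ) : Prop :=
  P 0 ^ 2 + P 1 ^ 2 + P 2 ^ 2 = 1 ∧
    ∀ i : Fin 3, ∃ N D : MvPolynomial (Fin 3) ℝ,
      aeval P D ≠ 0 ∧ g (toFun (X i)) * toFun D = toFun N ∧ aeval P N = P i * aeval P D

/-- The ideal of the curve `Fix(g)` of fixed points of `g`, for `g` acting trivially on the base:
`Fix(g)` is the closure of the set of the fixed points that lie in the general fibres `z = z₀`, so
its ideal consists of the polynomials that vanish at all the fixed points in all but finitely many
fibres. -/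
def fixIdeal (g : Bir) : Ideal (MvPolynomial (Fin 3) ℂ) where
  carrier := {F | {z₀ : ℂ | ∃ P, IsFixedPoint g P ∧ P 2 = z₀ ∧ eval P F ≠ 0}.Finite}
  add_mem' := by
    intro F G hF hG
    refine (Set.Finite.union hF hG).subset ?_
    rintro z₀ ⟨P, hP, hz, h⟩
    by_cases h1 : eval P F = 0
    · exact Or.inr ⟨P, hP, hz, fun h2 => h (by rw [map_add, h1, h2, add_zero])⟩
    · exact Or.inl ⟨P, hP, hz, h1⟩
  zero_mem' := by simp
  smul_mem' := by
    intro G F hF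
    refine Set.Finite.subset hF ?_
    rintro z₀ ⟨P, hP, hz, h⟩
    exact ⟨P, hP, hz, fun h2 => h (by rw [smul_eq_mul, map_mul, h2, mul_zero])⟩

/-- The closed subset of complex affine space with ideal `I` is a rational curve: it is irreducible
and its function field is isomorphic to `ℂ(u)`. -/
def IsRationalCurve (I : Ideal (MvPolynomial (Fin 3) ℂ)) : Prop :=
  I.IsPrime ∧ Nonempty (FractionRing (MvPolynomial (Fin 3) ℂ ⧸ I) ≃ₐ[ℂ] RatFunc ℂ)

/-- The closed set with ideal `I` contains no real point of `S`. -/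
def HasNoRealPoint (I : Ideal (MvPolynomial (Fin 3) ℂ)) : Prop :=
  ∀ p ∈ realPoints, ∃ F ∈ I, eval (fun i => (p i : ℂ)) F ≠ 0

end

end SphereBir

open SphereBir

namespace SphereBir

noncomputable section

/-! Everything is done in function fields. Real points are Zariski dense in S, so a sum of two
squares vanishes in ℝ(S) only trivially, and ℂ ⊗ ℝ(S) is a field. With t̄ = x + iy one has t t̄ = 1
- z²; hence this field is ℂ(t, z), and complex conjugation sends t to (1 - z²)/t. A map that
preserves π acts on t by a fractional linear transformation over ℂ(z). The matrices (a, b(1 - z²);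
b̄, ā) are compatible with the conjugation; such a matrix gives an element of Aut(S(ℝ)/π) as soon as
its determinant N = |a|² - |b|²(1 - z²) has no zero on [-1, 1] (`QPoly.exists_acts`,
`QPoly.Acts.mem_autRealOverPi`).

Part (1). Put r = 1 + z, s = it, v = -i t̄. Then `g₁'` fixes r and multiplies s by -b/a, where a = 2
- (1 + μ)s and b = 2 - (1 + μ̄)v. Explicit bases of the ten pencils turn the action on conic bundles
into identities (`IsG₁'.isDelPezzoG₁`), and the anticanonical system is a sum of products of
complementary pencils. Uniqueness holds because an automorphism that preserves four suitable pencils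
is the identity (`eq_one_of_carries`). The linear involution c of the quadric that exchanges p with
q̄ and q with p̄ swaps the members of P₁. The map c g₁ c⁻¹ has the formula of `g₂'` (`isG₂'_conj`),
so every assertion about g₂ is transported from g₁.

Part (2). The invariant is |1 + μ|², which determines μ up to inversion. An element of Aut(S(ℝ), π)
acts on the base by z ↦ ±(z + r)/(1 + rz). For `g₁'`, conjugation preserves the determinant 4 - |1 +
μ|²(1 - z²) up to squares and such a base change; its zeros lie on the imaginary axis, which forces
r = 0 and equality of the invariants (`kap_eq_of_conj_g₁'`). The map `g₂'` moves z, so it is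
composed with complex conjugation. The determinants then differ by a factor k k^σ, which is
nonnegative on the imaginary axis, and a comparison of signs there gives an inequality in each
direction (`kap_le_of_conj_g₂'`). Conversely a rotation about the z-axis conjugates the maps for μ
to those for μ⁻¹.

Part (3). An involution over the base has a traceless matrix, which may be taken primitive with real
structure (`exists_qPoly_of_involution`). Its curve of fixed points is the double cover s² = -N(z).
Absence of real points gives N ≥ 0; irreducibility and rationality leave exactly two branch points,
so N is a square times a positive definite quadratic (`QPoly.Acts.exists_norm_eq`). Injectivity on
S(ℝ) excludes zeros of N on [-1, 1]. A hyperbolic translation of the base moves the branch points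
onto the imaginary axis, so N agrees up to a square with the norm of a conjugate of some `g₁'(μ)`.
Finally, traceless matrices M, M' with equal determinant satisfy M² = M'², so M + M' intertwines
them; a choice of sign makes the intertwiner an element of Aut(S(ℝ)/π)
(`QPoly.exists_conj_of_norm_eq`). -/

instance : Semiring CoordRing := CommSemiring.toSemiring
instance : Module CoordRing CoordRing := Semiring.toModule
instance : DistribMulAction CoordRing CoordRing := Module.toDistribMulAction
instance : MulAction CoordRing CoordRing := DistribMulAction.toMulAction
instance : Field FunField := FractionRing.field CoordRing
instance : Semiring FunField := CommSemiring.toSemiring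
instance : Monoid FunField := MonoidWithZero.toMonoid
instance : MonoidWithZero FunField := Semiring.toMonoidWithZero
instance : Algebra ℝ FunField := OreLocalization.instAlgebra
instance : Module ℝ FunField := Algebra.toModule
instance : DistribMulAction ℝ FunField := Module.toDistribMulAction
instance : AddCommMonoid FunField := NonUnitalNonAssocSemiring.toAddCommMonoid
instance : Add FunField := Distrib.toAdd
instance : Mul FunField := Distrib.toMul
instance : Semiring CFunField := Algebra.TensorProduct.instSemiring
instance : Monoid CFunField := MonoidWithZero.toMonoid
instance : MonoidWithZero CFunField := Semiring.toMonoidWithZero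
instance : Algebra ℂ CFunField := Algebra.TensorProduct.leftAlgebra
instance : Algebra ℝ CFunField := Algebra.TensorProduct.instAlgebra
instance : Module ℂ CFunField := Algebra.toModule
instance : Module ℝ CFunField := TensorProduct.instModule
instance : DistribMulAction ℂ CFunField := Module.toDistribMulAction
instance : DistribMulAction ℝ CFunField := Module.toDistribMulAction

/-! ### Real points are dense -/

theorem toFun_eq_zero_iff (F : MvPolynomial (Fin 3) ℝ) : toFun F = 0 ↔ spherePoly ∣ F := by
  rw [← Ideal.mem_span_singleton, ← Ideal.Quotient.eq_zero_iff_mem]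
  constructor
  · intro h
    exact IsFractionRing.injective CoordRing FunField (by rw [map_zero]; exact h)
  · intro h
    change algebraMap CoordRing FunField (Ideal.Quotient.mk _ F) = 0
    rw [h, map_zero]

theorem toFun_spherePoly : toFun spherePoly = 0 := (toFun_eq_zero_iff _).2 dvd_rfl

/-- Division with remainder by `spherePoly`, which is monic of degree two in x. In the inductive
step, multiplication by x uses x² = 1 - y² - z². -/
theorem exists_linear_normalForm (F : MvPolynomial (Fin 3) ℝ) :
    ∃ A B : MvPolynomial (Fin 2) ℝ,
      spherePoly ∣ F - (rename Fin.succ A + X 0 * rename Fin.succ B) := by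
  induction F using MvPolynomial.induction_on with
  | C a => exact ⟨C a, 0, by simp⟩
  | add F G hF hG =>
    obtain ⟨A, B, hF⟩ := hF
    obtain ⟨A', B', hG⟩ := hG
    refine ⟨A + A', B + B', ?_⟩
    convert dvd_add hF hG using 1
    simp only [map_add]
    ring
  | mul_X F i hF =>
    obtain ⟨A, B, Q, hQ⟩ := hF
    refine Fin.cases ?_ (fun j => ?_) i
    · refine ⟨(1 - X 0 ^ 2 - X 1 ^ 2) * B, A, X 0 * Q + rename Fin.succ B, ?_⟩
      have h0 : F = spherePoly * Q + (rename Fin.succ A + X 0 * rename Fin.succ B) := by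
        rw [← hQ]; ring
      have e1 : (Fin.succ 0 : Fin 3) = 1 := rfl
      have e2 : (Fin.succ 1 : Fin 3) = 2 := rfl
      simp only [h0, map_mul, map_sub, map_one, map_pow, rename_X, spherePoly, e1, e2]
      ring
    · refine ⟨A * X j, B * X j, Q * X j.succ, ?_⟩
      have h0 : F = spherePoly * Q + (rename Fin.succ A + X 0 * rename Fin.succ B) := by
        rw [← hQ]; ring
      simp only [h0, map_mul, rename_X]
      ring

/-- A polynomial that vanishes on the real sphere is zero in the function field. -/
theorem toFun_eq_zero_of_forall {F : MvPolynomial (Fin 3) ℝ}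
    (h : ∀ p ∈ realPoints, eval p F = 0) : toFun F = 0 := by
  obtain ⟨A, B, hQ⟩ := exists_linear_normalForm F
  -- Over each point (y, z) of this square lie two real points, with first coordinates x and -x, x >
  -- 0. Hence A + xB and A - xB both vanish there.
  have key : ∀ q : Fin 2 → ℝ, q ∈ Set.pi .univ (fun _ : Fin 2 => Set.Ioo (-(1/2) : ℝ) (1/2)) →
      eval q A = 0 ∧ eval q B = 0 := by
    intro q hq
    have h0 := hq 0 trivial
    have h1 := hq 1 trivial
    have hpos : 0 < 1 - q 0 ^ 2 - q 1 ^ 2 := by nlinarith [h0.1, h0.2, h1.1, h1.2]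
    set x := Real.sqrt (1 - q 0 ^ 2 - q 1 ^ 2) with hx
    have hx2 : x ^ 2 = 1 - q 0 ^ 2 - q 1 ^ 2 := Real.sq_sqrt hpos.le
    have hx0 : 0 < x := Real.sqrt_pos.2 hpos
    have ev : ∀ u : ℝ, u ^ 2 = 1 - q 0 ^ 2 - q 1 ^ 2 → eval q A + u * eval q B = 0 := by
      intro u hu
      have hp : (Fin.cons u q : Fin 3 → ℝ) ∈ realPoints := by
        change u ^ 2 + q 0 ^ 2 + q 1 ^ 2 = 1
        linarith
      obtain ⟨Q, hQ⟩ := hQ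
      have h2 := congrArg (eval (Fin.cons u q : Fin 3 → ℝ)) hQ
      have h3 : eval (Fin.cons u q : Fin 3 → ℝ) spherePoly = 0 :=
        toFun_eq_zero toFun_spherePoly hp
      have h4 : (Fin.cons u q : Fin 3 → ℝ) ∘ Fin.succ = q := by ext i; simp
      simp only [map_sub, map_add, map_mul, h3, zero_mul, h _ hp, eval_X, eval_rename, h4,
        Fin.cons_zero] at h2
      linarith
    have e1 := ev x hx2
    have e2 := ev (-x) (by rw [neg_sq]; exact hx2)
    have hB : x * eval q B = 0 := by linarith
    have hA : eval q A = 0 := by linarith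
    exact ⟨hA, (mul_eq_zero.1 hB).resolve_left hx0.ne'⟩
  have hinf : ∀ _ : Fin 2, (Set.Ioo (-(1/2) : ℝ) (1/2)).Infinite := fun _ =>
    Set.Ioo_infinite (by norm_num)
  have hA : A = 0 := funext_set _ hinf fun q hq => by rw [(key q hq).1, map_zero]
  have hB : B = 0 := funext_set _ hinf fun q hq => by rw [(key q hq).2, map_zero]
  rw [toFun_eq_zero_iff]
  simpa [hA, hB] using hQ

theorem exists_toFun_div (f : FunField) :
    ∃ N D : MvPolynomial (Fin 3) ℝ, toFun D ≠ 0 ∧ f * toFun D = toFun N := by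
  obtain ⟨n, d, hd, rfl⟩ := IsFractionRing.div_surjective (A := CoordRing) f
  obtain ⟨N, rfl⟩ := Ideal.Quotient.mk_surjective n
  obtain ⟨D, rfl⟩ := Ideal.Quotient.mk_surjective d
  have h0 : toFun D ≠ 0 := by
    change algebraMap CoordRing FunField (Ideal.Quotient.mk _ D) ≠ 0
    exact IsFractionRing.to_map_ne_zero_of_mem_nonZeroDivisors hd
  exact ⟨N, D, h0, div_mul_cancel₀ _ h0⟩

/-- After clearing denominators this is the corresponding fact for real values, since a polynomial
that vanishes at all real points is zero in ℝ(S). It is what makes the complexification a field. -/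
theorem sq_add_sq_eq_zero {a b : FunField} (h : a ^ 2 + b ^ 2 = 0) : a = 0 ∧ b = 0 := by
  obtain ⟨N, D, hD, hN⟩ := exists_toFun_div a
  obtain ⟨N', D', hD', hN'⟩ := exists_toFun_div b
  have h1 : toFun ((N * D') ^ 2 + (N' * D) ^ 2) = 0 := by
    simp only [map_add, map_pow, map_mul, ← hN, ← hN']
    linear_combination (toFun D * toFun D') ^ 2 * h
  have h2 : ∀ p ∈ realPoints, eval p (N * D') = 0 ∧ eval p (N' * D) = 0 := by
    intro p hp
    have h3 := toFun_eq_zero h1 hp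
    rw [map_add, map_pow, map_pow] at h3
    exact ⟨by nlinarith, by nlinarith⟩
  have h3 := toFun_eq_zero_of_forall fun p hp => (h2 p hp).1
  have h4 := toFun_eq_zero_of_forall fun p hp => (h2 p hp).2
  rw [map_mul, ← hN, mul_eq_zero, mul_eq_zero] at h3
  rw [map_mul, ← hN', mul_eq_zero, mul_eq_zero] at h4
  tauto

instance : CharZero FunField := charZero_of_injective_algebraMap (algebraMap ℝ FunField).injective

/-! ### The complex function field is a field -/

/-- The inclusion of the real function field. -/
def incl : FunField →ₐ[ℝ] CFunField := Algebra.TensorProduct.includeRight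

theorem incl_apply (f : FunField) : incl f = (1 : ℂ) ⊗ₜ[ℝ] f := rfl

theorem const_mul_incl (c : ℂ) (f : FunField) : const c * incl f = c ⊗ₜ[ℝ] f := by
  rw [const, incl_apply, Algebra.TensorProduct.algebraMap_apply,
    Algebra.TensorProduct.tmul_mul_tmul]
  simp

theorem incl_algebraMap (r : ℝ) : incl (algebraMap ℝ FunField r) = const r := by
  rw [incl_apply, const, Algebra.TensorProduct.algebraMap_apply, Algebra.algebraMap_eq_smul_one,
    ← TensorProduct.smul_tmul]
  simp

theorem const_I_sq : const Complex.I ^ 2 = -1 := by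
  rw [const, ← map_pow, Complex.I_sq, map_neg, map_one]

/-- Real and imaginary part. -/
def rePart : CFunField →ₗ[ℝ] FunField :=
  (TensorProduct.lid ℝ FunField).toLinearMap ∘ₗ LinearMap.rTensor FunField Complex.reLm
def imPart : CFunField →ₗ[ℝ] FunField :=
  (TensorProduct.lid ℝ FunField).toLinearMap ∘ₗ LinearMap.rTensor FunField Complex.imLm

theorem rePart_tmul (c : ℂ) (f : FunField) : rePart (c ⊗ₜ[ℝ] f) = c.re • f := by
  simp [rePart]

theorem imPart_tmul (c : ℂ) (f : FunField) : imPart (c ⊗ₜ[ℝ] f) = c.im • f := by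
  simp [imPart]

theorem re_add_im (w : CFunField) : w = incl (rePart w) + const Complex.I * incl (imPart w) := by
  induction w using TensorProduct.induction_on with
  | zero => simp
  | tmul c f =>
    rw [rePart_tmul, imPart_tmul, const_mul_incl, incl_apply, ← TensorProduct.smul_tmul,
      ← TensorProduct.smul_tmul, ← TensorProduct.add_tmul]
    congr 1
    conv_lhs => rw [← Complex.re_add_im c]
    simp
  | add w w' h h' =>
    conv_lhs => rw [h, h']
    simp only [map_add]
    ring

theorem rePart_mk (a b : FunField) : rePart (incl a + const Complex.I * incl b) = a := by
  rw [const_mul_incl, incl_apply, map_add, rePart_tmul, rePart_tmul]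
  simp

theorem imPart_mk (a b : FunField) : imPart (incl a + const Complex.I * incl b) = b := by
  rw [const_mul_incl, incl_apply, map_add, imPart_tmul, imPart_tmul]
  simp

theorem mk_eq_zero {a b : FunField} (h : incl a + const Complex.I * incl b = 0) :
    a = 0 ∧ b = 0 :=
  ⟨by rw [← rePart_mk a b, h, map_zero], by rw [← imPart_mk a b, h, map_zero]⟩

theorem mk_inj {a b a' b' : FunField}
    (h : incl a + const Complex.I * incl b = incl a' + const Complex.I * incl b') :
    a = a' ∧ b = b' :=
  ⟨by rw [← rePart_mk a b, h, rePart_mk], by rw [← imPart_mk a b, h, imPart_mk]⟩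

theorem incl_injective : Function.Injective incl := fun a b h => by
  have := mk_inj (a := a) (b := 0) (a' := b) (b' := 0) (by simpa using h)
  exact this.1

/-- The inverse of a + ib is (a - ib)/(a² + b²), and a² + b² ≠ 0 because ℝ(S) is formally real. -/
theorem isField_cFunField : IsField CFunField where
  exists_pair_ne := ⟨0, 1, fun h => zero_ne_one (incl_injective (by rw [map_zero, map_one]; exact h))⟩
  mul_comm := mul_comm
  mul_inv_cancel := by
    intro w hw
    obtain ⟨a, b, rfl⟩ : ∃ a b, w = incl a + const Complex.I * incl b := ⟨_, _, re_add_im w⟩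
    have h0 : a ^ 2 + b ^ 2 ≠ 0 := fun h => hw (by
      obtain ⟨rfl, rfl⟩ := sq_add_sq_eq_zero h; simp)
    refine ⟨(incl a - const Complex.I * incl b) * incl (a ^ 2 + b ^ 2)⁻¹, ?_⟩
    have h1 : incl (a ^ 2 + b ^ 2) * incl (a ^ 2 + b ^ 2)⁻¹ = 1 := by
      rw [← map_mul, mul_inv_cancel₀ h0, map_one]
    have h2 : incl (a ^ 2 + b ^ 2) = incl a ^ 2 + incl b ^ 2 := by simp only [map_add, map_pow]
    rw [h2] at h1
    linear_combination h1 - incl b ^ 2 * incl (a ^ 2 + b ^ 2)⁻¹ * const_I_sq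

instance : Field CFunField := isField_cFunField.toField

instance : CharZero CFunField := charZero_of_injective_algebraMap (algebraMap ℂ CFunField).injective

theorem const_ne_zero {c : ℂ} (h : c ≠ 0) : const c ≠ 0 := by
  rw [const, Ne, map_eq_zero_iff _ (algebraMap ℂ CFunField).injective]
  exact h

@[simp] theorem const_add (a b : ℂ) : const (a + b) = const a + const b := map_add _ _ _
@[simp] theorem const_sub (a b : ℂ) : const (a - b) = const a - const b := map_sub _ _ _
@[simp] theorem const_mul (a b : ℂ) : const (a * b) = const a * const b := map_mul _ _ _
@[simp] theorem const_neg (a : ℂ) : const (-a) = -const a := map_neg _ _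
@[simp] theorem const_one : const 1 = 1 := map_one _
@[simp] theorem const_zero : const 0 = 0 := map_zero _
@[simp] theorem const_pow (a : ℂ) (n : ℕ) : const (a ^ n) = const a ^ n := map_pow _ _ _
@[simp] theorem const_ofNat (n : ℕ) [n.AtLeastTwo] : const (OfNat.ofNat n) = OfNat.ofNat n :=
  map_ofNat _ _

/-! ### Complex conjugation -/

/-- Complex conjugation on `ℂ(S)`; it fixes `ℝ(S)`. -/
def conjL : CFunField →ₐ[ℝ] CFunField :=
  Algebra.TensorProduct.map (Complex.conjAe : ℂ →ₐ[ℝ] ℂ) (AlgHom.id ℝ FunField)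

theorem conjL_tmul (c : ℂ) (f : FunField) :
    conjL (c ⊗ₜ[ℝ] f) = (starRingEnd ℂ c) ⊗ₜ[ℝ] f := by
  simp [conjL]

@[simp] theorem conjL_incl (f : FunField) : conjL (incl f) = incl f := by
  rw [incl_apply, conjL_tmul, map_one]

@[simp] theorem conjL_const (c : ℂ) : conjL (const c) = const (starRingEnd ℂ c) := by
  have h := const_mul_incl c 1
  rw [map_one, mul_one] at h
  have h' := const_mul_incl (starRingEnd ℂ c) 1
  rw [map_one, mul_one] at h'
  rw [h, h', conjL_tmul]

@[simp] theorem conjL_conjL (w : CFunField) : conjL (conjL w) = w := by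
  rw [re_add_im w]
  simp

/-- Galois descent for elements: invariance makes the imaginary part equal to its own negative. -/
theorem exists_incl_of_conjL_eq {w : CFunField} (h : conjL w = w) : ∃ f, incl f = w := by
  refine ⟨rePart w, ?_⟩
  rw [re_add_im w] at h
  simp only [map_add, map_mul, conjL_incl, conjL_const, Complex.conj_I, const_neg] at h
  have h2 := mk_inj (a := rePart w) (b := -imPart w) (a' := rePart w) (b' := imPart w)
    (by rw [map_neg, ← h]; ring)
  have h3 : imPart w = 0 := by
    have : (2 : FunField) * imPart w = 0 := by linear_combination -h2.2
    exact (mul_eq_zero.1 this).resolve_left two_ne_zero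
  conv_rhs => rw [re_add_im w, h3]
  simp

@[simp] theorem baseChange_incl (g : Bir) (f : FunField) : baseChange g (incl f) = incl (g f) := by
  simp [baseChange, incl_apply]

@[simp] theorem baseChange_const (g : Bir) (c : ℂ) : baseChange g (const c) = const c :=
  AlgHom.commutes _ _

theorem conjL_baseChange (g : Bir) (w : CFunField) :
    conjL (baseChange g w) = baseChange g (conjL w) := by
  rw [re_add_im w]
  simp

theorem baseChange_mul (g h : Bir) (w : CFunField) :
    baseChange (g * h) w = baseChange g (baseChange h w) := by
  rw [re_add_im w]
  simp

theorem baseChange_one (w : CFunField) : baseChange 1 w = w := by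
  rw [re_add_im w]
  simp

@[simp] theorem baseChange_inv_apply (g : Bir) (w : CFunField) :
    baseChange g⁻¹ (baseChange g w) = w := by
  rw [← baseChange_mul, inv_mul_cancel, baseChange_one]

@[simp] theorem baseChange_apply_inv (g : Bir) (w : CFunField) :
    baseChange g (baseChange g⁻¹ w) = w := by
  rw [← baseChange_mul, mul_inv_cancel, baseChange_one]

theorem baseChange_injective (g : Bir) : Function.Injective (baseChange g) :=
  (baseChange g).toRingHom.injective

/-! ### Polynomials on the complex sphere -/

theorem xC_eq : xC = incl xS := rfl
theorem yC_eq : yC = incl yS := rfl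
theorem zC_eq : zC = incl zS := rfl

/-- A complex polynomial in `x, y, z`, as a rational function on `S_ℂ`. -/
def toC : MvPolynomial (Fin 3) ℂ →ₐ[ℂ] CFunField := aeval ![xC, yC, zC]

@[simp] theorem toC_X0 : toC (X 0) = xC := by simp [toC]
@[simp] theorem toC_X1 : toC (X 1) = yC := by simp [toC]
@[simp] theorem toC_X2 : toC (X 2) = zC := by simp [toC]
@[simp] theorem toC_C (c : ℂ) : toC (C c) = const c := toC.commutes c

/-- Real polynomials as complex ones. -/
def cpoly : MvPolynomial (Fin 3) ℝ →+* MvPolynomial (Fin 3) ℂ := MvPolynomial.map (algebraMap ℝ ℂ)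

theorem toC_cpoly (F : MvPolynomial (Fin 3) ℝ) : toC (cpoly F) = incl (toFun F) := by
  induction F using MvPolynomial.induction_on with
  | C a =>
    have : toFun (C a) = algebraMap ℝ FunField a := toFun.commutes a
    rw [this, incl_algebraMap, cpoly, map_C, toC_C]
    rfl
  | add F G hF hG => simp only [map_add, hF, hG]
  | mul_X F i hF =>
    simp only [map_mul, hF]
    congr 1
    fin_cases i
    all_goals simp [cpoly, xC_eq, yC_eq, zC_eq, xS, yS, zS]

theorem eval_cpoly (F : MvPolynomial (Fin 3) ℝ) (P : Fin 3 → ℂ) : eval P (cpoly F) = aeval P F := by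
  rw [cpoly, eval_map]
  rfl

theorem exists_cpoly_add (F : MvPolynomial (Fin 3) ℂ) :
    ∃ F₁ F₂, F = cpoly F₁ + C Complex.I * cpoly F₂ := by
  induction F using MvPolynomial.induction_on with
  | C a =>
    refine ⟨C a.re, C a.im, ?_⟩
    rw [cpoly, map_C, map_C, ← C_mul, ← C_add]
    congr 1
    rw [mul_comm]
    exact (Complex.re_add_im a).symm
  | add F G hF hG =>
    obtain ⟨F₁, F₂, rfl⟩ := hF
    obtain ⟨G₁, G₂, rfl⟩ := hG
    exact ⟨F₁ + G₁, F₂ + G₂, by simp only [map_add]; ring⟩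
  | mul_X F i hF =>
    obtain ⟨F₁, F₂, rfl⟩ := hF
    refine ⟨F₁ * X i, F₂ * X i, ?_⟩
    have : cpoly (X i) = X i := by simp [cpoly]
    simp only [map_mul, this]
    ring

/-- This makes evaluation at complex points of the quadric well defined. The real and imaginary
parts of F vanish separately in ℝ(S), so each is a multiple of `spherePoly`. -/
theorem toC_eq_zero {F : MvPolynomial (Fin 3) ℂ} (h : toC F = 0) {P : Fin 3 → ℂ}
    (hP : P 0 ^ 2 + P 1 ^ 2 + P 2 ^ 2 = 1) : eval P F = 0 := by
  obtain ⟨F₁, F₂, rfl⟩ := exists_cpoly_add F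
  rw [map_add, map_mul, toC_C, toC_cpoly, toC_cpoly] at h
  obtain ⟨h1, h2⟩ := mk_eq_zero h
  have key : ∀ G, toFun G = 0 → eval P (cpoly G) = 0 := by
    intro G hG
    obtain ⟨Q, rfl⟩ := (toFun_eq_zero_iff G).1 hG
    have : eval P (cpoly spherePoly) = 0 := by
      rw [eval_cpoly]
      simp only [spherePoly, map_sub, map_add, map_pow, aeval_X, map_one, hP, sub_self]
    rw [map_mul, map_mul, this, zero_mul]
  rw [map_add, map_mul, key _ h1, key _ h2, mul_zero, add_zero]

theorem sphere_eq : xC ^ 2 + yC ^ 2 + zC ^ 2 = 1 := by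
  have h := congrArg incl toFun_spherePoly
  simp only [spherePoly, map_sub, map_add, map_pow, map_one, map_zero] at h
  change xC ^ 2 + yC ^ 2 + zC ^ 2 - 1 = 0 at h
  linear_combination h

/-- The rational function `f` on `S_ℂ` is regular at the point `P`, with value `r`. -/
def CVal (P : Fin 3 → ℂ) (f : CFunField) (r : ℂ) : Prop :=
  ∃ N D : MvPolynomial (Fin 3) ℂ, eval P D ≠ 0 ∧ f * toC D = toC N ∧ eval P N = r * eval P D

/-! ### Arithmetic of values at complex points -/

section CVal
variable {P : Fin 3 → ℂ} {f f' : CFunField} {r r' : ℂ}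

theorem CVal.unique (hP : P 0 ^ 2 + P 1 ^ 2 + P 2 ^ 2 = 1) (h : CVal P f r) (h' : CVal P f r') :
    r = r' := by
  obtain ⟨N, D, hD, hf, hr⟩ := h
  obtain ⟨N', D', hD', hf', hr'⟩ := h'
  have h0 : toC (N * D' - N' * D) = 0 := by
    rw [map_sub, map_mul, map_mul, ← hf, ← hf']; ring
  have h1 := toC_eq_zero h0 hP
  rw [map_sub, map_mul, map_mul, hr, hr'] at h1
  have h2 : (r - r') * (eval P D * eval P D') = 0 := by linear_combination h1
  exact sub_eq_zero.1 ((mul_eq_zero.1 h2).resolve_right (mul_ne_zero hD hD'))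

theorem CVal.add (h : CVal P f r) (h' : CVal P f' r') : CVal P (f + f') (r + r') := by
  obtain ⟨N, D, hD, hf, hr⟩ := h
  obtain ⟨N', D', hD', hf', hr'⟩ := h'
  refine ⟨N * D' + N' * D, D * D', by rw [map_mul]; exact mul_ne_zero hD hD', ?_, ?_⟩
  · rw [map_add, map_mul, map_mul, map_mul, ← hf, ← hf']; ring
  · simp only [map_add, map_mul, hr, hr']; ring

theorem CVal.mul (h : CVal P f r) (h' : CVal P f' r') : CVal P (f * f') (r * r') := by
  obtain ⟨N, D, hD, hf, hr⟩ := h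
  obtain ⟨N', D', hD', hf', hr'⟩ := h'
  refine ⟨N * N', D * D', by rw [map_mul]; exact mul_ne_zero hD hD', ?_, ?_⟩
  · rw [map_mul, map_mul, ← hf, ← hf']; ring
  · simp only [map_mul, hr, hr']; ring

theorem CVal.toC (F : MvPolynomial (Fin 3) ℂ) : CVal P (toC F) (eval P F) :=
  ⟨F, 1, by simp, by simp, by simp⟩

theorem CVal.const (c : ℂ) : CVal P (const c) c :=
  ⟨C c, 1, by simp, by rw [toC_C, map_one, mul_one], by simp⟩

theorem CVal.neg (h : CVal P f r) : CVal P (-f) (-r) := by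
  obtain ⟨N, D, hD, hf, hr⟩ := h
  exact ⟨-N, D, hD, by rw [neg_mul, hf, map_neg], by rw [map_neg, hr, neg_mul]⟩

theorem CVal.sub (h : CVal P f r) (h' : CVal P f' r') : CVal P (f - f') (r - r') := by
  rw [sub_eq_add_neg, sub_eq_add_neg]
  exact h.add h'.neg

theorem CVal.pow (h : CVal P f r) (n : ℕ) : CVal P (f ^ n) (r ^ n) := by
  induction n with
  | zero => simpa using CVal.const (P := P) 1
  | succ n ih => rw [pow_succ, pow_succ]; exact ih.mul h

theorem CVal.inv (hP : P 0 ^ 2 + P 1 ^ 2 + P 2 ^ 2 = 1) (h : CVal P f r) (hr : r ≠ 0) :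
    CVal P f⁻¹ r⁻¹ := by
  have hf0 : f ≠ 0 := by
    rintro rfl
    exact hr (h.unique hP (by simpa using CVal.const (P := P) 0))
  obtain ⟨N, D, hD, hf, hrD⟩ := h
  refine ⟨D, N, by rw [hrD]; exact mul_ne_zero hr hD, ?_, ?_⟩
  · rw [← hf, inv_mul_cancel_left₀ hf0]
  · rw [hrD, inv_mul_cancel_left₀ hr]

theorem CVal.div (hP : P 0 ^ 2 + P 1 ^ 2 + P 2 ^ 2 = 1) (h : CVal P f r) (h' : CVal P f' r')
    (hr : r' ≠ 0) : CVal P (f / f') (r / r') := by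
  rw [div_eq_mul_inv, div_eq_mul_inv]
  exact h.mul (h'.inv hP hr)

end CVal

theorem CVal.x (P : Fin 3 → ℂ) : CVal P xC (P 0) := by simpa using CVal.toC (P := P) (X 0)
theorem CVal.y (P : Fin 3 → ℂ) : CVal P yC (P 1) := by simpa using CVal.toC (P := P) (X 1)
theorem CVal.z (P : Fin 3 → ℂ) : CVal P zC (P 2) := by simpa using CVal.toC (P := P) (X 2)
theorem CVal.t (P : Fin 3 → ℂ) : CVal P tC (P 0 - Complex.I * P 1) :=
  (CVal.x P).sub ((CVal.const _).mul (CVal.y P))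

/-! ### Purely transcendental extensions of degree one -/

section Moebius
open IntermediateField

variable {E L : Type*} [Field E] [Field L] [Algebra E L] {t : L}

/-- Degree two is enough below: an identity between two fractional linear expressions in t becomes
quadratic after clearing denominators. -/
theorem quadratic_coeff_eq_zero (ht : Transcendental E t) {a b c : E}
    (h : algebraMap E L a * t ^ 2 + algebraMap E L b * t + algebraMap E L c = 0) :
    a = 0 ∧ b = 0 ∧ c = 0 := by
  have h0 : Polynomial.aeval t (Polynomial.C a * Polynomial.X ^ 2 + Polynomial.C b * Polynomial.X +
      Polynomial.C c) = 0 := by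
    simpa using h
  have h1 := (transcendental_iff.1 ht) _ h0
  refine ⟨?_, ?_, ?_⟩
  · simpa using congrArg (fun p => Polynomial.coeff p 2) h1
  · simpa [Polynomial.coeff_X] using congrArg (fun p => Polynomial.coeff p 1) h1
  · simpa using congrArg (fun p => Polynomial.coeff p 0) h1

theorem linear_ne_zero (ht : Transcendental E t) {c d : E} (h : c ≠ 0 ∨ d ≠ 0) :
    algebraMap E L c * t + algebraMap E L d ≠ 0 := fun h0 => by
  have := quadratic_coeff_eq_zero ht (a := 0) (b := c) (c := d) (by simpa using h0)
  tauto

/-- A generator of `E(t)` is a fractional linear function of `t`. -/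
theorem exists_moebius_of_adjoin_eq_top (ht : Transcendental E t) (htop : E⟮t⟯ = ⊤) {f : L}
    (hf : E⟮f⟯ = ⊤) :
    ∃ a b c d : E, a * d - b * c ≠ 0 ∧
      f * (algebraMap E L c * t + algebraMap E L d) =
        algebraMap E L a * t + algebraMap E L b := by
  classical
  let e : RatFunc E ≃ₐ[E] L :=
    (RatFunc.algEquivOfTranscendental t ht).trans
      ((IntermediateField.equivOfEq htop).trans IntermediateField.topEquiv)
  have he : ∀ u : RatFunc E, e u = Polynomial.aeval t u.num / Polynomial.aeval t u.denom :=
    fun u => RatFunc.algEquivOfTranscendental_apply t ht u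
  obtain ⟨u, rfl⟩ := e.surjective f
  have hu : E⟮u⟯ = ⊤ := by
    have h1 : IntermediateField.map e.toAlgHom E⟮u⟯ = ⊤ := by
      rw [IntermediateField.adjoin_map, Set.image_singleton]
      exact hf
    rw [eq_top_iff]
    intro v _
    have h2 : e v ∈ IntermediateField.map e.toAlgHom E⟮u⟯ := by rw [h1]; trivial
    obtain ⟨v', hv', h3⟩ := h2
    rwa [← e.injective h3]
  -- The degree of E(X) over E(u) is the larger of the degrees of the numerator and the denominator
  -- of u; here it is one.
  have hmax : max u.num.natDegree u.denom.natDegree = 1 := by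
    rw [← RatFunc.finrank_eq_max_natDegree, hu]
    exact IntermediateField.finrank_top
  have hn := u.num.eq_X_add_C_of_natDegree_le_one (le_of_max_le_left hmax.le)
  have hd := u.denom.eq_X_add_C_of_natDegree_le_one (le_of_max_le_right hmax.le)
  have hev : ∀ a b : E, Polynomial.aeval t (Polynomial.C a * Polynomial.X + Polynomial.C b) =
      algebraMap E L a * t + algebraMap E L b := fun a b => by simp
  have hd0 : Polynomial.aeval t u.denom ≠ 0 := fun h =>
    u.denom_ne_zero (transcendental_iff.1 ht _ h)
  refine ⟨u.num.coeff 1, u.num.coeff 0, u.denom.coeff 1, u.denom.coeff 0, fun hdet => ?_, ?_⟩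
  -- A vanishing determinant makes numerator and denominator proportional. Being coprime, they would
  -- both be constant, against the degree one.
  · have hcop : IsCoprime u.num u.denom := u.isCoprime_num_denom
    set a := u.num.coeff 1
    set b := u.num.coeff 0
    set c := u.denom.coeff 1
    set d := u.denom.coeff 0
    have hdvd : ∀ p q : Polynomial E, IsCoprime p q → p.natDegree = 1 → ∀ k l : E,
        Polynomial.C k * p = Polynomial.C l * q → k ≠ 0 → False := by
      intro p q hpq hp k l h hk
      have h1 : p ∣ Polynomial.C l * q := ⟨Polynomial.C k, by rw [← h, mul_comm]⟩
      have h2 := hpq.dvd_of_dvd_mul_right h1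
      by_cases hl : l = 0
      · subst hl
        rw [map_zero, zero_mul, mul_eq_zero, Polynomial.C_eq_zero] at h
        have hp0 := h.resolve_left hk
        rw [hp0, Polynomial.natDegree_zero] at hp
        omega
      · have h3 := Polynomial.natDegree_eq_zero_of_isUnit
          (isUnit_of_dvd_unit h2 (Polynomial.isUnit_C.2 (isUnit_iff_ne_zero.2 hl)))
        omega
    by_cases hc : c = 0
    · have hdn : d ≠ 0 := by
        rintro hd'
        apply u.denom_ne_zero
        rw [hd, hc, hd']; simp
      have ha : a = 0 := by
        rw [hc, mul_zero, sub_zero] at hdet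
        exact (mul_eq_zero.1 hdet).resolve_right hdn
      rw [hn, hd, ha, hc] at hmax
      simp at hmax
    · have hdeg : u.denom.natDegree = 1 := by
        rw [hd]; exact Polynomial.natDegree_linear hc
      by_cases ha : a = 0
      · have hb : b = 0 := by
          rw [ha, zero_mul, zero_sub, neg_eq_zero] at hdet
          exact (mul_eq_zero.1 hdet).resolve_right hc
        have hn0 : u.num = 0 := by rw [hn, ha, hb]; simp
        rw [hn0, isCoprime_zero_left] at hcop
        have := Polynomial.natDegree_eq_zero_of_isUnit hcop
        omega
      · refine hdvd u.denom u.num hcop.symm hdeg a c ?_ ha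
        rw [hn, hd]
        have : Polynomial.C a * Polynomial.C d = Polynomial.C b * Polynomial.C c := by
          rw [← map_mul, ← map_mul, sub_eq_zero.1 hdet]
        linear_combination this
  · rw [he, ← hev, ← hev, ← hn, ← hd]
    exact div_mul_cancel₀ _ hd0

/-- `E(t)` has an `E`-endomorphism with any prescribed nonconstant image of `t`. -/
theorem exists_algHom_apply_eq (ht : Transcendental E t) (htop : E⟮t⟯ = ⊤) {f : L}
    (hf : f ∉ Set.range (algebraMap E L)) : ∃ φ : L →ₐ[E] L, φ t = f := by
  let e : RatFunc E ≃ₐ[E] L :=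
    (RatFunc.algEquivOfTranscendental t ht).trans
      ((IntermediateField.equivOfEq htop).trans IntermediateField.topEquiv)
  have heX : e RatFunc.X = t := RatFunc.algEquivOfTranscendental_X t ht
  obtain ⟨u, rfl⟩ := e.surjective f
  have hu : ¬ ∃ c, u = RatFunc.C c := by
    rintro ⟨c, rfl⟩
    refine hf ⟨c, ?_⟩
    rw [← RatFunc.algebraMap_eq_C]
    exact (e.commutes c).symm
  have hu' := u.transcendental_of_ne_C hu
  -- A nonconstant u is transcendental over E, so X ↦ u defines an embedding of E(X) into itself;
  -- `e` transports it to L.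
  let ψ : RatFunc E →ₐ[E] RatFunc E := (IntermediateField.val E⟮u⟯).comp
    (RatFunc.algEquivOfTranscendental u hu').toAlgHom
  have hψ : ψ RatFunc.X = u := RatFunc.algEquivOfTranscendental_X u hu'
  have hes : e.symm t = RatFunc.X := by rw [← heX, e.symm_apply_apply]
  refine ⟨(e.toAlgHom.comp ψ).comp e.symm.toAlgHom, ?_⟩
  change e (ψ (e.symm t)) = e u
  rw [hes, hψ]

theorem algHom_ext_of_adjoin_eq_top (htop : E⟮t⟯ = ⊤) {φ ψ : L →ₐ[E] L} (h : φ t = ψ t) :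
    φ = ψ := by
  have : ∀ w ∈ E⟮t⟯, φ w = ψ w := by
    intro w hw
    induction hw using IntermediateField.adjoin_induction with
    | mem x hx => rw [Set.mem_singleton_iff.1 hx, h]
    | algebraMap x => rw [φ.commutes, ψ.commutes]
    | add x y _ _ hx hy => rw [map_add, map_add, hx, hy]
    | inv x _ hx => rw [map_inv₀, map_inv₀, hx]
    | mul x y _ _ hx hy => rw [map_mul, map_mul, hx, hy]
  ext w
  exact this w (by rw [htop]; trivial)

/-- Two matrices that induce the same fractional linear transformation are proportional. -/
theorem moebius_proportional (ht : Transcendental E t) {a b c d a' b' c' d' : E}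
    (hdet : a * d - b * c ≠ 0)
    (h : (algebraMap E L a * t + algebraMap E L b) * (algebraMap E L c' * t + algebraMap E L d') =
      (algebraMap E L a' * t + algebraMap E L b') * (algebraMap E L c * t + algebraMap E L d)) :
    ∃ k : E, a' = k * a ∧ b' = k * b ∧ c' = k * c ∧ d' = k * d := by
  obtain ⟨h2, h1, h0⟩ := quadratic_coeff_eq_zero ht (a := a * c' - a' * c)
    (b := a * d' + b * c' - a' * d - b' * c) (c := b * d' - b' * d) (by
      simp only [map_sub, map_add, map_mul]
      linear_combination h)
  -- If the second matrix is k times the first, then a'd - bc' = k(ad - bc), which dictates k.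
  refine ⟨(a' * d - b * c') / (a * d - b * c), ?_, ?_, ?_, ?_⟩ <;>
    rw [div_mul_eq_mul_div, eq_div_iff hdet]
  · linear_combination b * h2
  · linear_combination b * h1 - a * h0
  · linear_combination d * h2
  · linear_combination -c * h0 + d * h1

end Moebius

/-! ### The coordinates `(t, z)` -/

/-- The function `x + i y`, the conjugate of `t`. -/
def tbarC : CFunField := xC + const Complex.I * yC

theorem tC_mul_tbarC : tC * tbarC = 1 - zC ^ 2 := by
  have h := sphere_eq
  rw [tC, tbarC]
  linear_combination h - yC ^ 2 * const_I_sq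

theorem CVal.tbar (P : Fin 3 → ℂ) : CVal P tbarC (P 0 + Complex.I * P 1) :=
  (CVal.x P).add ((CVal.const _).mul (CVal.y P))

@[simp] theorem conjL_xC : conjL xC = xC := conjL_incl _
@[simp] theorem conjL_yC : conjL yC = yC := conjL_incl _
@[simp] theorem conjL_zC : conjL zC = zC := conjL_incl _

@[simp] theorem conjL_tC : conjL tC = tbarC := by
  rw [tC, tbarC, map_sub, map_mul, conjL_const, conjL_xC, conjL_yC, Complex.conj_I, const_neg]
  ring

@[simp] theorem conjL_tbarC : conjL tbarC = tC := by rw [← conjL_tC, conjL_conjL]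

/-- A polynomial relation between f and g would vanish on the product of two infinite sets, hence be
zero. -/
theorem algebraicIndependent_of_cVal {f g : CFunField} {s s' : Set ℂ} (hs : s.Infinite)
    (hs' : s'.Infinite) (h : ∀ a ∈ s, ∀ b ∈ s', ∃ P : Fin 3 → ℂ,
      P 0 ^ 2 + P 1 ^ 2 + P 2 ^ 2 = 1 ∧ CVal P f a ∧ CVal P g b) :
    AlgebraicIndependent ℂ ![f, g] := by
  rw [algebraicIndependent_iff]
  intro p hp
  refine funext_set (![s, s']) (by intro i; fin_cases i <;> assumption) fun q hq => ?_
  have h0 : q 0 ∈ s := hq 0 trivial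
  have h1 : q 1 ∈ s' := hq 1 trivial
  obtain ⟨P, hP, hf, hg⟩ := h _ h0 _ h1
  have key : ∀ F : MvPolynomial (Fin 2) ℂ, CVal P (aeval ![f, g] F) (eval q F) := by
    intro F
    induction F using MvPolynomial.induction_on with
    | C a => rw [algHom_C, eval_C]; exact CVal.const a
    | add F G hF hG => simpa only [map_add] using hF.add hG
    | mul_X F i hF =>
      rw [map_mul, map_mul, aeval_X, eval_X]
      refine hF.mul ?_
      fin_cases i
      · exact hf
      · exact hg
  rw [map_zero]
  refine (key p).unique hP ?_
  rw [hp]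
  simpa using CVal.const (P := P) 0

/-- The point of the complex sphere with given coordinates `t`, `x + i y`, `z`. -/
def spherePoint (t t' z : ℂ) : Fin 3 → ℂ := ![(t + t') / 2, (t' - t) / (2 * Complex.I), z]

theorem spherePoint_mem {t t' z : ℂ} (h : t * t' = 1 - z ^ 2) :
    spherePoint t t' z 0 ^ 2 + spherePoint t t' z 1 ^ 2 + spherePoint t t' z 2 ^ 2 = 1 := by
  have hI := Complex.I_ne_zero
  simp only [spherePoint, Matrix.cons_val]
  field_simp
  rw [Complex.I_sq]
  linear_combination -4 * h

theorem spherePoint_t (t t' z : ℂ) :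
    spherePoint t t' z 0 - Complex.I * spherePoint t t' z 1 = t := by
  have hI := Complex.I_ne_zero
  simp only [spherePoint, Matrix.cons_val]
  field_simp
  ring

theorem spherePoint_tbar (t t' z : ℂ) :
    spherePoint t t' z 0 + Complex.I * spherePoint t t' z 1 = t' := by
  have hI := Complex.I_ne_zero
  simp only [spherePoint, Matrix.cons_val]
  field_simp
  ring

/-- The map ψ is dominant: for t = a ≠ 0 and z = b arbitrary, the point with x + iy = (1 - b²)/a
lies on the quadric. -/
theorem algebraicIndependent_tC_zC : AlgebraicIndependent ℂ ![tC, zC] := by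
  refine algebraicIndependent_of_cVal (s := {0}ᶜ) (s' := Set.univ)
    (Set.finite_singleton 0).infinite_compl Set.infinite_univ fun a ha b _ => ?_
  have ha' : a ≠ 0 := ha
  have h : a * ((1 - b ^ 2) / a) = 1 - b ^ 2 := by field_simp
  refine ⟨spherePoint a ((1 - b ^ 2) / a) b, spherePoint_mem h, ?_, CVal.z _⟩
  have := CVal.t (spherePoint a ((1 - b ^ 2) / a) b)
  rwa [spherePoint_t] at this

open IntermediateField in
/-- The field `ℂ(z)`. -/
abbrev ZField : IntermediateField ℂ CFunField := ℂ⟮zC⟯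

theorem transcendental_zC : Transcendental ℂ zC := by
  simpa using algebraicIndependent_tC_zC.transcendental 1

theorem transcendental_tC : Transcendental ZField tC := by
  have h := algebraicIndependent_tC_zC.transcendental_adjoin (s := {1}) (i := 0) (by simp)
  rw [Set.image_singleton] at h
  exact IntermediateField.transcendental_adjoin_iff.2 h

theorem tC_ne_zero : tC ≠ 0 := fun h => transcendental_tC (by rw [h]; exact isAlgebraic_zero)

theorem tbarC_eq : tbarC = (1 - zC ^ 2) / tC := by
  rw [← tC_mul_tbarC, mul_div_cancel_left₀ _ tC_ne_zero]

theorem tbarC_ne_zero : tbarC ≠ 0 := fun h => tC_ne_zero (by rw [← conjL_tbarC, h, map_zero])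

theorem aeval_zC_ne_zero {p : Polynomial ℂ} (hp : p ≠ 0) : Polynomial.aeval zC p ≠ 0 :=
  fun h => hp (transcendental_iff.1 transcendental_zC _ h)

theorem aeval_zC_injective : Function.Injective (Polynomial.aeval zC : Polynomial ℂ → CFunField) :=
  transcendental_iff_injective.1 transcendental_zC

theorem zC_ne_const (c : ℂ) : zC ≠ const c := fun h =>
  transcendental_zC (by rw [h]; exact isAlgebraic_algebraMap c)

theorem xC_eq_tC : xC = (tC + tbarC) / 2 := by
  rw [tC, tbarC]; ring

theorem yC_eq_tC : yC = const Complex.I * (tC - tbarC) / 2 := by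
  rw [tC, tbarC]
  linear_combination yC * const_I_sq

theorem const_mem (F : IntermediateField ℂ CFunField) (c : ℂ) : const c ∈ F := F.algebraMap_mem c

/-- The map ψ is birational: x + iy = (1 - z²)/t, and x, y are linear combinations of t and x + iy.
-/
theorem intermediateField_eq_top {F : IntermediateField ℂ CFunField} (ht : tC ∈ F) (hz : zC ∈ F) :
    F = ⊤ := by
  have htb : tbarC ∈ F := by
    rw [tbarC_eq]
    exact F.div_mem (F.sub_mem F.one_mem (pow_mem hz 2)) ht
  have h2 : (2 : CFunField) ∈ F := by
    have := const_mem F 2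
    rwa [const_ofNat] at this
  have hx : xC ∈ F := by
    rw [xC_eq_tC]
    exact F.div_mem (F.add_mem ht htb) h2
  have hy : yC ∈ F := by
    rw [yC_eq_tC]
    exact F.div_mem (F.mul_mem (const_mem F _) (F.sub_mem ht htb)) h2
  have hF : ∀ G, incl (toFun G) ∈ F := by
    intro G
    induction G using MvPolynomial.induction_on with
    | C a =>
      have : toFun (C a) = algebraMap ℝ FunField a := toFun.commutes a
      rw [this, incl_algebraMap]
      exact const_mem F _
    | add G H hG hH => rw [map_add, map_add]; exact F.add_mem hG hH
    | mul_X G i hG =>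
      rw [map_mul, map_mul]
      refine F.mul_mem hG ?_
      fin_cases i
      · exact hx
      · exact hy
      · exact hz
  have hK : ∀ f, incl f ∈ F := by
    intro f
    obtain ⟨N, D, hD, h⟩ := exists_toFun_div f
    rw [← eq_div_iff hD] at h
    rw [h, map_div₀]
    exact F.div_mem (hF N) (hF D)
  rw [eq_top_iff]
  intro w _
  rw [re_add_im w]
  exact F.add_mem (hK _) (F.mul_mem (const_mem F _) (hK _))

open IntermediateField in
theorem adjoin_tC : ZField⟮tC⟯ = ⊤ := by
  have h : (ZField⟮tC⟯).restrictScalars ℂ = ⊤ := by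
    refine intermediateField_eq_top ?_ ?_
    · exact IntermediateField.mem_adjoin_simple_self ZField tC
    · exact (ZField⟮tC⟯).algebraMap_mem ⟨zC, IntermediateField.mem_adjoin_simple_self ℂ zC⟩
  rw [eq_top_iff]
  intro w _
  have : w ∈ (ZField⟮tC⟯).restrictScalars ℂ := by rw [h]; trivial
  exact this

/-- A ring homomorphism on `ℂ(S)` is determined by the images of the constants, `t` and `z`. -/
theorem ringHom_ext_tz {φ ψ : CFunField →+* CFunField} (hc : ∀ c, φ (const c) = ψ (const c))
    (ht : φ tC = ψ tC) (hz : φ zC = ψ zC) : φ = ψ := by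
  let F : IntermediateField ℂ CFunField :=
    { RingHom.eqLocusField φ ψ with
      algebraMap_mem' := hc }
  have hF : F = ⊤ := intermediateField_eq_top ht hz
  refine RingHom.ext fun w => ?_
  have : w ∈ F := by rw [hF]; trivial
  exact this

theorem bir_ext {g h : Bir} (ht : baseChange g tC = baseChange h tC)
    (hz : baseChange g zC = baseChange h zC) : g = h := by
  have h1 : (baseChange g : CFunField →+* CFunField) = (baseChange h : CFunField →+* CFunField) :=
    ringHom_ext_tz (fun c => by
      change baseChange g (const c) = baseChange h (const c)
      rw [baseChange_const, baseChange_const]) ht hz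
  ext f
  apply incl_injective
  rw [← baseChange_incl, ← baseChange_incl]
  exact congrArg (fun φ : CFunField →+* CFunField => φ (incl f)) h1

theorem baseChange_zC_eq_iff {g : Bir} : baseChange g zC = zC ↔ g zS = zS := by
  rw [zC_eq, baseChange_incl]
  exact incl_injective.eq_iff

theorem baseChange_tbarC (g : Bir) : baseChange g tbarC = conjL (baseChange g tC) := by
  rw [conjL_baseChange, conjL_tC]

/-- A pair of mutually inverse endomorphisms of `ℂ(S)` that are compatible with complex conjugation
comes from a birational map that is defined over `ℝ`. -/
theorem exists_bir {φ ψ : CFunField →ₐ[ℂ] CFunField} (h1 : ∀ w, φ (ψ w) = w)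
    (h2 : ∀ w, ψ (φ w) = w) (hφ : ∀ w, conjL (φ w) = φ (conjL w)) :
    ∃ g : Bir, ∀ w, baseChange g w = φ w := by
  have hψ : ∀ w, conjL (ψ w) = ψ (conjL w) := fun w => by
    rw [← h2 (conjL (ψ w)), ← hφ, h1]
  have hex : ∀ f, ∃ f', incl f' = φ (incl f) := fun f =>
    exists_incl_of_conjL_eq (by rw [hφ, conjL_incl])
  have hex' : ∀ f, ∃ f', incl f' = ψ (incl f) := fun f =>
    exists_incl_of_conjL_eq (by rw [hψ, conjL_incl])
  choose a ha using hex
  choose b hb using hex'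
  let g : Bir :=
    { toFun := a
      invFun := b
      left_inv := fun f => incl_injective (by rw [hb, ha, h2])
      right_inv := fun f => incl_injective (by rw [ha, hb, h1])
      map_mul' := fun f f' => incl_injective (by simp only [ha, map_mul])
      map_add' := fun f f' => incl_injective (by simp only [ha, map_add])
      commutes' := fun r => incl_injective (by
        rw [ha, incl_algebraMap]; exact φ.commutes _) }
  have hg : ∀ f, incl (g f) = φ (incl f) := ha
  refine ⟨g, fun w => ?_⟩
  rw [re_add_im w, map_add, map_mul, baseChange_const, baseChange_incl, baseChange_incl, hg, hg,
    map_add, map_mul]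
  congr 2
  exact (φ.commutes _).symm

/-! ### Polynomials in `z` -/

/-- A real polynomial in `z`, as a function on `S`. -/
def rz (p : Polynomial ℝ) : CFunField := incl (Polynomial.aeval zS p)

@[simp] theorem rz_add (p q : Polynomial ℝ) : rz (p + q) = rz p + rz q := by simp [rz]
@[simp] theorem rz_sub (p q : Polynomial ℝ) : rz (p - q) = rz p - rz q := by simp [rz]
@[simp] theorem rz_mul (p q : Polynomial ℝ) : rz (p * q) = rz p * rz q := by simp [rz]
@[simp] theorem rz_neg (p : Polynomial ℝ) : rz (-p) = -rz p := by simp [rz]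
@[simp] theorem rz_pow (p : Polynomial ℝ) (n : ℕ) : rz (p ^ n) = rz p ^ n := by simp [rz]
@[simp] theorem rz_one : rz 1 = 1 := by rw [rz, map_one, map_one]
@[simp] theorem rz_zero : rz 0 = 0 := by rw [rz, map_zero, map_zero]
@[simp] theorem rz_X : rz Polynomial.X = zC := by rw [rz, Polynomial.aeval_X, zC_eq]
@[simp] theorem rz_C (r : ℝ) : rz (Polynomial.C r) = const r := by
  rw [rz, Polynomial.aeval_C, incl_algebraMap]
@[simp] theorem conjL_rz (p : Polynomial ℝ) : conjL (rz p) = rz p := conjL_incl _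

theorem rz_eq_aeval (p : Polynomial ℝ) :
    rz p = Polynomial.aeval zC (p.map (algebraMap ℝ ℂ)) := by
  induction p using Polynomial.induction_on' with
  | add p q hp hq => rw [rz_add, hp, hq, Polynomial.map_add, map_add]
  | monomial n a =>
    rw [← Polynomial.C_mul_X_pow_eq_monomial, rz_mul, rz_C, rz_pow, rz_X, Polynomial.map_mul,
      Polynomial.map_pow, Polynomial.map_X, Polynomial.map_C, map_mul, map_pow, Polynomial.aeval_X,
      Polynomial.aeval_C]
    rfl

theorem aeval_zC_mem (p : Polynomial ℂ) : Polynomial.aeval zC p ∈ ZField := by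
  refine IntermediateField.algebra_adjoin_le_adjoin ℂ _ ?_
  exact Polynomial.aeval_mem_adjoin_singleton ℂ zC

theorem rz_mem (p : Polynomial ℝ) : rz p ∈ ZField := by
  rw [rz_eq_aeval]; exact aeval_zC_mem _

theorem rz_injective : Function.Injective rz := fun p q h => by
  rw [rz_eq_aeval, rz_eq_aeval] at h
  exact Polynomial.map_injective _ (algebraMap ℝ ℂ).injective (aeval_zC_injective h)

theorem rz_ne_zero {p : Polynomial ℝ} (hp : p ≠ 0) : rz p ≠ 0 := fun h =>
  hp (rz_injective (by rw [h, rz_zero]))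

/-- The complex polynomial `p + i q` in `z`. -/
def cz (p q : Polynomial ℝ) : CFunField := rz p + const Complex.I * rz q

theorem conjL_cz (p q : Polynomial ℝ) : conjL (cz p q) = rz p - const Complex.I * rz q := by
  rw [cz, map_add, map_mul, conjL_rz, conjL_rz, conjL_const, Complex.conj_I, const_neg]
  ring

theorem cz_mem (p q : Polynomial ℝ) : cz p q ∈ ZField :=
  ZField.add_mem (rz_mem p) (ZField.mul_mem (const_mem _ _) (rz_mem q))

theorem conjL_cz_mem (p q : Polynomial ℝ) : conjL (cz p q) ∈ ZField := by
  rw [conjL_cz]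
  exact ZField.sub_mem (rz_mem p) (ZField.mul_mem (const_mem _ _) (rz_mem q))

theorem zC_mem : zC ∈ ZField := IntermediateField.mem_adjoin_simple_self ℂ zC

theorem CVal.rz (P : Fin 3 → ℂ) (p : Polynomial ℝ) :
    CVal P (rz p) (Polynomial.aeval (P 2) p) := by
  induction p using Polynomial.induction_on' with
  | add p q hp hq => rw [rz_add, map_add]; exact hp.add hq
  | monomial n a =>
    rw [← Polynomial.C_mul_X_pow_eq_monomial, rz_mul, rz_C, rz_pow, rz_X, map_mul, map_pow,
      Polynomial.aeval_X, Polynomial.aeval_C]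
    exact (CVal.const _).mul ((CVal.z P).pow n)

/-! ### Fractional linear maps over the base -/

/-- The matrix `(a, b (1 - z²); b̄, ā)` with `a = a₁ + i a₂`, `b = b₁ + i b₂`. -/
structure QPoly where
  a₁ : Polynomial ℝ
  a₂ : Polynomial ℝ
  b₁ : Polynomial ℝ
  b₂ : Polynomial ℝ

namespace QPoly

/-- The determinant of the matrix. -/
def norm (q : QPoly) : Polynomial ℝ :=
  q.a₁ ^ 2 + q.a₂ ^ 2 - (q.b₁ ^ 2 + q.b₂ ^ 2) * (1 - Polynomial.X ^ 2)

/-- The adjugate matrix. -/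
def adj (q : QPoly) : QPoly := ⟨q.a₁, -q.a₂, -q.b₁, -q.b₂⟩

theorem norm_adj (q : QPoly) : q.adj.norm = q.norm := by
  simp only [norm, adj]; ring

/-- The birational map `g` acts by `t ↦ (a t + b (1 - z²)) / (b̄ t + ā)` and `z ↦ z`. -/
def Acts (q : QPoly) (g : Bir) : Prop :=
  baseChange g zC = zC ∧
    baseChange g tC * (conjL (cz q.b₁ q.b₂) * tC + conjL (cz q.a₁ q.a₂)) =
      cz q.a₁ q.a₂ * tC + cz q.b₁ q.b₂ * (1 - zC ^ 2)

theorem det_eq (q : QPoly) : cz q.a₁ q.a₂ * conjL (cz q.a₁ q.a₂) -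
    cz q.b₁ q.b₂ * (1 - zC ^ 2) * conjL (cz q.b₁ q.b₂) = rz q.norm := by
  rw [conjL_cz, conjL_cz, cz, cz, norm]
  simp only [rz_add, rz_sub, rz_mul, rz_pow, rz_one, rz_X]
  linear_combination (-rz q.a₂ ^ 2 + rz q.b₂ ^ 2 * (1 - zC ^ 2)) * const_I_sq

theorem linear_ne_zero' {c d : CFunField} (hc : c ∈ ZField) (hd : d ∈ ZField)
    (h : c ≠ 0 ∨ d ≠ 0) : c * tC + d ≠ 0 :=
  linear_ne_zero transcendental_tC (c := ⟨c, hc⟩) (d := ⟨d, hd⟩) (by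
    simpa only [ne_eq, ← ZeroMemClass.coe_eq_zero] using h)

theorem conj_cz_ne_zero_or {q : QPoly} (hq : q.norm ≠ 0) :
    conjL (cz q.b₁ q.b₂) ≠ 0 ∨ conjL (cz q.a₁ q.a₂) ≠ 0 := by
  by_contra! h
  apply rz_ne_zero hq
  rw [← det_eq, h.1, h.2]
  ring

theorem denom_ne_zero {q : QPoly} (hq : q.norm ≠ 0) :
    conjL (cz q.b₁ q.b₂) * tC + conjL (cz q.a₁ q.a₂) ≠ 0 :=
  linear_ne_zero' (conjL_cz_mem _ _) (conjL_cz_mem _ _) (conj_cz_ne_zero_or hq)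

theorem Acts.unique {q : QPoly} (hq : q.norm ≠ 0) {g h : Bir} (hg : q.Acts g) (hh : q.Acts h) :
    g = h :=
  bir_ext (mul_right_cancel₀ (denom_ne_zero hq) (hg.2.trans hh.2.symm)) (hg.1.trans hh.1.symm)

theorem one_sub_zC_mem : 1 - zC ^ 2 ∈ ZField :=
  ZField.sub_mem ZField.one_mem (pow_mem zC_mem 2)

/-- The variable t may be sent to any element outside ℂ(z). If the quotient were some e in ℂ(z), the
numerator would be e times the denominator and the determinant would vanish. -/
theorem exists_zField_algHom {q : QPoly} (hq : q.norm ≠ 0) :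
    ∃ φ : CFunField →ₐ[ZField] CFunField,
      φ tC * (conjL (cz q.b₁ q.b₂) * tC + conjL (cz q.a₁ q.a₂)) =
      cz q.a₁ q.a₂ * tC + cz q.b₁ q.b₂ * (1 - zC ^ 2) := by
  have hden := denom_ne_zero hq
  obtain ⟨φ, hφ⟩ := exists_algHom_apply_eq transcendental_tC adjoin_tC
    (f := (cz q.a₁ q.a₂ * tC + cz q.b₁ q.b₂ * (1 - zC ^ 2)) /
      (conjL (cz q.b₁ q.b₂) * tC + conjL (cz q.a₁ q.a₂))) (by
    rintro ⟨⟨e, he⟩, h⟩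
    change e = _ at h
    rw [eq_div_iff hden] at h
    by_contra
    refine linear_ne_zero' (c := e * conjL (cz q.b₁ q.b₂) - cz q.a₁ q.a₂)
      (d := e * conjL (cz q.a₁ q.a₂) - cz q.b₁ q.b₂ * (1 - zC ^ 2)) ?_ ?_ ?_ ?_
    · exact ZField.sub_mem (ZField.mul_mem he (conjL_cz_mem _ _)) (cz_mem _ _)
    · exact ZField.sub_mem (ZField.mul_mem he (conjL_cz_mem _ _))
        (ZField.mul_mem (cz_mem _ _) one_sub_zC_mem)
    · by_contra! h0
      apply rz_ne_zero hq
      rw [← det_eq]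
      linear_combination conjL (cz q.b₁ q.b₂) * h0.2 - conjL (cz q.a₁ q.a₂) * h0.1
    · linear_combination h)
  exact ⟨φ, by rw [hφ, div_mul_cancel₀ _ hden]⟩

/-- The adjugate matrix provides the inverse endomorphism. Conjugation sends t to (1 - z²)/t, and
the shape of the matrix is exactly what makes the endomorphism commute with it, so that `exists_bir`
descends it to ℝ. -/
theorem exists_acts {q : QPoly} (hq : q.norm ≠ 0) : ∃ g, q.Acts g := by
  obtain ⟨φ, hφ⟩ := exists_zField_algHom hq
  obtain ⟨ψ, hψ⟩ := exists_zField_algHom (q := q.adj) (by rwa [norm_adj])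
  have hE : ∀ (χ : CFunField →ₐ[ZField] CFunField) (w : CFunField), w ∈ ZField → χ w = w :=
    fun χ w hw => χ.commutes ⟨w, hw⟩
  have ea : cz q.adj.a₁ q.adj.a₂ = conjL (cz q.a₁ q.a₂) := by
    rw [conjL_cz, cz, adj, rz_neg]; ring
  have eb : cz q.adj.b₁ q.adj.b₂ = -cz q.b₁ q.b₂ := by
    rw [cz, cz, adj, rz_neg, rz_neg]; ring
  rw [ea, eb, conjL_conjL, map_neg] at hψ
  have hd := denom_ne_zero hq
  have hd' := denom_ne_zero (q := q.adj) (by rwa [norm_adj])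
  rw [ea, eb, conjL_conjL, map_neg] at hd'
  have hdet := det_eq q
  have hn := rz_ne_zero hq
  have ma := cz_mem q.a₁ q.a₂
  have mb := cz_mem q.b₁ q.b₂
  have ma' := conjL_cz_mem q.a₁ q.a₂
  have mb' := conjL_cz_mem q.b₁ q.b₂
  have mD := one_sub_zC_mem
  have eD : conjL (1 - zC ^ 2) = 1 - zC ^ 2 := by simp
  have eT : tC * conjL tC = 1 - zC ^ 2 := by rw [conjL_tC, tC_mul_tbarC]
  have cca := conjL_conjL (cz q.a₁ q.a₂)
  have ccb := conjL_conjL (cz q.b₁ q.b₂)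
  generalize haa : cz q.a₁ q.a₂ = a at *
  generalize hbb : cz q.b₁ q.b₂ = b at *
  generalize hDD : (1 - zC ^ 2 : CFunField) = D at *
  generalize ha' : conjL a = a' at *
  generalize hb' : conjL b = b' at *
  have c1 : ∀ w, φ (ψ w) = w := by
    have h1 := congrArg φ hψ
    simp only [map_mul, map_add, map_neg, hE φ _ ma, hE φ _ mb, hE φ _ mb', hE φ _ ma', hE φ _ mD]
      at h1
    have h2 : (φ.comp ψ) = AlgHom.id ZField CFunField := by
      refine algHom_ext_of_adjoin_eq_top adjoin_tC ?_
      change φ (ψ tC) = tC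
      have h3 : φ (ψ tC) * rz q.norm = tC * rz q.norm := by
        rw [← hdet]
        linear_combination (b' * tC + a') * h1 + (b' * φ (ψ tC) + a') * hφ
      exact mul_right_cancel₀ hn h3
    intro w
    exact congrArg (fun χ : CFunField →ₐ[ZField] CFunField => χ w) h2
  have c2 : ∀ w, ψ (φ w) = w := by
    have h1 := congrArg ψ hφ
    simp only [map_mul, map_add, hE ψ _ ma, hE ψ _ mb, hE ψ _ mb', hE ψ _ ma', hE ψ _ mD]
      at h1
    have h2 : (ψ.comp φ) = AlgHom.id ZField CFunField := by
      refine algHom_ext_of_adjoin_eq_top adjoin_tC ?_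
      change ψ (φ tC) = tC
      have h3 : ψ (φ tC) * rz q.norm = tC * rz q.norm := by
        rw [← hdet]
        linear_combination (-b' * tC + a) * h1 + (-b' * ψ (φ tC) + a) * hψ
      exact mul_right_cancel₀ hn h3
    intro w
    exact congrArg (fun χ : CFunField →ₐ[ZField] CFunField => χ w) h2
  have c3 : ∀ w, conjL (φ w) = φ (conjL w) := by
    have h2 : ((conjL : CFunField →+* CFunField).comp (φ : CFunField →+* CFunField)) =
        (φ : CFunField →+* CFunField).comp (conjL : CFunField →+* CFunField) := by
      refine ringHom_ext_tz (fun c => ?_) ?_ ?_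
      · change conjL (φ (const c)) = φ (conjL (const c))
        rw [hE φ _ (const_mem _ c), conjL_const, hE φ _ (const_mem _ _)]
      · change conjL (φ tC) = φ (conjL tC)
        have h1 := congrArg conjL hφ
        have h3 := congrArg φ eT
        simp only [map_mul, map_add, cca, ccb, eD, ha', hb', hE φ _ mD] at h1 h3
        have hF : φ tC ≠ 0 := fun h => tC_ne_zero (φ.toRingHom.injective (by
          rw [map_zero]; exact h))
        -- The image T of t satisfies T T̄ = 1 - z², the relation that t itself satisfies; this
        -- determines T̄.
        have h4 : conjL (φ tC) * φ tC * (b' * tC + a') = D * (b' * tC + a') := by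
          linear_combination tC * h1 + conjL (φ tC) * hφ - (conjL (φ tC) * b - a') * eT
        have h5 := mul_right_cancel₀ hd h4
        apply mul_right_cancel₀ hF
        rw [h5, ← h3, mul_comm]
      · change conjL (φ zC) = φ (conjL zC)
        rw [hE φ _ zC_mem, conjL_zC, hE φ _ zC_mem]
    intro w
    exact congrArg (fun χ : CFunField →+* CFunField => χ w) h2
  obtain ⟨g, hg⟩ := exists_bir (φ := φ.restrictScalars ℂ) (ψ := ψ.restrictScalars ℂ) c1 c2 c3
  refine ⟨g, ?_, ?_⟩
  · rw [hg]; exact hE φ _ zC_mem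
  · rw [hg, haa, hbb, ha', hb', hDD]; exact hφ

theorem baseChange_of_mem {g : Bir} (hg : baseChange g zC = zC) {w : CFunField}
    (hw : w ∈ ZField) : baseChange g w = w := by
  induction hw using IntermediateField.adjoin_induction with
  | mem x hx => rw [Set.mem_singleton_iff.1 hx, hg]
  | algebraMap x => exact baseChange_const g x
  | add x y _ _ hx hy => rw [map_add, hx, hy]
  | inv x _ hx => rw [map_inv₀, hx]
  | mul x y _ _ hx hy => rw [map_mul, hx, hy]

theorem baseChange_inv_zC {g : Bir} (hg : baseChange g zC = zC) : baseChange g⁻¹ zC = zC := by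
  conv_lhs => rw [← hg]
  exact baseChange_inv_apply g zC

theorem Acts.inv {q : QPoly} {g : Bir} (hg : q.Acts g) : q.adj.Acts g⁻¹ := by
  obtain ⟨h1, h2⟩ := hg
  have hz := baseChange_inv_zC h1
  refine ⟨hz, ?_⟩
  have ea : cz q.adj.a₁ q.adj.a₂ = conjL (cz q.a₁ q.a₂) := by
    rw [conjL_cz, cz, adj, rz_neg]; ring
  have eb : cz q.adj.b₁ q.adj.b₂ = -cz q.b₁ q.b₂ := by
    rw [cz, cz, adj, rz_neg, rz_neg]; ring
  have h3 := congrArg (baseChange g⁻¹) h2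
  simp only [map_mul, map_add, baseChange_inv_apply, baseChange_of_mem hz (cz_mem _ _),
    baseChange_of_mem hz (conjL_cz_mem _ _), baseChange_of_mem hz one_sub_zC_mem] at h3
  rw [ea, eb, conjL_conjL, map_neg]
  linear_combination -h3

/-- A real polynomial in the third coordinate. -/
def pz (p : Polynomial ℝ) : MvPolynomial (Fin 3) ℝ := Polynomial.aeval (X 2) p

theorem toFun_pz (p : Polynomial ℝ) : toFun (pz p) = Polynomial.aeval zS p := by
  rw [pz, ← Polynomial.aeval_algHom_apply]
  rfl

theorem incl_toFun_pz (p : Polynomial ℝ) : incl (toFun (pz p)) = rz p := by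
  rw [toFun_pz, rz]

theorem aeval_pz (P : Fin 3 → ℂ) (p : Polynomial ℝ) :
    aeval P (pz p) = Polynomial.aeval (P 2) p := by
  rw [pz, ← Polynomial.aeval_algHom_apply, aeval_X]

theorem eval_pz (P : Fin 3 → ℝ) (p : Polynomial ℝ) : eval P (pz p) = p.eval (P 2) := by
  have h : aeval P (pz p) = Polynomial.aeval (P 2) p := by
    rw [pz, ← Polynomial.aeval_algHom_apply, aeval_X]
  rw [← MvPolynomial.coe_aeval_eq_eval, ← Polynomial.coe_aeval_eq_eval]
  exact h

/-- Real and imaginary part of `b̄ t + ā` and of `a t + b (1 - z²)`. -/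
def denRe (q : QPoly) : MvPolynomial (Fin 3) ℝ := pz q.b₁ * X 0 - pz q.b₂ * X 1 + pz q.a₁
def denIm (q : QPoly) : MvPolynomial (Fin 3) ℝ := -pz q.b₁ * X 1 - pz q.b₂ * X 0 - pz q.a₂
def numRe (q : QPoly) : MvPolynomial (Fin 3) ℝ :=
  pz q.a₁ * X 0 + pz q.a₂ * X 1 + pz q.b₁ * (1 - X 2 ^ 2)
def numIm (q : QPoly) : MvPolynomial (Fin 3) ℝ :=
  pz q.a₂ * X 0 - pz q.a₁ * X 1 + pz q.b₂ * (1 - X 2 ^ 2)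

/-- The image of x - iy is a quotient of two complex expressions. Multiplying by the conjugate of
the denominator and separating real and imaginary parts gives formulas over ℝ with the common
denominator |b̄ t + ā|². -/
theorem Acts.xS_yS {q : QPoly} {g : Bir} (hg : q.Acts g) :
    g xS * toFun (q.denRe ^ 2 + q.denIm ^ 2) =
        toFun (q.numRe * q.denRe + q.numIm * q.denIm) ∧
      g yS * toFun (q.denRe ^ 2 + q.denIm ^ 2) =
        toFun (q.numRe * q.denIm - q.numIm * q.denRe) := by
  have h := hg.2
  have hX : ∀ i, incl (toFun (X i)) = ![xC, yC, zC] i := fun i => by fin_cases i <;> rfl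
  have e1 : conjL (cz q.b₁ q.b₂) * tC + conjL (cz q.a₁ q.a₂) =
      incl (toFun q.denRe) + const Complex.I * incl (toFun q.denIm) := by
    simp only [denRe, denIm, map_add, map_sub, map_mul, map_neg, incl_toFun_pz, hX, conjL_cz,
      Matrix.cons_val, tC]
    linear_combination rz q.b₂ * yC * const_I_sq
  have e2 : cz q.a₁ q.a₂ * tC + cz q.b₁ q.b₂ * (1 - zC ^ 2) =
      incl (toFun q.numRe) + const Complex.I * incl (toFun q.numIm) := by
    simp only [numRe, numIm, map_add, map_sub, map_mul, map_one, map_pow, incl_toFun_pz, hX, cz,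
      Matrix.cons_val, tC]
    linear_combination -rz q.a₂ * yC * const_I_sq
  have e3 : baseChange g tC = incl (g xS) - const Complex.I * incl (g yS) := by
    rw [tC, xC_eq, yC_eq, map_sub, map_mul, baseChange_const, baseChange_incl, baseChange_incl]
  rw [e1, e2, e3] at h
  obtain ⟨h1, h2⟩ := mk_inj (a := g xS * toFun q.denRe + g yS * toFun q.denIm)
    (b := g xS * toFun q.denIm - g yS * toFun q.denRe) (a' := toFun q.numRe) (b' := toFun q.numIm)
    (by
      rw [← h]
      simp only [map_add, map_sub, map_mul]
      linear_combination incl (g yS) * incl (toFun q.denIm) * const_I_sq)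
  simp only [map_add, map_sub, map_mul, map_pow]
  constructor
  · linear_combination toFun q.denRe * h1 + toFun q.denIm * h2
  · linear_combination toFun q.denIm * h1 - toFun q.denRe * h2

theorem eval_norm (q : QPoly) (r : ℝ) : q.norm.eval r = q.a₁.eval r ^ 2 + q.a₂.eval r ^ 2 -
    (q.b₁.eval r ^ 2 + q.b₂.eval r ^ 2) * (1 - r ^ 2) := by
  simp [norm]

theorem sq_le_one_of_mem {p : Fin 3 → ℝ} (hp : p ∈ realPoints) : p 2 ∈ Set.Icc (-1 : ℝ) 1 := by
  have : p 0 ^ 2 + p 1 ^ 2 + p 2 ^ 2 = 1 := hp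
  constructor <;> nlinarith [sq_nonneg (p 0), sq_nonneg (p 1)]

/-- If the denominator |b̄ t + ā|² vanishes at a real point, then |a|² = |b|²|t|² = |b|²(1 - z²)
there, so the norm vanishes at its height z, which lies in [-1, 1]. -/
theorem Acts.definedAtReal {q : QPoly} {g : Bir} (hg : q.Acts g)
    (hq : ∀ r ∈ Set.Icc (-1 : ℝ) 1, q.norm.eval r ≠ 0) : DefinedAtReal g := by
  intro p hp
  have hD : eval p (q.denRe ^ 2 + q.denIm ^ 2) ≠ 0 := by
    intro h0
    apply hq _ (sq_le_one_of_mem hp)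
    have hp' : p 0 ^ 2 + p 1 ^ 2 + p 2 ^ 2 = 1 := hp
    rw [map_add, map_pow, map_pow] at h0
    have h1 : eval p q.denRe = 0 := by nlinarith
    have h2 : eval p q.denIm = 0 := by nlinarith
    simp only [denRe, denIm, map_add, map_sub, map_mul, map_neg, eval_X, eval_pz] at h1 h2
    rw [eval_norm]
    have h3 : Polynomial.eval (p 2) q.a₁ = -(Polynomial.eval (p 2) q.b₁ * p 0 -
      Polynomial.eval (p 2) q.b₂ * p 1) := by linarith
    have h4 : Polynomial.eval (p 2) q.a₂ = -Polynomial.eval (p 2) q.b₁ * p 1 -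
      Polynomial.eval (p 2) q.b₂ * p 0 := by linarith
    rw [h3, h4]
    linear_combination
      (Polynomial.eval (p 2) q.b₁ ^ 2 + Polynomial.eval (p 2) q.b₂ ^ 2) * hp'
  obtain ⟨h1, h2⟩ := hg.xS_yS
  intro i
  fin_cases i
  · exact ⟨_, _, hD, h1⟩
  · exact ⟨_, _, hD, h2⟩
  · refine ⟨X 2, 1, by simp, ?_⟩
    rw [map_one, mul_one]
    exact baseChange_zC_eq_iff.1 hg.1

theorem Acts.mem_autRealOverPi {q : QPoly} {g : Bir} (hg : q.Acts g)
    (hq : ∀ r ∈ Set.Icc (-1 : ℝ) 1, q.norm.eval r ≠ 0) : g ∈ autRealOverPi := by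
  have hz := baseChange_zC_eq_iff.1 hg.1
  refine ⟨⟨⟨hg.definedAtReal hq, hg.inv.definedAtReal (by rwa [norm_adj])⟩, 1, 0, 0, 1, ?_, ?_⟩, hz⟩
  · norm_num
  · rw [hz]; simp

end QPoly

/-! ### Construction of birational maps from formulas -/

theorem aeval_eq_zero_of_toFun {f : Fin 3 → FunField} (hf : f 0 ^ 2 + f 1 ^ 2 + f 2 ^ 2 = 1)
    {F : MvPolynomial (Fin 3) ℝ} (hF : toFun F = 0) : aeval f F = 0 := by
  obtain ⟨Q, rfl⟩ := (toFun_eq_zero_iff F).1 hF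
  have : aeval f spherePoly = 0 := by
    simp only [spherePoly, map_sub, map_add, map_pow, map_one, aeval_X, hf, sub_self]
  rw [map_mul, this, zero_mul]

/-- The substitution f is injective on functions because f' undoes it. A power of D clears the
denominators of F ∘ f to a polynomial G, and substituting f' into G gives back F up to a nonzero
factor. -/
theorem toFun_eq_zero_of_aeval {N : Fin 3 → MvPolynomial (Fin 3) ℝ} {D : MvPolynomial (Fin 3) ℝ}
    {f f' : Fin 3 → FunField} (hf : ∀ i, f i * toFun D = toFun (N i))
    (hf' : f' 0 ^ 2 + f' 1 ^ 2 + f' 2 ^ 2 = 1) (hD : aeval f' D ≠ 0)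
    (hN : ∀ i, aeval f' (N i) = toFun (X i) * aeval f' D)
    {F : MvPolynomial (Fin 3) ℝ} (hF : aeval f F = 0) : toFun F = 0 := by
  have key : ∀ F : MvPolynomial (Fin 3) ℝ, ∃ (n : ℕ) (G : MvPolynomial (Fin 3) ℝ),
      toFun G = aeval f F * toFun D ^ n ∧ aeval f' G = toFun F * aeval f' D ^ n := by
    intro F
    induction F using MvPolynomial.induction_on with
    | C a =>
      have ha : toFun (C a) = algebraMap ℝ FunField a := toFun.commutes a
      exact ⟨0, C a, by rw [ha, algHom_C, pow_zero, mul_one],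
        by rw [ha, algHom_C, pow_zero, mul_one]⟩
    | add F F' h h' =>
      obtain ⟨n, G, h1, h2⟩ := h
      obtain ⟨n', G', h1', h2'⟩ := h'
      refine ⟨n + n', G * D ^ n' + G' * D ^ n, ?_, ?_⟩
      · simp only [map_add, map_mul, map_pow, h1, h1']; ring
      · simp only [map_add, map_mul, map_pow, h2, h2']; ring
    | mul_X F i h =>
      obtain ⟨n, G, h1, h2⟩ := h
      refine ⟨n + 1, G * N i, ?_, ?_⟩
      · rw [map_mul, map_mul, aeval_X, h1, ← hf]; ring
      · rw [map_mul, map_mul, h2, hN]; ring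
  obtain ⟨n, G, h1, h2⟩ := key F
  rw [hF, zero_mul] at h1
  rw [aeval_eq_zero_of_toFun hf' h1] at h2
  exact (mul_eq_zero.1 h2.symm).resolve_right (pow_ne_zero _ hD)

theorem exists_algHom_of_injective {f : Fin 3 → FunField} (hf : f 0 ^ 2 + f 1 ^ 2 + f 2 ^ 2 = 1)
    (hinj : ∀ F : MvPolynomial (Fin 3) ℝ, aeval f F = 0 → toFun F = 0) :
    ∃ φ : FunField →ₐ[ℝ] FunField, ∀ F, φ (toFun F) = aeval f F := by
  let φ₀ : CoordRing →ₐ[ℝ] FunField := Ideal.Quotient.liftₐ _ (aeval f) (fun F hF => by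
    refine aeval_eq_zero_of_toFun hf ((toFun_eq_zero_iff F).2 ?_)
    exact Ideal.mem_span_singleton.1 hF)
  have h0 : Function.Injective φ₀ := by
    rw [injective_iff_map_eq_zero]
    intro a
    obtain ⟨F, rfl⟩ := Ideal.Quotient.mk_surjective a
    intro h
    have h1 := hinj F h
    rw [toFun_eq_zero_iff, ← Ideal.mem_span_singleton] at h1
    exact Ideal.Quotient.eq_zero_iff_mem.2 h1
  refine ⟨IsFractionRing.liftAlgHom (K := FunField) h0, fun F => ?_⟩
  exact IsFractionRing.lift_algebraMap (K := FunField) h0 (Ideal.Quotient.mk _ F)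

theorem algHom_eq_id {φ : FunField →ₐ[ℝ] FunField} (h : ∀ i, φ (toFun (X i)) = toFun (X i))
    (w : FunField) : φ w = w := by
  have hF : ∀ F, φ (toFun F) = toFun F := by
    intro F
    have : φ.comp toFun = toFun := MvPolynomial.algHom_ext fun i => h i
    exact congrArg (fun χ : MvPolynomial (Fin 3) ℝ →ₐ[ℝ] FunField => χ F) this
  obtain ⟨N, D, hD, h⟩ := exists_toFun_div w
  have h1 := congrArg φ h
  rw [map_mul, hF, hF, ← h] at h1
  exact mul_right_cancel₀ hD h1

/-- Mutually inverse formulas define a birational map. -/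
theorem exists_bir_of_formulas {N N' : Fin 3 → MvPolynomial (Fin 3) ℝ}
    {D D' : MvPolynomial (Fin 3) ℝ} {f f' : Fin 3 → FunField}
    (hf : ∀ i, f i * toFun D = toFun (N i)) (hf' : ∀ i, f' i * toFun D' = toFun (N' i))
    (hs : f 0 ^ 2 + f 1 ^ 2 + f 2 ^ 2 = 1) (hs' : f' 0 ^ 2 + f' 1 ^ 2 + f' 2 ^ 2 = 1)
    (hD : aeval f' D ≠ 0) (hD' : aeval f D' ≠ 0)
    (hN : ∀ i, aeval f' (N i) = toFun (X i) * aeval f' D)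
    (hN' : ∀ i, aeval f (N' i) = toFun (X i) * aeval f D') :
    ∃ g : Bir, (∀ i, g (toFun (X i)) = f i) ∧ ∀ i, g⁻¹ (toFun (X i)) = f' i := by
  obtain ⟨φ, hφ⟩ := exists_algHom_of_injective hs fun F hF =>
    toFun_eq_zero_of_aeval hf hs' hD hN hF
  obtain ⟨ψ, hψ⟩ := exists_algHom_of_injective hs' fun F hF =>
    toFun_eq_zero_of_aeval hf' hs hD' hN' hF
  have h1 : ∀ w, φ (ψ w) = w := algHom_eq_id (φ := φ.comp ψ) fun i => by
    change φ (ψ (toFun (X i))) = _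
    have h := congrArg φ (hf' i)
    rw [map_mul, hφ, hφ, hN'] at h
    rw [hψ, aeval_X]
    exact mul_right_cancel₀ hD' h
  have h2 : ∀ w, ψ (φ w) = w := algHom_eq_id (φ := ψ.comp φ) fun i => by
    change ψ (φ (toFun (X i))) = _
    have h := congrArg ψ (hf i)
    rw [map_mul, hψ, hψ, hN] at h
    rw [hφ, aeval_X]
    exact mul_right_cancel₀ hD h
  let g : Bir := AlgEquiv.ofAlgHom φ ψ (AlgHom.ext h1) (AlgHom.ext h2)
  refine ⟨g, fun i => ?_, fun i => ?_⟩
  · change φ (toFun (X i)) = _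
    rw [hφ, aeval_X]
  · change ψ (toFun (X i)) = _
    rw [hψ, aeval_X]

theorem definedAtReal_of_formulas {g : Bir} {N : Fin 3 → MvPolynomial (Fin 3) ℝ}
    {D : MvPolynomial (Fin 3) ℝ} (hD : ∀ p ∈ realPoints, eval p D ≠ 0)
    (h : ∀ i, g (toFun (X i)) * toFun D = toFun (N i)) : DefinedAtReal g :=
  fun p hp i => ⟨N i, D, hD p hp, h i⟩

theorem toFun_ne_zero_of_eval {F : MvPolynomial (Fin 3) ℝ} {p : Fin 3 → ℝ} (hp : p ∈ realPoints)
    (h : eval p F ≠ 0) : toFun F ≠ 0 := fun h0 => h (toFun_eq_zero h0 hp)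

theorem sphere_eq_real : xS ^ 2 + yS ^ 2 + zS ^ 2 = 1 := by
  have h := toFun_spherePoly
  simp only [spherePoly, map_sub, map_add, map_pow, map_one] at h
  exact sub_eq_zero.1 h

/-- A real constant as a function on `S`. -/
abbrev rc (r : ℝ) : FunField := algebraMap ℝ FunField r

theorem toFun_C (r : ℝ) : toFun (C r) = rc r := toFun.commutes r

theorem northPole_mem : (![0, 0, 1] : Fin 3 → ℝ) ∈ realPoints := by
  change (0 : ℝ) ^ 2 + 0 ^ 2 + 1 ^ 2 = 1
  norm_num

theorem rc_ne_zero {r : ℝ} (h : r ≠ 0) : rc r ≠ 0 := by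
  rw [Ne, map_eq_zero_iff _ (algebraMap ℝ FunField).injective]; exact h

theorem incl_rc (r : ℝ) : incl (rc r) = const r := incl_algebraMap r

/-- Rotations about the `z`-axis. -/
theorem exists_rotation {l : ℂ} (hl : ‖l‖ = 1) :
    ∃ h ∈ autRealPi, baseChange h tC = const l * tC ∧ baseChange h zC = zC := by
  have hl2 : l.re ^ 2 + l.im ^ 2 = 1 := by
    have := Complex.sq_norm l
    rw [hl, Complex.normSq_apply] at this
    linarith
  have hlK : rc l.re ^ 2 + rc l.im ^ 2 = 1 := by
    rw [← map_pow, ← map_pow, ← map_add, hl2, map_one]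
  have hN : ∀ a b : ℝ, ∃ N : Fin 3 → MvPolynomial (Fin 3) ℝ,
      N = ![C a * X 0 + C b * X 1, C a * X 1 - C b * X 0, X 2] := fun a b => ⟨_, rfl⟩
  obtain ⟨N, hN1⟩ := hN l.re l.im
  obtain ⟨N', hN1'⟩ := hN l.re (-l.im)
  have e : ∀ i, toFun (N i) =
      ![rc l.re * xS + rc l.im * yS, rc l.re * yS - rc l.im * xS, zS] i := by
    intro i
    fin_cases i <;> simp [hN1, xS, yS, zS]
  have e' : ∀ i, toFun (N' i) =
      ![rc l.re * xS - rc l.im * yS, rc l.re * yS + rc l.im * xS, zS] i := by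
    intro i
    fin_cases i <;> simp [hN1', xS, yS, zS]
    ring
  obtain ⟨g, hg, hg'⟩ := exists_bir_of_formulas (N := N) (N' := N') (D := 1) (D' := 1)
    (f := fun i => toFun (N i)) (f' := fun i => toFun (N' i)) (by simp) (by simp)
    (by
      simp only [e, Matrix.cons_val]
      linear_combination (xS ^ 2 + yS ^ 2) * hlK + sphere_eq_real)
    (by
      simp only [e', Matrix.cons_val]
      linear_combination (xS ^ 2 + yS ^ 2) * hlK + sphere_eq_real)
    (by simp) (by simp)
    (by
      intro i
      rw [map_one, mul_one]
      fin_cases i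
      · simp only [hN1, Fin.zero_eta, Matrix.cons_val, map_add, map_mul, aeval_X, algHom_C, e']
        change _ = xS
        linear_combination xS * hlK
      · simp only [hN1, Fin.mk_one, Matrix.cons_val, map_sub, map_mul, aeval_X, algHom_C, e']
        change _ = yS
        linear_combination yS * hlK
      · simp only [hN1, Fin.reduceFinMk, Matrix.cons_val, aeval_X, e']
        rfl)
    (by
      intro i
      rw [map_one, mul_one]
      fin_cases i
      · simp only [hN1', Fin.zero_eta, Matrix.cons_val, map_add, map_mul, aeval_X, algHom_C, e,
          map_neg]
        change _ = xS
        linear_combination xS * hlK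
      · simp only [hN1', Fin.mk_one, Matrix.cons_val, map_sub, map_mul, aeval_X, algHom_C, e,
          map_neg]
        change _ = yS
        linear_combination yS * hlK
      · simp only [hN1', Fin.reduceFinMk, Matrix.cons_val, aeval_X, e]
        rfl)
  have hgx : g xS = rc l.re * xS + rc l.im * yS := (hg 0).trans (e 0)
  have hgy : g yS = rc l.re * yS - rc l.im * xS := (hg 1).trans (e 1)
  have hgz : g zS = zS := (hg 2).trans (e 2)
  refine ⟨g, ⟨⟨definedAtReal_of_formulas (N := N) (D := 1) (by simp) (by simpa using hg),
    definedAtReal_of_formulas (N := N') (D := 1) (by simp) (by simpa using hg')⟩,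
    1, 0, 0, 1, by norm_num, by rw [hgz]; simp⟩, ?_, ?_⟩
  · rw [tC, xC_eq, yC_eq, map_sub, map_mul, baseChange_const, baseChange_incl, baseChange_incl,
      hgx, hgy]
    simp only [map_add, map_sub, map_mul, incl_rc]
    have : const l = const l.re + const Complex.I * const l.im := by
      rw [← const_mul, ← const_add, mul_comm, Complex.re_add_im]
    rw [this]
    linear_combination const l.im * incl yS * const_I_sq
  · rw [zC_eq, baseChange_incl, hgz]

/-- The hyperbolic translations `z ↦ (z + r) / (r z + 1)`. -/
theorem exists_boost {r k : ℝ} (hr : |r| < 1) (hk : k ^ 2 = 1 - r ^ 2) :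
    ∃ h ∈ autRealPi, baseChange h tC * (1 + const r * zC) = const k * tC ∧
      baseChange h zC * (1 + const r * zC) = zC + const r := by
  have hr1 := abs_lt.1 hr
  have hk0 : 1 - r ^ 2 ≠ 0 := by nlinarith
  have hN : ∀ a : ℝ, ∃ N : Fin 3 → MvPolynomial (Fin 3) ℝ,
      N = ![C k * X 0, C k * X 1, X 2 + C a] := fun a => ⟨_, rfl⟩
  -- Since (1 + rz)² - (z + r)² = (1 - r²)(1 - z²), the equation of the sphere requires x and y to
  -- be scaled by k with k² = 1 - r².
  have hkK : rc k ^ 2 = 1 - rc r ^ 2 := by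
    rw [← map_pow, hk, map_sub, map_pow, map_one]
  obtain ⟨N, hN1⟩ := hN r
  obtain ⟨N', hN1'⟩ := hN (-r)
  -- On the real sphere |z| ≤ 1, so the denominators 1 ± rz are positive there.
  have hpos : ∀ (a : ℝ), |a| < 1 → ∀ p ∈ realPoints,
      eval p (1 + C a * X 2 : MvPolynomial (Fin 3) ℝ) ≠ 0 := by
    intro a ha p hp
    have hp2 := QPoly.sq_le_one_of_mem hp
    have ha1 := abs_lt.1 ha
    simp only [map_add, map_one, map_mul, eval_C, eval_X]
    have h3 : |a * p 2| < 1 := by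
      rw [abs_mul]
      have := abs_le.2 hp2
      nlinarith [abs_nonneg a, abs_nonneg (p 2)]
    have := (abs_lt.1 h3).1
    linarith
  have hr' : |-r| < 1 := by rwa [abs_neg]
  have eD : toFun (1 + C r * X 2) = 1 + rc r * zS := by
    simp [zS]
  have eD' : toFun (1 + C (-r) * X 2) = 1 - rc r * zS := by
    simp only [map_add, map_one, map_mul, toFun_C, zS, map_neg]; ring
  have hD0 := toFun_ne_zero_of_eval northPole_mem (hpos r hr _ northPole_mem)
  have hD0' := toFun_ne_zero_of_eval northPole_mem (hpos (-r) hr' _ northPole_mem)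
  rw [eD] at hD0
  rw [eD'] at hD0'
  obtain ⟨u, hu⟩ : ∃ u, u * (1 + rc r * zS) = 1 := ⟨_, inv_mul_cancel₀ hD0⟩
  obtain ⟨u', hu'⟩ : ∃ u, u * (1 - rc r * zS) = 1 := ⟨_, inv_mul_cancel₀ hD0'⟩
  have hu0 : u ≠ 0 := left_ne_zero_of_mul_eq_one hu
  have hu0' : u' ≠ 0 := left_ne_zero_of_mul_eq_one hu'
  have e : ∀ i, toFun (N i) = ![rc k * xS, rc k * yS, zS + rc r] i := by
    intro i
    fin_cases i <;> simp [hN1, xS, yS, zS]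
  have e' : ∀ i, toFun (N' i) = ![rc k * xS, rc k * yS, zS - rc r] i := by
    intro i
    fin_cases i <;> simp [hN1', xS, yS, zS]
    ring
  have hkc : 1 - rc r ^ 2 ≠ 0 := by
    have := rc_ne_zero hk0
    rwa [rc, map_sub, map_one, map_pow] at this
  have a1 : aeval (fun i => toFun (N' i) * u')
      (1 + C r * X 2 : MvPolynomial (Fin 3) ℝ) = (1 - rc r ^ 2) * u' := by
    simp only [map_add, map_one, map_mul, algHom_C, aeval_X, e', Matrix.cons_val]
    linear_combination -hu'
  have a2 : aeval (fun i => toFun (N i) * u)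
      (1 + C (-r) * X 2 : MvPolynomial (Fin 3) ℝ) = (1 - rc r ^ 2) * u := by
    simp only [map_add, map_one, map_mul, algHom_C, aeval_X, e, Matrix.cons_val, map_neg]
    linear_combination -hu
  have b1 : ∀ i, aeval (fun i => toFun (N' i) * u') (N i) =
      ![rc k * (rc k * xS * u'), rc k * (rc k * yS * u'), (zS - rc r) * u' + rc r] i := by
    intro i
    fin_cases i <;> simp [hN1, e']
  have b2 : ∀ i, aeval (fun i => toFun (N i) * u) (N' i) =
      ![rc k * (rc k * xS * u), rc k * (rc k * yS * u), (zS + rc r) * u - rc r] i := by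
    intro i
    fin_cases i <;> simp [hN1', e]
    ring
  obtain ⟨g, hg, hg'⟩ := exists_bir_of_formulas (N := N) (N' := N') (D := 1 + C r * X 2)
    (D' := 1 + C (-r) * X 2) (f := fun i => toFun (N i) * u) (f' := fun i => toFun (N' i) * u')
    (fun i => by rw [eD, mul_assoc, hu, mul_one]) (fun i => by rw [eD', mul_assoc, hu', mul_one])
    (by
      simp only [e, Matrix.cons_val]
      linear_combination u ^ 2 * (xS ^ 2 + yS ^ 2) * hkK +
        u ^ 2 * (1 - rc r ^ 2) * sphere_eq_real + (u * (1 + rc r * zS) + 1) * hu)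
    (by
      simp only [e', Matrix.cons_val]
      linear_combination u' ^ 2 * (xS ^ 2 + yS ^ 2) * hkK +
        u' ^ 2 * (1 - rc r ^ 2) * sphere_eq_real + (u' * (1 - rc r * zS) + 1) * hu')
    (by rw [a1]; exact mul_ne_zero hkc hu0')
    (by rw [a2]; exact mul_ne_zero hkc hu0)
    (by
      intro i
      rw [a1, b1]
      fin_cases i
      · change rc k * (rc k * xS * u') = xS * _
        linear_combination u' * xS * hkK
      · change rc k * (rc k * yS * u') = yS * _
        linear_combination u' * yS * hkK
      · change (zS - rc r) * u' + rc r = zS * _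
        linear_combination -rc r * hu')
    (by
      intro i
      rw [a2, b2]
      fin_cases i
      · change rc k * (rc k * xS * u) = xS * _
        linear_combination u * xS * hkK
      · change rc k * (rc k * yS * u) = yS * _
        linear_combination u * yS * hkK
      · change (zS + rc r) * u - rc r = zS * _
        linear_combination rc r * hu)
  have hmul : ∀ i, g (toFun (X i)) * toFun (1 + C r * X 2) = toFun (N i) := fun i => by
    rw [hg, eD, mul_assoc, hu, mul_one]
  have hmul' : ∀ i, g⁻¹ (toFun (X i)) * toFun (1 + C (-r) * X 2) = toFun (N' i) := fun i => by
    rw [hg', eD', mul_assoc, hu', mul_one]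
  have hx := hmul 0
  have hy := hmul 1
  have hz := hmul 2
  rw [e, eD] at hx hy hz
  change g xS * _ = rc k * xS at hx
  change g yS * _ = rc k * yS at hy
  change g zS * _ = zS + rc r at hz
  refine ⟨g, ⟨⟨definedAtReal_of_formulas (hpos r hr) hmul,
    definedAtReal_of_formulas (hpos (-r) hr') hmul'⟩, 1, r, r, 1, ?_, ?_⟩, ?_, ?_⟩
  · intro h; apply hk0; linarith
  · rw [map_one]; linear_combination hz
  · have hx' := congrArg incl hx
    have hy' := congrArg incl hy
    simp only [map_add, map_mul, map_one, incl_rc] at hx' hy'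
    rw [tC, xC_eq, yC_eq, map_sub, map_mul, baseChange_const, baseChange_incl, baseChange_incl,
      zC_eq]
    linear_combination hx' - const Complex.I * hy'
  · have hz' := congrArg incl hz
    simp only [map_add, map_mul, map_one, incl_rc] at hz'
    rw [zC_eq, baseChange_incl]
    exact hz'

/-- The linear involution of the quadric that exchanges `p` with `q̄` and `q` with `p̄`. -/
theorem exists_linear_involution {μ : ℂ} (hμ : ‖μ‖ = 1) (hμ1 : μ ≠ 1) :
    ∃ c ∈ autReal, c * c = 1 ∧ ∀ W : CFunField,
      2 * W = 4 - ((1 + const μ) * (const Complex.I * tC) +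
        (1 + const (starRingEnd ℂ μ)) * (-const Complex.I * tbarC)) → W ≠ 0 ∧
      baseChange c (const Complex.I * tC) * W = (1 - zC) - const Complex.I * tC -
        const (starRingEnd ℂ μ) * (-const Complex.I * tbarC) +
          const (starRingEnd ℂ μ) * (1 + zC) ∧
      2 * (baseChange c zC * W) = (const μ - 1) * (const Complex.I * tC) +
        (const (starRingEnd ℂ μ) - 1) * (-const Complex.I * tbarC) := by
  obtain ⟨a, b, rfl⟩ : ∃ a b : ℝ, μ = a + b * Complex.I := ⟨_, _, (Complex.re_add_im μ).symm⟩
  have hab : a ^ 2 + b ^ 2 = 1 := by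
    have := Complex.sq_norm (a + b * Complex.I)
    rw [hμ, Complex.normSq_add_mul_I] at this
    linarith
  have ha : a ≠ 1 := by
    rintro rfl
    apply hμ1
    have : b = 0 := by nlinarith
    rw [this]; simp
  have habK : rc a ^ 2 + rc b ^ 2 = 1 := by
    rw [← map_pow, ← map_pow, ← map_add, hab, map_one]
  have ha1 : -1 ≤ a ∧ a < 1 := by
    refine ⟨by nlinarith [sq_nonneg b], lt_of_le_of_ne (by nlinarith [sq_nonneg b]) ha⟩
  -- A projective linear map in the chart w = 1, with μ = a + ib: the numerators N and the
  -- denominator D are polynomials of degree at most one with real coefficients.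
  obtain ⟨D, hD1⟩ : ∃ D : MvPolynomial (Fin 3) ℝ,
    D = 2 - (1 + C a) * X 1 + C b * X 0 := ⟨_, rfl⟩
  obtain ⟨N, hN1⟩ : ∃ N : Fin 3 → MvPolynomial (Fin 3) ℝ,
    N = ![-X 0 + C b * X 1 + C a * X 0 - C b * (1 + X 2),
      (1 - X 2) - X 1 - C a * X 1 + C b * X 0 + C a * (1 + X 2),
      (C a - 1) * X 1 - C b * X 0] := ⟨_, rfl⟩
  have hpos : ∀ p ∈ realPoints, eval p D ≠ 0 := by
    intro p hp h
    have hp' : p 0 ^ 2 + p 1 ^ 2 + p 2 ^ 2 = 1 := hp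
    simp only [hD1, map_add, map_sub, map_mul, map_one, map_ofNat, eval_C, eval_X] at h
    -- The linear form (1 + a)y - bx has squared length 2 + 2a < 4, so by Cauchy–Schwarz it cannot
    -- take the value 2 on the unit sphere.
    nlinarith [sq_nonneg (p 0 * (1 + a) + p 1 * b), sq_nonneg (p 2)]
  obtain ⟨d, hd⟩ : ∃ d, d = 2 - (1 + rc a) * yS + rc b * xS := ⟨_, rfl⟩
  have eD : toFun D = d := by
    simp only [hD1, hd, map_add, map_sub, map_mul, map_one, map_ofNat, toFun_C, xS, yS]
  have hd0 : d ≠ 0 := by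
    rw [← eD]; exact toFun_ne_zero_of_eval northPole_mem (hpos _ northPole_mem)
  have e : ∀ i, toFun (N i) = ![-xS + rc b * yS + rc a * xS - rc b * (1 + zS),
      (1 - zS) - yS - rc a * yS + rc b * xS + rc a * (1 + zS),
      (rc a - 1) * yS - rc b * xS] i := by
    intro i
    fin_cases i <;> simp [hN1, xS, yS, zS]
  have hk : 2 - 2 * rc a ≠ 0 := by
    have := rc_ne_zero (r := 2 - 2 * a) (by intro h; apply ha; linarith)
    rwa [rc, map_sub, map_mul, map_ofNat] at this
  obtain ⟨u, hu⟩ : ∃ u, u * d = 1 := ⟨_, inv_mul_cancel₀ hd0⟩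
  have hu0 : u ≠ 0 := left_ne_zero_of_mul_eq_one hu
  obtain ⟨f, hf⟩ : ∃ f : Fin 3 → FunField, f = fun i => toFun (N i) * u := ⟨_, rfl⟩
  have f0 : f 0 = (-xS + rc b * yS + rc a * xS - rc b * (1 + zS)) * u := by
    rw [hf]; beta_reduce; rw [e]; rfl
  have f1 : f 1 = ((1 - zS) - yS - rc a * yS + rc b * xS + rc a * (1 + zS)) * u := by
    rw [hf]; beta_reduce; rw [e]; rfl
  have f2 : f 2 = ((rc a - 1) * yS - rc b * xS) * u := by
    rw [hf]; beta_reduce; rw [e]; rfl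
  -- The square of the underlying linear map is the scalar 2 - 2a, which is nonzero because μ ≠ 1.
  -- Hence the same formulas serve for the inverse.
  have aD : aeval f D = (2 - 2 * rc a) * u := by
    simp only [hD1, map_add, map_sub, map_mul, map_one, map_ofNat, algHom_C, aeval_X, f0, f1]
    linear_combination u * (yS - zS - 1) * habK - 2 * hu + 2 * u * hd
  have aN : ∀ i, aeval f (N i) = toFun (X i) * ((2 - 2 * rc a) * u) := by
    intro i
    fin_cases i
    · simp only [hN1, Fin.zero_eta, Matrix.cons_val, map_add, map_sub, map_mul, map_one, map_neg,
        aeval_X, algHom_C, f0, f1, f2]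
      change _ = xS * _
      linear_combination u * xS * habK + rc b * hu - rc b * u * hd
    · simp only [hN1, Fin.mk_one, Matrix.cons_val, map_add, map_sub, map_mul, map_one,
        aeval_X, algHom_C, f0, f1, f2]
      change _ = yS * _
      linear_combination u * (yS - zS - 1) * habK - (1 + rc a) * hu + (1 + rc a) * u * hd
    · simp only [hN1, Fin.reduceFinMk, Matrix.cons_val, map_sub, map_mul, map_one,
        aeval_X, algHom_C, f0, f1]
      change _ = zS * _
      linear_combination u * (1 + zS - yS) * habK
  have hfs : f 0 ^ 2 + f 1 ^ 2 + f 2 ^ 2 = 1 := by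
    rw [f0, f1, f2]
    linear_combination u ^ 2 * ((2 - 2 * rc a) * sphere_eq_real +
      (xS ^ 2 + yS ^ 2 + zS ^ 2 + 1 + 2 * zS - 2 * yS * zS - 2 * yS) * habK) + (u * d + 1) * hu -
      u ^ 2 * (d + (2 - (1 + rc a) * yS + rc b * xS)) * hd
  have hfD : ∀ i, f i * toFun D = toFun (N i) := fun i => by
    rw [hf, eD, mul_assoc, hu, mul_one]
  have hne : aeval f D ≠ 0 := by rw [aD]; exact mul_ne_zero hk hu0
  obtain ⟨g, hg, hg'⟩ := exists_bir_of_formulas hfD hfD hfs hfs hne hne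
    (fun i => by rw [aD, aN]) (fun i => by rw [aD, aN])
  have hgg : g * g = 1 := by
    have hall : ∀ w, (g⁻¹ * g⁻¹ : Bir) w = w :=
      algHom_eq_id (φ := ((g⁻¹ * g⁻¹ : Bir) : FunField →ₐ[ℝ] FunField)) fun i => by
        change g⁻¹ (g⁻¹ (toFun (X i))) = _
        rw [hg', ← hg, ← AlgEquiv.mul_apply, inv_mul_cancel, AlgEquiv.one_apply]
    have : (g⁻¹ * g⁻¹ : Bir) = 1 := AlgEquiv.ext hall
    rwa [← mul_inv_rev, inv_eq_one] at this
  have hinv : g = g⁻¹ := eq_inv_of_mul_eq_one_left hgg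
  have hdef : DefinedAtReal g := definedAtReal_of_formulas hpos fun i => by rw [hg, hfD]
  refine ⟨g, ⟨hdef, by rwa [← hinv]⟩, hgg, fun W hW => ?_⟩
  have hx : g xS * d = -xS + rc b * yS + rc a * xS - rc b * (1 + zS) := by
    rw [← eD]; exact (congrArg (· * toFun D) (hg 0)).trans ((hfD 0).trans (e 0))
  have hy : g yS * d = (1 - zS) - yS - rc a * yS + rc b * xS + rc a * (1 + zS) := by
    rw [← eD]; exact (congrArg (· * toFun D) (hg 1)).trans ((hfD 1).trans (e 1))
  have hz : g zS * d = (rc a - 1) * yS - rc b * xS := by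
    rw [← eD]; exact (congrArg (· * toFun D) (hg 2)).trans ((hfD 2).trans (e 2))
  have hμc : const (a + b * Complex.I) = const a + const b * const Complex.I := by
    rw [const_add, const_mul]
  have hμc' : const (starRingEnd ℂ (a + b * Complex.I)) =
      const a - const b * const Complex.I := by
    rw [map_add, map_mul, Complex.conj_ofReal, Complex.conj_ofReal, Complex.conj_I, const_add,
      const_mul, const_neg]
    ring
  have hWd : W = incl d := by
    rw [hμc, hμc', tC, tbarC] at hW
    have h2 : 2 * W = 2 * incl d := by
      rw [hW, hd]
      simp only [map_add, map_sub, map_mul, map_one, map_ofNat, incl_rc, ← xC_eq, ← yC_eq]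
      linear_combination ((2 + 2 * const a) * yC - 2 * const b * xC) * const_I_sq
    exact mul_left_cancel₀ two_ne_zero h2
  have hx' := congrArg incl hx
  have hy' := congrArg incl hy
  have hz' := congrArg incl hz
  simp only [map_add, map_sub, map_mul, map_one, map_neg, incl_rc, ← xC_eq, ← yC_eq, ← zC_eq,
    ← hWd] at hx' hy' hz'
  refine ⟨?_, ?_, ?_⟩
  · rw [hWd]
    exact fun h => hd0 (incl_injective (by rw [h, map_zero]))
  · have : baseChange g tC = incl (g xS) - const Complex.I * incl (g yS) := by
      rw [tC, xC_eq, yC_eq, map_sub, map_mul, baseChange_const, baseChange_incl, baseChange_incl]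
    rw [map_mul, baseChange_const, this, hμc', tC, tbarC]
    linear_combination const Complex.I * hx' + hy' + (const Complex.I * const b * yC - incl (g yS) * W +
      xC * const b - yC - yC * const a) * const_I_sq
  · have : baseChange g zC = incl (g zS) := by rw [zC_eq, baseChange_incl]
    rw [this, hμc, hμc', tC, tbarC]
    linear_combination 2 * hz' + (2 * const a * yC - 2 * yC - 2 * const b * xC) * const_I_sq

/-! ### The action on real points -/

/-- Injectivity on real points: g⁻¹ is defined at q, and pulling its coordinates back by g shows
that its value there is both p and p'. -/
theorem HasValue.point_unique {g : Bir} (hg : g ∈ autReal) {p p' q : Fin 3 → ℝ}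
    (hp : p ∈ realPoints) (hp' : p' ∈ realPoints) (hq : q ∈ realPoints)
    (h : ∀ F : MvPolynomial (Fin 3) ℝ, HasValue p (g (toFun F)) (eval q F))
    (h' : ∀ F : MvPolynomial (Fin 3) ℝ, HasValue p' (g (toFun F)) (eval q F)) : p = p' := by
  have key : ∀ (p : Fin 3 → ℝ), p ∈ realPoints →
      (∀ F : MvPolynomial (Fin 3) ℝ, HasValue p (g (toFun F)) (eval q F)) →
      ∀ i, ∀ N D : MvPolynomial (Fin 3) ℝ, g⁻¹ (toFun (X i)) * toFun D = toFun N →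
        p i * eval q D = eval q N := by
    intro p hp h i N D hf
    have h1 := congrArg g hf
    have h2 : g (g⁻¹ (toFun (X i))) = toFun (X i) := by
      rw [← AlgEquiv.mul_apply, mul_inv_cancel, AlgEquiv.one_apply]
    rw [map_mul, h2] at h1
    have h3 : HasValue p (toFun (X i)) (p i) := ⟨X i, 1, by simp, by simp, by simp⟩
    have h4 := h3.mul (h D)
    rw [h1] at h4
    exact h4.unique hp (h N)
  ext i
  obtain ⟨N, D, hD, hf⟩ := hg.2 q hq i
  have h1 := key p hp h i N D hf
  have h2 := key p' hp' h' i N D hf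
  exact mul_right_cancel₀ hD (h1.trans h2.symm)

/-! ### The conic bundles on the Del Pezzo surface -/

/-- The forms `r = u`, `s`, `v` on the quadric. -/
def RC : CFunField := 1 + zC
def SC : CFunField := yC + const Complex.I * xC
def VC : CFunField := yC - const Complex.I * xC

theorem SC_eq : SC = const Complex.I * tC := by
  rw [SC, tC]; linear_combination yC * const_I_sq

theorem VC_eq : VC = -const Complex.I * tbarC := by
  rw [VC, tbarC]; linear_combination yC * const_I_sq

/-- The equation of the quadric as (w + z)(w - z) = x² + y², with 2 - r = 1 - z in the chart w = 1.
-/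
theorem SC_mul_VC : SC * VC = RC * (2 - RC) := by
  rw [SC_eq, VC_eq, RC]
  linear_combination tC_mul_tbarC - tC * tbarC * const_I_sq

theorem const_I_ne_zero : const Complex.I ≠ 0 := const_ne_zero Complex.I_ne_zero

theorem SC_ne_zero : SC ≠ 0 := by
  rw [SC_eq]; exact mul_ne_zero const_I_ne_zero tC_ne_zero

theorem RC_ne_zero : RC ≠ 0 := fun h => zC_ne_const (-1) (by
  rw [const_neg, const_one]; rw [RC] at h; linear_combination h)

/-- The coefficients of a form of bidegree at most `(2, 2)`. -/
def coeffs (c : Fin 3 → Fin 3 → ℂ) : ℕ → ℕ → ℂ := fun i j =>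
  if h : i < 3 ∧ j < 3 then c ⟨i, h.1⟩ ⟨j, h.2⟩ else 0

/-- Reduces the determination of a linear system to linear algebra on coefficients: forms through T
lie in the span, and each generator is itself such a form. -/
theorem linSys_eq_span {a b : ℕ} {T : Set BiPoint} {B : Set CFunField}
    (h1 : ∀ c : ℕ → ℕ → ℂ, (∀ P ∈ T, biform a b c P.r P.s P.u P.v = 0) →
      biform a b c RC SC RC VC ∈ Submodule.span ℂ B)
    (h2 : ∀ f ∈ B, ∃ c : Fin 3 → Fin 3 → ℂ,
      (∀ P ∈ T, biform a b (coeffs c) P.r P.s P.u P.v = 0) ∧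
        f = biform a b (coeffs c) RC SC RC VC) :
    linSys a b T = Submodule.span ℂ B := by
  apply le_antisymm
  · refine Submodule.span_le.2 ?_
    rintro F ⟨c, hc, rfl⟩
    exact h1 c hc
  · refine Submodule.span_mono fun f hf => ?_
    obtain ⟨c, hc, rfl⟩ := h2 f hf
    exact ⟨_, hc, rfl⟩

theorem smul_eq_const_mul (c : ℂ) (f : CFunField) : c • f = const c * f := Algebra.smul_def c f

theorem biform_eq (a b : ℕ) (c : ℕ → ℕ → ℂ) (r s u v : CFunField) :
    biform a b c r s u v = ∑ i ∈ Finset.range (a + 1), ∑ j ∈ Finset.range (b + 1),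
      const (c i j) * (r ^ (a - i) * s ^ i * (u ^ (b - j) * v ^ j)) := rfl

theorem biform_complex (a b : ℕ) (c : ℕ → ℕ → ℂ) (r s u v : ℂ) :
    biform a b c r s u v = ∑ i ∈ Finset.range (a + 1), ∑ j ∈ Finset.range (b + 1),
      c i j * (r ^ (a - i) * s ^ i * (u ^ (b - j) * v ^ j)) := rfl

/-! ### Explicit bases of the linear systems on X -/

section
variable {μ : ℂ}

/-- The two forms of bidegree `(1, 1)` that span the system through `q` and `q̄`. -/
def AC (μ : ℂ) : CFunField := RC ^ 2 + SC * VC - (1 + const μ) * (SC * RC)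
def BC (μ : ℂ) : CFunField := RC ^ 2 + SC * VC - (1 + const (starRingEnd ℂ μ)) * (RC * VC)

theorem linSys_f : linSys 1 0 ∅ = Submodule.span ℂ {RC, SC} := by
  refine linSys_eq_span (fun c _ => ?_) ?_
  · rw [Submodule.mem_span_pair]
    refine ⟨c 0 0, c 1 0, ?_⟩
    simp [biform_eq, Finset.sum_range_succ, smul_eq_const_mul]
  · simp only [Set.mem_insert_iff, Set.mem_singleton_iff, forall_eq_or_imp, forall_eq]
    refine ⟨⟨![![1, 0, 0], ![0, 0, 0], ![0, 0, 0]], by simp, ?_⟩,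
      ⟨![![0, 0, 0], ![1, 0, 0], ![0, 0, 0]], by simp, ?_⟩⟩
    all_goals simp [biform_eq, Finset.sum_range_succ, coeffs]

theorem linSys_fbar : linSys 0 1 ∅ = Submodule.span ℂ {RC, VC} := by
  refine linSys_eq_span (fun c _ => ?_) ?_
  · rw [Submodule.mem_span_pair]
    refine ⟨c 0 0, c 0 1, ?_⟩
    simp [biform_eq, Finset.sum_range_succ, smul_eq_const_mul]
  · simp only [Set.mem_insert_iff, Set.mem_singleton_iff, forall_eq_or_imp, forall_eq]
    refine ⟨⟨![![1, 0, 0], ![0, 0, 0], ![0, 0, 0]], by simp, ?_⟩,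
      ⟨![![0, 1, 0], ![0, 0, 0], ![0, 0, 0]], by simp, ?_⟩⟩
    all_goals simp [biform_eq, Finset.sum_range_succ, coeffs]

theorem linSys_p_pbar : linSys 1 1 {ptP, ptPbar} = Submodule.span ℂ {RC ^ 2, SC * VC} := by
  refine linSys_eq_span (fun c hc => ?_) ?_
  · have hp := hc ptP (by simp)
    have hp' := hc ptPbar (by simp)
    simp [biform_complex, Finset.sum_range_succ, ptP, ptPbar] at hp hp'
    rw [Submodule.mem_span_pair]
    refine ⟨c 0 0, c 1 1, ?_⟩
    simp only [biform_eq, Finset.sum_range_succ, smul_eq_const_mul, hp, hp']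
    simp [-mul_eq_mul_left_iff]
    ring
  · simp only [Set.mem_insert_iff, Set.mem_singleton_iff, forall_eq_or_imp, forall_eq]
    refine ⟨⟨![![1, 0, 0], ![0, 0, 0], ![0, 0, 0]], ?_, ?_⟩,
      ⟨![![0, 0, 0], ![0, 1, 0], ![0, 0, 0]], ?_, ?_⟩⟩
    all_goals simp [biform_eq, biform_complex, Finset.sum_range_succ, coeffs, ptP, ptPbar]
    all_goals ring

theorem linSys_p_q : linSys 1 1 {ptP, ptQ μ} =
    Submodule.span ℂ {RC * (RC - SC), SC * (VC - const μ * RC)} := by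
  refine linSys_eq_span (fun c hc => ?_) ?_
  · have hp := hc ptP (by simp)
    have hq := hc (ptQ μ) (by simp)
    simp [biform_complex, Finset.sum_range_succ, ptP, ptQ] at hp hq
    rw [Submodule.mem_span_pair]
    refine ⟨c 0 0, c 1 1, ?_⟩
    have hq' := congrArg const hq
    simp [hp] at hq'
    simp [biform_eq, Finset.sum_range_succ, smul_eq_const_mul, hp]
    linear_combination -SC * RC * hq'
  · simp only [Set.mem_insert_iff, Set.mem_singleton_iff, forall_eq_or_imp, forall_eq]
    refine ⟨⟨![![1, 0, 0], ![-1, 0, 0], ![0, 0, 0]], ?_, ?_⟩,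
      ⟨![![0, 0, 0], ![-μ, 1, 0], ![0, 0, 0]], ?_, ?_⟩⟩
    all_goals simp [biform_eq, biform_complex, Finset.sum_range_succ, coeffs, ptP, ptQ]
    all_goals ring

theorem linSys_pbar_qbar : linSys 1 1 {ptPbar, ptQbar μ} =
    Submodule.span ℂ {RC * (RC - VC), VC * (SC - const (starRingEnd ℂ μ) * RC)} := by
  refine linSys_eq_span (fun c hc => ?_) ?_
  · have hp := hc ptPbar (by simp)
    have hq := hc (ptQbar μ) (by simp)
    simp [biform_complex, Finset.sum_range_succ, ptPbar, ptQbar] at hp hq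
    rw [Submodule.mem_span_pair]
    refine ⟨c 0 0, c 1 1, ?_⟩
    have hq' := congrArg const hq
    simp [hp] at hq'
    simp [biform_eq, Finset.sum_range_succ, smul_eq_const_mul, hp]
    linear_combination -VC * RC * hq'
  · simp only [Set.mem_insert_iff, Set.mem_singleton_iff, forall_eq_or_imp, forall_eq]
    refine ⟨⟨![![1, -1, 0], ![0, 0, 0], ![0, 0, 0]], ?_, ?_⟩,
      ⟨![![0, -starRingEnd ℂ μ, 0], ![0, 1, 0], ![0, 0, 0]], ?_, ?_⟩⟩
    all_goals simp [biform_eq, biform_complex, Finset.sum_range_succ, coeffs, ptPbar, ptQbar]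
    all_goals ring

theorem linSys_p_qbar : linSys 1 1 {ptP, ptQbar μ} =
    Submodule.span ℂ {RC * (SC - const (starRingEnd ℂ μ) * RC), SC * (VC - RC)} := by
  refine linSys_eq_span (fun c hc => ?_) ?_
  · have hp := hc ptP (by simp)
    have hq := hc (ptQbar μ) (by simp)
    simp [biform_complex, Finset.sum_range_succ, ptP, ptQbar] at hp hq
    rw [Submodule.mem_span_pair]
    refine ⟨c 1 0 + c 1 1, c 1 1, ?_⟩
    have hq' := congrArg const hq
    simp [hp] at hq'
    simp [biform_eq, Finset.sum_range_succ, smul_eq_const_mul, hp]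
    linear_combination -RC ^ 2 * hq'
  · simp only [Set.mem_insert_iff, Set.mem_singleton_iff, forall_eq_or_imp, forall_eq]
    refine ⟨⟨![![-starRingEnd ℂ μ, 0, 0], ![1, 0, 0], ![0, 0, 0]], ?_, ?_⟩,
      ⟨![![0, 0, 0], ![-1, 1, 0], ![0, 0, 0]], ?_, ?_⟩⟩
    all_goals simp [biform_eq, biform_complex, Finset.sum_range_succ, coeffs, ptP, ptQbar]
    all_goals ring

theorem linSys_pbar_q : linSys 1 1 {ptPbar, ptQ μ} =
    Submodule.span ℂ {RC * (VC - const μ * RC), VC * (SC - RC)} := by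
  refine linSys_eq_span (fun c hc => ?_) ?_
  · have hp := hc ptPbar (by simp)
    have hq := hc (ptQ μ) (by simp)
    simp [biform_complex, Finset.sum_range_succ, ptPbar, ptQ] at hp hq
    rw [Submodule.mem_span_pair]
    refine ⟨c 0 1 + c 1 1, c 1 1, ?_⟩
    have hq' := congrArg const hq
    simp [hp] at hq'
    simp [biform_eq, Finset.sum_range_succ, smul_eq_const_mul, hp]
    linear_combination -RC ^ 2 * hq'
  · simp only [Set.mem_insert_iff, Set.mem_singleton_iff, forall_eq_or_imp, forall_eq]
    refine ⟨⟨![![-μ, 1, 0], ![0, 0, 0], ![0, 0, 0]], ?_, ?_⟩,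
      ⟨![![0, -1, 0], ![0, 1, 0], ![0, 0, 0]], ?_, ?_⟩⟩
    all_goals simp [biform_eq, biform_complex, Finset.sum_range_succ, coeffs, ptPbar, ptQ]
    all_goals ring


theorem mul_starRingEnd_of_norm (hμ : ‖μ‖ = 1) : μ * starRingEnd ℂ μ = 1 := by
  rw [Complex.mul_conj, Complex.normSq_eq_norm_sq, hμ]; simp

theorem one_add_conj_ne_zero (hm1 : μ ≠ -1) : 1 + starRingEnd ℂ μ ≠ 0 := fun h => hm1 (by
  have := congrArg (starRingEnd ℂ) h
  simp only [map_add, map_one, Complex.conj_conj, map_zero] at this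
  linear_combination this)

theorem linSys_q_qbar (hμ : ‖μ‖ = 1) (h1 : μ ≠ 1) (hm1 : μ ≠ -1) :
    linSys 1 1 {ptQ μ, ptQbar μ} = Submodule.span ℂ {AC μ, BC μ} := by
  have hm := mul_starRingEnd_of_norm hμ
  have hp : 1 + μ ≠ 0 := fun h => hm1 (by linear_combination h)
  have hp' := one_add_conj_ne_zero hm1
  have hd : 1 - μ ≠ 0 := sub_ne_zero.2 h1.symm
  refine linSys_eq_span (fun c hc => ?_) ?_
  · have hq := hc (ptQ μ) (by simp)
    have hq' := hc (ptQbar μ) (by simp)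
    simp [biform_complex, Finset.sum_range_succ, ptQ, ptQbar] at hq hq'
    rw [Submodule.mem_span_pair]
    -- The condition at q minus μ times the condition at q̄ leaves (1 - μ)(c₀₀ - c₁₁) = 0.
    have e1 : c 0 0 = c 1 1 := mul_left_cancel₀ hd (by
      linear_combination hq - μ * hq' + (c 1 0 + c 1 1) * hm)
    obtain ⟨α, hα⟩ : ∃ α, c 1 0 = -(α * (1 + μ)) := ⟨-c 1 0 / (1 + μ), by field_simp⟩
    obtain ⟨β, hβ⟩ : ∃ β, c 0 1 = -(β * (1 + starRingEnd ℂ μ)) :=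
      ⟨-c 0 1 / (1 + starRingEnd ℂ μ), by field_simp⟩
    have e2 : c 0 0 = α + β := mul_left_cancel₀ hp (by
      linear_combination hq + μ * e1 - hα - μ * hβ + β * hm)
    refine ⟨α, β, ?_⟩
    simp [biform_eq, Finset.sum_range_succ, smul_eq_const_mul, ← e1, e2, hα, hβ, AC, BC]
    ring
  · simp only [Set.mem_insert_iff, Set.mem_singleton_iff, forall_eq_or_imp, forall_eq]
    refine ⟨⟨![![1, 0, 0], ![-(1 + μ), 1, 0], ![0, 0, 0]], ⟨?_, ?_⟩, ?_⟩,
      ⟨![![1, -(1 + starRingEnd ℂ μ), 0], ![0, 1, 0], ![0, 0, 0]], ⟨?_, ?_⟩, ?_⟩⟩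
    all_goals simp [biform_eq, biform_complex, Finset.sum_range_succ, coeffs, ptQ, ptQbar, AC, BC]
    · linear_combination -hm
    · ring
    · linear_combination -hm
    · ring

theorem linSys_one_two (hμ : ‖μ‖ = 1) (h1 : μ ≠ 1) :
    linSys 1 2 {ptP, ptPbar, ptQ μ, ptQbar μ} =
      Submodule.span ℂ {RC * BC μ, VC * AC μ} := by
  have hm := mul_starRingEnd_of_norm hμ
  have hd : 1 - μ ≠ 0 := sub_ne_zero.2 h1.symm
  have hμ0 : μ ≠ 0 := by rintro rfl; simp at hμ
  refine linSys_eq_span (fun c hc => ?_) ?_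
  · have hp := hc ptP (by simp)
    have hp' := hc ptPbar (by simp)
    have hq := hc (ptQ μ) (by simp)
    have hq' := hc (ptQbar μ) (by simp)
    simp [biform_complex, Finset.sum_range_succ, ptP, ptPbar, ptQ, ptQbar] at hp hp' hq hq'
    rw [hp, hp'] at hq hq'
    rw [Submodule.mem_span_pair]
    have e1 : c 1 1 = c 0 0 - (1 + μ) * c 1 2 := mul_left_cancel₀ hd (by
      linear_combination -hq + μ * hq' - (c 1 1 + c 1 2) * hm)
    have e2 : c 0 1 = c 1 2 - (1 + starRingEnd ℂ μ) * c 0 0 := by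
      linear_combination hq' - starRingEnd ℂ μ * e1 + c 1 2 * hm
    refine ⟨c 0 0, c 1 2, ?_⟩
    simp [biform_eq, Finset.sum_range_succ, smul_eq_const_mul, e1, e2, hp, hp', AC, BC]
    ring
  · simp only [Set.mem_insert_iff, Set.mem_singleton_iff, forall_eq_or_imp, forall_eq]
    refine ⟨⟨![![1, -(1 + starRingEnd ℂ μ), 0], ![0, 1, 0], ![0, 0, 0]], ⟨?_, ?_, ?_, ?_⟩, ?_⟩,
      ⟨![![0, 1, 0], ![0, -(1 + μ), 1], ![0, 0, 0]], ⟨?_, ?_, ?_, ?_⟩, ?_⟩⟩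
    all_goals simp [biform_eq, biform_complex, Finset.sum_range_succ, coeffs, ptP, ptPbar,
      ptQ, ptQbar, AC, BC]
    · linear_combination -hm
    · ring
    · ring
    · linear_combination -hm
    · ring

theorem linSys_two_one (hμ : ‖μ‖ = 1) (h1 : μ ≠ 1) :
    linSys 2 1 {ptP, ptPbar, ptQ μ, ptQbar μ} =
      Submodule.span ℂ {RC * AC μ, SC * BC μ} := by
  have hm := mul_starRingEnd_of_norm hμ
  have hd : 1 - μ ≠ 0 := sub_ne_zero.2 h1.symm
  have hμ0 : μ ≠ 0 := by rintro rfl; simp at hμ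
  refine linSys_eq_span (fun c hc => ?_) ?_
  · have hp := hc ptP (by simp)
    have hp' := hc ptPbar (by simp)
    have hq := hc (ptQ μ) (by simp)
    have hq' := hc (ptQbar μ) (by simp)
    simp [biform_complex, Finset.sum_range_succ, ptP, ptPbar, ptQ, ptQbar] at hp hp' hq hq'
    rw [hp, hp'] at hq hq'
    rw [Submodule.mem_span_pair]
    have e1 : c 1 1 = c 0 0 - (1 + starRingEnd ℂ μ) * c 2 1 := mul_left_cancel₀ hd (by
      linear_combination -hq + μ * hq' - (c 1 0 + c 1 1 + starRingEnd ℂ μ * c 2 1) * hm - c 2 1 * hm)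
    have e2 : c 1 0 = c 2 1 - (1 + μ) * c 0 0 := by
      linear_combination hq - μ * e1 + c 2 1 * hm
    refine ⟨c 0 0, c 2 1, ?_⟩
    simp [biform_eq, Finset.sum_range_succ, smul_eq_const_mul, e1, e2, hp, hp', AC, BC]
    ring
  · simp only [Set.mem_insert_iff, Set.mem_singleton_iff, forall_eq_or_imp, forall_eq]
    refine ⟨⟨![![1, 0, 0], ![-(1 + μ), 1, 0], ![0, 0, 0]], ⟨?_, ?_, ?_, ?_⟩, ?_⟩,
      ⟨![![0, 0, 0], ![1, -(1 + starRingEnd ℂ μ), 0], ![0, 1, 0]], ⟨?_, ?_, ?_, ?_⟩, ?_⟩⟩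
    all_goals simp [biform_eq, biform_complex, Finset.sum_range_succ, coeffs, ptP, ptPbar,
      ptQ, ptQbar, AC, BC]
    · linear_combination -hm
    · ring
    · linear_combination -hm
    · ring
    · ring

/-- The anticanonical system is spanned by the products of the members of the first pair and of
the fourth pair of conic bundles. -/
theorem linSys_two_two (hμ : ‖μ‖ = 1) (h1 : μ ≠ 1) (hm1 : μ ≠ -1) :
    linSys 2 2 {ptP, ptPbar, ptQ μ, ptQbar μ} =
      Submodule.span ℂ {RC ^ 2 * AC μ, RC ^ 2 * BC μ, SC * VC * AC μ, SC * VC * BC μ,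
        RC * (SC * BC μ), RC * (VC * AC μ)} := by
  have hm := mul_starRingEnd_of_norm hμ
  have hp : 1 + μ ≠ 0 := fun h => hm1 (by linear_combination h)
  have hp' := one_add_conj_ne_zero hm1
  have hd : 1 - μ ≠ 0 := sub_ne_zero.2 h1.symm
  refine linSys_eq_span (fun c hc => ?_) ?_
  · have hp := hc ptP (by simp)
    have hp' := hc ptPbar (by simp)
    have hq := hc (ptQ μ) (by simp)
    have hq' := hc (ptQbar μ) (by simp)
    simp [biform_complex, Finset.sum_range_succ, ptP, ptPbar, ptQ, ptQbar] at hp hp' hq hq'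
    rw [hp, hp'] at hq hq'
    obtain ⟨x2, e01⟩ : ∃ β, c 0 1 = -(β * (1 + starRingEnd ℂ μ)) :=
      ⟨-c 0 1 / (1 + starRingEnd ℂ μ), by field_simp⟩
    obtain ⟨x4, e12⟩ : ∃ β, c 1 2 = -(β * (1 + starRingEnd ℂ μ)) :=
      ⟨-c 1 2 / (1 + starRingEnd ℂ μ), by field_simp⟩
    obtain ⟨x1, e00⟩ : ∃ x, c 0 0 = x + x2 := ⟨c 0 0 - x2, by ring⟩
    obtain ⟨x3, e22⟩ : ∃ x, c 2 2 = x + x4 := ⟨c 2 2 - x4, by ring⟩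
    obtain ⟨x5, e10⟩ : ∃ x, c 1 0 = x - (1 + μ) * x1 := ⟨c 1 0 + (1 + μ) * x1, by ring⟩
    have e21 : c 2 1 = x5 - (1 + μ) * x3 := by
      rw [e00, e01, e12, e22, e10] at hq hq'
      apply mul_left_cancel₀ hd
      grind
    have e11 : c 1 1 = x1 + x2 + x3 + x4 - (1 + starRingEnd ℂ μ) * x5 := by
      rw [e00, e01, e12, e22, e10, e21] at hq hq'
      grind
    -- Nine coefficients and four conditions leave five parameters, so five of the generators
    -- suffice. The sixth is kept in order that the generators be all the products of complementary
    -- members.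
    have : biform 2 2 c RC SC RC VC = x1 • (RC ^ 2 * AC μ) + x2 • (RC ^ 2 * BC μ) +
        x3 • (SC * VC * AC μ) + x4 • (SC * VC * BC μ) + x5 • (RC * (SC * BC μ)) := by
      simp [biform_eq, Finset.sum_range_succ, smul_eq_const_mul, e00, e01, e12, e22, e10, e21,
        e11, hp, hp', AC, BC]
      ring
    rw [this]
    refine add_mem (add_mem (add_mem (add_mem ?_ ?_) ?_) ?_) ?_
    all_goals exact Submodule.smul_mem _ _ (Submodule.subset_span (by simp))
  · simp only [Set.mem_insert_iff, Set.mem_singleton_iff, forall_eq_or_imp, forall_eq]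
    refine ⟨⟨![![1, 0, 0], ![-(1 + μ), 1, 0], ![0, 0, 0]], ⟨?_, ?_, ?_, ?_⟩, ?_⟩,
      ⟨![![1, -(1 + starRingEnd ℂ μ), 0], ![0, 1, 0], ![0, 0, 0]], ⟨?_, ?_, ?_, ?_⟩, ?_⟩,
      ⟨![![0, 0, 0], ![0, 1, 0], ![0, -(1 + μ), 1]], ⟨?_, ?_, ?_, ?_⟩, ?_⟩,
      ⟨![![0, 0, 0], ![0, 1, -(1 + starRingEnd ℂ μ)], ![0, 0, 1]], ⟨?_, ?_, ?_, ?_⟩, ?_⟩,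
      ⟨![![0, 0, 0], ![1, -(1 + starRingEnd ℂ μ), 0], ![0, 1, 0]], ⟨?_, ?_, ?_, ?_⟩, ?_⟩,
      ⟨![![0, 1, 0], ![0, -(1 + μ), 1], ![0, 0, 0]], ⟨?_, ?_, ?_, ?_⟩, ?_⟩⟩
    all_goals simp [biform_eq, biform_complex, Finset.sum_range_succ, coeffs, ptP, ptPbar,
      ptQ, ptQbar, AC, BC]
    all_goals first
      | ring1
      | linear_combination -hm
      | linear_combination -(1 + starRingEnd ℂ μ) * hm
      | linear_combination -starRingEnd ℂ μ * hm
      | linear_combination -μ * hm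

end

/-! ### Transport of linear systems -/

/-- `g` carries `V` to `W`, the common factor being `l`. -/
def CarriesBy (l : CFunField) (g : Bir) (V W : Submodule ℂ CFunField) : Prop :=
  W.map (baseChange g).toLinearMap = V.map (LinearMap.mulLeft ℂ l)

theorem CarriesBy.carries {l : CFunField} {g : Bir} {V W : Submodule ℂ CFunField}
    (h : CarriesBy l g V W) (hl : l ≠ 0) : Carries g V W := ⟨Units.mk0 l hl, h⟩

/-- Multiplication by l is multiplication by the line spanned by l, so the statement is
commutativity of products of subspaces. It derives the action on |-K_X| from the action on the conic
bundles. -/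
theorem CarriesBy.mul {l l' : CFunField} {g : Bir} {V W V' W' : Submodule ℂ CFunField}
    (h : CarriesBy l g V W) (h' : CarriesBy l' g V' W') :
    CarriesBy (l * l') g (V * V') (W * W') := by
  have e : ∀ (l : CFunField) (V : Submodule ℂ CFunField),
      V.map (LinearMap.mulLeft ℂ l) = Submodule.span ℂ {l} * V := fun l V => by
    ext w
    simp [Submodule.mem_span_singleton_mul]
  unfold CarriesBy at *
  rw [Submodule.map_mul, h, h', e, e, e, ← Set.singleton_mul_singleton, ← Submodule.span_mul_span]
  exact mul_mul_mul_comm _ _ _ _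

/-- The factor must be the same on both summands; this is why factors are tracked explicitly. -/
theorem CarriesBy.sup {l : CFunField} {g : Bir} {V W V' W' : Submodule ℂ CFunField}
    (h : CarriesBy l g V W) (h' : CarriesBy l g V' W') : CarriesBy l g (V ⊔ V') (W ⊔ W') := by
  unfold CarriesBy at *
  rw [Submodule.map_sup, Submodule.map_sup, h, h']

theorem mulLeft_mulLeft (l l' : CFunField) (V : Submodule ℂ CFunField) :
    (V.map (LinearMap.mulLeft ℂ l)).map (LinearMap.mulLeft ℂ l') =
      V.map (LinearMap.mulLeft ℂ (l' * l)) := by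
  rw [← Submodule.map_comp]
  congr 1
  ext w
  simp

theorem map_mulLeft_baseChange (g : Bir) (l : CFunField) (V : Submodule ℂ CFunField) :
    (V.map (LinearMap.mulLeft ℂ l)).map (baseChange g).toLinearMap =
      (V.map (baseChange g).toLinearMap).map (LinearMap.mulLeft ℂ (baseChange g l)) := by
  rw [← Submodule.map_comp, ← Submodule.map_comp]
  congr 1
  ext w
  simp

theorem map_baseChange_mul (g h : Bir) (V : Submodule ℂ CFunField) :
    V.map (baseChange (g * h)).toLinearMap =
      (V.map (baseChange h).toLinearMap).map (baseChange g).toLinearMap := by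
  rw [← Submodule.map_comp]
  congr 1
  ext w
  simp [baseChange_mul]

theorem baseChange_ne_zero (g : Bir) {w : CFunField} (h : w ≠ 0) : baseChange g w ≠ 0 :=
  fun h0 => h (baseChange_injective g (by rw [h0, map_zero]))

theorem Carries.comp {g h : Bir} {U V W : Submodule ℂ CFunField} (hh : Carries h U V)
    (hg : Carries g V W) : Carries (h * g) U W := by
  obtain ⟨l, hl⟩ := hg
  obtain ⟨l', hl'⟩ := hh
  refine CarriesBy.carries (l := baseChange h l * l') ?_
    (mul_ne_zero (baseChange_ne_zero h l.ne_zero) l'.ne_zero)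
  rw [CarriesBy, map_baseChange_mul, hl, map_mulLeft_baseChange, hl', mulLeft_mulLeft]

theorem Carries.inv {g : Bir} {V W : Submodule ℂ CFunField} (h : Carries g V W) :
    Carries g⁻¹ W V := by
  obtain ⟨l, hl⟩ := h
  have hl0 := baseChange_ne_zero g⁻¹ l.ne_zero
  refine CarriesBy.carries (l := (baseChange g⁻¹ l)⁻¹) ?_ (inv_ne_zero hl0)
  have h1 := congrArg (Submodule.map (baseChange g⁻¹).toLinearMap) hl
  rw [map_mulLeft_baseChange, ← map_baseChange_mul, inv_mul_cancel] at h1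
  have h2 : W.map (baseChange 1).toLinearMap = W := by
    conv_rhs => rw [← Submodule.map_id W]
    congr 1
    exact LinearMap.ext baseChange_one
  rw [h2] at h1
  rw [CarriesBy, h1, mulLeft_mulLeft, inv_mul_cancel₀ hl0]
  conv_lhs => rw [← Submodule.map_id (Submodule.map (baseChange g⁻¹).toLinearMap V)]
  congr 1
  ext w
  simp

theorem map_mulLeft_pair (l v₁ v₂ : CFunField) :
    (Submodule.span ℂ {v₁, v₂}).map (LinearMap.mulLeft ℂ l) =
      Submodule.span ℂ {l * v₁, l * v₂} := by
  rw [Submodule.map_span, Set.image_pair]; rfl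

/-- Invertibility of the coefficient matrix gives the second inclusion, by the inverse matrix. -/
theorem CarriesBy.pair {l : CFunField} {g : Bir} {v₁ v₂ w₁ w₂ : CFunField} {a b c d : ℂ}
    (hdet : a * d - b * c ≠ 0) (h₁ : baseChange g w₁ = l * (const a * v₁ + const b * v₂))
    (h₂ : baseChange g w₂ = l * (const c * v₁ + const d * v₂)) :
    CarriesBy l g (Submodule.span ℂ {v₁, v₂}) (Submodule.span ℂ {w₁, w₂}) := by
  rw [CarriesBy, map_mulLeft_pair, Submodule.map_span, Set.image_pair]
  change Submodule.span ℂ {baseChange g w₁, baseChange g w₂} = _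
  rw [h₁, h₂]
  apply le_antisymm
  · rw [Submodule.span_le]
    rintro _ (rfl | rfl)
    · exact Submodule.mem_span_pair.2 ⟨a, b, by simp only [smul_eq_const_mul]; ring⟩
    · exact Submodule.mem_span_pair.2 ⟨c, d, by simp only [smul_eq_const_mul]; ring⟩
  · have hK : (const a * const d - const b * const c) * const (a * d - b * c)⁻¹ = 1 := by
      rw [← const_mul, ← const_mul, ← const_sub, ← const_mul, mul_inv_cancel₀ hdet, const_one]
    rw [Submodule.span_le]
    rintro _ (rfl | rfl)
    · refine Submodule.mem_span_pair.2 ⟨d * (a * d - b * c)⁻¹, -b * (a * d - b * c)⁻¹, ?_⟩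
      simp only [smul_eq_const_mul, const_mul, const_neg] at hK ⊢
      linear_combination l * v₁ * hK
    · refine Submodule.mem_span_pair.2 ⟨-c * (a * d - b * c)⁻¹, a * (a * d - b * c)⁻¹, ?_⟩
      simp only [smul_eq_const_mul, const_mul, const_neg] at hK ⊢
      linear_combination l * v₂ * hK

theorem CarriesBy.pair_diag {l : CFunField} {g : Bir} {v₁ v₂ w₁ w₂ : CFunField} {a d : ℂ}
    (ha : a ≠ 0) (hd : d ≠ 0) (h₁ : baseChange g w₁ = l * (const a * v₁))
    (h₂ : baseChange g w₂ = l * (const d * v₂)) :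
    CarriesBy l g (Submodule.span ℂ {v₁, v₂}) (Submodule.span ℂ {w₁, w₂}) :=
  .pair (a := a) (b := 0) (c := 0) (d := d) (by simp [ha, hd]) (by simpa using h₁)
    (by simpa using h₂)

theorem CarriesBy.pair_swap {l : CFunField} {g : Bir} {v₁ v₂ w₁ w₂ : CFunField} {b c : ℂ}
    (hb : b ≠ 0) (hc : c ≠ 0) (h₁ : baseChange g w₁ = l * (const b * v₂))
    (h₂ : baseChange g w₂ = l * (const c * v₁)) :
    CarriesBy l g (Submodule.span ℂ {v₁, v₂}) (Submodule.span ℂ {w₁, w₂}) :=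
  .pair (a := 0) (b := b) (c := c) (d := 0) (by simp [hb, hc]) (by simpa using h₁)
    (by simpa using h₂)

/-- The product h * g of pull-backs belongs to the map h followed by the map g, so σ is applied
before σ'. -/
theorem ActsOnBundles.mul {μ : ℂ} {g h : Bir} {σ σ' : Fin 5 → Fin 5} {e e' : Fin 5 → Fin 2}
    (hh : ActsOnBundles μ h σ e) (hg : ActsOnBundles μ g σ' e') :
    ActsOnBundles μ (h * g) (fun i => σ' (σ i)) (fun i => e i + e' (σ i)) := fun i k => by
  have h1 := (hh i k).comp (hg (σ i) (k + e i))
  rwa [add_assoc] at h1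

theorem IsDelPezzoAut.mul {μ : ℂ} {g h : Bir} (hh : IsDelPezzoAut μ h) (hg : IsDelPezzoAut μ g) :
    IsDelPezzoAut μ (h * g) := Carries.comp hh hg

/-! ### Evaluation at the north pole -/

/-- The point `(0, 0, 1)`. -/
def northC : Fin 3 → ℂ := ![0, 0, 1]

theorem northC_mem : northC 0 ^ 2 + northC 1 ^ 2 + northC 2 ^ 2 = 1 := by simp [northC]

theorem CVal.RC_north : CVal northC RC 2 := by
  have h := (CVal.const (P := northC) 1).add (CVal.z northC)
  have e : (1 : ℂ) + northC 2 = 2 := by simp [northC]; norm_num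
  rw [e, const_one] at h
  exact h

theorem CVal.SC_north : CVal northC SC 0 := by
  have h := (CVal.y northC).add ((CVal.const (P := northC) Complex.I).mul (CVal.x northC))
  simpa [northC, SC] using h

theorem CVal.VC_north : CVal northC VC 0 := by
  have h := (CVal.y northC).sub ((CVal.const (P := northC) Complex.I).mul (CVal.x northC))
  simpa [northC, VC] using h

theorem CVal.ne_zero {P : Fin 3 → ℂ} {f : CFunField} {r : ℂ}
    (hP : P 0 ^ 2 + P 1 ^ 2 + P 2 ^ 2 = 1) (h : CVal P f r) (hr : r ≠ 0) : f ≠ 0 := by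
  rintro rfl
  refine hr (h.unique hP ?_)
  simpa using CVal.const (P := P) 0

/-- Two linear forms in `r, s, v` have no zero at the north pole. -/
theorem linear_form_ne_zero {a b c d : ℂ} (h : a + 2 * b ≠ 0) :
    const a + const b * RC + const c * SC + const d * VC ≠ 0 := by
  have := ((((CVal.const (P := northC) a).add
    ((CVal.const b).mul CVal.RC_north)).add ((CVal.const c).mul CVal.SC_north)).add
    ((CVal.const d).mul CVal.VC_north)).ne_zero northC_mem
  refine this ?_
  simp only [mul_zero, add_zero]
  rwa [mul_comm b]

/-! ### The automorphism `g₁` -/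

section
variable {μ : ℂ}

theorem const_two : const 2 = 2 := map_ofNat (algebraMap ℂ CFunField) 2
theorem const_four : const 4 = 4 := map_ofNat (algebraMap ℂ CFunField) 4

theorem re_sq_add_im_sq (hμ : ‖μ‖ = 1) : μ.re ^ 2 + μ.im ^ 2 = 1 := by
  have := Complex.sq_norm μ
  rw [hμ, Complex.normSq_apply] at this
  linarith

theorem re_lt_one (hμ : ‖μ‖ = 1) (hμ1 : μ ≠ 1) : μ.re < 1 := by
  have h := re_sq_add_im_sq hμ
  by_contra! h1
  refine hμ1 (Complex.ext ?_ ?_)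
  · rw [Complex.one_re]; nlinarith [sq_nonneg μ.im]
  · rw [Complex.one_im]; nlinarith [sq_nonneg μ.im]

/-- The linear factors of the two forms through `q` and `q̄`. -/
def aC (μ : ℂ) : CFunField := 2 - (1 + const μ) * SC
def bC (μ : ℂ) : CFunField := 2 - (1 + const (starRingEnd ℂ μ)) * VC

theorem AC_eq : AC μ = RC * aC μ := by
  rw [AC, aC]; linear_combination SC_mul_VC

theorem BC_eq : BC μ = RC * bC μ := by
  rw [BC, bC]; linear_combination SC_mul_VC

theorem aC_ne_zero : aC μ ≠ 0 := by
  have := linear_form_ne_zero (a := 2) (b := 0) (c := -(1 + μ)) (d := 0) (by norm_num)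
  convert this using 1
  simp [aC, const_two]; ring

theorem bC_ne_zero : bC μ ≠ 0 := by
  have := linear_form_ne_zero (a := 2) (b := 0) (c := 0) (d := -(1 + starRingEnd ℂ μ)) (by norm_num)
  convert this using 1
  simp [bC, const_two]; ring

theorem const_mul_starRingEnd (hμ : ‖μ‖ = 1) : const μ * const (starRingEnd ℂ μ) = 1 := by
  rw [← const_mul, mul_starRingEnd_of_norm hμ, const_one]

theorem ne_zero_of_norm (hμ : ‖μ‖ = 1) : μ ≠ 0 := by rintro rfl; simp at hμ

theorem baseChange_RC {g : Bir} (h : baseChange g zC = zC) : baseChange g RC = RC := by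
  rw [RC, map_add, map_one, h]

/-- In terms of s = it the involution multiplies s by -b/a, where a and b are linear forms exchanged
by complex conjugation. This symmetric shape is the one used in all computations on X. -/
theorem isG₁'_iff (hμ : ‖μ‖ = 1) {g : Bir} : IsG₁' μ g ↔
    baseChange g zC = zC ∧ baseChange g SC * aC μ = -SC * bC μ := by
  have hm := const_mul_starRingEnd hμ
  have hμ0 := const_ne_zero (ne_zero_of_norm hμ)
  have e1 : baseChange g SC = const Complex.I * baseChange g tC := by
    rw [SC_eq, map_mul, baseChange_const]
  have e2 : tC = -const Complex.I * SC := by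
    rw [SC_eq]; linear_combination tC * const_I_sq
  have e3 : 1 - zC ^ 2 = SC * VC := by rw [SC_mul_VC, RC]; ring
  rw [IsG₁', and_comm, e3, e1]
  refine and_congr_right fun _ => ?_
  have key : const μ * (const Complex.I * baseChange g tC * aC μ - -SC * bC μ) =
      baseChange g tC * (const μ * (2 * const Complex.I + (1 + const μ) * tC)) -
      (-2 * const Complex.I * const μ * tC + (1 + const μ) * (SC * VC)) := by
    rw [aC, bC]
    have : const Complex.I * tC = SC := SC_eq.symm
    linear_combination (-SC * VC) * hm - const μ * 2 * this +
      const μ * baseChange g tC * (1 + const μ) * (const Complex.I * this - tC * const_I_sq)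
  rw [← sub_eq_zero, ← key, mul_eq_zero, or_iff_right hμ0, sub_eq_zero]

theorem IsG₁'.unique (hμ : ‖μ‖ = 1) {g h : Bir} (hg : IsG₁' μ g) (hh : IsG₁' μ h) : g = h := by
  obtain ⟨h1, h2⟩ := (isG₁'_iff hμ).1 hg
  obtain ⟨h3, h4⟩ := (isG₁'_iff hμ).1 hh
  have h5 : baseChange g SC = baseChange h SC := mul_right_cancel₀ aC_ne_zero (h2.trans h4.symm)
  refine bir_ext ?_ (h1.trans h3.symm)
  rw [SC_eq, map_mul, map_mul, baseChange_const, baseChange_const] at h5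
  exact mul_left_cancel₀ const_I_ne_zero h5

/-- The coefficients of `g₁'(μ)`. -/
def g₁Poly (μ : ℂ) : QPoly :=
  ⟨0, Polynomial.C (-2), Polynomial.C (1 + μ.re), Polynomial.C (-μ.im)⟩

theorem g₁Poly_a : cz (g₁Poly μ).a₁ (g₁Poly μ).a₂ = -2 * const Complex.I := by
  simp [g₁Poly, cz, const_two]; ring

theorem g₁Poly_b : cz (g₁Poly μ).b₁ (g₁Poly μ).b₂ = 1 + const (starRingEnd ℂ μ) := by
  have : starRingEnd ℂ μ = μ.re + Complex.I * (-μ.im : ℝ) := by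
    apply Complex.ext <;> simp
  rw [this]
  simp [g₁Poly, cz]; ring

theorem isG₁'_iff_acts (hμ : ‖μ‖ = 1) {g : Bir} : IsG₁' μ g ↔ (g₁Poly μ).Acts g := by
  have hm := const_mul_starRingEnd hμ
  have hμ0 := const_ne_zero (ne_zero_of_norm hμ)
  rw [IsG₁', and_comm, QPoly.Acts, g₁Poly_a, g₁Poly_b]
  refine and_congr_right fun _ => ?_
  simp only [map_mul, map_neg, map_ofNat, map_add, map_one, conjL_const, Complex.conj_I,
    Complex.conj_conj, const_neg]
  refine ⟨fun h => mul_left_cancel₀ hμ0 ?_, fun h => ?_⟩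
  · linear_combination h - (1 - zC ^ 2) * hm
  · linear_combination const μ * h + (1 - zC ^ 2) * hm

/-- The norm is 4 - |1 + μ|²(1 - r²), which is positive since |1 + μ|² < 4 for μ ≠ 1 on the unit
circle. -/
theorem g₁Poly_norm_eval (hμ : ‖μ‖ = 1) (hμ1 : μ ≠ 1) (r : ℝ) :
    (g₁Poly μ).norm.eval r ≠ 0 := by
  have h := re_sq_add_im_sq hμ
  have h1 := re_lt_one hμ hμ1
  have e : (g₁Poly μ).norm.eval r = 4 - (2 + 2 * μ.re) * (1 - r ^ 2) := by
    simp [g₁Poly, QPoly.norm]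
    linear_combination -(1 - r ^ 2) * h
  have h2 : 0 ≤ 1 + μ.re := by nlinarith [sq_nonneg μ.im]
  rw [e]
  nlinarith [sq_nonneg r, mul_nonneg h2 (sq_nonneg r)]

theorem exists_isG₁' (hμ : ‖μ‖ = 1) (hμ1 : μ ≠ 1) : ∃ g ∈ autRealOverPi, IsG₁' μ g := by
  have hq := g₁Poly_norm_eval hμ hμ1
  obtain ⟨g, hg⟩ := QPoly.exists_acts (q := g₁Poly μ) fun h => hq 0 (by simp [h])
  exact ⟨g, hg.mem_autRealOverPi fun r _ => hq r, (isG₁'_iff_acts hμ).2 hg⟩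

/-- The common factors are expressed through this form. -/
def nC (μ : ℂ) : CFunField := 4 - (1 + const μ) * (1 + const (starRingEnd ℂ μ)) * (SC * VC)

theorem nC_ne_zero : nC μ ≠ 0 := by
  have h := (CVal.const (P := northC) 4).sub ((CVal.const
    ((1 + μ) * (1 + starRingEnd ℂ μ))).mul (CVal.SC_north.mul CVal.VC_north))
  have := h.ne_zero northC_mem (by norm_num)
  simpa [nC, const_four] using this

theorem IsG₁'.acts_VC (hμ : ‖μ‖ = 1) {g : Bir} (hg : IsG₁' μ g) :
    baseChange g VC * bC μ = -VC * aC μ := by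
  obtain ⟨h1, h2⟩ := (isG₁'_iff hμ).1 hg
  have h3 : baseChange g SC * baseChange g VC = SC * VC := by
    rw [← map_mul, SC_mul_VC, map_mul, map_sub, map_ofNat, baseChange_RC h1]
  apply mul_left_cancel₀ SC_ne_zero
  linear_combination -aC μ * h3 + baseChange g VC * h2

/-- The products g(a)·a and g(b)·b are both equal to n = 4 - |1 + μ|² s v. Hence the factor -b/a of
s is sent by g to -a/b, and s returns to itself. -/
theorem IsG₁'.mul_self (hμ : ‖μ‖ = 1) {g : Bir} (hg : IsG₁' μ g) : g * g = 1 := by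
  obtain ⟨h1, h2⟩ := (isG₁'_iff hμ).1 hg
  have h3 := hg.acts_VC hμ
  have h4 : baseChange g (baseChange g SC) = SC := by
    have h5 := congrArg (baseChange g) h2
    rw [map_mul, map_mul, map_neg] at h5
    have ea : baseChange g (aC μ) * aC μ = nC μ := by
      rw [aC, map_sub, map_mul, map_add, map_one, map_ofNat, baseChange_const, nC]
      rw [aC, bC] at h2
      linear_combination -(1 + const μ) * h2
    have eb : baseChange g (bC μ) * bC μ = nC μ := by
      rw [bC, map_sub, map_mul, map_add, map_one, map_ofNat, baseChange_const, nC]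
      rw [aC, bC] at h3
      linear_combination -(1 + const (starRingEnd ℂ μ)) * h3
    apply mul_right_cancel₀ (nC_ne_zero (μ := μ))
    apply mul_right_cancel₀ (bC_ne_zero (μ := μ))
    linear_combination aC μ * bC μ * h5 - baseChange g (baseChange g SC) * bC μ * ea -
      baseChange g SC * aC μ * eb - nC μ * h2
  refine bir_ext ?_ ?_
  · rw [SC_eq, map_mul, map_mul, baseChange_const, baseChange_const] at h4
    rw [baseChange_mul, baseChange_one]
    exact mul_left_cancel₀ const_I_ne_zero h4
  · rw [baseChange_mul, baseChange_one, h1, h1]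

end

/-! ### The action of `g₁` on the conic bundles -/

section
variable {μ : ℂ}

theorem span_pair_mul_span_pair (p q u v : CFunField) :
    Submodule.span ℂ {p, q} * Submodule.span ℂ {u, v} =
      Submodule.span ℂ {p * u, p * v, q * u, q * v} := by
  rw [Submodule.span_mul_span]
  congr 1
  ext w
  simp only [Set.mem_mul, Set.mem_insert_iff, Set.mem_singleton_iff, exists_eq_or_imp,
    exists_eq_left]
  simp only [eq_comm (b := w)]
  tauto

/-- The anticanonical system in terms of the first and the fourth pair of conic bundles. -/
theorem linSys_two_two_eq_sup₄ (hμ : ‖μ‖ = 1) (h1 : μ ≠ 1) (hm1 : μ ≠ -1) :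
    linSys 2 2 {ptP, ptPbar, ptQ μ, ptQbar μ} =
      Submodule.span ℂ {RC ^ 2, SC * VC} * Submodule.span ℂ {AC μ, BC μ} ⊔
        Submodule.span ℂ {RC, SC} * Submodule.span ℂ {RC * BC μ, VC * AC μ} := by
  rw [linSys_two_two hμ h1 hm1, span_pair_mul_span_pair, span_pair_mul_span_pair,
    ← Submodule.span_union, ← mul_assoc RC RC, ← pow_two, ← mul_assoc SC VC,
    mul_left_comm SC RC]
  congr 1
  ext w
  simp only [Set.mem_union, Set.mem_insert_iff, Set.mem_singleton_iff]
  tauto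

/-- The anticanonical system in terms of the first and the fifth pair of conic bundles. -/
theorem linSys_two_two_eq_sup₅ (hμ : ‖μ‖ = 1) (h1 : μ ≠ 1) (hm1 : μ ≠ -1) :
    linSys 2 2 {ptP, ptPbar, ptQ μ, ptQbar μ} =
      Submodule.span ℂ {RC ^ 2, SC * VC} * Submodule.span ℂ {AC μ, BC μ} ⊔
        Submodule.span ℂ {RC * AC μ, SC * BC μ} * Submodule.span ℂ {RC, VC} := by
  rw [linSys_two_two hμ h1 hm1, span_pair_mul_span_pair, span_pair_mul_span_pair,
    ← Submodule.span_union, mul_right_comm RC (AC μ) RC, ← pow_two, mul_right_comm SC (BC μ) VC,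
    mul_comm (SC * BC μ) RC, mul_assoc RC (AC μ), mul_comm (AC μ) VC]
  congr 1
  ext w
  simp only [Set.mem_union, Set.mem_insert_iff, Set.mem_singleton_iff]
  tauto

/-- From r ↦ r, s ↦ -s b/a, v ↦ -v a/b one gets A = ra ↦ r n/a and B = rb ↦ r n/b. On each basis of
a pencil the effect is then diagonal or a swap, up to a common factor. -/
theorem IsG₁'.isDelPezzoG₁ (hμ : ‖μ‖ = 1) (h1 : μ ≠ 1) (hm1 : μ ≠ -1) {g : Bir}
    (hg : IsG₁' μ g) : IsDelPezzoG₁ μ g := by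
  obtain ⟨hz, h2⟩ := (isG₁'_iff hμ).1 hg
  have h3 := hg.acts_VC hμ
  have hR := baseChange_RC hz
  have hgg : g⁻¹ = g := inv_eq_of_mul_eq_one_left (hg.mul_self hμ)
  have hm := const_mul_starRingEnd hμ
  have hSV := SC_mul_VC
  have hn := nC_ne_zero (μ := μ)
  obtain ⟨ia, hia⟩ : ∃ w, aC μ * w = 1 := ⟨_, mul_inv_cancel₀ aC_ne_zero⟩
  obtain ⟨ib, hib⟩ : ∃ w, bC μ * w = 1 := ⟨_, mul_inv_cancel₀ bC_ne_zero⟩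
  obtain ⟨iR, hiR⟩ : ∃ w, RC * w = 1 := ⟨_, mul_inv_cancel₀ RC_ne_zero⟩
  have hia0 : ia ≠ 0 := right_ne_zero_of_mul_eq_one hia
  have hib0 : ib ≠ 0 := right_ne_zero_of_mul_eq_one hib
  have hiR0 : iR ≠ 0 := right_ne_zero_of_mul_eq_one hiR
  have hS : baseChange g SC = -SC * bC μ * ia := by
    linear_combination ia * h2 - baseChange g SC * hia
  have hV : baseChange g VC = -VC * aC μ * ib := by
    linear_combination ib * h3 - baseChange g VC * hib
  have hSVg : baseChange g (SC * VC) = SC * VC := by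
    rw [SC_mul_VC, map_mul, map_sub, map_ofNat, hR]
  have hA : baseChange g (AC μ) = RC * nC μ * ia := by
    rw [AC_eq, map_mul, hR, aC, map_sub, map_mul, map_add, map_one, map_ofNat, baseChange_const,
      hS, nC]
    rw [aC] at hia
    rw [bC]
    linear_combination -2 * RC * hia
  have hB : baseChange g (BC μ) = RC * nC μ * ib := by
    rw [BC_eq, map_mul, hR, bC, map_sub, map_mul, map_add, map_one, map_ofNat, baseChange_const,
      hV, nC]
    rw [bC] at hib
    rw [aC]
    linear_combination -2 * RC * hib
  have c1a : CarriesBy 1 g (Submodule.span ℂ {RC ^ 2, SC * VC})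
      (Submodule.span ℂ {RC ^ 2, SC * VC}) :=
    .pair_diag one_ne_zero one_ne_zero (by simp [hR]) (by rw [hSVg]; simp)
  have c1b : CarriesBy (nC μ * ia * ib) g (Submodule.span ℂ {AC μ, BC μ})
      (Submodule.span ℂ {AC μ, BC μ}) := by
    refine .pair_swap one_ne_zero one_ne_zero ?_ ?_
    · rw [hA, BC_eq, const_one]; linear_combination -RC * nC μ * ia * hib
    · rw [hB, AC_eq, const_one]; linear_combination -RC * nC μ * ib * hia
  have c5b : CarriesBy (RC * nC μ * ia) g (Submodule.span ℂ {RC, SC})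
      (Submodule.span ℂ {RC * AC μ, SC * BC μ}) := by
    refine .pair_diag one_ne_zero (neg_ne_zero.2 one_ne_zero) ?_ ?_
    · rw [map_mul, hR, hA, const_one]; ring
    · rw [map_mul, hS, hB, const_neg, const_one]
      linear_combination -SC * RC * nC μ * ia * hib
  have c4b : CarriesBy (RC * nC μ * ib) g (Submodule.span ℂ {RC, VC})
      (Submodule.span ℂ {RC * BC μ, VC * AC μ}) := by
    refine .pair_diag one_ne_zero (neg_ne_zero.2 one_ne_zero) ?_ ?_
    · rw [map_mul, hR, hB, const_one]; ring
    · rw [map_mul, hV, hA, const_neg, const_one]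
      linear_combination -VC * RC * nC μ * ib * hia
  have c5a : CarriesBy (iR * ib) g (Submodule.span ℂ {RC * BC μ, VC * AC μ})
      (Submodule.span ℂ {RC, VC}) := by
    refine .pair_diag one_ne_zero (neg_ne_zero.2 one_ne_zero) ?_ ?_
    · rw [hR, BC_eq, const_one]
      linear_combination (-RC * RC * iR) * hib - RC * hiR
    · rw [hV, AC_eq, const_neg, const_one]
      linear_combination VC * aC μ * ib * hiR
  have c3a : Carries g (Submodule.span ℂ {RC * (RC - SC), SC * (VC - const μ * RC)})
      (Submodule.span ℂ {RC * (SC - const (starRingEnd ℂ μ) * RC), SC * (VC - RC)}) := by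
    refine CarriesBy.carries (l := (2 - (1 + const (starRingEnd ℂ μ)) * RC) * ia)
      (.pair_diag one_ne_zero one_ne_zero ?_ ?_) (mul_ne_zero ?_ hia0)
    · rw [map_mul, map_sub, map_mul, hR, baseChange_const, hS, const_one]
      rw [aC] at hia
      rw [bC]
      linear_combination const (starRingEnd ℂ μ) * RC ^ 2 * hia +
        RC * ia * ((1 + const (starRingEnd ℂ μ)) * hSV + SC * RC * hm)
    · rw [mul_sub, map_sub, hSVg, map_mul, hR, hS, const_one]
      rw [aC] at hia
      rw [bC]
      linear_combination -SC * VC * hia + SC * ia * (-(1 + const μ) * hSV - RC ^ 2 * hm)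
    · have := linear_form_ne_zero (a := 2) (b := -(1 + starRingEnd ℂ μ)) (c := 0) (d := 0) ?_
      · convert this using 1
        simp [const_two]; ring
      · intro h
        refine one_ne_zero (α := ℂ) ?_
        have hm' := mul_starRingEnd_of_norm hμ
        linear_combination -hm' - μ * h / 2
  have c3b : Carries g
      (Submodule.span ℂ {RC * (RC - VC), VC * (SC - const (starRingEnd ℂ μ) * RC)})
      (Submodule.span ℂ {RC * (VC - const μ * RC), VC * (SC - RC)}) := by
    refine CarriesBy.carries (l := (2 - (1 + const μ) * RC) * ib)
      (.pair_diag one_ne_zero one_ne_zero ?_ ?_) (mul_ne_zero ?_ hib0)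
    · rw [map_mul, map_sub, map_mul, hR, baseChange_const, hV, const_one]
      rw [bC] at hib
      rw [aC]
      linear_combination const μ * RC ^ 2 * hib +
        RC * ib * ((1 + const μ) * hSV + VC * RC * hm)
    · rw [mul_sub, map_sub, mul_comm VC SC, hSVg, map_mul, hR, hV, const_one]
      rw [bC] at hib
      rw [aC]
      linear_combination -SC * VC * hib +
        VC * ib * (-(1 + const (starRingEnd ℂ μ)) * hSV - RC ^ 2 * hm)
    · have := linear_form_ne_zero (a := 2) (b := -(1 + μ)) (c := 0) (d := 0) ?_
      · convert this using 1
        simp [const_two]; ring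
      · intro h
        refine ne_zero_of_norm hμ ?_
        linear_combination -h / 2
  have hl4b : RC * nC μ * ib ≠ 0 := mul_ne_zero (mul_ne_zero RC_ne_zero hn) hib0
  have hl5b : RC * nC μ * ia ≠ 0 := mul_ne_zero (mul_ne_zero RC_ne_zero hn) hia0
  have hl1b : nC μ * ia * ib ≠ 0 := mul_ne_zero (mul_ne_zero hn hia0) hib0
  refine ⟨?_, ?_⟩
  -- The system |-K_X| is the product of the members of P₁ plus that of P₄, and equally with P₅ in
  -- place of P₄. The P₁ summand goes to itself and the P₄ summand to the P₅ summand, with the same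
  -- factor n/(ab).
  · have h5 : CarriesBy (nC μ * ia * ib) g _ _ :=
      (one_mul (nC μ * ia * ib) ▸ c1a.mul c1b).sup
        ((by linear_combination nC μ * ia * ib * hiR :
          RC * nC μ * ia * (iR * ib) = nC μ * ia * ib) ▸ c5b.mul c5a)
    have h6 := h5.carries hl1b
    rw [← linSys_two_two_eq_sup₅ hμ h1 hm1, ← linSys_two_two_eq_sup₄ hμ h1 hm1] at h6
    exact h6
  · have d1a := c1a.carries one_ne_zero
    have d1b := c1b.carries hl1b
    have d4b := c4b.carries hl4b
    have d5b := c5b.carries hl5b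
    -- As g is an involution, the inverses of the transports already found supply the remaining
    -- ones.
    have d2a := c3a.inv
    have d2b := c3b.inv
    have d5a := d4b.inv
    have d4a := d5b.inv
    rw [hgg] at d2a d2b d5a d4a
    rw [← linSys_p_pbar] at d1a
    rw [← linSys_q_qbar hμ h1 hm1] at d1b
    rw [← linSys_p_q, ← linSys_p_qbar] at c3a d2a
    rw [← linSys_pbar_qbar, ← linSys_pbar_q] at c3b d2b
    rw [← linSys_fbar, ← linSys_one_two hμ h1] at d4b d5a
    rw [← linSys_f, ← linSys_two_one hμ h1] at d5b d4a
    intro i k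
    fin_cases i <;> fin_cases k
    · exact d1a
    · exact d1b
    · exact c3a
    · exact c3b
    · exact d2a
    · exact d2b
    · exact d5b
    · exact d5a
    · exact d4b
    · exact d4a

end

/-! ### The linear involution and the automorphism `g₂` -/

section
variable {μ : ℂ}

/-- Half the sum of the two forms through `q` and `q̄`. -/
def uC (μ : ℂ) : CFunField := const (1 / 2) * (AC μ + BC μ)

theorem two_mul_uC : 2 * uC μ = AC μ + BC μ := by
  have : const (1 / 2) * 2 = 1 := by rw [← const_two, ← const_mul]; norm_num
  rw [uC]; linear_combination (AC μ + BC μ) * this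

/-- `c` is the linear automorphism that exchanges the conics through `p, p̄` and through `q, q̄`. -/
def IsLinearInvolution (μ : ℂ) (c : Bir) : Prop :=
  baseChange c RC * uC μ = (RC - SC) * (RC - VC) ∧
    baseChange c SC * uC μ = (SC - const (starRingEnd ℂ μ) * RC) * (VC - RC) ∧
    baseChange c VC * uC μ = (VC - const μ * RC) * (SC - RC)

theorem uC_ne_zero : uC μ ≠ 0 := by
  intro h
  have h2 := two_mul_uC (μ := μ)
  rw [h, mul_zero, AC_eq, BC_eq, ← mul_add] at h2
  rcases mul_eq_zero.1 h2.symm with h3 | h3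
  · exact RC_ne_zero h3
  · have := linear_form_ne_zero (a := 4) (b := 0) (c := -(1 + μ)) (d := -(1 + starRingEnd ℂ μ))
      (by norm_num)
    refine this ?_
    rw [aC, bC] at h3
    simp only [const_four, const_zero, const_neg, const_add, const_one]
    linear_combination h3

/-- The affine formulas are multiplied by r to become forms of bidegree (1, 1). The formula for v is
the complex conjugate of the one for s. -/
theorem exists_isLinearInvolution (hμ : ‖μ‖ = 1) (h1 : μ ≠ 1) :
    ∃ c ∈ autReal, c * c = 1 ∧ IsLinearInvolution μ c := by
  obtain ⟨c, hc, hcc, h⟩ := exists_linear_involution hμ h1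
  have hm := const_mul_starRingEnd hμ
  have hSV := SC_mul_VC
  have hhalf : const (1 / 2) * 2 = 1 := by rw [← const_two, ← const_mul]; norm_num
  have eW := h (const (1 / 2) * (aC μ + bC μ)) (by
    rw [← SC_eq, ← VC_eq, aC, bC]
    linear_combination (4 - ((1 + const μ) * SC + (1 + const (starRingEnd ℂ μ)) * VC)) * hhalf)
  rw [← SC_eq, ← VC_eq] at eW
  obtain ⟨-, hS, hz⟩ := eW
  have hu : uC μ = RC * (const (1 / 2) * (aC μ + bC μ)) := by
    rw [uC, AC_eq, BC_eq]; ring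
  have hconjS : conjL SC = VC := by
    rw [SC_eq, VC_eq, map_mul, conjL_const, conjL_tC, Complex.conj_I, const_neg]
  have hconjV : conjL VC = SC := by rw [← hconjS, conjL_conjL]
  have hV := congrArg conjL hS
  have hab : conjL (const (1 / 2) * (aC μ + bC μ)) = const (1 / 2) * (aC μ + bC μ) := by
    rw [aC, bC]
    simp only [map_mul, map_add, map_sub, map_one, map_ofNat, conjL_const, hconjS, hconjV,
      map_div₀, Complex.conj_conj]
    ring
  rw [map_mul, hab, conjL_baseChange, hconjS] at hV
  simp only [map_mul, map_add, map_sub, map_one, conjL_const, hconjS, hconjV, conjL_zC,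
    Complex.conj_conj] at hV
  have hRz : zC = RC - 1 := by rw [RC]; ring
  refine ⟨c, hc, hcc, ?_, ?_, ?_⟩
  · rw [hu, RC, map_add, map_one]
    rw [hRz] at hz ⊢
    have h2 : (2 : CFunField) ≠ 0 := two_ne_zero
    apply mul_left_cancel₀ h2
    rw [aC, bC] at hz ⊢
    linear_combination RC * hz + RC * (4 - ((1 + const μ) * SC +
      (1 + const (starRingEnd ℂ μ)) * VC)) * hhalf - 2 * hSV
  · rw [hu]
    rw [hRz] at hS
    linear_combination RC * hS - hSV
  · rw [hu]
    rw [hRz] at hV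
    linear_combination RC * hV - hSV

section
variable {c : Bir}

/-- The right-hand side is a member of the pencil spanned by r² and sv, that is, of the pencil
through p and p̄. Together with its conjugate it shows that c takes A and B into that pencil, up to
a factor. -/
theorem IsLinearInvolution.aC (hμ : ‖μ‖ = 1) (h : IsLinearInvolution μ c) :
    baseChange c (aC μ) * uC μ = (1 - const μ) * (SC * VC - const (starRingEnd ℂ μ) * RC ^ 2) := by
  obtain ⟨-, hS, -⟩ := h
  have hu := two_mul_uC (μ := μ)
  rw [AC, BC] at hu
  rw [SphereBir.aC, map_sub, map_mul, map_add, map_one, map_ofNat, baseChange_const]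
  linear_combination hu - (1 + const μ) * hS + (RC * VC - 2 * RC ^ 2) * const_mul_starRingEnd hμ

theorem IsLinearInvolution.bC (hμ : ‖μ‖ = 1) (h : IsLinearInvolution μ c) :
    baseChange c (bC μ) * uC μ = (1 - const (starRingEnd ℂ μ)) * (SC * VC - const μ * RC ^ 2) := by
  obtain ⟨-, -, hV⟩ := h
  have hu := two_mul_uC (μ := μ)
  rw [AC, BC] at hu
  rw [SphereBir.bC, map_sub, map_mul, map_add, map_one, map_ofNat, baseChange_const]
  linear_combination hu - (1 + const (starRingEnd ℂ μ)) * hV +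
    (RC * SC - 2 * RC ^ 2) * const_mul_starRingEnd hμ

theorem starRingEnd_ne_one (h1 : μ ≠ 1) : starRingEnd ℂ μ ≠ 1 := fun h => h1 (by
  rw [← Complex.conj_conj μ, h, map_one])

theorem RC_sub_SC_ne_zero : RC - SC ≠ 0 := by
  have := linear_form_ne_zero (a := 0) (b := 1) (c := -1) (d := 0) (by norm_num)
  convert this using 1
  simp; ring

theorem RC_sub_VC_ne_zero : RC - VC ≠ 0 := by
  have := linear_form_ne_zero (a := 0) (b := 1) (c := 0) (d := -1) (by norm_num)
  convert this using 1
  simp; ring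

/-- On ℙ¹ × ℙ¹ the involution acts factorwise, by s/r ↦ (s - μ̄r)/(s - r) and v/r ↦ (v - μr)/(v -
r). Hence it preserves both rulings, and exchanging p with q̄ and q with p̄ it swaps the members of
P₁ and of P₂ and preserves those of P₃. -/
theorem IsLinearInvolution.actsOnBundles (hμ : ‖μ‖ = 1) (h1 : μ ≠ 1) (hm1 : μ ≠ -1)
    (hcc : c * c = 1) (h : IsLinearInvolution μ c) :
    IsDelPezzoAut μ c ∧ ActsOnBundles μ c (fun i => i) ![1, 1, 0, 0, 0] := by
  have ha := h.aC hμ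
  have hb := h.bC hμ
  obtain ⟨hR, hS, hV⟩ := h
  have hinv : c⁻¹ = c := inv_eq_of_mul_eq_one_left hcc
  have hm := const_mul_starRingEnd hμ
  have hm' := mul_starRingEnd_of_norm hμ
  have hd : 1 - μ ≠ 0 := sub_ne_zero.2 h1.symm
  have hd' : 1 - starRingEnd ℂ μ ≠ 0 := sub_ne_zero.2 (starRingEnd_ne_one h1).symm
  have hp : 1 + μ ≠ 0 := fun h => hm1 (by linear_combination h)
  have hsq : (1 - μ) * (1 + μ) ≠ 0 := mul_ne_zero hd hp
  have hk : const (1 + μ)⁻¹ * (1 + const μ) = 1 := by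
    rw [← const_one, ← const_add, ← const_mul, inv_mul_cancel₀ hp]
  obtain ⟨iu, hiu⟩ : ∃ w, uC μ * w = 1 := ⟨_, mul_inv_cancel₀ uC_ne_zero⟩
  have hiu0 : iu ≠ 0 := right_ne_zero_of_mul_eq_one hiu
  have div : ∀ {x y : CFunField}, x * uC μ = y → x = y * iu := fun {x y} hxy => by
    linear_combination iu * hxy - x * hiu
  replace hR := div hR
  replace hS := div hS
  replace hV := div hV
  replace ha := div ha
  replace hb := div hb
  have hX : (RC - SC) * (RC - VC) ≠ 0 := mul_ne_zero RC_sub_SC_ne_zero RC_sub_VC_ne_zero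
  have hA : baseChange c (AC μ) = (RC - SC) * (RC - VC) * iu *
      ((1 - const μ) * (SC * VC - const (starRingEnd ℂ μ) * RC ^ 2) * iu) := by
    rw [AC_eq, map_mul, hR, ha]
  have hB : baseChange c (BC μ) = (RC - SC) * (RC - VC) * iu *
      ((1 - const (starRingEnd ℂ μ)) * (SC * VC - const μ * RC ^ 2) * iu) := by
    rw [BC_eq, map_mul, hR, hb]
  have c1a : CarriesBy ((RC - SC) * (RC - VC) * iu ^ 2) c (Submodule.span ℂ {AC μ, BC μ})
      (Submodule.span ℂ {RC ^ 2, SC * VC}) := by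
    refine .pair (a := (1 + μ)⁻¹) (b := μ * (1 + μ)⁻¹) (c := μ * (1 + μ)⁻¹) (d := (1 + μ)⁻¹)
      ?_ ?_ ?_
    · have : (1 + μ)⁻¹ * (1 + μ)⁻¹ - μ * (1 + μ)⁻¹ * (μ * (1 + μ)⁻¹) =
          (1 + μ)⁻¹ * (1 + μ)⁻¹ * ((1 - μ) * (1 + μ)) := by ring
      rw [this]
      exact mul_ne_zero (mul_ne_zero (inv_ne_zero hp) (inv_ne_zero hp)) hsq
    · rw [map_pow, hR, AC, BC, const_mul]
      linear_combination (RC - SC) * (RC - VC) * iu ^ 2 * (-((RC - SC) * (RC - VC)) * hk +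
        const (1 + μ)⁻¹ * RC * VC * hm)
    · rw [map_mul, hS, hV, AC, BC, const_mul]
      linear_combination (RC - SC) * (RC - VC) * iu ^ 2 *
        (-((SC - const (starRingEnd ℂ μ) * RC) * (VC - const μ * RC)) * hk +
        const (1 + μ)⁻¹ * ((1 + const μ) * RC ^ 2 - RC * VC) * hm)
  have c1b : CarriesBy ((RC - SC) * (RC - VC) * iu ^ 2) c (Submodule.span ℂ {RC ^ 2, SC * VC})
      (Submodule.span ℂ {AC μ, BC μ}) := by
    refine .pair (a := -(1 - μ) * starRingEnd ℂ μ) (b := 1 - μ) (c := -(1 - starRingEnd ℂ μ) * μ)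
      (d := 1 - starRingEnd ℂ μ) ?_ ?_ ?_
    · have : -(1 - μ) * starRingEnd ℂ μ * (1 - starRingEnd ℂ μ) -
          (1 - μ) * (-(1 - starRingEnd ℂ μ) * μ) =
          -(starRingEnd ℂ μ * (1 - starRingEnd ℂ μ) * (1 - μ) * ((1 - μ) * (1 + μ))) := by
        linear_combination -(1 - starRingEnd ℂ μ) * (1 - μ) * μ * hm'
      rw [this]
      exact neg_ne_zero.2 (mul_ne_zero (mul_ne_zero (mul_ne_zero
        (right_ne_zero_of_mul_eq_one hm') hd') hd) hsq)
    · rw [hA]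
      simp only [const_mul, const_neg, const_sub, const_one]
      ring
    · rw [hB]
      simp only [const_mul, const_neg, const_sub, const_one]
      ring
  have c4a : CarriesBy ((RC - VC) * iu) c (Submodule.span ℂ {RC, SC})
      (Submodule.span ℂ {RC, SC}) := by
    refine .pair (a := 1) (b := -1) (c := starRingEnd ℂ μ) (d := -1) ?_ ?_ ?_
    · intro h; apply hd'; linear_combination -h
    · rw [hR, const_one, const_neg, const_one]; ring
    · rw [hS, const_neg, const_one]; ring
  have c5a : CarriesBy ((RC - SC) * iu) c (Submodule.span ℂ {RC, VC})
      (Submodule.span ℂ {RC, VC}) := by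
    refine .pair (a := 1) (b := -1) (c := μ) (d := -1) ?_ ?_ ?_
    · intro h; apply hd; linear_combination -h
    · rw [hR, const_one, const_neg, const_one]; ring
    · rw [hV, const_neg, const_one]; ring
  have c4b : CarriesBy ((RC - SC) * (RC - VC) * (RC - SC) * iu ^ 3) c
      (Submodule.span ℂ {RC * BC μ, VC * AC μ}) (Submodule.span ℂ {RC * BC μ, VC * AC μ}) := by
    refine .pair (a := -(1 - starRingEnd ℂ μ) * μ) (b := -(1 - starRingEnd ℂ μ)) (c := -(1 - μ))
      (d := -(1 - μ)) ?_ ?_ ?_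
    · intro h
      refine mul_ne_zero (mul_ne_zero hd hd') hd ?_
      linear_combination -h
    · rw [map_mul, hR, hB, AC, BC]
      simp only [const_mul, const_neg, const_sub, const_one]
      linear_combination (RC - SC) * (RC - VC) * (RC - SC) * iu ^ 3 *
        (1 - const (starRingEnd ℂ μ)) * (-RC ^ 2 * VC) * hm
    · rw [map_mul, hV, hA, AC, BC]
      simp only [const_neg, const_sub, const_one]
      linear_combination -((RC - SC) * (RC - VC) * (RC - SC) * iu ^ 3) *
        (1 - const μ) * RC ^ 3 * hm
  have c5b : CarriesBy ((RC - SC) * (RC - VC) * (RC - VC) * iu ^ 3) c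
      (Submodule.span ℂ {RC * AC μ, SC * BC μ}) (Submodule.span ℂ {RC * AC μ, SC * BC μ}) := by
    refine .pair (a := -(1 - μ) * starRingEnd ℂ μ) (b := -(1 - μ)) (c := -(1 - starRingEnd ℂ μ))
      (d := -(1 - starRingEnd ℂ μ)) ?_ ?_ ?_
    · intro h
      refine mul_ne_zero (mul_ne_zero hd hd') hd' ?_
      linear_combination -h
    · rw [map_mul, hR, hA, AC, BC]
      simp only [const_mul, const_neg, const_sub, const_one]
      linear_combination (RC - SC) * (RC - VC) * (RC - VC) * iu ^ 3 *
        (1 - const μ) * (-RC ^ 2 * SC) * hm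
    · rw [map_mul, hS, hB, AC, BC]
      simp only [const_neg, const_sub, const_one]
      linear_combination -((RC - SC) * (RC - VC) * (RC - VC) * iu ^ 3) *
        (1 - const (starRingEnd ℂ μ)) * RC ^ 3 * hm
  have hl : (RC - SC) * (RC - VC) * iu ^ 2 ≠ 0 := mul_ne_zero hX (pow_ne_zero 2 hiu0)
  have c2 : Carries c (Submodule.span ℂ {RC * (RC - VC), VC * (SC - const (starRingEnd ℂ μ) * RC)})
      (Submodule.span ℂ {RC * (RC - SC), SC * (VC - const μ * RC)}) := by
    refine CarriesBy.carries (l := (RC - SC) * (RC - VC) * iu ^ 2)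
      (.pair_diag hd' hd ?_ ?_) hl
    · rw [map_mul, map_sub, hR, hS, const_sub, const_one]; ring
    · rw [map_mul, map_sub, map_mul, baseChange_const, hR, hS, hV, const_sub, const_one]; ring
  have c3a : Carries c (Submodule.span ℂ {RC * (SC - const (starRingEnd ℂ μ) * RC), SC * (VC - RC)})
      (Submodule.span ℂ {RC * (SC - const (starRingEnd ℂ μ) * RC), SC * (VC - RC)}) := by
    refine CarriesBy.carries (l := (RC - SC) * (RC - VC) * iu ^ 2)
      (.pair_swap hd' hd ?_ ?_) hl
    · rw [map_mul, map_sub, map_mul, baseChange_const, hR, hS, const_sub, const_one]; ring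
    · rw [map_mul, map_sub, hR, hS, hV, const_sub, const_one]; ring
  have c3b : Carries c (Submodule.span ℂ {RC * (VC - const μ * RC), VC * (SC - RC)})
      (Submodule.span ℂ {RC * (VC - const μ * RC), VC * (SC - RC)}) := by
    refine CarriesBy.carries (l := (RC - SC) * (RC - VC) * iu ^ 2)
      (.pair_swap hd hd' ?_ ?_) hl
    · rw [map_mul, map_sub, map_mul, baseChange_const, hR, hV, const_sub, const_one]; ring
    · rw [map_mul, map_sub, hR, hS, hV, const_sub, const_one]; ring
  refine ⟨?_, ?_⟩
  · have h1' := c1a.mul c1b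
    have h4' := c4a.mul c4b
    rw [mul_comm (Submodule.span ℂ {AC μ, BC μ})] at h1'
    rw [show (RC - VC) * iu * ((RC - SC) * (RC - VC) * (RC - SC) * iu ^ 3) =
      (RC - SC) * (RC - VC) * iu ^ 2 * ((RC - SC) * (RC - VC) * iu ^ 2) by ring] at h4'
    have h6 := (h1'.sup h4').carries (mul_ne_zero hl hl)
    rw [← linSys_two_two_eq_sup₄ hμ h1 hm1] at h6
    exact h6
  · have d1a := c1a.carries hl
    have d1b := c1b.carries hl
    have d4a := c4a.carries (mul_ne_zero RC_sub_VC_ne_zero hiu0)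
    have d5a := c5a.carries (mul_ne_zero RC_sub_SC_ne_zero hiu0)
    have d4b := c4b.carries (mul_ne_zero (mul_ne_zero hX RC_sub_SC_ne_zero) (pow_ne_zero 3 hiu0))
    have d5b := c5b.carries (mul_ne_zero (mul_ne_zero hX RC_sub_VC_ne_zero) (pow_ne_zero 3 hiu0))
    have d2 := c2.inv
    rw [hinv] at d2
    rw [← linSys_p_pbar, ← linSys_q_qbar hμ h1 hm1] at d1a d1b
    rw [← linSys_p_q, ← linSys_pbar_qbar] at c2 d2
    rw [← linSys_p_qbar] at c3a
    rw [← linSys_pbar_q] at c3b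
    rw [← linSys_one_two hμ h1] at d4b
    rw [← linSys_two_one hμ h1] at d5b
    rw [← linSys_f] at d4a
    rw [← linSys_fbar] at d5a
    intro i k
    fin_cases i <;> fin_cases k
    · exact d1b
    · exact d1a
    · exact d2
    · exact c2
    · exact c3a
    · exact c3b
    · exact d4a
    · exact d4b
    · exact d5a
    · exact d5b

end

/-- Since 1 - z² = sv and t is a constant multiple of s, numerator and denominator of the given
formula share the factor s, which cancels. -/
theorem isG₂'_iff (hμ : ‖μ‖ = 1) {g : Bir} : IsG₂' μ g ↔
    baseChange g zC = -zC ∧ baseChange g SC * (const μ * bC μ) = -VC * aC μ := by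
  have hm := const_mul_starRingEnd hμ
  have e1 : baseChange g SC = const Complex.I * baseChange g tC := by
    rw [SC_eq, map_mul, baseChange_const]
  have e3 : 1 - zC ^ 2 = SC * VC := by rw [SC_mul_VC, RC]; ring
  rw [IsG₂', and_comm, e3, e1]
  refine and_congr_right fun _ => ?_
  have this : const Complex.I * tC = SC := SC_eq.symm
  have key : SC * (const Complex.I * baseChange g tC * (const μ * bC μ) - -VC * aC μ) =
      baseChange g tC * (-2 * const μ * tC - const Complex.I * (1 + const μ) * (SC * VC)) -
      SC * VC * (const Complex.I * tC * (1 + const μ) - 2) := by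
    rw [aC, bC]
    linear_combination (-const Complex.I * baseChange g tC * SC * VC) * hm +
      (SC * VC * (1 + const μ) - 2 * const μ * const Complex.I * baseChange g tC) * this +
      (2 * const μ * baseChange g tC * tC) * const_I_sq
  rw [← sub_eq_zero, ← key, mul_eq_zero, or_iff_right SC_ne_zero, sub_eq_zero]

theorem IsG₂'.unique (hμ : ‖μ‖ = 1) {g h : Bir} (hg : IsG₂' μ g) (hh : IsG₂' μ h) : g = h := by
  obtain ⟨h1, h2⟩ := (isG₂'_iff hμ).1 hg
  obtain ⟨h3, h4⟩ := (isG₂'_iff hμ).1 hh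
  have h5 : baseChange g SC = baseChange h SC := mul_right_cancel₀
    (mul_ne_zero (const_ne_zero (ne_zero_of_norm hμ)) bC_ne_zero) (h2.trans h4.symm)
  refine bir_ext ?_ (h1.trans h3.symm)
  rw [SC_eq, map_mul, map_mul, baseChange_const, baseChange_const] at h5
  exact mul_left_cancel₀ const_I_ne_zero h5

end

/-- The algebra behind the formula for c g₁ c⁻¹, isolated in an abstract field. Here m, n stand for
μ, μ̄; the letters r, s, v, α, β, U are the images under c of r, s, v, a, b, u; and s', v', U', φS,
φR are the images of s, v, U, S, R under the conjugated map. -/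
theorem conj_formulas {K : Type*} [Field K] {m n R S V r s v α β A B U u φS φR s' v' U' : K}
    (h2 : (2 : K) ≠ 0) (hm : m * n = 1) (hd : 1 - m ≠ 0) (hd' : 1 - n ≠ 0) (hR0 : R ≠ 0)
    (hRS : R - S ≠ 0) (hRV : R - V ≠ 0) (ha0 : 2 - (1 + m) * S ≠ 0) (hb0 : 2 - (1 + n) * V ≠ 0)
    (hU0 : U ≠ 0)
    (hAe : A = R ^ 2 + S * V - (1 + m) * (S * R)) (hBe : B = R ^ 2 + S * V - (1 + n) * (R * V))
    (hAR : A = R * (2 - (1 + m) * S)) (hBR : B = R * (2 - (1 + n) * V))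
    (huA : 2 * u = A + B)
    (hR : r * u = (R - S) * (R - V)) (hS : s * u = (S - n * R) * (V - R))
    (hV : v * u = (V - m * R) * (S - R)) (hSV : s * v = r * (2 - r))
    (hα : α = 2 - (1 + m) * s) (hβ : β = 2 - (1 + n) * v)
    (hu2 : 2 * U = r * α + r * β) (hR2 : R * U = (r - s) * (r - v))
    (hgS2 : s' * α = -s * β) (hgV2 : v' * β = -v * α)
    (hφS : φS * U' = (s' - n * r) * (v' - r)) (hφR : φR * U' = (r - s') * (r - v'))
    (hφu : 2 * U' = r * (2 - (1 + m) * s') + r * (2 - (1 + n) * v')) :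
    φR = 2 - R ∧ φS * (m * (2 - (1 + n) * V)) = -V * (2 - (1 + m) * S) := by
  rw [hAe, hBe] at huA
  have hq : ((1 + n) * r - 2) * u = -(1 - n) * A := by
    rw [hAe]
    linear_combination (1 + n) * hR - huA + S * R * hm
  have hq' : ((1 + m) * r - 2) * u = -(1 - m) * B := by
    rw [hBe]
    linear_combination (1 + m) * hR - huA + V * R * hm
  have hqq : 4 - (1 + m) * (1 + n) * (s * v) =
      ((1 + n) * r - 2) * ((1 + m) * r - 2) := by
    linear_combination -(1 + m) * (1 + n) * hSV - 2 * r * hm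
  have hA0 : A ≠ 0 := by rw [hAR]; exact mul_ne_zero hR0 ha0
  have hB0 : B ≠ 0 := by rw [hBR]; exact mul_ne_zero hR0 hb0
  have hq0 : (1 + n) * r - 2 ≠ 0 := left_ne_zero_of_mul
    (hq ▸ mul_ne_zero (neg_ne_zero.2 hd') hA0)
  have hq0' : (1 + m) * r - 2 ≠ 0 := left_ne_zero_of_mul
    (hq' ▸ mul_ne_zero (neg_ne_zero.2 hd) hB0)
  have hrs : (r - s) * u = (1 - n) * R * (R - V) := by
    linear_combination hR - hS
  have hrv : (r - v) * u = (1 - m) * R * (R - S) := by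
    linear_combination hR - hV
  have hvr : (v - m * r) * u = (1 - m) * V * (S - R) := by
    linear_combination hV - m * hR
  have hrs0 : r - s ≠ 0 := left_ne_zero_of_mul
    (hrs ▸ mul_ne_zero (mul_ne_zero hd' hR0) hRV)
  have e1 : α * β * U' = ((1 + n) * r - 2) * ((1 + m) * r - 2) * U := by
    apply mul_left_cancel₀ h2
    rw [← hqq]
    have e : (2 - (1 + m) * s') * α =
        4 - (1 + m) * (1 + n) * (s * v) := by
      linear_combination 2 * hα - (1 + m) * hgS2 + (1 + m) * s * hβ
    have e' : (2 - (1 + n) * v') * β =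
        4 - (1 + m) * (1 + n) * (s * v) := by
      linear_combination 2 * hβ - (1 + n) * hgV2 +
        (1 + n) * v * hα
    linear_combination α * β * hφu + r * β * e + r * α * e' -
      (4 - (1 + m) * (1 + n) * (s * v)) * hu2
  have f1 : s * β + n * r * α =
      (r - s) * ((1 + n) * r - 2) := by
    rw [hα, hβ]
    linear_combination -(1 + n) * hSV - r * s * hm
  have f2 : v * α + r * β =
      -(v - m * r) * ((1 + n) * r - 2) := by
    rw [hα, hβ]
    linear_combination -(1 + m) * hSV - r ^ 2 * hm
  have f3 : r * α + s * β =
      n * (r - m * s) * ((1 + m) * r - 2) := by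
    rw [hα, hβ]
    linear_combination -(1 + n) * hSV +
      ((1 + m) * r * s - 2 * s - r ^ 2) * hm
  have k1 : φS * U * ((1 + m) * r - 2) =
      -(r - s) * (v - m * r) * ((1 + n) * r - 2) := by
    apply mul_left_cancel₀ hq0
    linear_combination -φS * e1 + α * β * hφS +
      hgS2 * (v' * β - r * β) - (s * β + n * r * α) * hgV2 +
      f1 * (v * α + r * β) + (r - s) * ((1 + n) * r - 2) * f2
  have k2 : φR * U =
      -n * (r - m * s) * (v - m * r) := by
    apply mul_left_cancel₀ (mul_ne_zero hq0 hq0')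
    linear_combination -φR * e1 + α * β * hφR -
      hgS2 * (r * β - v' * β) - (r * α + s * β) * hgV2 + f3 * (v * α + r * β) +
      n * (r - m * s) * ((1 + m) * r - 2) * f2
  refine ⟨?_, ?_⟩
  · apply mul_right_cancel₀ hU0
    linear_combination k2 - hu2 + hR2 - r * hα - r * hβ +
      (m * n + 1) * hSV - (m * r * s - 2 * r) * hm
  · have k4 : φS * (1 - m) * B =
        V * (1 - n) * A := by
      apply mul_left_cancel₀ (mul_ne_zero (mul_ne_zero hd hR0) hRS)
      have k1' : φS * ((1 + m) * r - 2) * (r - v) =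
          -R * (v - m * r) * ((1 + n) * r - 2) := by
        apply mul_left_cancel₀ hrs0
        linear_combination R * k1 - φS * ((1 + m) * r - 2) * hR2
      linear_combination -u ^ 2 * k1' + φS *
        (hq' * (r - v) * u - (1 - m) * B * hrv) +
        R * (hvr * ((1 + n) * r - 2) * u +
          (1 - m) * V * (S - R) * hq)
    apply mul_left_cancel₀ (mul_ne_zero hd hR0)
    rw [hAR, hBR] at k4
    linear_combination m * k4 - V * R * (2 - (1 + m) * S) * hm

section
variable {μ : ℂ}

/-- As c is an involution, r, s, v are known rational expressions in c(r), c(s), c(v), and on the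
latter the conjugated map acts by the formulas of g₁. What remains is the elimination in
`conj_formulas`. -/
theorem isG₂'_conj (hμ : ‖μ‖ = 1) (h1 : μ ≠ 1) {c g : Bir}
    (hcc : c * c = 1) (hc : IsLinearInvolution μ c) (hg : IsG₁' μ g) : IsG₂' μ (c * g * c⁻¹) := by
  have hm := const_mul_starRingEnd hμ
  have hd : 1 - const μ ≠ 0 := by
    rw [← const_one, ← const_sub]; exact const_ne_zero (sub_ne_zero.2 h1.symm)
  have hd' : 1 - const (starRingEnd ℂ μ) ≠ 0 := by
    rw [← const_one, ← const_sub]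
    exact const_ne_zero (sub_ne_zero.2 (starRingEnd_ne_one h1).symm)
  obtain ⟨hz, hgS⟩ := (isG₁'_iff hμ).1 hg
  have hgV := hg.acts_VC hμ
  have hgR := baseChange_RC hz
  obtain ⟨hR, hS, hV⟩ := hc
  have hc2 : ∀ w, baseChange c (baseChange c w) = w := fun w => by
    rw [← baseChange_mul, hcc, baseChange_one]
  have hφ : ∀ w, baseChange (c * g * c⁻¹) (baseChange c w) = baseChange c (baseChange g w) :=
    fun w => by rw [baseChange_mul, baseChange_mul, baseChange_inv_apply]
  have hR2 := congrArg (baseChange c) hR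
  have hS2 := congrArg (baseChange c) hS
  have hu2 := congrArg (baseChange c) (two_mul_uC (μ := μ))
  have hgS2 := congrArg (baseChange c) hgS
  have hgV2 := congrArg (baseChange c) hgV
  have hgR2 := congrArg (baseChange c) hgR
  have hSV := congrArg (baseChange c) SC_mul_VC
  have hα : baseChange c (aC μ) = 2 - (1 + const μ) * baseChange c SC := by
    rw [aC, map_sub, map_mul, map_add, map_one, map_ofNat, baseChange_const]
  have hβ : baseChange c (bC μ) = 2 - (1 + const (starRingEnd ℂ μ)) * baseChange c VC := by
    rw [bC, map_sub, map_mul, map_add, map_one, map_ofNat, baseChange_const]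
  have hU0 := baseChange_ne_zero c (uC_ne_zero (μ := μ))
  rw [AC_eq, BC_eq] at hu2
  rw [map_mul] at hgS2 hgV2
  rw [← hφ] at hgS2 hgV2 hgR2
  simp only [map_mul, map_sub, map_add, map_neg, map_ofNat, hc2]
    at hR2 hS2 hu2 hgS2 hgV2 hgR2 hSV
  have hφS := congrArg (baseChange (c * g * c⁻¹)) hS2
  have hφR := congrArg (baseChange (c * g * c⁻¹)) hR2
  have hφu := congrArg (baseChange (c * g * c⁻¹)) hu2
  rw [hα, hβ] at hφu
  simp only [map_mul, map_sub, map_add, map_ofNat, map_one, baseChange_const] at hφS hφR hφu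
  rw [hgR2] at hφS hφR hφu
  obtain ⟨k1, k2⟩ := conj_formulas two_ne_zero hm hd hd' RC_ne_zero RC_sub_SC_ne_zero
    RC_sub_VC_ne_zero (aC_ne_zero (μ := μ)) (bC_ne_zero (μ := μ)) hU0 rfl rfl AC_eq BC_eq
    two_mul_uC hR hS hV hSV hα hβ hu2 hR2 hgS2 hgV2 hφS hφR hφu
  refine (isG₂'_iff hμ).2 ⟨?_, k2⟩
  rw [RC, map_add, map_one] at k1
  linear_combination k1

end

section
variable {μ : ℂ}

/-! ### Uniqueness -/

theorem quadratic_eq_zero {a b c : ℂ} (h : ∀ x : ℂ, a + b * x + c * x ^ 2 = 0) :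
    a = 0 ∧ b = 0 ∧ c = 0 := by
  have h0 := h 0
  have h1 := h 1
  have h2 := h (-1)
  have ha : a = 0 := by linear_combination h0
  refine ⟨ha, ?_, ?_⟩
  · linear_combination (h1 - h2) / 2
  · linear_combination (h1 + h2) / 2 - ha

/-- The two affine coordinates on the quadric. -/
def sC : CFunField := SC / RC
def vC : CFunField := VC / RC

theorem sC_mul_RC : sC * RC = SC := div_mul_cancel₀ _ RC_ne_zero
theorem vC_mul_RC : vC * RC = VC := div_mul_cancel₀ _ RC_ne_zero

/-- Prescribed values a, b of s/r and v/r are attained at the point with r(1 + ab) = 2. Natural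
numbers are used because 1 + ab is then never zero. -/
theorem algebraicIndependent_sC_vC : AlgebraicIndependent ℂ ![sC, vC] := by
  have hinf : (Set.range ((↑) : ℕ → ℂ)).Infinite := Set.infinite_range_of_injective Nat.cast_injective
  refine algebraicIndependent_of_cVal hinf hinf ?_
  rintro _ ⟨a, rfl⟩ _ ⟨b, rfl⟩
  have hd : (1 + a * b : ℂ) ≠ 0 := by exact_mod_cast (by positivity : (1 + a * b : ℕ) ≠ 0)
  obtain ⟨r, hr⟩ : ∃ r : ℂ, r * (1 + a * b) = 2 := ⟨2 / (1 + a * b), div_mul_cancel₀ _ hd⟩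
  have hr0 : r ≠ 0 := left_ne_zero_of_mul (hr ▸ two_ne_zero)
  have hI := Complex.I_sq
  have hmem : (-Complex.I * (a * r)) * (Complex.I * (b * r)) = 1 - (r - 1) ^ 2 := by
    linear_combination (-a * b * r ^ 2) * hI + r * hr
  have hP := spherePoint_mem hmem
  refine ⟨_, hP, ?_, ?_⟩
  · have hR := (CVal.const (P := spherePoint (-Complex.I * (a * r)) (Complex.I * (b * r)) (r - 1))
      1).add (CVal.z _)
    have hS := (CVal.const (P := spherePoint (-Complex.I * (a * r)) (Complex.I * (b * r)) (r - 1))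
      Complex.I).mul (CVal.t _)
    rw [spherePoint_t, ← SC_eq] at hS
    rw [const_one] at hR
    change CVal _ RC _ at hR
    have e : 1 + spherePoint (-Complex.I * (a * r)) (Complex.I * (b * r)) (r - 1) 2 = r := by
      simp [spherePoint]
    rw [e] at hR
    have := hS.div hP hR hr0
    change CVal _ sC _ at this
    convert this using 1
    rw [eq_div_iff hr0]
    linear_combination a * r * hI
  · have hR := (CVal.const (P := spherePoint (-Complex.I * (a * r)) (Complex.I * (b * r)) (r - 1))
      1).add (CVal.z _)
    have hV := (CVal.const (P := spherePoint (-Complex.I * (a * r)) (Complex.I * (b * r)) (r - 1))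
      (-Complex.I)).mul (CVal.tbar _)
    rw [spherePoint_tbar, const_neg, ← VC_eq] at hV
    rw [const_one] at hR
    change CVal _ RC _ at hR
    have e : 1 + spherePoint (-Complex.I * (a * r)) (Complex.I * (b * r)) (r - 1) 2 = r := by
      simp [spherePoint]
    rw [e] at hR
    have := hV.div hP hR hr0
    change CVal _ vC _ at this
    convert this using 1
    rw [eq_div_iff hr0]
    linear_combination b * r * hI

theorem biquadratic_eq_zero {a₀ a₁ a₂ b₀ b₁ b₂ c₀ c₁ c₂ : ℂ}
    (h : (const a₀ + const a₁ * vC + const a₂ * vC ^ 2) +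
      (const b₀ + const b₁ * vC + const b₂ * vC ^ 2) * sC +
      (const c₀ + const c₁ * vC + const c₂ * vC ^ 2) * sC ^ 2 = 0) :
    (a₀ = 0 ∧ a₁ = 0 ∧ a₂ = 0) ∧ (b₀ = 0 ∧ b₁ = 0 ∧ b₂ = 0) ∧ (c₀ = 0 ∧ c₁ = 0 ∧ c₂ = 0) := by
  have h0 := (algebraicIndependent_iff.1 algebraicIndependent_sC_vC)
    ((C a₀ + C a₁ * X 1 + C a₂ * X 1 ^ 2) + (C b₀ + C b₁ * X 1 + C b₂ * X 1 ^ 2) * X 0 +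
      (C c₀ + C c₁ * X 1 + C c₂ * X 1 ^ 2) * X 0 ^ 2) (by
      rw [← h]
      simp only [map_add, map_mul, map_pow, aeval_X, MvPolynomial.aeval_C, Matrix.cons_val_zero,
        Matrix.cons_val_one]
      rfl)
  have h1 : ∀ x y : ℂ, (a₀ + a₁ * y + a₂ * y ^ 2) + (b₀ + b₁ * y + b₂ * y ^ 2) * x +
      (c₀ + c₁ * y + c₂ * y ^ 2) * x ^ 2 = 0 := fun x y => by
    simpa using congrArg (eval ![x, y]) h0
  have h2 := fun y => quadratic_eq_zero fun x => h1 x y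
  exact ⟨quadratic_eq_zero fun y => (h2 y).1, quadratic_eq_zero fun y => (h2 y).2.1,
    quadratic_eq_zero fun y => (h2 y).2.2⟩

/-- The pull-backs of a basis of an invariant pencil. -/
theorem Carries.exists_coeffs {g : Bir} {v₁ v₂ : CFunField}
    (hv : ∀ a b : ℂ, const a * v₁ + const b * v₂ = 0 → a = 0 ∧ b = 0)
    (h : Carries g (Submodule.span ℂ {v₁, v₂}) (Submodule.span ℂ {v₁, v₂})) :
    ∃ (l : CFunField) (a b c d : ℂ), l ≠ 0 ∧ a * d - b * c ≠ 0 ∧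
      baseChange g v₁ = l * (const a * v₁ + const b * v₂) ∧
      baseChange g v₂ = l * (const c * v₁ + const d * v₂) := by
  obtain ⟨l, hl⟩ := h
  rw [map_mulLeft_pair] at hl
  have key : ∀ w ∈ ({v₁, v₂} : Set CFunField), ∃ a b : ℂ,
      baseChange g w = l * (const a * v₁ + const b * v₂) := fun w hw => by
    have : baseChange g w ∈ Submodule.span ℂ {(l : CFunField) * v₁, (l : CFunField) * v₂} := by
      rw [← hl]
      exact Submodule.mem_map_of_mem (Submodule.subset_span hw)
    obtain ⟨a, b, hab⟩ := Submodule.mem_span_pair.1 this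
    refine ⟨a, b, ?_⟩
    rw [← hab, smul_eq_const_mul, smul_eq_const_mul]
    ring
  obtain ⟨a, b, h1⟩ := key v₁ (by simp)
  obtain ⟨c, d, h2⟩ := key v₂ (by simp)
  refine ⟨l, a, b, c, d, l.ne_zero, fun hdet => ?_, h1, h2⟩
  have hdetC : const a * const d - const b * const c = 0 := by
    rw [← const_mul, ← const_mul, ← const_sub, hdet, const_zero]
  have e1 : const d * v₁ + const (-b) * v₂ = 0 := baseChange_injective g (by
    simp only [map_add, map_mul, baseChange_const, h1, h2, map_zero, const_neg, map_neg]
    linear_combination l * v₁ * hdetC)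
  have e2 : const (-c) * v₁ + const a * v₂ = 0 := baseChange_injective g (by
    simp only [map_add, map_mul, baseChange_const, h1, h2, map_zero, const_neg, map_neg]
    linear_combination l * v₂ * hdetC)
  have hb := neg_eq_zero.1 (hv _ _ e1).2
  have ha := (hv _ _ e2).2
  rw [ha, hb] at h1
  have h3 : v₁ = 0 := baseChange_injective g (by rw [h1]; simp)
  have h4 := (hv 1 0 (by rw [h3]; simp)).1
  exact one_ne_zero h4

/-- Preserving the two rulings makes g act by fractional linear maps on s/r and on v/r separately.
The pencil through p and p̄ makes these both diagonal or both antidiagonal, and the pencil through p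
and q leaves only the identity. -/
theorem eq_one_of_carries (hμ : ‖μ‖ = 1) {g : Bir}
    (h₄ : Carries g (linSys 1 0 ∅) (linSys 1 0 ∅)) (h₅ : Carries g (linSys 0 1 ∅) (linSys 0 1 ∅))
    (h₁ : Carries g (linSys 1 1 {ptP, ptPbar}) (linSys 1 1 {ptP, ptPbar}))
    (h₂ : Carries g (linSys 1 1 {ptP, ptQ μ}) (linSys 1 1 {ptP, ptQ μ})) : g = 1 := by
  have hR0 := RC_ne_zero
  have hμ0 := ne_zero_of_norm hμ
  rw [linSys_f] at h₄
  rw [linSys_fbar] at h₅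
  rw [linSys_p_pbar] at h₁
  rw [linSys_p_q] at h₂
  obtain ⟨l, α, β, γ, δ, hl, hdet, hR, hS⟩ := h₄.exists_coeffs fun a b hab => by
    have := biquadratic_eq_zero (a₀ := a) (a₁ := 0) (a₂ := 0) (b₀ := b) (b₁ := 0) (b₂ := 0)
      (c₀ := 0) (c₁ := 0) (c₂ := 0) (by
        apply mul_right_cancel₀ hR0
        simp only [const_zero]
        linear_combination hab + const b * sC_mul_RC)
    exact ⟨this.1.1, this.2.1.1⟩
  obtain ⟨l', α', β', γ', δ', hl', hdet', hR', hV⟩ := h₅.exists_coeffs fun a b hab => by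
    have := biquadratic_eq_zero (a₀ := a) (a₁ := b) (a₂ := 0) (b₀ := 0) (b₁ := 0) (b₂ := 0)
      (c₀ := 0) (c₁ := 0) (c₂ := 0) (by
        apply mul_right_cancel₀ hR0
        simp only [const_zero]
        linear_combination hab + const b * vC_mul_RC)
    exact ⟨this.1.1, this.1.2.1⟩
  have hs := sC_mul_RC
  have hv := vC_mul_RC
  obtain ⟨k, p, q, p', q', hk, hdetp, hRR, hSV⟩ := h₁.exists_coeffs fun a b hab => by
    have := biquadratic_eq_zero (a₀ := a) (a₁ := 0) (a₂ := 0) (b₀ := 0) (b₁ := b) (b₂ := 0)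
      (c₀ := 0) (c₁ := 0) (c₂ := 0) (by
        apply mul_right_cancel₀ (pow_ne_zero 2 hR0)
        rw [← hs, ← hv] at hab
        simp only [const_zero]
        linear_combination hab)
    exact ⟨this.1.1, this.2.1.2.1⟩
  obtain ⟨k', e, f, e', f', hk', hdete, hP, hQ⟩ := h₂.exists_coeffs fun a b hab => by
    have := biquadratic_eq_zero (a₀ := a) (a₁ := 0) (a₂ := 0) (b₀ := -a - μ * b) (b₁ := b) (b₂ := 0)
      (c₀ := 0) (c₁ := 0) (c₂ := 0) (by
        apply mul_right_cancel₀ (pow_ne_zero 2 hR0)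
        rw [← hs, ← hv] at hab
        simp only [const_zero, const_sub, const_neg, const_mul]
        linear_combination hab)
    exact ⟨this.1.1, this.2.1.2.1⟩
  have hgR0 := baseChange_ne_zero g hR0
  have hgs := congrArg (baseChange g) hs
  have hgv := congrArg (baseChange g) hv
  rw [map_mul] at hgs hgv
  have m1 : baseChange g sC * (const α + const β * sC) = const γ + const δ * sC := by
    apply mul_right_cancel₀ (mul_ne_zero hl hR0)
    rw [← hs] at hR hS
    rw [map_mul] at hS
    linear_combination -baseChange g sC * hR + hS
  have m2 : baseChange g vC * (const α' + const β' * vC) = const γ' + const δ' * vC := by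
    apply mul_right_cancel₀ (mul_ne_zero hl' hR0)
    rw [← hv] at hR' hV
    rw [map_mul] at hV
    linear_combination -baseChange g vC * hR' + hV
  have m3 : baseChange g sC * baseChange g vC * (const p + const q * (sC * vC)) =
      const p' + const q' * (sC * vC) := by
    apply mul_right_cancel₀ (mul_ne_zero hk (pow_ne_zero 2 hR0))
    simp only [map_pow, map_mul] at hRR hSV
    rw [← hs, ← hv, map_mul, map_mul] at hSV
    rw [← hs, ← hv] at hRR
    linear_combination -baseChange g sC * baseChange g vC * hRR + hSV
  have m4 : baseChange g sC * (baseChange g vC - const μ) *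
      (const e * (1 - sC) + const f * (sC * (vC - const μ))) =
      (1 - baseChange g sC) * (const e' * (1 - sC) + const f' * (sC * (vC - const μ))) := by
    apply mul_right_cancel₀ (mul_ne_zero hk' (pow_ne_zero 2 hR0))
    simp only [map_sub, map_mul, baseChange_const] at hP hQ
    rw [← hgs] at hP hQ
    rw [← hgv] at hQ
    rw [← hs, ← hv] at hP hQ
    linear_combination -baseChange g sC * (baseChange g vC - const μ) * hP +
      (1 - baseChange g sC) * hQ
  -- The pencil through p and p̄ is given by the function sv (in affine coordinates), so the product
  -- of the two fractional linear maps is a fractional linear function of sv. Comparing coefficients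
  -- gives the vanishing of the mixed products `z1` to `z4`.
  have m5 : (const γ + const δ * sC) * (const γ' + const δ' * vC) *
      (const p + const q * (sC * vC)) = (const p' + const q' * (sC * vC)) *
      ((const α + const β * sC) * (const α' + const β' * vC)) := by
    rw [← m1, ← m2, ← m3]; ring
  have n1 := biquadratic_eq_zero (a₀ := γ * γ' * p - p' * α * α') (a₁ := γ * δ' * p - p' * α * β')
    (a₂ := 0) (b₀ := δ * γ' * p - p' * β * α')
    (b₁ := δ * δ' * p + γ * γ' * q - p' * β * β' - q' * α * α') (b₂ := γ * δ' * q - q' * α * β')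
    (c₀ := 0) (c₁ := δ * γ' * q - q' * β * α') (c₂ := δ * δ' * q - q' * β * β') (by
      simp only [const_sub, const_add, const_mul, const_zero]
      linear_combination m5)
  have hone : 1 + sC * vC ≠ 0 := by
    intro h
    have := biquadratic_eq_zero (a₀ := 1) (a₁ := 0) (a₂ := 0) (b₀ := 0) (b₁ := 1) (b₂ := 0)
      (c₀ := 0) (c₁ := 0) (c₂ := 0) (by
        simp only [const_zero, const_one]
        linear_combination h)
    exact one_ne_zero this.1.1
  obtain ⟨⟨-, n2, -⟩, ⟨n3, -, n4⟩, ⟨-, n5, -⟩⟩ := n1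
  have z1 : γ * δ' = 0 := (mul_eq_zero.1 (by linear_combination q' * n2 - p' * n4 :
    γ * δ' * (p * q' - q * p') = 0)).resolve_right hdetp
  have z2 : α * β' = 0 := (mul_eq_zero.1 (by linear_combination q * n2 - p * n4 :
    α * β' * (p * q' - q * p') = 0)).resolve_right hdetp
  have z3 : δ * γ' = 0 := (mul_eq_zero.1 (by linear_combination q' * n3 - p' * n5 :
    δ * γ' * (p * q' - q * p') = 0)).resolve_right hdetp
  have z4 : β * α' = 0 := (mul_eq_zero.1 (by linear_combination q * n3 - p * n5 :
    β * α' * (p * q' - q * p') = 0)).resolve_right hdetp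
  by_cases hδ : δ = 0
  -- Here s ↦ k₁/s and v ↦ k₂/v, which exchanges p and p̄; the pencil through p and q does not allow
  -- this.
  · exfalso
    have hβγ : β * γ ≠ 0 := fun h => hdet (by rw [hδ, h]; ring)
    have hβ := left_ne_zero_of_mul hβγ
    have hγ := right_ne_zero_of_mul hβγ
    have hδ' := (mul_eq_zero.1 z1).resolve_left hγ
    have hα' := (mul_eq_zero.1 z4).resolve_left hβ
    have hβγ' : β' * γ' ≠ 0 := fun h => hdet' (by rw [hδ', h]; ring)
    have hβ' := left_ne_zero_of_mul hβγ'
    have hα := (mul_eq_zero.1 z2).resolve_right hβ'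
    obtain ⟨k₁, rfl⟩ : ∃ k₁, γ = k₁ * β := ⟨γ / β, (div_mul_cancel₀ _ hβ).symm⟩
    obtain ⟨k₂, rfl⟩ : ∃ k₂, γ' = k₂ * β' := ⟨γ' / β', (div_mul_cancel₀ _ hβ').symm⟩
    have r1 : baseChange g sC * sC = const k₁ := by
      apply mul_left_cancel₀ (const_ne_zero hβ)
      rw [hα, hδ, const_mul, const_zero] at m1
      linear_combination m1
    have r2 : baseChange g vC * vC = const k₂ := by
      apply mul_left_cancel₀ (const_ne_zero hβ')
      rw [hα', hδ', const_mul, const_zero] at m2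
      linear_combination m2
    have n6 := biquadratic_eq_zero (a₀ := k₁ * k₂ * e) (a₁ := -k₁ * μ * e + k₁ * e') (a₂ := 0)
      (b₀ := k₁ * k₂ * (-e - μ * f))
      (b₁ := k₁ * k₂ * f + k₁ * μ * e + k₁ * μ ^ 2 * f - e' - k₁ * e' - k₁ * f' * μ)
      (b₂ := -k₁ * μ * f + k₁ * f') (c₀ := 0) (c₁ := e' + f' * μ) (c₂ := -f') (by
        simp only [const_sub, const_add, const_mul, const_zero, const_neg, const_pow]
        rw [← r1, ← r2]
        linear_combination sC * vC * m4)
    have hk₁ : k₁ ≠ 0 := left_ne_zero_of_mul hγ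
    have hk₂ : k₂ ≠ 0 := left_ne_zero_of_mul (right_ne_zero_of_mul hβγ')
    have he : e = 0 := (mul_eq_zero.1 n6.1.1).resolve_left (mul_ne_zero hk₁ hk₂)
    have he' : e' = 0 := by
      have := n6.1.2.1
      rw [he, mul_zero, zero_add] at this
      exact (mul_eq_zero.1 this).resolve_left hk₁
    exact hdete (by rw [he, he']; ring)
  -- Here s and v are scaled by k₁ and k₂, and the pencil through p and q forces both factors to be
  -- one.
  · have hγ' := (mul_eq_zero.1 z3).resolve_left hδ
    have hαδ' : α' * δ' ≠ 0 := fun h => hdet' (by rw [hγ', h]; ring)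
    have hα' := left_ne_zero_of_mul hαδ'
    have hδ' := right_ne_zero_of_mul hαδ'
    have hγ := (mul_eq_zero.1 z1).resolve_right hδ'
    have hβ := (mul_eq_zero.1 z4).resolve_right hα'
    have hα : α ≠ 0 := fun h => hdet (by rw [h, hγ]; ring)
    have hβ' := (mul_eq_zero.1 z2).resolve_left hα
    obtain ⟨k₁, rfl⟩ : ∃ k₁, δ = k₁ * α := ⟨δ / α, (div_mul_cancel₀ _ hα).symm⟩
    obtain ⟨k₂, rfl⟩ : ∃ k₂, δ' = k₂ * α' := ⟨δ' / α', (div_mul_cancel₀ _ hα').symm⟩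
    have r1 : baseChange g sC = const k₁ * sC := by
      apply mul_left_cancel₀ (const_ne_zero hα)
      rw [hβ, hγ, const_mul, const_zero] at m1
      linear_combination m1
    have r2 : baseChange g vC = const k₂ * vC := by
      apply mul_left_cancel₀ (const_ne_zero hα')
      rw [hβ', hγ', const_mul, const_zero] at m2
      linear_combination m2
    have n6 := biquadratic_eq_zero (a₀ := -e') (a₁ := 0) (a₂ := 0)
      (b₀ := -k₁ * μ * e + e' + f' * μ + k₁ * e') (b₁ := k₁ * k₂ * e - f') (b₂ := 0)
      (c₀ := k₁ * μ * e + k₁ * μ ^ 2 * f - k₁ * e' - k₁ * μ * f')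
      (c₁ := -k₁ * k₂ * e - k₁ * k₂ * μ * f - k₁ * μ * f + k₁ * f') (c₂ := k₁ * k₂ * f) (by
        simp only [const_sub, const_add, const_mul, const_zero, const_neg, const_pow]
        rw [r1, r2] at m4
        linear_combination m4)
    have hk₁ : k₁ ≠ 0 := left_ne_zero_of_mul hδ
    have hk₂ : k₂ ≠ 0 := left_ne_zero_of_mul hδ'
    have he' : e' = 0 := neg_eq_zero.1 n6.1.1
    have hf : f = 0 := (mul_eq_zero.1 n6.2.2.2.2).resolve_left (mul_ne_zero hk₁ hk₂)
    have hef : e * f' ≠ 0 := fun h => hdete (by rw [hf, h]; ring)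
    have he := left_ne_zero_of_mul hef
    have e1 : f' = k₁ * e := mul_left_cancel₀ hμ0 (by
      have := n6.2.1.1
      rw [he'] at this
      linear_combination this)
    have e2 : k₂ = 1 := mul_left_cancel₀ (mul_ne_zero hk₁ he) (by
      linear_combination n6.2.1.2.1 + e1)
    have e3 : k₁ = 1 := by
      have := n6.2.2.1
      rw [he', hf, e1] at this
      apply mul_left_cancel₀ (mul_ne_zero (mul_ne_zero hk₁ hμ0) he)
      linear_combination -this
    rw [e3, const_one, one_mul] at r1
    rw [e2, const_one, one_mul] at r2
    -- The function r is recovered from the two affine coordinates, so it is fixed too.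
    have hRsv : RC * (1 + sC * vC) = 2 := by
      apply mul_right_cancel₀ hR0
      have h := SC_mul_VC
      rw [← hs, ← hv] at h
      linear_combination h
    have hgR : baseChange g RC = RC := by
      apply mul_right_cancel₀ hone
      have h := congrArg (baseChange g) hRsv
      rw [map_mul, map_add, map_mul, map_one, map_ofNat, r1, r2] at h
      rw [h, hRsv]
    refine bir_ext ?_ ?_
    · rw [baseChange_one]
      apply mul_left_cancel₀ const_I_ne_zero
      rw [← baseChange_const g Complex.I, ← map_mul, baseChange_const, ← SC_eq, ← hgs, r1, hgR, hs]
    · rw [baseChange_one]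
      rw [RC, map_add, map_one] at hgR
      exact add_left_cancel hgR

end

section
variable {μ : ℂ}

theorem IsG₁'.ne_one (hμ : ‖μ‖ = 1) {g : Bir} (hg : IsG₁' μ g) : g ≠ 1 := by
  rintro rfl
  obtain ⟨-, h⟩ := (isG₁'_iff hμ).1 hg
  rw [baseChange_one] at h
  have h2 : aC μ + bC μ = 0 := mul_left_cancel₀ SC_ne_zero (by linear_combination h)
  have h3 := two_mul_uC (μ := μ)
  rw [AC_eq, BC_eq, ← mul_add, h2, mul_zero] at h3
  exact mul_ne_zero two_ne_zero uC_ne_zero h3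

theorem IsG₁'.orderOf (hμ : ‖μ‖ = 1) {g : Bir} (hg : IsG₁' μ g) : orderOf g = 2 :=
  orderOf_eq_prime (by rw [pow_two]; exact hg.mul_self hμ) (hg.ne_one hμ)

/-- The product of the two maps preserves the members of the conic bundles, hence is the identity.
-/
theorem IsDelPezzoG₁.eq (hμ : ‖μ‖ = 1) {g g₁ : Bir}
    (hg : IsDelPezzoG₁ μ g) (hg₁ : IsDelPezzoG₁ μ g₁) (h : g₁ * g₁ = 1) : g = g₁ := by
  have h1 := hg.2.mul hg₁.2
  have h2 : g * g₁ = 1 := eq_one_of_carries hμ (h1 3 0) (h1 4 0) (h1 0 0) (h1 1 0)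
  rw [eq_inv_of_mul_eq_one_left h2, inv_eq_of_mul_eq_one_left h]

/-- Existence for g₂ comes from conjugating g₁ by c. For uniqueness, an automorphism that acts like
g₂ is conjugated back by c into one that acts like g₁. -/
theorem exists_automorphisms (hμ : ‖μ‖ = 1) (h1 : μ ≠ 1) (hm1 : μ ≠ -1) :
    ∃ g₁ g₂ : Bir,
      (∀ g : Bir, IsDelPezzoG₁ μ g ↔ g = g₁) ∧
      (∀ g : Bir, IsDelPezzoG₂ μ g ↔ g = g₂) ∧
      (∀ g : Bir, IsG₁' μ g ↔ g = g₁) ∧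
      (∀ g : Bir, IsG₂' μ g ↔ g = g₂) ∧
      orderOf g₁ = 2 ∧ orderOf g₂ = 2 ∧
      g₁ ∈ autRealOverPi ∧
      g₂ ∈ autRealPi ∧ g₂ ∉ autRealOverPi ∧
      ∃ c ∈ autReal, IsDelPezzoAut μ c ∧
        Carries c (conicBundle μ 0 0) (conicBundle μ 0 1) ∧
        Carries c (conicBundle μ 0 1) (conicBundle μ 0 0) ∧
        c * g₁ * c⁻¹ = g₂ := by
  obtain ⟨g₁, hg₁, h⟩ := exists_isG₁' hμ h1
  obtain ⟨c, hc, hcc, hlin⟩ := exists_isLinearInvolution hμ h1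
  have h₂ := isG₂'_conj hμ h1 hcc hlin h
  obtain ⟨hcd, hca⟩ := hlin.actsOnBundles hμ h1 hm1 hcc
  have hdp := h.isDelPezzoG₁ hμ h1 hm1
  have hinv : c⁻¹ = c := inv_eq_of_mul_eq_one_left hcc
  have hz : (c * g₁ * c⁻¹) zS = -zS := by
    apply incl_injective
    rw [← baseChange_incl, map_neg, ← zC_eq]
    exact h₂.2
  have hdp₂ : IsDelPezzoG₂ μ (c * g₁ * c⁻¹) := by
    refine ⟨by rw [hinv]; exact (hcd.mul hdp.1).mul hcd, ?_⟩
    have := (hca.mul hdp.2).mul hca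
    rw [hinv]
    convert this using 1
    -- Only the bookkeeping of the permutation of the pairs and of the order exchanges is left.
    decide
  refine ⟨g₁, c * g₁ * c⁻¹, fun g => ⟨fun hg => hg.eq hμ hdp (h.mul_self hμ), ?_⟩,
    fun g => ⟨fun hg => ?_, ?_⟩, fun g => ⟨fun hg => hg.unique hμ h, ?_⟩,
    fun g => ⟨fun hg => hg.unique hμ h₂, ?_⟩, h.orderOf hμ, ?_, hg₁, ⟨?_, ?_⟩, ?_,
    c, hc, hcd, hca 0 0, hca 0 1, rfl⟩
  · rintro rfl; exact hdp
  · have : IsDelPezzoG₁ μ (c * g * c⁻¹) := by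
      refine ⟨by rw [hinv]; exact (hcd.mul hg.1).mul hcd, ?_⟩
      have := (hca.mul hg.2).mul hca
      rw [hinv]
      convert this using 1
      decide
    have h3 := this.eq hμ hdp (h.mul_self hμ)
    rw [← h3, hinv]
    simp only [mul_assoc]
    rw [hcc, mul_one, ← mul_assoc, hcc, one_mul]
  · rintro rfl; exact hdp₂
  · rintro rfl; exact h
  · rintro rfl; exact h₂
  · refine orderOf_eq_prime ?_ ?_
    · rw [pow_two]
      have := h.mul_self hμ
      simp only [mul_assoc]
      rw [inv_mul_cancel_left, ← mul_assoc g₁, this, one_mul, mul_inv_cancel]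
    · intro h3
      refine h.ne_one hμ ?_
      rw [mul_inv_eq_one] at h3
      exact mul_eq_left.1 h3
  · exact mul_mem (mul_mem hc hg₁.1.1) (inv_mem hc)
  · exact ⟨-1, 0, 0, 1, by norm_num, by rw [hz]; simp⟩
  · rintro ⟨-, h3⟩
    have h4 : zS = 0 := by
      have : (2 : FunField) * zS = 0 := by linear_combination hz - h3
      exact (mul_eq_zero.1 this).resolve_left two_ne_zero
    refine zC_ne_const 0 ?_
    rw [zC_eq, h4, map_zero, const_zero]

end

/-! ### The action on the base of the fibration -/

theorem HasValue.toFun (p : Fin 3 → ℝ) (F : MvPolynomial (Fin 3) ℝ) :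
    HasValue p (toFun F) (eval p F) := ⟨F, 1, by simp, by simp, by simp⟩

theorem toFun_linear (a b : ℝ) : toFun (C a * X 2 + C b) =
    algebraMap ℝ FunField a * zS + algebraMap ℝ FunField b := by
  rw [map_add, map_mul, toFun_C, toFun_C, zS]

theorem third_coord_eq {g : Bir} {a b c d : ℝ}
    (hz : g zS * (algebraMap ℝ FunField c * zS + algebraMap ℝ FunField d) =
      algebraMap ℝ FunField a * zS + algebraMap ℝ FunField b) {p q : Fin 3 → ℝ}
    (hp : p ∈ realPoints)
    (h : ∀ F : MvPolynomial (Fin 3) ℝ, HasValue p (g (SphereBir.toFun F)) (eval q F)) :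
    q 2 * (c * p 2 + d) = a * p 2 + b := by
  have h1 := (h (X 2)).mul (HasValue.toFun p (C c * X 2 + C d))
  have h2 := HasValue.toFun p (C a * X 2 + C b)
  rw [toFun_linear] at h1 h2
  change HasValue p (g zS * _) _ at h1
  rw [hz] at h1
  simpa using h1.unique hp h2

/-- The image of an interior value under the action on the base is an interior value. -/
theorem base_interior {g : Bir} (hg : g ∈ autReal) {a b c d : ℝ} (hdet : a * d - b * c ≠ 0)
    (hz : g zS * (algebraMap ℝ FunField c * zS + algebraMap ℝ FunField d) =
      algebraMap ℝ FunField a * zS + algebraMap ℝ FunField b) {r : ℝ} (hr : |r| < 1) :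
    ∃ s, |s| < 1 ∧ s * (c * r + d) = a * r + b := by
  have hr' := abs_lt.1 hr
  -- Two distinct real points of the fibre over r. If the image height were not interior, both would
  -- be mapped to the same pole, against injectivity on real points.
  have hp : ∀ e : ℝ, e ^ 2 = 1 → ![e * √(1 - r ^ 2), 0, r] ∈ realPoints := fun e he => by
    have h0 : 0 ≤ 1 - r ^ 2 := by nlinarith
    change (e * √(1 - r ^ 2)) ^ 2 + 0 ^ 2 + r ^ 2 = 1
    rw [mul_pow, he, Real.sq_sqrt h0]; ring
  obtain ⟨q, hq, h⟩ := hg.1.exists_image (hp 1 (by norm_num))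
  obtain ⟨q', hq', h'⟩ := hg.1.exists_image (hp (-1) (by norm_num))
  have e := third_coord_eq hz (hp 1 (by norm_num)) h
  have e' := third_coord_eq hz (hp (-1) (by norm_num)) h'
  simp only [Matrix.cons_val] at e e'
  refine ⟨q 2, ?_, e⟩
  have hq1 : q 0 ^ 2 + q 1 ^ 2 + q 2 ^ 2 = 1 := hq
  have hq1' : q' 0 ^ 2 + q' 1 ^ 2 + q' 2 ^ 2 = 1 := hq'
  have hden : c * r + d ≠ 0 := fun h0 => by
    rw [h0, mul_zero] at e
    rcases eq_or_ne c 0 with hc | hc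
    · rw [hc] at h0
      exact hdet (by rw [hc]; linear_combination a * h0)
    · apply hdet
      have : c * (a * d - b * c) = 0 := by linear_combination a * c * h0 + c ^ 2 * e
      exact (mul_eq_zero.1 this).resolve_left hc
  have e2 : q 2 = q' 2 := mul_right_cancel₀ hden (e.trans e'.symm)
  rw [← sq_lt_one_iff_abs_lt_one]
  by_contra! hlt
  have h0 : q 0 = 0 := by nlinarith [sq_nonneg (q 0), sq_nonneg (q 1)]
  have h1 : q 1 = 0 := by nlinarith [sq_nonneg (q 0), sq_nonneg (q 1)]
  rw [e2] at hlt
  have h0' : q' 0 = 0 := by nlinarith [sq_nonneg (q' 0), sq_nonneg (q' 1)]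
  have h1' : q' 1 = 0 := by nlinarith [sq_nonneg (q' 0), sq_nonneg (q' 1)]
  have hqq : q = q' := by
    funext i
    fin_cases i
    · exact h0.trans h0'.symm
    · exact h1.trans h1'.symm
    · exact e2
  rw [← hqq] at h'
  have h2 := congrFun (HasValue.point_unique hg (hp 1 (by norm_num)) (hp (-1) (by norm_num)) hq h h') 0
  simp only [Matrix.cons_val] at h2
  have h3 : √(1 - r ^ 2) = 0 := by linarith
  rw [Real.sqrt_eq_zero (by nlinarith)] at h3
  nlinarith

/-- A homography that maps the open interval into itself, as its inverse does, is a composition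
of a translation of the hyperbolic line with at most a reflection. -/
theorem homography_of_interior {a b c d : ℝ} (hdet : a * d - b * c ≠ 0)
    (h : ∀ r : ℝ, |r| < 1 → ∃ s, |s| < 1 ∧ s * (c * r + d) = a * r + b)
    (h' : ∀ r : ℝ, |r| < 1 → ∃ s, |s| < 1 ∧ s * (-c * r + a) = d * r - b) :
    d ≠ 0 ∧ |c / d| < 1 ∧ ((a = d ∧ b = c) ∨ (a = -d ∧ b = -c)) := by
  have hf : ∀ r ∈ Set.Ioo (-1 : ℝ) 1, (a * r + b) ^ 2 ≤ (c * r + d) ^ 2 := fun r hr => by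
    obtain ⟨s, hs, e⟩ := h r (abs_lt.2 hr)
    rw [← e, mul_pow]
    exact mul_le_of_le_one_left (sq_nonneg _) ((sq_lt_one_iff_abs_lt_one s).2 hs).le
  -- The weak inequality passes to the end points by continuity.
  have hcl : Set.Icc (-1 : ℝ) 1 ⊆ {r | (a * r + b) ^ 2 ≤ (c * r + d) ^ 2} := by
    rw [← closure_Ioo (by norm_num)]
    exact (isClosed_le (by fun_prop) (by fun_prop)).closure_subset_iff.2 hf
  have h1 : (a * 1 + b) ^ 2 ≤ (c * 1 + d) ^ 2 := hcl (by norm_num)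
  have h2 : (a * -1 + b) ^ 2 ≤ (c * -1 + d) ^ 2 := hcl (by norm_num)
  -- If an end point e had an interior image, the inverse homography would send that interior value
  -- to e, which is not interior. So end points go to end points.
  have hlt : ∀ e : ℝ, e ^ 2 = 1 → (c * e + d) ^ 2 ≤ (a * e + b) ^ 2 := fun e he => by
    by_contra! hlt
    have hw : c * e + d ≠ 0 := fun h0 => by
      rw [h0] at hlt; nlinarith [sq_nonneg (a * e + b)]
    obtain ⟨s, hs, hs'⟩ := h' ((a * e + b) / (c * e + d)) (by
      rw [← sq_lt_one_iff_abs_lt_one, div_pow, div_lt_one (by positivity)]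
      exact hlt)
    have h3 : s = e := by
      have h4 : s * (-c * (a * e + b) + a * (c * e + d)) = d * (a * e + b) - b * (c * e + d) := by
        field_simp at hs'
        linear_combination hs'
      apply mul_right_cancel₀ hdet
      linear_combination h4
    rw [h3, ← sq_lt_one_iff_abs_lt_one, he] at hs
    exact lt_irrefl _ hs
  have h3 := hlt 1 (by norm_num)
  have h4 := hlt (-1) (by norm_num)
  obtain ⟨s, hs, e⟩ := h 0 (by simp)
  have hd : d ≠ 0 := by
    rintro rfl
    exact hdet (by linear_combination c * e)
  have hbd : |b| < |d| := by
    have : b = s * d := by linear_combination -e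
    rw [this, abs_mul]
    exact mul_lt_of_lt_one_left (abs_pos.2 hd) hs
  have hab : (a = d ∧ b = c) ∨ (a = -d ∧ b = -c) := by
    have e1 : (a + b) ^ 2 = (c + d) ^ 2 := by linarith
    have e2 : (a - b) ^ 2 = (d - c) ^ 2 := by linarith
    rcases sq_eq_sq_iff_eq_or_eq_neg.1 e1 with e1 | e1 <;>
      rcases sq_eq_sq_iff_eq_or_eq_neg.1 e2 with e2 | e2
    · left; constructor <;> linarith
    · exfalso; apply hdet
      have ha : a = c := by linarith
      have hb : b = d := by linarith
      rw [ha, hb]; ring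
    · exfalso; apply hdet
      have ha : a = -c := by linarith
      have hb : b = -d := by linarith
      rw [ha, hb]; ring
    · right; constructor <;> linarith
  refine ⟨hd, ?_, hab⟩
  rw [abs_div, div_lt_one (abs_pos.2 hd)]
  rcases hab with ⟨-, rfl⟩ | ⟨-, rfl⟩
  · exact hbd
  · rwa [abs_neg] at hbd

/-- The real fibres with two or more real points lie over (-1, 1), so the base action preserves this
interval and its end points; only hyperbolic translations and their compositions with a reflection
do so. -/
theorem exists_base_action {g : Bir} (hg : g ∈ autRealPi) :
    ∃ e r : ℝ, e ^ 2 = 1 ∧ |r| < 1 ∧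
      baseChange g zC * (1 + const r * zC) = const e * (zC + const r) := by
  obtain ⟨hgR, a, b, c, d, hdet, hz⟩ := hg
  have hz' : g⁻¹ zS * (algebraMap ℝ FunField (-c) * zS + algebraMap ℝ FunField a) =
      algebraMap ℝ FunField d * zS + algebraMap ℝ FunField (-b) := by
    have h1 := congrArg (g⁻¹ : Bir) hz
    have h2 : (g⁻¹ : Bir) (g zS) = zS := by
      rw [← AlgEquiv.mul_apply, inv_mul_cancel, AlgEquiv.one_apply]
    simp only [map_mul, map_add, AlgEquiv.commutes, h2] at h1
    simp only [map_neg]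
    linear_combination -h1
  obtain ⟨hd, hr, hab⟩ := homography_of_interior hdet (fun r hr => base_interior hgR hdet hz hr)
    (fun r hr => by
      obtain ⟨s, hs, e⟩ := base_interior (inv_mem hgR)
        (by intro h; exact hdet (by linear_combination h)) hz' hr
      exact ⟨s, hs, by rw [e]; ring⟩)
  have hz2 := congrArg incl hz
  have hc : ∀ x : ℝ, incl (algebraMap ℝ FunField x) = const x := incl_algebraMap
  simp only [map_mul, map_add, hc, ← baseChange_incl, ← zC_eq] at hz2
  have hcd : const (c / d : ℝ) * const d = const c := by
    rw [← const_mul, ← Complex.ofReal_mul, div_mul_cancel₀ _ hd]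
  have hd0 : const d ≠ 0 := const_ne_zero (by exact_mod_cast hd)
  rcases hab with ⟨rfl, rfl⟩ | ⟨rfl, rfl⟩
  · refine ⟨1, b / a, by norm_num, hr, mul_right_cancel₀ hd0 ?_⟩
    rw [Complex.ofReal_one, const_one]
    linear_combination hz2 + (baseChange g zC * zC - 1) * hcd
  · refine ⟨-1, c / d, by norm_num, hr, mul_right_cancel₀ hd0 ?_⟩
    rw [Complex.ofReal_neg, Complex.ofReal_one, const_neg, const_one]
    rw [Complex.ofReal_neg, Complex.ofReal_neg, const_neg, const_neg] at hz2
    linear_combination hz2 + (baseChange g zC * zC + 1) * hcd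

theorem baseChange_mem_of_zC {g : Bir} (h : baseChange g zC ∈ ZField) {w : CFunField}
    (hw : w ∈ ZField) : baseChange g w ∈ ZField := by
  induction hw using IntermediateField.adjoin_induction with
  | mem x hx => rwa [Set.mem_singleton_iff.1 hx]
  | algebraMap x =>
    change baseChange g (const x) ∈ ZField
    rw [baseChange_const]; exact const_mem _ x
  | add x y _ _ hx hy => rw [map_add]; exact ZField.add_mem hx hy
  | inv x _ hx => rw [map_inv₀]; exact ZField.inv_mem hx
  | mul x y _ _ hx hy => rw [map_mul]; exact ZField.mul_mem hx hy

open IntermediateField in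
-- The preimage under g of the field ℂ(z, g(t)) contains t and z, hence is everything, and g is
-- surjective.
theorem adjoin_baseChange_tC {g : Bir} (h : baseChange g zC ∈ ZField) :
    ZField⟮baseChange g tC⟯ = ⊤ := by
  set F : IntermediateField ℂ CFunField := (ZField⟮baseChange g tC⟯).restrictScalars ℂ with hF
  have hz : ∀ w ∈ ZField, w ∈ F := fun w hw => (ZField⟮baseChange g tC⟯).algebraMap_mem ⟨w, hw⟩
  have h1 : F.comap (baseChange g) = ⊤ := intermediateField_eq_top
    (IntermediateField.mem_adjoin_simple_self ZField (baseChange g tC)) (hz _ h)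
  rw [eq_top_iff]
  intro w _
  have h2 : baseChange g⁻¹ w ∈ F.comap (baseChange g) := by rw [h1]; trivial
  have h3 : baseChange g (baseChange g⁻¹ w) ∈ F := h2
  rw [baseChange_apply_inv] at h3
  exact h3

/-- A birational map that preserves the fibration acts on `t` by a fractional linear
transformation over the base. -/
theorem exists_moebius {g : Bir} (h : baseChange g zC ∈ ZField) :
    ∃ a ∈ ZField, ∃ b ∈ ZField, ∃ c ∈ ZField, ∃ d ∈ ZField, a * d - b * c ≠ 0 ∧
      baseChange g tC * (c * tC + d) = a * tC + b := by
  obtain ⟨a, b, c, d, hdet, e⟩ :=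
    exists_moebius_of_adjoin_eq_top transcendental_tC adjoin_tC (adjoin_baseChange_tC h)
  exact ⟨a, a.2, b, b.2, c, c.2, d, d.2, fun h => hdet (Subtype.ext h), e⟩

theorem baseChange_zC_mem {g : Bir} {e r : ℝ}
    (h : baseChange g zC * (1 + const r * zC) = const e * (zC + const r)) :
    baseChange g zC ∈ ZField := by
  have h0 : 1 + const r * zC ≠ 0 := by
    intro h0
    have := aeval_zC_ne_zero (p := 1 + Polynomial.C (r : ℂ) * Polynomial.X) (by
      intro h1
      simpa using congrArg (Polynomial.eval 0) h1)
    apply this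
    rw [← h0]
    simp [Polynomial.aeval_C, const]
  rw [eq_div_of_mul_eq h0 h]
  have hr := const_mem ZField (r : ℂ)
  exact ZField.div_mem (ZField.mul_mem (const_mem _ _) (ZField.add_mem zC_mem hr))
    (ZField.add_mem ZField.one_mem (ZField.mul_mem hr zC_mem))

/-- If the conjugation of a fractional linear transformation gives another one, then the matrices
are conjugate up to a factor. -/
theorem exists_matrix_eq {p q r s p' q' r' s' a b c d a' b' c' d' f : CFunField}
    (hp : p ∈ ZField) (hq : q ∈ ZField) (hr : r ∈ ZField) (hs : s ∈ ZField)
    (hp' : p' ∈ ZField) (hq' : q' ∈ ZField) (hr' : r' ∈ ZField) (hs' : s' ∈ ZField)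
    (ha : a ∈ ZField) (hb : b ∈ ZField) (hc : c ∈ ZField) (hd : d ∈ ZField)
    (ha' : a' ∈ ZField) (hb' : b' ∈ ZField) (hc' : c' ∈ ZField) (hd' : d' ∈ ZField)
    (hH : p * s - q * r ≠ 0) (hM : a * d - b * c ≠ 0)
    (h1 : f * (c * (p * tC + q) + d * (r * tC + s)) = a * (p * tC + q) + b * (r * tC + s))
    (h2 : f * (r' * (a' * tC + b') + s' * (c' * tC + d')) =
      p' * (a' * tC + b') + q' * (c' * tC + d')) :
    ∃ k ∈ ZField, p' * a' + q' * c' = k * (a * p + b * r) ∧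
      p' * b' + q' * d' = k * (a * q + b * s) ∧ r' * a' + s' * c' = k * (c * p + d * r) ∧
      r' * b' + s' * d' = k * (c * q + d * s) := by
  lift p to ZField using hp
  lift q to ZField using hq
  lift r to ZField using hr
  lift s to ZField using hs
  lift p' to ZField using hp'
  lift q' to ZField using hq'
  lift r' to ZField using hr'
  lift s' to ZField using hs'
  lift a to ZField using ha
  lift b to ZField using hb
  lift c to ZField using hc
  lift d to ZField using hd
  lift a' to ZField using ha'
  lift b' to ZField using hb'
  lift c' to ZField using hc'
  lift d' to ZField using hd'
  obtain ⟨k, e1, e2, e3, e4⟩ := moebius_proportional transcendental_tC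
    (a := a * p + b * r) (b := a * q + b * s) (c := c * p + d * r) (d := c * q + d * s)
    (a' := p' * a' + q' * c') (b' := p' * b' + q' * d') (c' := r' * a' + s' * c')
    (d' := r' * b' + s' * d') (by
      have : (a * p + b * r) * (c * q + d * s) - (a * q + b * s) * (c * p + d * r) =
        (a * d - b * c) * (p * s - q * r) := by ring
      rw [this]
      refine mul_ne_zero (fun h => hM ?_) (fun h => hH ?_)
      · exact congrArg Subtype.val h
      · exact congrArg Subtype.val h) (by
      simp only [map_add, map_mul, IntermediateField.algebraMap_apply]
      linear_combination (-(↑r' * (↑a' * tC + ↑b') + ↑s' * (↑c' * tC + ↑d')) : CFunField) * h1 +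
        ((c : CFunField) * (p * tC + q) + d * (r * tC + s)) * h2)
  exact ⟨k, k.2, congrArg Subtype.val e1, congrArg Subtype.val e2, congrArg Subtype.val e3,
    congrArg Subtype.val e4⟩

/-! ### Conjugacy classes of the explicit involutions -/

section
open Polynomial

/-- The determinants of two conjugate involutions have the same ramification. -/
theorem eq_of_mul_sq_eq {k k' r : ℝ} (h0 : 0 < k') (h4 : k' < 4) {A B : ℂ[X]} (hB : B ≠ 0)
    (h : B ^ 2 * (Polynomial.C 4 - Polynomial.C (k' : ℂ) * (1 - Polynomial.X ^ 2)) *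
      (1 + Polynomial.C (r : ℂ) * Polynomial.X) ^ 2 =
      A ^ 2 * (Polynomial.C 4 * (1 + Polynomial.C (r : ℂ) * Polynomial.X) ^ 2 -
        Polynomial.C (k * (1 - r ^ 2) : ℂ) * (1 - Polynomial.X ^ 2))) : k = k' := by
  have hk0 : (k' : ℂ) ≠ 0 := by exact_mod_cast h0.ne'
  -- The zeros of 4 - k'(1 - z²) are ±iτ; they are distinct because k' < 4.
  obtain ⟨τ, hτ, hτ0⟩ : ∃ τ : ℝ, k' * τ ^ 2 = 4 - k' ∧ τ ≠ 0 := by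
    have h1 : 0 < (4 - k') / k' := div_pos (by linarith) h0
    refine ⟨√((4 - k') / k'), ?_, (Real.sqrt_pos.2 h1).ne'⟩
    rw [Real.sq_sqrt h1.le]; field_simp
  have hτC : (k' : ℂ) * τ ^ 2 = 4 - k' := by exact_mod_cast hτ
  have hτC0 : (τ : ℂ) ≠ 0 := by exact_mod_cast hτ0
  have hI := Complex.I_sq
  set ζ : ℂ := Complex.I * τ with hζ
  have hζ0 : ζ ≠ 0 := mul_ne_zero Complex.I_ne_zero hτC0
  have hN : (Polynomial.C 4 - Polynomial.C (k' : ℂ) * (1 - Polynomial.X ^ 2) : ℂ[X]) =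
      (Polynomial.X - Polynomial.C ζ) * (Polynomial.C (k' : ℂ) * (Polynomial.X + Polynomial.C ζ)) := by
    have h1 : (4 - k' + k' * ζ ^ 2 : ℂ) = 0 := by
      rw [hζ]; linear_combination k' * τ ^ 2 * hI - hτC
    have h2 : Polynomial.C (4 - k' + k' * ζ ^ 2 : ℂ) = 0 := by rw [h1, Polynomial.C_0]
    simp only [Polynomial.C_add, Polynomial.C_sub, Polynomial.C_mul, Polynomial.C_pow] at h2
    linear_combination h2
  set G : ℂ[X] := Polynomial.C 4 * (1 + Polynomial.C (r : ℂ) * Polynomial.X) ^ 2 -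
        Polynomial.C (k * (1 - r ^ 2) : ℂ) * (1 - Polynomial.X ^ 2) with hG
  set L : ℂ[X] := 1 + Polynomial.C (r : ℂ) * Polynomial.X with hL
  have hL0 : L ≠ 0 := fun h1 => by
    simpa [hL] using congrArg (Polynomial.eval 0) h1
  have hQ : (Polynomial.C (k' : ℂ) * (Polynomial.X + Polynomial.C ζ)).eval ζ ≠ 0 := by
    simp only [Polynomial.eval_mul, Polynomial.eval_C, Polynomial.eval_add, Polynomial.eval_X]
    exact mul_ne_zero hk0 (by rw [← two_mul]; exact mul_ne_zero two_ne_zero hζ0)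
  set Q : ℂ[X] := Polynomial.C (k' : ℂ) * (Polynomial.X + Polynomial.C ζ) with hQdef
  have hQ0 : Q ≠ 0 := fun h1 => hQ (by rw [h1]; simp)
  rw [hN] at h
  have hX0 : (Polynomial.X - Polynomial.C ζ : ℂ[X]) ≠ 0 := Polynomial.X_sub_C_ne_zero ζ
  have hne : B ^ 2 * ((Polynomial.X - Polynomial.C ζ) * Q) * L ^ 2 ≠ 0 :=
    mul_ne_zero (mul_ne_zero (pow_ne_zero 2 hB) (mul_ne_zero hX0 hQ0)) (pow_ne_zero 2 hL0)
  have hAG : A ^ 2 * G ≠ 0 := h ▸ hne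
  have hA0 : A ≠ 0 := by rintro rfl; simp at hAG
  have hG0 : G ≠ 0 := right_ne_zero_of_mul hAG
  -- On the left ζ = iτ has odd multiplicity, as it is a simple zero of the middle factor. If G did
  -- not vanish there, the multiplicity on the right would be even.
  have hroot : G.eval ζ = 0 := by
    by_contra hGe
    have h1 := congrArg (Polynomial.rootMultiplicity ζ) h
    have hsq : ∀ {P : ℂ[X]}, P ≠ 0 → (P ^ 2).rootMultiplicity ζ = 2 * P.rootMultiplicity ζ :=
      fun {P} hP => by
        rw [pow_two, Polynomial.rootMultiplicity_mul (mul_ne_zero hP hP), two_mul]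
    rw [Polynomial.rootMultiplicity_mul hne, Polynomial.rootMultiplicity_mul
      (left_ne_zero_of_mul hne), Polynomial.rootMultiplicity_mul (mul_ne_zero hX0 hQ0),
      Polynomial.rootMultiplicity_mul hAG, hsq hA0, hsq hB, hsq hL0,
      Polynomial.rootMultiplicity_X_sub_C_self, Polynomial.rootMultiplicity_eq_zero hQ,
      Polynomial.rootMultiplicity_eq_zero hGe] at h1
    omega
  have h1 : (4 * (1 + r * ζ) ^ 2 - k * (1 - r ^ 2) * (1 - ζ ^ 2) : ℂ) = 0 := by
    rw [← hroot]; simp [hG, hL]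
  -- The imaginary part of the equation at iτ is 8rτ, which forces r = 0; the real part then
  -- compares k with k'.
  have h2 : ((4 * (1 - r ^ 2 * τ ^ 2) - k * (1 - r ^ 2) * (1 + τ ^ 2) : ℝ) : ℂ) +
      ((8 * r * τ : ℝ) : ℂ) * Complex.I = 0 := by
    push_cast
    rw [hζ] at h1
    linear_combination h1 - (4 * r ^ 2 * τ ^ 2 + k * (1 - r ^ 2) * τ ^ 2) * hI
  have h3 := congrArg Complex.re h2
  have h5 := congrArg Complex.im h2
  simp only [Complex.add_re, Complex.add_im, Complex.re_ofReal_mul, Complex.im_ofReal_mul,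
    Complex.ofReal_re, Complex.ofReal_im, Complex.I_re, Complex.I_im, Complex.zero_re,
    Complex.zero_im] at h3 h5
  have hr : r = 0 := by
    have : r * (8 * τ) = 0 := by linarith
    exact (mul_eq_zero.1 this).resolve_right (mul_ne_zero (by norm_num) hτ0)
  rw [hr] at h3
  have h6 : k * (1 + τ ^ 2) = k' * (1 + τ ^ 2) := by linarith
  exact mul_right_cancel₀ (by positivity) h6

/-- At z = iv one has z̄ = -z, so A times its twisted conjugate takes the value |A(iv)|², and
likewise for B. If k < k', the factors 4 - k(1 + v²) and 4 - k'(1 + v²) have opposite signs on an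
interval of v, so B vanishes at infinitely many points. -/
theorem le_of_mul_conj_eq {k k' : ℝ} (h0 : 0 < k) (h0' : 0 < k') (h4 : k < 4) {A B : ℂ[X]}
    (hB : B ≠ 0)
    (h : A * (A.map (starRingEnd ℂ)).comp (-Polynomial.X) *
        (Polynomial.C 4 - Polynomial.C (k : ℂ) * (1 - Polynomial.X ^ 2)) =
      B * (B.map (starRingEnd ℂ)).comp (-Polynomial.X) *
        (Polynomial.C 4 - Polynomial.C (k' : ℂ) * (1 - Polynomial.X ^ 2))) : k' ≤ k := by
  by_contra! hlt
  have key : ∀ v : ℝ, 4 / k' < 1 + v ^ 2 → 1 + v ^ 2 < 4 / k → B.eval (Complex.I * v) = 0 := by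
    intro v hv hv'
    have e : ∀ P : ℂ[X], ((P.map (starRingEnd ℂ)).comp (-Polynomial.X)).eval (Complex.I * v) =
        starRingEnd ℂ (P.eval (Complex.I * v)) := fun P => by
      rw [Polynomial.eval_comp, Polynomial.eval_neg, Polynomial.eval_X,
        show -(Complex.I * v) = starRingEnd ℂ (Complex.I * v) by simp, Polynomial.eval_map,
        Polynomial.eval₂_at_apply]
    have h1 := congrArg (Polynomial.eval (Complex.I * v)) h
    simp only [Polynomial.eval_mul, e, Complex.mul_conj] at h1
    have e2 : ∀ x : ℝ, (Polynomial.C 4 - Polynomial.C (x : ℂ) * (1 - Polynomial.X ^ 2)).eval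
        (Complex.I * v) = ((4 - x * (1 + v ^ 2) : ℝ) : ℂ) := fun x => by
      simp [mul_pow]
    rw [e2, e2, ← Complex.ofReal_mul, ← Complex.ofReal_mul, Complex.ofReal_inj] at h1
    rw [div_lt_iff₀ h0'] at hv
    rw [lt_div_iff₀ h0] at hv'
    have h2 := Complex.normSq_nonneg (A.eval (Complex.I * v))
    have h3 := Complex.normSq_nonneg (B.eval (Complex.I * v))
    rw [← Complex.normSq_eq_zero]
    by_contra h5
    have h6 := lt_of_le_of_ne h3 (Ne.symm h5)
    nlinarith
  -- The lower end is cut off at zero because nothing here bounds k' by 4.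
  have hlt2 : √(max (4 / k' - 1) 0) < √(4 / k - 1) := by
    have h5 : 4 / k' < 4 / k := div_lt_div_of_pos_left (by norm_num) h0 hlt
    have h6 : 1 < 4 / k := by rw [lt_div_iff₀ h0]; linarith
    exact Real.sqrt_lt_sqrt (le_max_right _ _) (max_lt (by linarith) (by linarith))
  refine hB (Polynomial.eq_zero_of_infinite_isRoot B (Set.Infinite.mono (s :=
    (fun v : ℝ => Complex.I * (v : ℂ)) '' Set.Ioo (√(max (4 / k' - 1) 0)) (√(4 / k - 1))) ?_ ?_))
  · rintro _ ⟨v, ⟨hv, hv'⟩, rfl⟩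
    have hv0 : 0 < v := lt_of_le_of_lt (Real.sqrt_nonneg _) hv
    rw [Real.sqrt_lt' hv0] at hv
    rw [Real.lt_sqrt hv0.le] at hv'
    have := le_max_left (4 / k' - 1) 0
    exact key v (by linarith) (by linarith)
  · refine Set.Infinite.image ?_ (Set.Ioo_infinite hlt2)
    intro v _ w _ hvw
    exact Complex.ofReal_injective (mul_left_cancel₀ Complex.I_ne_zero hvw)

end

theorem exists_aeval_div {w : CFunField} (hw : w ∈ ZField) :
    ∃ A B : Polynomial ℂ, B ≠ 0 ∧ w * Polynomial.aeval zC B = Polynomial.aeval zC A := by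
  obtain ⟨A, B, rfl⟩ := (IntermediateField.mem_adjoin_simple_iff ℂ w).1 hw
  by_cases hB : Polynomial.aeval zC B = 0
  · exact ⟨0, 1, one_ne_zero, by rw [hB]; simp⟩
  · exact ⟨A, B, by rintro rfl; simp at hB, div_mul_cancel₀ _ hB⟩

/-! ### The conjugacy invariant |1 + μ|² -/

section
variable {μ μ' : ℂ}

/-- The number `|1 + μ|²`. -/
def kap (μ : ℂ) : ℝ := 2 + 2 * μ.re

theorem const_kap (hμ : ‖μ‖ = 1) :
    (1 + const μ) * (1 + const (starRingEnd ℂ μ)) = const (kap μ : ℂ) := by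
  rw [← const_one, ← const_add, ← const_add, ← const_mul]
  congr 1
  have := mul_starRingEnd_of_norm hμ
  have h2 : μ + starRingEnd ℂ μ = (2 * μ.re : ℝ) := Complex.add_conj μ
  rw [kap, Complex.ofReal_add, ← h2]
  push_cast
  linear_combination this

theorem kap_lt (hμ : ‖μ‖ = 1) (h1 : μ ≠ 1) : kap μ < 4 := by
  have := re_lt_one hμ h1
  rw [kap]; linarith

theorem kap_pos (hμ : ‖μ‖ = 1) (hm1 : μ ≠ -1) : 0 < kap μ := by
  have := re_lt_one (μ := -μ) (by rwa [norm_neg]) (fun h => hm1 (by rw [← h, neg_neg]))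
  rw [Complex.neg_re] at this
  rw [kap]; linarith

theorem eq_or_eq_inv_of_kap_eq (hμ : ‖μ‖ = 1) (hμ' : ‖μ'‖ = 1) (h : kap μ = kap μ') :
    μ' = μ ∨ μ' = μ⁻¹ := by
  have h1 := re_sq_add_im_sq hμ
  have h2 := re_sq_add_im_sq hμ'
  have hre : μ'.re = μ.re := by rw [kap, kap] at h; linarith
  have him : μ'.im ^ 2 = μ.im ^ 2 := by rw [hre] at h2; linarith
  have hinv : μ⁻¹ = starRingEnd ℂ μ :=
    inv_eq_of_mul_eq_one_right (mul_starRingEnd_of_norm hμ)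
  rcases sq_eq_sq_iff_eq_or_eq_neg.1 him with h3 | h3
  · left; exact Complex.ext hre h3
  · right; rw [hinv]; exact Complex.ext (by simpa using hre) (by simpa using h3)

end

section
variable {μ μ' : ℂ}

theorem IsG₁'.acts_tC (hμ : ‖μ‖ = 1) {g : Bir} (hg : IsG₁' μ g) :
    baseChange g tC * ((1 + const μ) * tC + 2 * const Complex.I) =
      -2 * const Complex.I * tC + (1 + const (starRingEnd ℂ μ)) * (1 - zC ^ 2) := by
  apply mul_left_cancel₀ (const_ne_zero (ne_zero_of_norm hμ))
  linear_combination hg.1 - (1 - zC ^ 2) * const_mul_starRingEnd hμ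

theorem aeval_zC_C (c : ℂ) : Polynomial.aeval zC (Polynomial.C c) = const c := by
  rw [Polynomial.aeval_C]; rfl

theorem aeval_zC_C' (w : CFunField) (c : ℂ) : Polynomial.aeval w (Polynomial.C c) = const c := by
  rw [Polynomial.aeval_C]; rfl

theorem four_sub_kap_ne_zero : 4 - const (kap μ : ℂ) * (1 - zC ^ 2) ≠ 0 := by
  have h := aeval_zC_ne_zero
    (p := Polynomial.C 4 - Polynomial.C (kap μ : ℂ) * (1 - Polynomial.X ^ 2)) (by
      intro h0
      have := congrArg (Polynomial.eval 1) h0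
      norm_num at this)
  simpa only [map_sub, map_mul, map_pow, map_one, Polynomial.aeval_X, aeval_zC_C, const_four]
    using h

/-- Determinants of the matrix identity H M' = k M H. -/
theorem det_mul_eq {K : Type*} [Field K] {p q r s a b c d a' b' c' d' k : K}
    (e1 : p * a' + q * c' = k * (a * p + b * r)) (e2 : p * b' + q * d' = k * (a * q + b * s))
    (e3 : r * a' + s * c' = k * (c * p + d * r)) (e4 : r * b' + s * d' = k * (c * q + d * s)) :
    (p * s - q * r) * (a' * d' - b' * c') = (p * s - q * r) * (k ^ 2 * (a * d - b * c)) := by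
  linear_combination e1 * (r * b' + s * d') + k * (a * p + b * r) * e4 -
    e2 * (r * a' + s * c') - k * (a * q + b * s) * e3

/-- If h acts on t by the matrix H, the conjugation gives H M' = k M^h H, where M^h is the matrix of
g with z replaced by its image h(z). Determinants give 4 - κ'(1 - z²) = k²(4 - κ(1 - h(z)²)), and
`eq_of_mul_sq_eq` compares the zeros of odd order. -/
theorem kap_eq_of_conj_g₁' (hμ : ‖μ‖ = 1) (hμ' : ‖μ'‖ = 1) (hμ1' : μ' ≠ 1) (hμm' : μ' ≠ -1)
    {g g' : Bir} (hg : IsG₁' μ g) (hg' : IsG₁' μ' g') (hc : ConjInAutRealPi g g') :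
    kap μ = kap μ' := by
  obtain ⟨h, hh, hconj⟩ := hc
  have hcomm : h * g = g' * h := by rw [← hconj]; group
  obtain ⟨e, ρ, he, hr, hz⟩ := exists_base_action hh
  have hzm := baseChange_zC_mem hz
  obtain ⟨p, hp, q, hq, r, hrm, s, hs, hdet, ht⟩ := exists_moebius hzm
  have hT : baseChange h (baseChange g tC) = baseChange g' (baseChange h tC) := by
    rw [← baseChange_mul, ← baseChange_mul, hcomm]
  have hD : ∀ w ∈ ZField, baseChange g' w = w := fun w hw => QPoly.baseChange_of_mem hg'.2 hw
  have h1 := congrArg (baseChange h) (hg.acts_tC hμ)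
  have h2 := congrArg (baseChange g') ht
  have h3 := hg'.acts_tC hμ'
  simp only [map_mul, map_add, map_sub, map_neg, map_one, map_ofNat, map_pow, baseChange_const]
    at h1 h2
  rw [hD _ hp, hD _ hq, hD _ hrm, hD _ hs, ← hT] at h2
  have hI := const_I_sq
  have hk := const_kap hμ
  have hk' := const_kap hμ'
  have m1 : ∀ c : ℂ, 1 + const c ∈ ZField := fun c => ZField.add_mem ZField.one_mem (const_mem _ c)
  have m2 : 2 * const Complex.I ∈ ZField := by
    rw [← const_two, ← const_mul]; exact const_mem _ _
  have m3 : -2 * const Complex.I ∈ ZField := by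
    rw [← const_two, ← const_neg, ← const_mul]; exact const_mem _ _
  have m4 : 1 - baseChange h zC ^ 2 ∈ ZField := ZField.sub_mem ZField.one_mem (pow_mem hzm 2)
  have hN0 := baseChange_ne_zero h (four_sub_kap_ne_zero (μ := μ))
  simp only [map_sub, map_ofNat, map_mul, map_one, map_pow, baseChange_const] at hN0
  obtain ⟨k, hkm, e1, e2, e3, e4⟩ := exists_matrix_eq hp hq hrm hs hp hq hrm hs
    m3 (ZField.mul_mem (m1 (starRingEnd ℂ μ)) m4) (m1 μ) m2
    m3 (ZField.mul_mem (m1 (starRingEnd ℂ μ')) QPoly.one_sub_zC_mem) (m1 μ') m2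
    (f := baseChange h (baseChange g tC)) hdet (by
      convert hN0 using 1
      linear_combination -4 * hI - (1 - baseChange h zC ^ 2) * hk) (by
      linear_combination (r * tC + s) * h1 + (-baseChange h (baseChange g tC) * (1 + const μ) -
        2 * const Complex.I) * ht) (by
      linear_combination ((1 + const μ') * tC + 2 * const Complex.I) * h2 +
        (p - baseChange h (baseChange g tC) * r) * h3)
  have key : 4 - const (kap μ' : ℂ) * (1 - zC ^ 2) =
      k ^ 2 * (4 - const (kap μ : ℂ) * (1 - baseChange h zC ^ 2)) := by
    rw [← hk, ← hk']
    linear_combination mul_left_cancel₀ hdet (det_mul_eq e1 e2 e3 e4) + (4 - 4 * k ^ 2) * hI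
  obtain ⟨A, B, hB, hAB⟩ := exists_aeval_div hkm
  refine eq_of_mul_sq_eq (k := kap μ) (k' := kap μ') (r := ρ) (A := A) (B := B)
    (kap_pos hμ' hμm') (kap_lt hμ' hμ1') hB (aeval_zC_injective ?_)
  simp only [map_sub, map_mul, map_pow, map_one, map_add, Polynomial.aeval_X, aeval_zC_C, const_four,
    ← hAB, key]
  have he' : const (e : ℂ) ^ 2 = 1 := by
    rw [← const_pow, ← Complex.ofReal_pow, he, Complex.ofReal_one, const_one]
  generalize Polynomial.aeval zC B = b
  linear_combination k ^ 2 * b ^ 2 * const (kap μ : ℂ) * ((baseChange h zC * (1 + const ρ * zC) +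
    const e * (zC + const ρ)) * hz + (zC + const ρ) ^ 2 * he')

theorem conjL_mem {w : CFunField} (hw : w ∈ ZField) : conjL w ∈ ZField := by
  induction hw using IntermediateField.adjoin_induction with
  | mem x hx => rw [Set.mem_singleton_iff.1 hx, conjL_zC]; exact zC_mem
  | algebraMap x =>
    change conjL (const x) ∈ ZField
    rw [conjL_const]; exact const_mem _ _
  | add x y _ _ hx hy => rw [map_add]; exact ZField.add_mem hx hy
  | inv x _ hx => rw [map_inv₀]; exact ZField.inv_mem hx
  | mul x y _ _ hx hy => rw [map_mul]; exact ZField.mul_mem hx hy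

/-- The composition of `g₂'(μ)` with complex conjugation. -/
theorem IsG₂'.acts_conj {g : Bir} (hg : IsG₂' μ g) :
    conjL (baseChange g tC) * (-const Complex.I * (1 + const (starRingEnd ℂ μ)) * tC +
      2 * const (starRingEnd ℂ μ)) = 2 * tC +
        const Complex.I * (1 + const (starRingEnd ℂ μ)) * (1 - zC ^ 2) := by
  have h := congrArg conjL hg.1
  simp only [map_mul, map_sub, map_add, map_neg, map_one, map_ofNat, map_pow, conjL_const,
    conjL_tC, conjL_zC, Complex.conj_I, const_neg] at h
  rw [← tC_mul_tbarC] at h ⊢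
  apply mul_left_cancel₀ tbarC_ne_zero
  apply mul_left_cancel₀ tC_ne_zero
  linear_combination -tC * h

theorem conjL_aeval_neg (B : Polynomial ℂ) : conjL (Polynomial.aeval (-zC) B) =
    Polynomial.aeval zC ((B.map (starRingEnd ℂ)).comp (-Polynomial.X)) := by
  induction B using Polynomial.induction_on' with
  | add p q hp hq =>
    rw [map_add, map_add, hp, hq, Polynomial.map_add, Polynomial.add_comp, map_add]
  | monomial n a =>
    rw [← Polynomial.C_mul_X_pow_eq_monomial, map_mul, map_mul, map_pow, map_pow,
      Polynomial.aeval_X, aeval_zC_C', conjL_const, map_neg, conjL_zC]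
    simp only [Polynomial.map_mul, Polynomial.map_pow, Polynomial.map_C, Polynomial.map_X,
      Polynomial.mul_comp, Polynomial.pow_comp, Polynomial.C_comp, Polynomial.X_comp, map_mul,
      map_pow, map_neg, Polynomial.aeval_X, aeval_zC_C]

/-- Let σ be g' followed by complex conjugation. The equations e say H^σ M' = k M H, and f1, f2 are
the first row of its image under σ. Both M^σ M and M'^σ M' are scalar, because the maps are
involutions; inserting one identity into the other gives N' H = k k^σ N H in the first row, with N,
N' these scalars. -/
theorem antilinear_core {K : Type*} [Field K] {i D n o n' o' m' mb mb' p q r s P Q R S k k₂ : K}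
    (hi : i ^ 2 = -1) (hn : mb * o = n) (hn' : m' * n' = o') (ho' : mb' * o' = n')
    (hmm' : m' * mb' = 1)
    (e1 : P * 2 + Q * (-i * n') = k * (2 * p + i * n * D * r))
    (e2 : P * (i * n' * D) + Q * (2 * mb') = k * (2 * q + i * n * D * s))
    (e3 : R * 2 + S * (-i * n') = k * (-i * n * p + 2 * mb * r))
    (e4 : R * (i * n' * D) + S * (2 * mb') = k * (-i * n * q + 2 * mb * s))
    (f1 : p * 2 + q * (i * o') = k₂ * (2 * P + -i * o * D * R))
    (f2 : p * (-i * o' * D) + q * (2 * m') = k₂ * (2 * Q + -i * o * D * S)) :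
    p * (4 - o' * n' * D) = p * (k * k₂ * (4 - o * n * D)) ∧
      q * (4 - o' * n' * D) = q * (k * k₂ * (4 - o * n * D)) := by
  constructor
  · linear_combination 2 * f1 - i * n' * f2 + k₂ * (2 * e1 - i * o * D * e3) +
      2 * i * q * hn' + (-p * o' * n' * D + k₂ * k * p * o * n * D) * hi -
      2 * k * k₂ * i * D * r * hn
  · linear_combination i * n' * D * f1 + 2 * mb' * f2 + k₂ * (2 * e2 - i * o * D * e4) +
      2 * i * p * D * ho' - 4 * q * hmm' + (-q * o' * n' * D + k₂ * k * q * o * n * D) * hi -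
      2 * k * k₂ * i * D * s * hn

/-- As `g₂'` moves z, it has no determinant over ℂ(z) to compare modulo squares. Composed with
complex conjugation it becomes semilinear over z ↦ -z with conjugated constants; the norms then
differ by a factor k k^σ, which is nonnegative on the imaginary axis. `le_of_mul_conj_eq` turns this
into an inequality. -/
theorem kap_le_of_conj_g₂' (hμ : ‖μ‖ = 1) (hμ1 : μ ≠ 1) (hμm : μ ≠ -1) (hμ' : ‖μ'‖ = 1)
    (hμm' : μ' ≠ -1)
    {g g' : Bir} (hg : IsG₂' μ g) (hg' : IsG₂' μ' g') (hgg' : g' * g' = 1)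
    (hc : ConjInAutRealPi g g') : kap μ' ≤ kap μ := by
  obtain ⟨h, hh, hconj⟩ := hc
  have hcomm : h * g = g' * h := by rw [← hconj]; group
  obtain ⟨e, ρ, he, hr, hz⟩ := exists_base_action hh
  have hzm := baseChange_zC_mem hz
  obtain ⟨p, hp, q, hq, r, hrm, s, hs, hdet, ht⟩ := exists_moebius hzm
  have hcz : baseChange h (-zC) = baseChange g' (baseChange h zC) := by
    rw [← hg.2, ← baseChange_mul, ← baseChange_mul, hcomm]
  have he' : const (e : ℂ) ^ 2 = 1 := by
    rw [← const_pow, ← Complex.ofReal_pow, he, Complex.ofReal_one, const_one]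
  -- The base action of h commutes with z ↦ -z, which a nontrivial hyperbolic translation does not.
  have hρ : const (ρ : ℂ) = 0 := by
    by_contra hρ
    have h1 := congrArg (baseChange g') hz
    simp only [map_mul, map_add, map_one, baseChange_const, hg'.2] at h1
    rw [← hcz, map_neg] at h1
    have h2 : zC * baseChange h zC = const e := by
      apply mul_left_cancel₀ hρ
      apply mul_left_cancel₀ (two_ne_zero (α := CFunField))
      linear_combination hz + h1
    have h3 : zC ^ 2 = 1 := by
      linear_combination (-const e * zC) * (hz - const ρ * h2) + const e * h2 + (1 - zC ^ 2) * he'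
    have h4 : (zC - 1) * (zC - -1) = 0 := by linear_combination h3
    rcases mul_eq_zero.1 h4 with h4 | h4
    · exact zC_ne_const 1 (by rw [const_one]; exact sub_eq_zero.1 h4)
    · exact zC_ne_const (-1) (by rw [const_neg, const_one]; exact sub_eq_zero.1 h4)
  have hφz : baseChange h zC = const e * zC := by
    rw [hρ] at hz; linear_combination hz
  have hφD : 1 - baseChange h zC ^ 2 = 1 - zC ^ 2 := by
    rw [hφz]; linear_combination -zC ^ 2 * he'
  have hT : baseChange h (conjL (baseChange g tC)) = conjL (baseChange g' (baseChange h tC)) := by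
    rw [← conjL_baseChange, ← baseChange_mul, ← baseChange_mul, hcomm]
  have hmem : ∀ w ∈ ZField, conjL (baseChange g' w) ∈ ZField := fun w hw =>
    conjL_mem (baseChange_mem_of_zC (by rw [hg'.2]; exact ZField.neg_mem zC_mem) hw)
  have hinv : ∀ w, conjL (baseChange g' (conjL (baseChange g' w))) = w := fun w => by
    rw [conjL_baseChange, conjL_conjL, ← baseChange_mul, hgg', baseChange_one]
  have h1 := congrArg (baseChange h) hg.acts_conj
  have h2 := congrArg (fun w => conjL (baseChange g' w)) ht
  have h3 := hg'.acts_conj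
  simp only [map_mul, map_add, map_sub, map_neg, map_one, map_ofNat, map_pow, baseChange_const]
    at h1 h2
  rw [hφD] at h1
  rw [← hT] at h2
  have hI := const_I_sq
  have hk := const_kap hμ
  have hk' := const_kap hμ'
  have hm := const_mul_starRingEnd hμ
  have hm' := const_mul_starRingEnd hμ'
  have mI := const_mem ZField Complex.I
  have m1 : ∀ c : ℂ, const Complex.I * (1 + const c) ∈ ZField := fun c =>
    ZField.mul_mem mI (ZField.add_mem ZField.one_mem (const_mem _ c))
  have m1' : ∀ c : ℂ, -const Complex.I * (1 + const c) ∈ ZField := fun c =>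
    ZField.mul_mem (ZField.neg_mem mI) (ZField.add_mem ZField.one_mem (const_mem _ c))
  have m2 : ∀ c : ℂ, 2 * const c ∈ ZField := fun c => by
    rw [← const_two, ← const_mul]; exact const_mem _ _
  have m3 : (2 : CFunField) ∈ ZField := by rw [← const_two]; exact const_mem _ _
  have mD := QPoly.one_sub_zC_mem
  obtain ⟨k, hkm, e1, e2, e3, e4⟩ := exists_matrix_eq hp hq hrm hs (hmem p hp) (hmem q hq)
    (hmem r hrm) (hmem s hs)
    m3 (ZField.mul_mem (m1 (starRingEnd ℂ μ)) mD) (m1' (starRingEnd ℂ μ)) (m2 (starRingEnd ℂ μ))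
    m3 (ZField.mul_mem (m1 (starRingEnd ℂ μ')) mD) (m1' (starRingEnd ℂ μ'))
    (m2 (starRingEnd ℂ μ'))
    (f := baseChange h (conjL (baseChange g tC))) hdet (by
      have h5 := mul_ne_zero (const_ne_zero (right_ne_zero_of_mul_eq_one
        (mul_starRingEnd_of_norm hμ))) (four_sub_kap_ne_zero (μ := μ))
      rw [← hk] at h5
      convert h5 using 1
      linear_combination (1 + const (starRingEnd ℂ μ)) ^ 2 * (1 - zC ^ 2) * hI +
        (1 + const (starRingEnd ℂ μ)) * (1 - zC ^ 2) * hm) (by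
      linear_combination (r * tC + s) * h1 + (-baseChange h (conjL (baseChange g tC)) *
        (-const Complex.I * (1 + const (starRingEnd ℂ μ))) + 2) * ht) (by
      linear_combination (-const Complex.I * (1 + const (starRingEnd ℂ μ')) * tC +
        2 * const (starRingEnd ℂ μ')) * h2 +
        (conjL (baseChange g' p) - baseChange h (conjL (baseChange g tC)) *
          conjL (baseChange g' r)) * h3)
  have f1 := congrArg (fun w => conjL (baseChange g' w)) e1
  have f2 := congrArg (fun w => conjL (baseChange g' w)) e2
  simp only [map_mul, map_add, map_sub, map_neg, map_one, map_ofNat, map_pow, baseChange_const,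
    hinv, conjL_const, hg'.2, Complex.conj_I, Complex.conj_conj, const_neg, conjL_zC, neg_neg,
    even_two.neg_pow] at f1 f2
  obtain ⟨k1, k2⟩ := antilinear_core (n := 1 + const (starRingEnd ℂ μ)) (o := 1 + const μ)
    (n' := 1 + const (starRingEnd ℂ μ')) (o' := 1 + const μ') (m' := const μ') hI
    (by linear_combination hm) (by linear_combination hm') (by linear_combination hm') hm'
    e1 e2 e3 e4 f1 f2
  rw [hk, hk'] at k1 k2
  have key : 4 - const (kap μ' : ℂ) * (1 - zC ^ 2) =
      k * conjL (baseChange g' k) * (4 - const (kap μ : ℂ) * (1 - zC ^ 2)) := by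
    -- The first row of an invertible matrix has a nonzero entry, and either entry may be cancelled.
    by_cases hp0 : p = 0
    · refine mul_left_cancel₀ (fun hq0 => hdet ?_) k2
      rw [hp0, hq0]; ring
    · exact mul_left_cancel₀ hp0 k1
  obtain ⟨A, B, hB, hAB⟩ := exists_aeval_div hkm
  have hAB' := congrArg (fun w => conjL (baseChange g' w)) hAB
  simp only [map_mul, ← Polynomial.aeval_algHom_apply, hg'.2, conjL_aeval_neg] at hAB'
  refine le_of_mul_conj_eq (A := A) (B := B) (kap_pos hμ hμm) (kap_pos hμ' hμm') (kap_lt hμ hμ1)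
    hB (aeval_zC_injective ?_)
  simp only [map_sub, map_mul, map_pow, map_one, Polynomial.aeval_X, aeval_zC_C, const_four,
    ← hAB, ← hAB', key]
  ring

/-- On the unit circle μ⁻¹ = μ̄. The rotation t ↦ μ̄t takes the linear forms a and b for μ to those
for μ̄, hence conjugates the involutions accordingly. -/
theorem conj_inv_of_rotation (hμ : ‖μ‖ = 1) {g₁ g₁' g₂ g₂' : Bir} (hg₁ : IsG₁' μ g₁)
    (hg₁' : IsG₁' μ⁻¹ g₁') (hg₂ : IsG₂' μ g₂) (hg₂' : IsG₂' μ⁻¹ g₂') :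
    ConjInAutRealPi g₁ g₁' ∧ ConjInAutRealPi g₂ g₂' := by
  have hinv : μ⁻¹ = starRingEnd ℂ μ := inv_eq_of_mul_eq_one_right (mul_starRingEnd_of_norm hμ)
  have hμ' : ‖starRingEnd ℂ μ‖ = 1 := by rwa [RCLike.norm_conj]
  have hm := const_mul_starRingEnd hμ
  rw [hinv] at hg₁' hg₂'
  obtain ⟨h, hh, ht, hz⟩ := exists_rotation hμ'
  have hS : baseChange h SC = const (starRingEnd ℂ μ) * SC := by
    rw [SC_eq, map_mul, baseChange_const, ht]; ring
  have hV : baseChange h VC = const μ * VC := by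
    rw [VC_eq, map_mul, map_neg, baseChange_const, baseChange_tbarC, ht, map_mul, conjL_tC,
      conjL_const, Complex.conj_conj]
    ring
  have hz' := QPoly.baseChange_inv_zC hz
  have hS' : baseChange h⁻¹ SC = const μ * SC := by
    have h1 := congrArg (baseChange h⁻¹) hS
    rw [baseChange_inv_apply, map_mul, baseChange_const] at h1
    linear_combination -const μ * h1 - baseChange h⁻¹ SC * hm
  have ha : baseChange h (aC μ) = aC (starRingEnd ℂ μ) := by
    rw [aC, aC, map_sub, map_mul, map_add, map_one, map_ofNat, baseChange_const, hS]
    linear_combination -SC * hm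
  have hb : baseChange h (bC μ) = bC (starRingEnd ℂ μ) := by
    rw [bC, bC, map_sub, map_mul, map_add, map_one, map_ofNat, baseChange_const, hV,
      Complex.conj_conj]
    linear_combination -VC * hm
  refine ⟨⟨h, hh, ?_⟩, ⟨h, hh, ?_⟩⟩
  · refine IsG₁'.unique hμ' ((isG₁'_iff hμ').2 ⟨?_, ?_⟩) hg₁'
    · rw [baseChange_mul, baseChange_mul, hz', hg₁.2, hz]
    · have h1 := congrArg (baseChange h) ((isG₁'_iff hμ).1 hg₁).2
      rw [map_mul, map_mul, map_neg, ha, hb, hS] at h1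
      rw [baseChange_mul, baseChange_mul, hS', map_mul, map_mul, baseChange_const, baseChange_const]
      linear_combination const μ * h1 - SC * bC (starRingEnd ℂ μ) * hm
  · refine IsG₂'.unique hμ' ((isG₂'_iff hμ').2 ⟨?_, ?_⟩) hg₂'
    · rw [baseChange_mul, baseChange_mul, hz', hg₂.2, map_neg, hz]
    · have h1 := congrArg (baseChange h) ((isG₂'_iff hμ).1 hg₂).2
      rw [map_mul, map_mul, map_mul, map_neg, ha, hb, hV, baseChange_const] at h1
      rw [baseChange_mul, baseChange_mul, hS', map_mul, map_mul, baseChange_const, baseChange_const]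
      linear_combination const (starRingEnd ℂ μ) * h1 - VC * aC (starRingEnd ℂ μ) * hm

theorem conj_tfae (hμ : ‖μ‖ = 1) (h1 : μ ≠ 1) (hm1 : μ ≠ -1) (hμ' : ‖μ'‖ = 1)
    (h1' : μ' ≠ 1) (hm1' : μ' ≠ -1) {g₁ g₁' g₂ g₂' : Bir} (hg₁ : IsG₁' μ g₁)
    (hg₁' : IsG₁' μ' g₁') (hg₂ : IsG₂' μ g₂) (hg₂' : IsG₂' μ' g₂') :
    List.TFAE [ConjInAutRealPi g₁ g₁', ConjInAutRealPi g₂ g₂', μ' = μ ∨ μ' = μ⁻¹] := by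
  have hone : ∀ g : Bir, ConjInAutRealPi g g := fun g => ⟨1, one_mem _, by simp⟩
  have hback : μ' = μ ∨ μ' = μ⁻¹ → ConjInAutRealPi g₁ g₁' ∧ ConjInAutRealPi g₂ g₂' := by
    rintro (rfl | rfl)
    · rw [hg₁.unique hμ hg₁', hg₂.unique hμ hg₂']
      exact ⟨hone _, hone _⟩
    · exact conj_inv_of_rotation hμ hg₁ hg₁' hg₂ hg₂'
  have hsymm : ∀ {g g' : Bir}, ConjInAutRealPi g g' → ConjInAutRealPi g' g := by
    rintro g g' ⟨h, hh, rfl⟩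
    exact ⟨h⁻¹, inv_mem hh, by group⟩
  have hinvol : ∀ {ν : ℂ} {g : Bir}, ‖ν‖ = 1 → ν ≠ 1 → ν ≠ -1 → IsG₂' ν g → g * g = 1 :=
    fun {ν g} hν hν1 hνm hg => by
      obtain ⟨-, k, -, -, -, h4, -, h6, -⟩ := exists_automorphisms hν hν1 hνm
      rw [(h4 g).1 hg, ← pow_two, ← h6, pow_orderOf_eq_one]
  tfae_have 1 → 3 := fun h => eq_or_eq_inv_of_kap_eq hμ hμ'
    (kap_eq_of_conj_g₁' hμ hμ' h1' hm1' hg₁ hg₁' h)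
  -- The relation of conjugacy is symmetric, so the one-sided estimate is applied in both
  -- directions.
  tfae_have 2 → 3 := fun h => eq_or_eq_inv_of_kap_eq hμ hμ' (le_antisymm
    (kap_le_of_conj_g₂' hμ' h1' hm1' hμ hm1 hg₂' hg₂ (hinvol hμ h1 hm1 hg₂) (hsymm h))
    (kap_le_of_conj_g₂' hμ h1 hm1 hμ' hm1' hg₂ hg₂' (hinvol hμ' h1' hm1' hg₂') h))
  tfae_have 3 → 1 := fun h => (hback h).1
  tfae_have 3 → 2 := fun h => (hback h).2
  tfae_finish

end

/-! ### Squares in a pencil of polynomials -/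

section SquarePencil
open Polynomial

/-- Suppose the Wronskian W is nonzero. Each Aᵢ divides W, and the Aᵢ are pairwise coprime, so the
sum of their degrees is at most deg W. On the other hand W is up to a constant the Wronskian of Aᵢ²
and Aⱼ², so deg W < 2 deg Aᵢ + 2 deg Aⱼ; adding this for two disjoint pairs of indices gives a
contradiction. -/
theorem wronskian_eq_zero_of_sq {P Q : ℂ[X]} (hPQ : IsCoprime P Q) {r : Fin 4 → ℂ}
    (hr : Function.Injective r) {A : Fin 4 → ℂ[X]} (h : ∀ i, P - Polynomial.C (r i) * Q = A i ^ 2) :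
    wronskian P Q = 0 := by
  by_contra hW
  have hW' : ∀ i j, wronskian (A i ^ 2) (A j ^ 2) = Polynomial.C (r i - r j) * wronskian P Q := fun i j => by
    rw [← h, ← h]
    simp only [wronskian, derivative_sub, derivative_mul, derivative_C, zero_mul, zero_add, Polynomial.C_sub]
    ring
  have hC : ∀ i j, i ≠ j → r i - r j ≠ 0 := fun i j hij h0 => hij (hr (sub_eq_zero.1 h0))
  have hdeg : ∀ i j, i ≠ j →
      (wronskian P Q).natDegree < 2 * (A i).natDegree + 2 * (A j).natDegree := fun i j hij => by
    have h1 := natDegree_wronskian_lt_add (a := A i ^ 2) (b := A j ^ 2) (by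
      rw [hW' i j]; exact mul_ne_zero (C_ne_zero.2 (hC i j hij)) hW)
    rwa [hW' i j, natDegree_C_mul (hC i j hij), natDegree_pow, natDegree_pow] at h1
  have hdvd : ∀ i, A i ∣ wronskian P Q := fun i => by
    have h1 : wronskian P Q = wronskian (A i ^ 2) Q := by
      rw [← h]
      simp only [wronskian, derivative_sub, derivative_mul, derivative_C, zero_mul, zero_add]
      ring
    rw [h1]
    refine ⟨A i * derivative Q - 2 * derivative (A i) * Q, ?_⟩
    simp only [wronskian, derivative_pow, Nat.cast_ofNat, Nat.add_one_sub_one, pow_one, Polynomial.C_ofNat]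
    ring
  have hcop : ∀ i j, i ≠ j → IsCoprime (A i) (A j) := fun i j hij => by
    have h1 : IsCoprime (A i ^ 2) Q := by
      rw [← h, sub_eq_add_neg, ← neg_mul]
      exact IsCoprime.add_mul_right_left hPQ _
    have h2 : A j ^ 2 = A i ^ 2 * 1 + Polynomial.C (r i - r j) * Q := by
      rw [← h, ← h, Polynomial.C_sub]; ring
    have hu : IsUnit (Polynomial.C (r i - r j) : ℂ[X]) := isUnit_C.2 (hC i j hij).isUnit
    have h3 : IsCoprime (A i ^ 2) (A j ^ 2) := by
      rw [h2, add_comm]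
      exact IsCoprime.add_mul_left_right ((isCoprime_mul_unit_left_right hu _ _).2 h1) _
    exact (IsCoprime.pow_iff two_pos two_pos).1 h3
  have hprod : ∏ i, A i ∣ wronskian P Q :=
    Finset.prod_dvd_of_coprime (fun i _ j _ hij => hcop i j hij) fun i _ => hdvd i
  have h1 := natDegree_le_of_dvd hprod hW
  have h0 : ∀ i ∈ Finset.univ, A i ≠ 0 := fun i _ hi => hW (by
    have := hdvd i; rwa [hi, zero_dvd_iff] at this)
  rw [natDegree_prod _ _ h0, Fin.sum_univ_four] at h1
  have h2 := hdeg 0 1 (by decide)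
  have h3 := hdeg 2 3 (by decide)
  omega

/-- With z = P/Q, the polynomial d(P/Q)Q^N is congruent to d(r)Q^N modulo P - rQ, because P ≡ rQ.
All large N are allowed, so that sums can be brought to a common exponent. -/
theorem exists_homogenization {P Q : ℂ[X]} (r : ℂ) {z : RatFunc ℂ}
    (hz : z * algebraMap ℂ[X] (RatFunc ℂ) Q = algebraMap ℂ[X] (RatFunc ℂ) P) (d : ℂ[X]) :
    ∃ N₀ : ℕ, ∀ N, N₀ ≤ N → ∃ H : ℂ[X],
      Polynomial.aeval z d * algebraMap ℂ[X] (RatFunc ℂ) Q ^ N = algebraMap ℂ[X] (RatFunc ℂ) H ∧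
      P - Polynomial.C r * Q ∣ H - Polynomial.C (d.eval r) * Q ^ N := by
  induction d using Polynomial.induction_on' with
  | add p q hp hq =>
    obtain ⟨N₁, h1⟩ := hp
    obtain ⟨N₂, h2⟩ := hq
    refine ⟨max N₁ N₂, fun N hN => ?_⟩
    obtain ⟨H₁, e1, d1⟩ := h1 N (le_of_max_le_left hN)
    obtain ⟨H₂, e2, d2⟩ := h2 N (le_of_max_le_right hN)
    refine ⟨H₁ + H₂, ?_, ?_⟩
    · rw [map_add, map_add, add_mul, e1, e2]
    · convert dvd_add d1 d2 using 1
      rw [Polynomial.eval_add, Polynomial.C_add]; ring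
  | monomial n a =>
    refine ⟨n, fun N hN => ⟨Polynomial.C a * P ^ n * Q ^ (N - n), ?_, ?_⟩⟩
    · obtain ⟨k, rfl⟩ := Nat.exists_eq_add_of_le hN
      rw [Nat.add_sub_cancel_left, Polynomial.aeval_monomial, map_mul, map_mul, map_pow, map_pow, ← hz,
        mul_pow, pow_add]
      have : algebraMap ℂ (RatFunc ℂ) a = algebraMap ℂ[X] (RatFunc ℂ) (Polynomial.C a) := rfl
      rw [this]
      ring
    · obtain ⟨k, rfl⟩ := Nat.exists_eq_add_of_le hN
      rw [Nat.add_sub_cancel_left, Polynomial.eval_monomial]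
      have h1 : P - Polynomial.C r * Q ∣ P ^ n - (Polynomial.C r * Q) ^ n := sub_dvd_pow_sub_pow _ _ n
      convert h1.mul_left (Polynomial.C a * Q ^ k) using 1
      rw [Polynomial.C_mul, Polynomial.C_pow, mul_pow, pow_add]
      ring

/-- Write d = (X - r)d₁ with d₁(r) ≠ 0. Clearing denominators makes (P - rQ)H a square, where H ≡
d₁(r)Q^N modulo P - rQ is coprime to P - rQ. So P - rQ is a square up to a unit, and the unit is a
square in ℂ. -/
theorem exists_sq_of_simple_root {P Q : ℂ[X]} (hPQ : IsCoprime P Q) {z s : RatFunc ℂ}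
    (hz : z * algebraMap ℂ[X] (RatFunc ℂ) Q = algebraMap ℂ[X] (RatFunc ℂ) P) {d : ℂ[X]}
    (hs : s ^ 2 = Polynomial.aeval z d) {r : ℂ} (hr : d.eval r = 0) (hr' : (derivative d).eval r ≠ 0) :
    ∃ A, P - Polynomial.C r * Q = A ^ 2 := by
  obtain ⟨d₁, rfl⟩ := dvd_iff_isRoot.2 hr
  have h1 : d₁.eval r ≠ 0 := by
    simpa [derivative_mul] using hr'
  obtain ⟨N₀, hN⟩ := exists_homogenization r hz d₁
  -- An odd exponent: the factor z - r contributes one more power of Q, and the total 2N₀ + 2 is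
  -- even.
  obtain ⟨H, e, hd⟩ := hN (2 * N₀ + 1) (by omega)
  have h2 : (s * algebraMap ℂ[X] (RatFunc ℂ) Q ^ (N₀ + 1)) ^ 2 =
      algebraMap ℂ[X] (RatFunc ℂ) ((P - Polynomial.C r * Q) * H) := by
    rw [map_mul, map_sub, map_mul, ← e, ← hz, mul_pow, hs, map_mul, map_sub, Polynomial.aeval_X, Polynomial.aeval_C]
    have : algebraMap ℂ (RatFunc ℂ) r = algebraMap ℂ[X] (RatFunc ℂ) (Polynomial.C r) := rfl
    rw [this]
    ring
  obtain ⟨S, hS⟩ := IsIntegrallyClosed.exists_algebraMap_eq_of_isIntegral_pow (R := ℂ[X])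
    (K := RatFunc ℂ) (x := s * algebraMap ℂ[X] (RatFunc ℂ) Q ^ (N₀ + 1)) (n := 2) two_pos
    (by rw [h2]; exact isIntegral_algebraMap)
  rw [← hS, ← map_pow] at h2
  have h3 := IsFractionRing.injective ℂ[X] (RatFunc ℂ) h2
  have hcop : IsCoprime (P - Polynomial.C r * Q) H := by
    obtain ⟨k, hk⟩ := hd
    rw [sub_eq_iff_eq_add, add_comm] at hk
    rw [hk]
    refine IsCoprime.add_mul_left_right ?_ _
    refine (isCoprime_mul_unit_left_right (isUnit_C.2 h1.isUnit) _ _).2 (IsCoprime.pow_right ?_)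
    rw [sub_eq_add_neg, ← neg_mul]
    exact IsCoprime.add_mul_right_left hPQ _
  obtain ⟨A, u, hA⟩ := exists_associated_pow_of_mul_eq_pow' hcop h3.symm
  obtain ⟨c, hc, hcu⟩ := Polynomial.isUnit_iff.1 u.isUnit
  obtain ⟨b, hb⟩ := IsAlgClosed.exists_pow_nat_eq c two_pos
  exact ⟨A * Polynomial.C b, by rw [← hA, ← hcu, ← hb, mul_pow, Polynomial.C_pow]⟩

/-- A hyperelliptic curve `s ^ 2 = d(z)` with at least four branch points has no rational
parametrization. -/
theorem eq_const_of_sq_eq_aeval {d : ℂ[X]} (hd : d.Separable) (h4 : 4 ≤ d.natDegree)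
    {z s : RatFunc ℂ} (hs : s ^ 2 = Polynomial.aeval z d) : ∃ c, z = algebraMap ℂ (RatFunc ℂ) c := by
  have hd0 : d ≠ 0 := by rintro rfl; simp at h4
  have hcard : d.roots.toFinset.card = d.natDegree := by
    rw [Multiset.toFinset_card_of_nodup (nodup_roots hd)]
    exact (IsAlgClosed.splits d).natDegree_eq_card_roots.symm
  obtain ⟨f⟩ : Nonempty (Fin 4 ↪ d.roots.toFinset) := by
    apply Function.Embedding.nonempty_of_card_le
    rw [Fintype.card_fin, Fintype.card_coe, hcard]
    exact h4
  have hcop := RatFunc.isCoprime_num_denom z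
  have hden := RatFunc.denom_ne_zero z
  have hz : z * algebraMap ℂ[X] (RatFunc ℂ) z.denom = algebraMap ℂ[X] (RatFunc ℂ) z.num := by
    conv_lhs => enter [1]; rw [← RatFunc.num_div_denom z]
    exact div_mul_cancel₀ _ (RatFunc.algebraMap_ne_zero hden)
  have hroot : ∀ i, d.eval (f i : ℂ) = 0 := fun i =>
    (mem_roots'.1 (Multiset.mem_toFinset.1 (f i).2)).2
  have hA : ∀ i, ∃ A, z.num - Polynomial.C (f i : ℂ) * z.denom = A ^ 2 := fun i => by
    refine exists_sq_of_simple_root hcop hz hs (hroot i) fun h0 => ?_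
    obtain ⟨a, b, hab⟩ := hd
    have := congrArg (Polynomial.eval (f i : ℂ)) hab
    rw [Polynomial.eval_add, Polynomial.eval_mul, Polynomial.eval_mul, hroot, h0] at this
    simp at this
  choose A hA using hA
  have hw := wronskian_eq_zero_of_sq hcop (r := fun i => (f i : ℂ))
    (Subtype.val_injective.comp f.injective) hA
  -- Coprime polynomials with vanishing Wronskian have zero derivatives, so numerator and
  -- denominator of z are constant.
  obtain ⟨h1, h2⟩ := (IsCoprime.wronskian_eq_zero_iff hcop).1 hw
  obtain ⟨a, ha⟩ := natDegree_eq_zero.1 (derivative_eq_zero.1 h1)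
  obtain ⟨b, hb⟩ := natDegree_eq_zero.1 (derivative_eq_zero.1 h2)
  refine ⟨a / b, ?_⟩
  rw [← hb] at hden
  have hb0 : b ≠ 0 := by rintro rfl; simp at hden
  rw [← ha, ← hb] at hz
  have hC : ∀ c, algebraMap ℂ[X] (RatFunc ℂ) (Polynomial.C c) = algebraMap ℂ (RatFunc ℂ) c := fun c => rfl
  rw [hC, hC] at hz
  rw [map_div₀, eq_div_iff ((_root_.map_ne_zero _).2 hb0), hz]

/-- Up to squares, a real polynomial is squarefree. -/
theorem exists_squarefree_mul_sq (n : ℝ[X]) (hn : n ≠ 0) :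
    ∃ d e : ℝ[X], Squarefree d ∧ n = d * e ^ 2 := by
  induction hk : n.natDegree using Nat.strong_induction_on generalizing n with
  | _ k ih =>
    by_cases hsq : Squarefree n
    · exact ⟨n, 1, hsq, by ring⟩
    · rw [Squarefree] at hsq
      push Not at hsq
      obtain ⟨x, ⟨m, rfl⟩, hx⟩ := hsq
      have hm : m ≠ 0 := right_ne_zero_of_mul hn
      have hx0 : x ≠ 0 := left_ne_zero_of_mul (left_ne_zero_of_mul hn)
      have hx1 : 0 < x.natDegree := Nat.pos_of_ne_zero fun h0 => hx (by
        obtain ⟨c, rfl⟩ := natDegree_eq_zero.1 h0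
        exact isUnit_C.2 (by simpa using hx0))
      rw [natDegree_mul (mul_ne_zero hx0 hx0) hm, natDegree_mul hx0 hx0] at hk
      obtain ⟨d, e, hd, rfl⟩ := ih m.natDegree (by omega) m hm rfl
      exact ⟨d, x * e, hd, by ring⟩

theorem nonneg_of_mul_sq_nonneg {d e : ℝ[X]} (he : e ≠ 0)
    (h : ∀ x, 0 ≤ (d * e ^ 2).eval x) (x : ℝ) : 0 ≤ d.eval x := by
  have h1 : Dense {x : ℝ | e.eval x ≠ 0} := by
    have : {x : ℝ | e.eval x ≠ 0} = (e.rootSet ℝ)ᶜ := by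
      ext x
      simp [mem_rootSet, he]
    rw [this]
    exact (e.rootSet_finite ℝ).countable.dense_compl ℝ
  have h2 : IsClosed {x : ℝ | 0 ≤ d.eval x} := isClosed_le continuous_const d.continuous
  have h3 : {x : ℝ | e.eval x ≠ 0} ⊆ {x : ℝ | 0 ≤ d.eval x} := fun x hx => by
    have h4 := h x
    rw [Polynomial.eval_mul, Polynomial.eval_pow] at h4
    exact nonneg_of_mul_nonneg_left h4 (by positivity [show e.eval x ≠ 0 from hx])
  exact (h2.closure_subset_iff.2 h3) (h1 x)

/-- A zero would be a minimum, hence a zero of the derivative as well, against separability. -/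
theorem eval_ne_zero_of_nonneg {d : ℝ[X]} (hd : d.Separable) (h : ∀ x, 0 ≤ d.eval x) (x : ℝ) :
    d.eval x ≠ 0 := by
  intro h0
  have h1 : IsLocalMin (fun y => d.eval y) x := Filter.Eventually.of_forall fun y => by
    change d.eval x ≤ d.eval y
    rw [h0]; exact h y
  have h2 := h1.deriv_eq_zero
  rw [Polynomial.deriv] at h2
  obtain ⟨a, b, hab⟩ := hd
  have := congrArg (Polynomial.eval x) hab
  rw [Polynomial.eval_add, Polynomial.eval_mul, Polynomial.eval_mul, h0, h2] at this
  simp at this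

theorem natDegree_eq_two_of_irreducible {f : ℝ[X]} (hf : Irreducible f)
    (h : ∀ x, f.eval x ≠ 0) : f.natDegree = 2 := by
  have h1 := hf.natDegree_le_two
  have h2 : f.natDegree ≠ 0 := fun h0 => hf.not_isUnit (by
    obtain ⟨c, rfl⟩ := natDegree_eq_zero.1 h0
    exact isUnit_C.2 (by simpa using hf.ne_zero))
  have h3 : f.natDegree ≠ 1 := fun h0 => by
    obtain ⟨x, hx⟩ := exists_root_of_degree_eq_one ((degree_eq_iff_natDegree_eq_of_pos one_pos).2 h0)
    exact h x hx
  omega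

/-- A real polynomial without real zeros is a product of irreducible quadratics; two factors split
off already settle the cases. -/
theorem natDegree_trichotomy {d : ℝ[X]} (h : ∀ x, d.eval x ≠ 0) :
    d.natDegree = 0 ∨ d.natDegree = 2 ∨ 4 ≤ d.natDegree := by
  have hd0 : d ≠ 0 := by rintro rfl; exact h 0 (by simp)
  by_cases h0 : d.natDegree = 0
  · exact Or.inl h0
  obtain ⟨f, hf, d₁, rfl⟩ := WfDvdMonoid.exists_irreducible_factor
    (fun hu => h0 (natDegree_eq_zero_of_isUnit hu)) hd0
  have hev : ∀ x, f.eval x ≠ 0 ∧ d₁.eval x ≠ 0 := fun x => by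
    have := h x
    rwa [Polynomial.eval_mul, mul_ne_zero_iff] at this
  have hf2 := natDegree_eq_two_of_irreducible hf fun x => (hev x).1
  have hd₁ := right_ne_zero_of_mul hd0
  rw [natDegree_mul hf.ne_zero hd₁, hf2]
  by_cases h1 : d₁.natDegree = 0
  · omega
  obtain ⟨f', hf', d₂, rfl⟩ := WfDvdMonoid.exists_irreducible_factor
    (fun hu => h1 (natDegree_eq_zero_of_isUnit hu)) hd₁
  have hev' : ∀ x, f'.eval x ≠ 0 := fun x => by
    have := (hev x).2
    rw [Polynomial.eval_mul, mul_ne_zero_iff] at this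
    exact this.1
  have hf2' := natDegree_eq_two_of_irreducible hf' hev'
  rw [natDegree_mul hf'.ne_zero (right_ne_zero_of_mul hd₁), hf2']
  omega

end SquarePencil

/-! ### The curve of fixed points of a traceless map -/

theorem aeval_point_eq_zero {F : MvPolynomial (Fin 3) ℝ} (h : toFun F = 0) {P : Fin 3 → ℂ}
    (hP : P 0 ^ 2 + P 1 ^ 2 + P 2 ^ 2 = 1) : aeval P F = 0 := by
  rw [← eval_cpoly]
  exact toC_eq_zero (by rw [toC_cpoly, h, map_zero]) hP

theorem finite_aeval_eq_zero {p : Polynomial ℝ} (hp : p ≠ 0) :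
    {z : ℂ | Polynomial.aeval z p = 0}.Finite := by
  have : {z : ℂ | Polynomial.aeval z p = 0} = p.rootSet ℂ := by
    ext z
    simp [Polynomial.mem_rootSet, hp]
  rw [this]
  exact p.rootSet_finite ℂ

namespace QPoly

variable {q : QPoly} {g : Bir}

theorem isFixedPoint_iff (hg : q.Acts g) {P : Fin 3 → ℂ} :
    IsFixedPoint g P ↔ P 0 ^ 2 + P 1 ^ 2 + P 2 ^ 2 = 1 ∧
      (∃ N D : MvPolynomial (Fin 3) ℝ,
        aeval P D ≠ 0 ∧ g xS * toFun D = toFun N ∧ aeval P N = P 0 * aeval P D) ∧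
      ∃ N D : MvPolynomial (Fin 3) ℝ,
        aeval P D ≠ 0 ∧ g yS * toFun D = toFun N ∧ aeval P N = P 1 * aeval P D := by
  refine ⟨fun h => ⟨h.1, h.2 0, h.2 1⟩, fun ⟨h, hx, hy⟩ => ⟨h, fun i => ?_⟩⟩
  fin_cases i
  · exact hx
  · exact hy
  · refine ⟨X 2, 1, by simp, ?_, by simp⟩
    rw [map_one, mul_one]
    exact baseChange_zC_eq_iff.1 hg.1

/-- The fixed point equation t(b̄t + ā) = at + b t t̄ becomes, after division by t, the vanishing of
2i times the "imaginary part" of b̄t + ā. At complex points x, y are not real, so J = i and J = -i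
are used in turn; together they give the square of the wanted expression. -/
theorem denIm_eq_zero_algebra {x y A B₁ B₂ D : ℂ} (hD : x ^ 2 + y ^ 2 = D) (hD0 : D ≠ 0)
    (h₁ : (A * y + B₁ * D) * (B₁ * x - B₂ * y) + (A * x + B₂ * D) * (-B₁ * y - B₂ * x - A) =
      x * ((B₁ * x - B₂ * y) ^ 2 + (-B₁ * y - B₂ * x - A) ^ 2))
    (h₂ : (A * y + B₁ * D) * (-B₁ * y - B₂ * x - A) - (A * x + B₂ * D) * (B₁ * x - B₂ * y) =
      y * ((B₁ * x - B₂ * y) ^ 2 + (-B₁ * y - B₂ * x - A) ^ 2)) :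
    -B₁ * y - B₂ * x - A = 0 := by
  have key : ∀ J : ℂ, J ^ 2 = -1 → (B₁ * x - B₂ * y - J * (-B₁ * y - B₂ * x - A)) *
      (-B₁ * y - B₂ * x - A) = 0 := fun J hJ => by
    have ht : (x - J * y) ≠ 0 := fun h0 => hD0 (by
      rw [← hD]
      linear_combination (x + J * y) * h0 + y ^ 2 * hJ)
    have hJ0 : J ≠ 0 := by rintro rfl; norm_num at hJ
    have : (x - J * y) * (2 * J * ((B₁ * x - B₂ * y - J * (-B₁ * y - B₂ * x - A)) *
      (-B₁ * y - B₂ * x - A))) = 0 := by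
      subst hD
      linear_combination -h₁ + J * h₂ + (-y * (B₁ * x - B₂ * y - J * (-B₁ * y - B₂ * x - A)) +
        (A * x + B₂ * (x ^ 2 + y ^ 2)) - (x - J * y) * (-B₁ * y - B₂ * x - A)) *
        (-B₁ * y - B₂ * x - A) * hJ
    simpa [ht, hJ0] using this
  have h1 := key Complex.I Complex.I_sq
  have h2 := key (-Complex.I) (by rw [neg_sq, Complex.I_sq])
  have h3 : 2 * Complex.I * (-B₁ * y - B₂ * x - A) ^ 2 = 0 := by linear_combination h2 - h1
  simpa using h3

theorem aeval_denIm_of_isFixedPoint (hg : q.Acts g) (h0 : q.a₁ = 0)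
    {P : Fin 3 → ℂ} (hP : IsFixedPoint g P)
    (hz : 1 - P 2 ^ 2 ≠ 0) : aeval P q.denIm = 0 := by
  obtain ⟨hS, ⟨N, D, hD, hx, hNx⟩, ⟨N', D', hD', hy, hNy⟩⟩ := (isFixedPoint_iff hg).1 hP
  obtain ⟨ex, ey⟩ := hg.xS_yS
  have h1 := aeval_point_eq_zero (F := N * (q.denRe ^ 2 + q.denIm ^ 2) -
    D * (q.numRe * q.denRe + q.numIm * q.denIm)) (by
      rw [map_sub, map_mul, map_mul, ← ex, ← hx]; ring) hS
  have h2 := aeval_point_eq_zero (F := N' * (q.denRe ^ 2 + q.denIm ^ 2) -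
    D' * (q.numRe * q.denIm - q.numIm * q.denRe)) (by
      rw [map_sub, map_mul, map_mul, ← ey, ← hy]; ring) hS
  rw [map_sub, map_mul, map_mul, hNx] at h1
  rw [map_sub, map_mul, map_mul, hNy] at h2
  have h3 : aeval P (q.numRe * q.denRe + q.numIm * q.denIm) =
      P 0 * aeval P (q.denRe ^ 2 + q.denIm ^ 2) :=
    mul_left_cancel₀ hD (by linear_combination -h1)
  have h4 : aeval P (q.numRe * q.denIm - q.numIm * q.denRe) =
      P 1 * aeval P (q.denRe ^ 2 + q.denIm ^ 2) :=
    mul_left_cancel₀ hD' (by linear_combination -h2)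
  simp only [denRe, denIm, numRe, numIm, h0, map_add, map_sub, map_mul, map_neg, map_pow, map_one,
    aeval_X, aeval_pz, map_zero] at h3 h4 ⊢
  refine denIm_eq_zero_algebra (D := 1 - P 2 ^ 2) (by linear_combination hS) hz ?_ ?_
  · linear_combination h3
  · linear_combination h4

/-- Where the imaginary part of the denominator vanishes, the square of its real part is minus the
norm. The common denominator is therefore nonzero, and the formulas for x and y return the point
itself. -/
theorem isFixedPoint_of_aeval_denIm (hg : q.Acts g) (h0 : q.a₁ = 0)
    {P : Fin 3 → ℂ} (hS : P 0 ^ 2 + P 1 ^ 2 + P 2 ^ 2 = 1)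
    (hP : aeval P q.denIm = 0) (hn : Polynomial.aeval (P 2) q.norm ≠ 0) : IsFixedPoint g P := by
  obtain ⟨ex, ey⟩ := hg.xS_yS
  have hD : 1 - P 2 ^ 2 = P 0 ^ 2 + P 1 ^ 2 := by linear_combination hS.symm
  have hV : aeval P q.denRe ^ 2 = -Polynomial.aeval (P 2) q.norm := by
    simp only [denRe, denIm, norm, h0, map_add, map_sub, map_mul, map_neg, map_pow, map_one,
      aeval_X, aeval_pz, map_zero, Polynomial.aeval_X] at hP ⊢
    rw [hD]
    linear_combination (Polynomial.aeval (P 2) q.b₁ * P 1 + Polynomial.aeval (P 2) q.b₂ * P 0 -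
      Polynomial.aeval (P 2) q.a₂) * hP
  have hΔ : aeval P (q.denRe ^ 2 + q.denIm ^ 2) ≠ 0 := by
    rw [map_add, map_pow, map_pow, hP, hV]
    simpa using hn
  refine (isFixedPoint_iff hg).2 ⟨hS, ⟨_, _, hΔ, ex, ?_⟩, ⟨_, _, hΔ, ey, ?_⟩⟩
  all_goals
    simp only [map_add, map_sub, map_mul, map_pow, hP]
    simp only [denRe, denIm, numRe, numIm, h0, map_add, map_sub, map_mul, map_neg, map_pow,
      map_one, aeval_X, aeval_pz, map_zero] at hP ⊢
    rw [hD]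
    have hA : Polynomial.aeval (P 2) q.a₂ =
      -Polynomial.aeval (P 2) q.b₁ * P 1 - Polynomial.aeval (P 2) q.b₂ * P 0 := by
      linear_combination -hP
    rw [hA]
    ring

/-- This exhibits the curve of fixed points as the double cover s² = -N(z) of the base, with s the
real part of the denominator. -/
theorem aeval_denRe_sq (hg : q.Acts g) (h0 : q.a₁ = 0)
    {P : Fin 3 → ℂ} (hP : IsFixedPoint g P) (hz : 1 - P 2 ^ 2 ≠ 0) :
    aeval P q.denRe ^ 2 = -Polynomial.aeval (P 2) q.norm := by
  have h1 := aeval_denIm_of_isFixedPoint hg h0 hP hz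
  have hD : 1 - P 2 ^ 2 = P 0 ^ 2 + P 1 ^ 2 := by linear_combination hP.1.symm
  simp only [denRe, denIm, norm, h0, map_add, map_sub, map_mul, map_neg, map_pow, map_one,
    aeval_X, aeval_pz, map_zero, Polynomial.aeval_X] at h1 ⊢
  rw [hD]
  linear_combination (Polynomial.aeval (P 2) q.b₁ * P 1 + Polynomial.aeval (P 2) q.b₂ * P 0 -
    Polynomial.aeval (P 2) q.a₂) * h1

/-- The equations "real part = s, imaginary part = 0" are linear in x and y with determinant b₁² +
b₂² up to sign; the relation for s² is the condition that the solution lie on the quadric. -/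
theorem exists_isFixedPoint (hg : q.Acts g) (h0 : q.a₁ = 0) {z s : ℂ}
    (hb : Polynomial.aeval z (q.b₁ ^ 2 + q.b₂ ^ 2) ≠ 0) (hn : Polynomial.aeval z q.norm ≠ 0)
    (hs : s ^ 2 = -Polynomial.aeval z q.norm) :
    ∃ P, IsFixedPoint g P ∧ P 2 = z ∧ aeval P q.denRe = s := by
  set A := Polynomial.aeval z q.a₂ with hA
  set B₁ := Polynomial.aeval z q.b₁ with hB₁
  set B₂ := Polynomial.aeval z q.b₂ with hB₂
  rw [map_add, map_pow, map_pow, ← hB₁, ← hB₂] at hb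
  obtain ⟨P, hP⟩ : ∃ P : Fin 3 → ℂ, P = ![(B₁ * s - B₂ * A) / (B₁ ^ 2 + B₂ ^ 2),
    (-B₂ * s - B₁ * A) / (B₁ ^ 2 + B₂ ^ 2), z] := ⟨_, rfl⟩
  have hx : P 0 = (B₁ * s - B₂ * A) / (B₁ ^ 2 + B₂ ^ 2) := by rw [hP]; rfl
  have hy : P 1 = (-B₂ * s - B₁ * A) / (B₁ ^ 2 + B₂ ^ 2) := by rw [hP]; rfl
  have hz : P 2 = z := by rw [hP]; rfl
  have hs' := hs
  simp only [norm, h0, map_add, map_sub, map_mul, map_pow, map_one, map_zero,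
    Polynomial.aeval_X, ← hA, ← hB₁, ← hB₂] at hs'
  refine ⟨P, isFixedPoint_of_aeval_denIm hg h0 ?_ ?_ (by rwa [hz]), hz, ?_⟩
  · rw [hx, hy, hz]
    field_simp
    linear_combination (B₁ ^ 2 + B₂ ^ 2) * hs'
  · simp only [denIm, map_sub, map_mul, map_neg, aeval_X, aeval_pz, hz, hx, hy, ← hA,
      ← hB₁, ← hB₂]
    field_simp
    ring
  · simp only [denRe, h0, map_sub, map_mul, map_add, aeval_X, aeval_pz, hz, hx, hy,
      ← hB₁, ← hB₂, map_zero]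
    field_simp
    ring

theorem mem_fixIdeal_of_forall {p : Polynomial ℝ} (hp : p ≠ 0) {F : MvPolynomial (Fin 3) ℂ}
    (h : ∀ P, IsFixedPoint g P → Polynomial.aeval (P 2) p ≠ 0 → eval P F = 0) :
    F ∈ fixIdeal g := by
  refine (finite_aeval_eq_zero hp).subset ?_
  rintro z ⟨P, hP, rfl, hF⟩
  by_contra h1
  exact hF (h P hP h1)

theorem not_mem_fixIdeal {p : Polynomial ℝ} (hp : p ≠ 0) {F : MvPolynomial (Fin 3) ℂ}
    (h : ∀ z, Polynomial.aeval z p ≠ 0 → ∃ P, IsFixedPoint g P ∧ P 2 = z ∧ eval P F ≠ 0) :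
    F ∉ fixIdeal g := by
  intro hF
  have h1 : {z : ℂ | ∃ P, IsFixedPoint g P ∧ P 2 = z ∧ eval P F ≠ 0}.Finite := hF
  refine Set.infinite_univ (h1.union (finite_aeval_eq_zero hp) |>.subset fun z _ => ?_)
  by_cases hz : Polynomial.aeval z p = 0
  · exact Or.inr hz
  · exact Or.inl (h z hz)

theorem one_sub_X_sq_ne_zero : (1 - Polynomial.X ^ 2 : Polynomial ℝ) ≠ 0 := by
  intro h
  have := congrArg (Polynomial.eval 0) h
  simp at this

theorem cpoly_denRe_sq_mem (hg : q.Acts g) (h0 : q.a₁ = 0) :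
    cpoly (q.denRe ^ 2 + pz q.norm) ∈ fixIdeal g :=
  mem_fixIdeal_of_forall one_sub_X_sq_ne_zero fun P hP hz => by
    rw [eval_cpoly, map_add, map_pow, aeval_denRe_sq hg h0 hP (by simpa using hz), aeval_pz]
    ring

/-- For b = 0 the equation of the fixed points reads a₂(z) = 0, so general fibres contain none and
the ideal is the unit ideal. -/
theorem b_ne_zero (hg : q.Acts g) (h0 : q.a₁ = 0) (hn : q.norm ≠ 0)
    (hI : fixIdeal g ≠ ⊤) : q.b₁ ^ 2 + q.b₂ ^ 2 ≠ 0 := by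
  intro hb
  have hA : q.a₂ ≠ 0 := by
    intro hA
    rw [norm, hb, hA, h0] at hn
    simp at hn
  have hb' : ∀ x, q.b₁.eval x = 0 ∧ q.b₂.eval x = 0 := fun x => by
    have := congrArg (Polynomial.eval x) hb
    simp only [Polynomial.eval_add, Polynomial.eval_pow, Polynomial.eval_zero] at this
    constructor <;> nlinarith
  have hb₁ : q.b₁ = 0 := Polynomial.funext fun x => by simpa using (hb' x).1
  have hb₂ : q.b₂ = 0 := Polynomial.funext fun x => by simpa using (hb' x).2
  refine hI ((Ideal.eq_top_iff_one _).2 ?_)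
  refine mem_fixIdeal_of_forall (mul_ne_zero one_sub_X_sq_ne_zero hA) fun P hP hz => ?_
  rw [map_mul, mul_ne_zero_iff] at hz
  have := aeval_denIm_of_isFixedPoint hg h0 hP (by simpa using hz.1)
  simp only [denIm, hb₁, hb₂, map_sub, map_mul, map_neg, aeval_pz, map_zero] at this
  exact absurd (by simpa using this) hz.2

/-- If the curve of fixed points has no real point, the norm is nonnegative. -/
theorem norm_nonneg (hg : q.Acts g) (h0 : q.a₁ = 0) (hR : HasNoRealPoint (fixIdeal g)) (r : ℝ) :
    0 ≤ q.norm.eval r := by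
  by_contra! hneg
  set B : Polynomial ℝ := q.b₁ ^ 2 + q.b₂ ^ 2 with hB
  -- Where the norm is negative, these fixed points are real, and they move continuously with the
  -- height x.
  let s : ℝ → ℝ := fun x => √(-q.norm.eval x)
  let P : ℝ → Fin 3 → ℝ := fun x => ![(q.b₁.eval x * s x - q.b₂.eval x * q.a₂.eval x) / B.eval x,
    (-q.b₂.eval x * s x - q.b₁.eval x * q.a₂.eval x) / B.eval x, x]
  have hBne : ∀ x, q.norm.eval x < 0 → B.eval x ≠ 0 := fun x hx h => by
    rw [eval_norm] at hx
    simp only [hB, Polynomial.eval_add, Polynomial.eval_pow] at h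
    rw [h] at hx
    nlinarith [sq_nonneg (q.a₁.eval x), sq_nonneg (q.a₂.eval x)]
  have hs : ∀ x, q.norm.eval x < 0 → s x ^ 2 = -q.norm.eval x := fun x hx =>
    Real.sq_sqrt (by linarith)
  have hP : ∀ x, q.norm.eval x < 0 → P x ∈ realPoints := fun x hx => by
    have h1 := hs x hx
    have h2 := hBne x hx
    rw [eval_norm, h0, Polynomial.eval_zero] at h1
    simp only [hB, Polynomial.eval_add, Polynomial.eval_pow] at h2
    change ((q.b₁.eval x * s x - q.b₂.eval x * q.a₂.eval x) / B.eval x) ^ 2 +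
      ((-q.b₂.eval x * s x - q.b₁.eval x * q.a₂.eval x) / B.eval x) ^ 2 + x ^ 2 = 1
    simp only [hB, Polynomial.eval_add, Polynomial.eval_pow]
    field_simp
    linear_combination (q.b₁.eval x ^ 2 + q.b₂.eval x ^ 2) * h1
  have hfix : ∀ x, q.norm.eval x < 0 → IsFixedPoint g (fun i => (P x i : ℂ)) := fun x hx => by
    have hae : ∀ F : MvPolynomial (Fin 3) ℝ,
        aeval (fun i => (P x i : ℂ)) F = ((eval (P x) F : ℝ) : ℂ) := fun F => by
      rw [← MvPolynomial.coe_aeval_eq_eval]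
      exact (aeval_algebraMap_apply ℂ (P x) F)
    have hpe : Polynomial.aeval (x : ℂ) q.norm = ((q.norm.eval x : ℝ) : ℂ) := by
      rw [← Polynomial.coe_aeval_eq_eval]
      exact Polynomial.aeval_algebraMap_apply ℂ x q.norm
    refine isFixedPoint_of_aeval_denIm hg h0 ?_ ?_ ?_
    · have := hP x hx
      change P x 0 ^ 2 + P x 1 ^ 2 + P x 2 ^ 2 = 1 at this
      exact_mod_cast this
    · have h2 := hBne x hx
      rw [hae, Complex.ofReal_eq_zero]
      simp only [hB, Polynomial.eval_add, Polynomial.eval_pow] at h2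
      simp only [denIm, map_sub, map_mul, map_neg, eval_X, eval_pz]
      change -q.b₁.eval x * ((-q.b₂.eval x * s x - q.b₁.eval x * q.a₂.eval x) / B.eval x) -
        q.b₂.eval x * ((q.b₁.eval x * s x - q.b₂.eval x * q.a₂.eval x) / B.eval x) -
        q.a₂.eval x = 0
      simp only [hB, Polynomial.eval_add, Polynomial.eval_pow]
      field_simp
      ring
    · change Polynomial.aeval (x : ℂ) q.norm ≠ 0
      rw [hpe, Complex.ofReal_ne_zero]
      exact hx.ne
  obtain ⟨F, hF, hFr⟩ := hR (P r) (hP r hneg)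
  -- A member of the ideal that is nonzero at the point over r stays nonzero at the fixed points
  -- over a neighbourhood of r, that is, in infinitely many fibres.
  have hcont : ContinuousAt (fun x => eval (fun i => (P x i : ℂ)) F) r := by
    have hB' := hBne r hneg
    have h1 : ContinuousAt P r := by
      have hsc : ContinuousAt s r := (q.norm.continuous.neg.sqrt).continuousAt
      refine continuousAt_pi.2 fun i => ?_
      fin_cases i
      · exact ((q.b₁.continuousAt.mul hsc).sub
          (q.b₂.continuousAt.mul q.a₂.continuousAt)).div B.continuousAt hB'
      · exact (((q.b₂.continuousAt.neg).mul hsc).sub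
          (q.b₁.continuousAt.mul q.a₂.continuousAt)).div B.continuousAt hB'
      · exact continuousAt_id
    have h2 : ContinuousAt (fun x => fun i => ((P x i : ℝ) : ℂ)) r :=
      continuousAt_pi.2 fun i => Complex.continuous_ofReal.continuousAt.comp
        ((continuous_apply i).continuousAt.comp h1)
    exact (MvPolynomial.continuous_eval F).continuousAt.comp h2
  have hev := (hcont.eventually_ne hFr).and
    (q.norm.continuous.continuousAt.eventually_lt continuousAt_const hneg)
  have hinf := infinite_of_mem_nhds r hev
  have hfin : {z : ℂ | ∃ P, IsFixedPoint g P ∧ P 2 = z ∧ eval P F ≠ 0}.Finite := hF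
  refine hinf ((hfin.preimage Complex.ofReal_injective.injOn).subset
    fun x hx => ?_)
  exact ⟨_, hfix x hx.2, rfl, hx.1⟩

end QPoly

/-! ### Rationality of the curve of fixed points -/

/-- A parametrization of the curve by its generic point, with kernel exactly the ideal. -/
theorem IsRationalCurve.exists_algHom {I : Ideal (MvPolynomial (Fin 3) ℂ)}
    (h : IsRationalCurve I) :
    ∃ φ : MvPolynomial (Fin 3) ℂ →ₐ[ℂ] RatFunc ℂ, ∀ F, φ F = 0 ↔ F ∈ I := by
  obtain ⟨hI, ⟨e⟩⟩ := h
  refine ⟨(e.toAlgHom.comp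
    (IsScalarTower.toAlgHom ℂ (MvPolynomial (Fin 3) ℂ ⧸ I) _)).comp (Ideal.Quotient.mkₐ ℂ I),
    fun F => ?_⟩
  change e (algebraMap (MvPolynomial (Fin 3) ℂ ⧸ I) _ (Ideal.Quotient.mk I F)) = 0 ↔ _
  rw [map_eq_zero_iff e e.injective, map_eq_zero_iff _ (IsFractionRing.injective _ _),
    Ideal.Quotient.eq_zero_iff_mem]

theorem exists_monic_quadratic {d : Polynomial ℝ} (hd : d.natDegree = 2)
    (h : ∀ x, 0 < d.eval x) : ∃ k m p : ℝ, 0 < k ∧ m ^ 2 < p ∧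
      d = Polynomial.C k *
        (Polynomial.X ^ 2 - Polynomial.C (2 * m) * Polynomial.X + Polynomial.C p) := by
  obtain ⟨k, b, c, rfl⟩ : ∃ k b c : ℝ, d = Polynomial.C k * Polynomial.X ^ 2 +
      Polynomial.C b * Polynomial.X + Polynomial.C c :=
    ⟨_, _, _, Polynomial.eq_quadratic_of_degree_le_two (Polynomial.natDegree_le_iff_degree_le.1 hd.le)⟩
  have h' : ∀ x : ℝ, 0 < k * x ^ 2 + b * x + c := fun x => by simpa using h x
  have hk : k ≠ 0 := by
    rintro rfl
    have : (Polynomial.C b * Polynomial.X + Polynomial.C c).natDegree ≤ 1 :=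
      Polynomial.natDegree_linear_le
    simp only [Polynomial.C_0, zero_mul, zero_add] at hd
    omega
  have hk0 : 0 < k := by
    by_contra! hneg
    have hk1 : k < 0 := lt_of_le_of_ne hneg hk
    have hc := h' 0
    simp only [ne_eq, OfNat.ofNat_ne_zero, not_false_eq_true, zero_pow, mul_zero, zero_add] at hc
    have h1 := h' (1 - c / k)
    have h2 := h' (-(1 - c / k))
    have h3 : c / k < 0 := div_neg_of_pos_of_neg hc hk1
    have h4 : k * (c / k) = c := by field_simp
    nlinarith
  have h1 := h' (-b / (2 * k))
  refine ⟨k, -b / (2 * k), c / k, hk0, ?_, ?_⟩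
  · have h2 : k * (-b / (2 * k)) ^ 2 + b * (-b / (2 * k)) + c =
        k * (c / k - (-b / (2 * k)) ^ 2) := by field_simp; ring
    rw [h2] at h1
    linarith [pos_of_mul_pos_right h1 hk0.le |>.le, (mul_pos_iff_of_pos_left hk0).1 h1]
  · rw [mul_add, mul_sub, ← mul_assoc, ← Polynomial.C_mul, ← Polynomial.C_mul]
    have e1 : k * (2 * (-b / (2 * k))) = -b := by field_simp
    have e2 : k * (c / k) = c := by field_simp
    rw [e1, e2, Polynomial.C_neg]
    ring

namespace QPoly

variable {q : QPoly} {g : Bir}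

theorem cpoly_pz (p : Polynomial ℝ) :
    cpoly (pz p) = Polynomial.aeval (X 2 : MvPolynomial (Fin 3) ℂ) p := by
  have h : (cpoly : MvPolynomial (Fin 3) ℝ →+* MvPolynomial (Fin 3) ℂ) =
    (MvPolynomial.mapAlgHom (Algebra.ofId ℝ ℂ) : MvPolynomial (Fin 3) ℝ →ₐ[ℝ] _).toRingHom := rfl
  rw [h, pz]
  change MvPolynomial.mapAlgHom (Algebra.ofId ℝ ℂ) _ = _
  rw [← Polynomial.aeval_algHom_apply]
  simp

/-- If the norm is minus a square, the fixed curve has two sheets. On the one with s = ce the given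
function equals 2ce, which is nonzero in general fibres. -/
theorem not_mem_of_factor (hg : q.Acts g) (h0 : q.a₁ = 0)
    (hn : q.norm ≠ 0) (hb : q.b₁ ^ 2 + q.b₂ ^ 2 ≠ 0) {c : ℂ} {e : Polynomial ℝ}
    (he : ∀ z : ℂ, Polynomial.aeval z q.norm = -(c * Polynomial.aeval z e) ^ 2) :
    cpoly q.denRe + C c * cpoly (pz e) ∉ fixIdeal g := by
  refine not_mem_fixIdeal (mul_ne_zero hb hn) fun z hz => ?_
  rw [map_mul, mul_ne_zero_iff] at hz
  obtain ⟨P, hP, rfl, hs⟩ := exists_isFixedPoint hg h0 (s := c * Polynomial.aeval z e) hz.1 hz.2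
    (by rw [he, neg_neg])
  refine ⟨P, hP, rfl, ?_⟩
  rw [map_add, map_mul, eval_cpoly, eval_cpoly, eval_C, hs, aeval_pz]
  have h1 := hz.2
  rw [he, neg_ne_zero] at h1
  intro h2
  exact (pow_ne_zero_iff two_ne_zero).1 h1 (by linear_combination h2 / 2)

/-- If the curve of fixed points is irreducible, its branch divisor is not empty. -/
theorem natDegree_ne_zero (hg : q.Acts g) (h0 : q.a₁ = 0) (hn : q.norm ≠ 0)
    (hI : (fixIdeal g).IsPrime) {d e : Polynomial ℝ} (hd : q.norm = d * e ^ 2) :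
    d.natDegree ≠ 0 := by
  intro hdeg
  obtain ⟨k, rfl⟩ := Polynomial.natDegree_eq_zero.1 hdeg
  obtain ⟨c, hc⟩ := IsAlgClosed.exists_pow_nat_eq (-(k : ℂ)) two_pos
  have hk : k ≠ 0 := by
    rintro rfl
    rw [hd] at hn
    simp at hn
  have hc0 : c ≠ 0 := by
    rintro rfl
    simp at hc
    exact hk hc
  have hb := b_ne_zero hg h0 hn hI.ne_top
  have hev : ∀ z : ℂ, Polynomial.aeval z q.norm = -(c * Polynomial.aeval z e) ^ 2 := fun z => by
    rw [hd, map_mul, map_pow, Polynomial.aeval_C, mul_pow, hc, Complex.coe_algebraMap]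
    ring
  -- With c² = -k the equation s² = -k e² splits into two factors. A prime ideal contains one of
  -- them, but each factor is nonzero on one of the two sheets.
  have hmem : (cpoly q.denRe + C c * cpoly (pz e)) * (cpoly q.denRe + C (-c) * cpoly (pz e)) ∈
      fixIdeal g := by
    have h1 := cpoly_denRe_sq_mem hg h0
    convert h1 using 1
    have h2 : cpoly (C k) = -(C c) ^ 2 := by
      rw [← C_pow, hc, ← C_neg, neg_neg]
      exact MvPolynomial.map_C _ _
    have h3 : pz (Polynomial.C k * e ^ 2) = C k * pz e ^ 2 := by
      rw [pz, map_mul, map_pow, Polynomial.aeval_C]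
      rfl
    rw [hd, h3, map_add, map_pow, map_mul, map_pow, h2, C_neg]
    ring
  rcases hI.mem_or_mem hmem with h | h
  · exact not_mem_of_factor hg h0 hn hb hev h
  · exact not_mem_of_factor hg h0 hn hb
      (fun z => by rw [hev]; ring) h

/-- If the curve of fixed points is rational, it has fewer than four branch points. -/
theorem natDegree_lt_four (hg : q.Acts g) (h0 : q.a₁ = 0) (hn : q.norm ≠ 0)
    (hI : IsRationalCurve (fixIdeal g)) {d e : Polynomial ℝ} (hsq : Squarefree d)
    (hd : q.norm = d * e ^ 2) : d.natDegree < 4 := by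
  by_contra! h4
  obtain ⟨φ, hφ⟩ := hI.exists_algHom
  have hb := b_ne_zero hg h0 hn hI.1.ne_top
  -- The function z is not constant on the curve, since general fibres contain fixed points.
  have hz : ∀ c, φ (X 2) ≠ algebraMap ℂ (RatFunc ℂ) c := fun c hc => by
    have h1 : X 2 - C c ∈ fixIdeal g := (hφ _).1 (by
      rw [map_sub, hc, sub_eq_zero]
      exact (φ.commutes c).symm)
    have h2 : {z : ℂ | ∃ P, IsFixedPoint g P ∧ P 2 = z ∧ eval P (X 2 - C c) ≠ 0}.Finite := h1
    refine Set.infinite_univ (((h2.union (finite_aeval_eq_zero (mul_ne_zero hb hn))).union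
      (Set.finite_singleton c)).subset fun z _ => ?_)
    by_cases hz : Polynomial.aeval z ((q.b₁ ^ 2 + q.b₂ ^ 2) * q.norm) = 0
    · exact Or.inl (Or.inr hz)
    by_cases hzc : z = c
    · exact Or.inr hzc
    refine Or.inl (Or.inl ?_)
    rw [map_mul, ← ne_eq, mul_ne_zero_iff] at hz
    obtain ⟨s, hs⟩ := IsAlgClosed.exists_pow_nat_eq (-Polynomial.aeval z q.norm) two_pos
    obtain ⟨P, hP, hPz, -⟩ := exists_isFixedPoint hg h0 hz.1 hz.2 hs
    refine ⟨P, hP, hPz, ?_⟩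
    rw [map_sub, eval_X, eval_C, hPz]
    exact sub_ne_zero.2 hzc
  have hpz : ∀ p : Polynomial ℝ, φ (cpoly (pz p)) =
      Polynomial.aeval (φ (X 2)) (p.map (algebraMap ℝ ℂ)) := fun p => by
    rw [cpoly_pz, Polynomial.aeval_map_algebraMap]
    exact (Polynomial.aeval_algHom_apply (φ.restrictScalars ℝ) (X 2) p).symm
  have h1 := (hφ _).2 (cpoly_denRe_sq_mem hg h0)
  rw [map_add, map_add, map_pow, map_pow, hpz, hd, Polynomial.map_mul, Polynomial.map_pow,
    map_mul, map_pow] at h1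
  have he : e.map (algebraMap ℝ ℂ) ≠ 0 := by
    rw [Polynomial.map_ne_zero_iff (algebraMap ℝ ℂ).injective]
    rintro rfl
    rw [hd] at hn
    simp at hn
  have he' : Polynomial.aeval (φ (X 2)) (e.map (algebraMap ℝ ℂ)) ≠ 0 := by
    intro h2
    obtain ⟨r, hr⟩ := (IsAlgClosed.splits (e.map (algebraMap ℝ ℂ))).mem_range_of_isRoot
      (i := algebraMap ℂ (RatFunc ℂ)) he
      (x := φ (X 2)) (by rwa [Polynomial.IsRoot, Polynomial.eval_map_algebraMap])
    exact hz r hr.symm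
  set w := Polynomial.aeval (φ (X 2)) (e.map (algebraMap ℝ ℂ)) with hw
  have hsep : (d.map (algebraMap ℝ ℂ)).Separable :=
    (PerfectField.separable_iff_squarefree.2 hsq).map
  -- As s² = -d e² on the curve, the function i s/e has square d(z); this would parametrize a curve
  -- with at least four branch points.
  obtain ⟨c, hc⟩ := eq_const_of_sq_eq_aeval hsep (by rwa [Polynomial.natDegree_map])
    (z := φ (X 2)) (s := algebraMap ℂ (RatFunc ℂ) Complex.I * φ (cpoly q.denRe) / w) (by
      have hI2 : algebraMap ℂ (RatFunc ℂ) Complex.I ^ 2 = -1 := by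
        rw [← map_pow, Complex.I_sq, map_neg, map_one]
      rw [div_pow, mul_pow, hI2, div_eq_iff (pow_ne_zero 2 he')]
      linear_combination -h1)
  exact hz c hc

/-- The norm of an involution whose curve of fixed points is rational without real points. -/
theorem Acts.exists_norm_eq (hg : q.Acts g) (h0 : q.a₁ = 0) (hn : q.norm ≠ 0)
    (hI : IsRationalCurve (fixIdeal g)) (hR : HasNoRealPoint (fixIdeal g)) :
    ∃ m p : ℝ, ∃ e : Polynomial ℝ, m ^ 2 < p ∧ q.norm =
      (Polynomial.X ^ 2 - Polynomial.C (2 * m) * Polynomial.X + Polynomial.C p) * e ^ 2 := by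
  obtain ⟨d, e, hsq, hd⟩ := exists_squarefree_mul_sq q.norm hn
  have he : e ≠ 0 := by
    rintro rfl
    rw [hd] at hn
    simp at hn
  have hd0 : ∀ x, 0 ≤ d.eval x := nonneg_of_mul_sq_nonneg he fun x => by
    rw [← hd]
    exact norm_nonneg hg h0 hR x
  have hd1 := eval_ne_zero_of_nonneg (PerfectField.separable_iff_squarefree.2 hsq) hd0
  have h2 : d.natDegree = 2 := by
    have h3 := natDegree_trichotomy hd1
    have h4 := natDegree_ne_zero hg h0 hn hI.1 hd
    have h5 := natDegree_lt_four hg h0 hn hI hsq hd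
    omega
  obtain ⟨k, m, p, hk, hm, rfl⟩ := exists_monic_quadratic h2 fun x =>
    lt_of_le_of_ne (hd0 x) (hd1 x).symm
  refine ⟨m, p, Polynomial.C √k * e, hm, ?_⟩
  rw [hd, mul_pow, ← Polynomial.C_pow, Real.sq_sqrt hk.le]
  ring

end QPoly

/-! ### Normal form of an involution over the base -/

section NormalFormAlgebra
variable {K : Type*} [Field K]

/-- Eliminates the image τ of t from the two relations that express an involution. The vanishing
coefficients force trace zero or a scalar matrix. -/
theorem moebius_sq_algebra {t τ a b c d : K} (h : τ * (c * t + d) = a * t + b)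
    (h' : t * (c * τ + d) = a * τ + b) :
    c * (a + d) * t ^ 2 + (d ^ 2 - a ^ 2) * t + -(b * (a + d)) = 0 := by
  linear_combination (c * t + d) * h' - (t * c - a) * h

/-- Eliminates the images of t and t̄, using that both pairs have product D; the coefficients
express compatibility of the matrix with the real structure. -/
theorem moebius_conj_algebra {t t' τ τ' a a' b b' c c' D : K} (h : τ * (c * t - a) = a * t + b)
    (h' : τ' * (c' * t' - a') = a' * t' + b') (ht : t * t' = D) (hτ : τ * τ' = D) :
    (-(D * a' * c) - a * b') * t ^ 2 + (D ^ 2 * c' * c - b * b') * t +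
      (-(D ^ 2 * c' * a) - b * a' * D) = 0 := by
  have h1 : D * (c' * D - a' * t) = τ * (a' * D + b' * t) := by
    linear_combination τ * t * h' + (-c' * t * t' + a' * t) * hτ + (-c' * D + τ * a') * ht
  linear_combination (c * t - a) * h1 + (a' * D + b' * t) * h

end NormalFormAlgebra

theorem quadratic_tC_eq_zero {a b c : CFunField} (ha : a ∈ ZField) (hb : b ∈ ZField)
    (hc : c ∈ ZField) (h : a * tC ^ 2 + b * tC + c = 0) : a = 0 ∧ b = 0 ∧ c = 0 := by
  obtain ⟨h1, h2, h3⟩ := quadratic_coeff_eq_zero transcendental_tC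
    (a := ⟨a, ha⟩) (b := ⟨b, hb⟩) (c := ⟨c, hc⟩) h
  exact ⟨congrArg Subtype.val h1, congrArg Subtype.val h2, congrArg Subtype.val h3⟩

theorem cz_mul (p q p' q' : Polynomial ℝ) :
    cz p q * cz p' q' = cz (p * p' - q * q') (p * q' + q * p') := by
  simp only [cz, rz_sub, rz_add, rz_mul]
  linear_combination rz q * rz q' * const_I_sq

theorem exists_cz_eq_aeval (A : Polynomial ℂ) : ∃ p q, Polynomial.aeval zC A = cz p q := by
  induction A using Polynomial.induction_on' with
  | add A B hA hB =>
    obtain ⟨p, q, h⟩ := hA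
    obtain ⟨p', q', h'⟩ := hB
    refine ⟨p + p', q + q', ?_⟩
    rw [map_add, h, h', cz, cz, cz, rz_add, rz_add]
    ring
  | monomial n a =>
    refine ⟨Polynomial.C a.re * Polynomial.X ^ n, Polynomial.C a.im * Polynomial.X ^ n, ?_⟩
    rw [Polynomial.aeval_monomial, cz, rz_mul, rz_mul, rz_pow, rz_X, rz_C, rz_C]
    change const a * _ = _
    conv_lhs => rw [← Complex.re_add_im a, const_add, const_mul]
    ring

/-- Multiplying numerator and denominator by the conjugate of the denominator makes the latter a
real polynomial. -/
theorem exists_mul_rz_eq_cz {w : CFunField} (hw : w ∈ ZField) :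
    ∃ p q d : Polynomial ℝ, d ≠ 0 ∧ w * rz d = cz p q := by
  obtain ⟨A, B, hB, h⟩ := exists_aeval_div hw
  obtain ⟨p, q, hA⟩ := exists_cz_eq_aeval A
  obtain ⟨p', q', hB'⟩ := exists_cz_eq_aeval B
  have h0 := aeval_zC_ne_zero hB
  have e1 : cz p' q' * cz p' (-q') = rz (p' ^ 2 + q' ^ 2) := by
    rw [cz_mul, cz]
    have : p' * -q' + q' * p' = 0 := by ring
    rw [this, rz_zero]
    simp only [rz_sub, rz_mul, rz_neg, rz_add, rz_pow]
    ring
  refine ⟨p * p' - q * -q', p * -q' + q * p', p' ^ 2 + q' ^ 2, ?_, ?_⟩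
  · intro h1
    have h2 : ∀ x, p'.eval x = 0 ∧ q'.eval x = 0 := fun x => by
      have := congrArg (Polynomial.eval x) h1
      simp only [Polynomial.eval_add, Polynomial.eval_pow, Polynomial.eval_zero] at this
      constructor <;> nlinarith
    have hp : p' = 0 := Polynomial.funext fun x => by simpa using (h2 x).1
    have hq : q' = 0 := Polynomial.funext fun x => by simpa using (h2 x).2
    rw [hB', hp, hq, cz, rz_zero] at h0
    simp at h0
  · rw [← e1, ← cz_mul, ← hA, ← h, hB']
    ring

theorem exists_bezout_triple {a b c : Polynomial ℝ} (h : ¬(a = 0 ∧ b = 0 ∧ c = 0)) :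
    ∃ g a' b' c' u v w : Polynomial ℝ, g ≠ 0 ∧ a = g * a' ∧ b = g * b' ∧ c = g * c' ∧
      u * a' + v * b' + w * c' = 1 := by
  classical
  set g₁ := EuclideanDomain.gcd a b with hg₁
  set g := EuclideanDomain.gcd g₁ c with hg
  have ha₁ : g₁ ∣ a := EuclideanDomain.gcd_dvd_left a b
  have hb₁ : g₁ ∣ b := EuclideanDomain.gcd_dvd_right a b
  have hgg : g ∣ g₁ := EuclideanDomain.gcd_dvd_left g₁ c
  obtain ⟨a', ha⟩ := hgg.trans ha₁
  obtain ⟨b', hb⟩ := hgg.trans hb₁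
  obtain ⟨c', hc⟩ : g ∣ c := EuclideanDomain.gcd_dvd_right g₁ c
  have e₁ := EuclideanDomain.gcd_eq_gcd_ab a b
  have e₂ := EuclideanDomain.gcd_eq_gcd_ab g₁ c
  rw [← hg₁] at e₁
  rw [← hg] at e₂
  set u := EuclideanDomain.gcdA a b
  set v := EuclideanDomain.gcdB a b
  set u' := EuclideanDomain.gcdA g₁ c
  set v' := EuclideanDomain.gcdB g₁ c
  clear_value u v u' v' g g₁
  have hg0 : g ≠ 0 := by
    rintro rfl
    exact h ⟨by rw [ha, zero_mul], by rw [hb, zero_mul], by rw [hc, zero_mul]⟩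
  refine ⟨g, a', b', c', u * u', v * u', v', hg0, ha, hb, hc, mul_left_cancel₀ hg0 ?_⟩
  rw [mul_one]
  linear_combination -e₂ - u' * e₁ - u * u' * ha - v * u' * hb - v' * hc

/-- A traceless matrix, compatible with the real structure, of an involution over the base. -/
theorem exists_traceless {g : Bir} (hz : baseChange g zC = zC) (h2 : g * g = 1) (h1 : g ≠ 1) :
    ∃ a ∈ ZField, ∃ c ∈ ZField, conjL a = -a ∧
      a * conjL a - conjL c * (1 - zC ^ 2) * c ≠ 0 ∧
      baseChange g tC * (c * tC - a) = a * tC + conjL c * (1 - zC ^ 2) := by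
  obtain ⟨a, ha, b, hb, c, hc, d, hd, hdet, h⟩ := exists_moebius (g := g) (by rw [hz]; exact zC_mem)
  have hE := fun {w : CFunField} (hw : w ∈ ZField) => QPoly.baseChange_of_mem hz hw
  have hgg : ∀ w, baseChange g (baseChange g w) = w := fun w => by
    rw [← baseChange_mul, h2, baseChange_one]
  have h' := congrArg (baseChange g) h
  simp only [map_mul, map_add, hgg, hE ha, hE hb, hE hc, hE hd] at h'
  have hD := QPoly.one_sub_zC_mem
  have hD0 : (1 - zC ^ 2 : CFunField) ≠ 0 := by
    rw [← tC_mul_tbarC]; exact mul_ne_zero tC_ne_zero tbarC_ne_zero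
  have cD : conjL (1 - zC ^ 2) = 1 - zC ^ 2 := by simp
  obtain ⟨q1, q2, q3⟩ := quadratic_tC_eq_zero
    (ZField.mul_mem hc (ZField.add_mem ha hd))
    (ZField.sub_mem (pow_mem hd 2) (pow_mem ha 2))
    (ZField.neg_mem (ZField.mul_mem hb (ZField.add_mem ha hd))) (moebius_sq_algebra h h')
  have htr : a + d = 0 := by
    by_contra h0
    have hc0 : c = 0 := (mul_eq_zero.1 q1).resolve_right h0
    have hb0 : b = 0 := (mul_eq_zero.1 (neg_eq_zero.1 q3)).resolve_right h0
    have hda : d = a := by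
      have : (d - a) * (a + d) = 0 := by linear_combination q2
      exact sub_eq_zero.1 ((mul_eq_zero.1 this).resolve_right h0)
    rw [hc0, hb0, hda] at h hdet
    have ha0 : a ≠ 0 := by rintro rfl; simp at hdet
    refine h1 (bir_ext (mul_left_cancel₀ ha0 ?_) ?_)
    · rw [baseChange_one]; linear_combination h
    · rw [baseChange_one, hz]
  obtain rfl : d = -a := by linear_combination htr
  have hτ : baseChange g tC * conjL (baseChange g tC) = 1 - zC ^ 2 := by
    rw [conjL_baseChange, conjL_tC, ← map_mul, tC_mul_tbarC, hE hD]
  have hτ' := congrArg conjL h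
  simp only [map_mul, map_add, map_neg, conjL_tC] at hτ'
  rw [← sub_eq_add_neg] at h hτ'
  obtain ⟨-, r2, r3⟩ := quadratic_tC_eq_zero
    (ZField.sub_mem (ZField.neg_mem (ZField.mul_mem (ZField.mul_mem hD (conjL_mem ha)) hc))
      (ZField.mul_mem ha (conjL_mem hb)))
    (ZField.sub_mem (ZField.mul_mem (ZField.mul_mem (pow_mem hD 2) (conjL_mem hc)) hc)
      (ZField.mul_mem hb (conjL_mem hb)))
    (ZField.sub_mem (ZField.neg_mem (ZField.mul_mem (ZField.mul_mem (pow_mem hD 2)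
      (conjL_mem hc)) ha)) (ZField.mul_mem (ZField.mul_mem hb (conjL_mem ha)) hD))
    (moebius_conj_algebra h hτ' tC_mul_tbarC hτ)
  -- The matrix is determined up to a factor ρ, and it remains to choose ρ so that ρa is purely
  -- imaginary and ρb = conj(ρc)(1 - z²).
  have key : ∀ ρ ∈ ZField, ρ ≠ 0 → conjL (ρ * a) = -(ρ * a) →
      ρ * b = conjL (ρ * c) * (1 - zC ^ 2) →
      ∃ a ∈ ZField, ∃ c ∈ ZField, conjL a = -a ∧
        a * conjL a - conjL c * (1 - zC ^ 2) * c ≠ 0 ∧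
        baseChange g tC * (c * tC - a) = a * tC + conjL c * (1 - zC ^ 2) := by
    intro ρ hρ hρ0 e1 e2
    refine ⟨ρ * a, ZField.mul_mem hρ ha, ρ * c, ZField.mul_mem hρ hc, e1, ?_, ?_⟩
    · rw [← e2, e1]
      intro h0
      apply hdet
      have : ρ ^ 2 * (a * -a - b * c) = 0 := by linear_combination h0
      exact (mul_eq_zero.1 this).resolve_left (pow_ne_zero 2 hρ0)
    · rw [← e2]; linear_combination ρ * h
  -- If a ≠ 0, take ρ = i/a. If a = 0, the relation `r2` says that b and (1 - z²)c̄ have the same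
  -- norm, and ρ is found as in Hilbert 90: the sum (1 - z²)c̄ + b̄, or i times the difference when
  -- the sum vanishes.
  by_cases ha0 : a = 0
  · subst ha0
    have hbc : b ≠ 0 ∧ c ≠ 0 := by
      rw [← mul_ne_zero_iff]
      intro h0
      apply hdet
      rw [h0]; ring
    have hbb : (1 - zC ^ 2) * conjL c ≠ 0 := mul_ne_zero hD0 fun h0 => hbc.2 (by
      rw [← conjL_conjL c, h0, map_zero])
    have mcc := conjL_mem hc
    have mbb := conjL_mem hb
    by_cases hs : (1 - zC ^ 2) * conjL c + conjL b = 0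
    · refine key (const Complex.I * ((1 - zC ^ 2) * conjL c - conjL b)) ?_ ?_ ?_ ?_
      · exact ZField.mul_mem (const_mem _ _) (ZField.sub_mem (ZField.mul_mem hD mcc) mbb)
      · refine mul_ne_zero (const_ne_zero Complex.I_ne_zero) fun h0 => hbb ?_
        linear_combination (h0 + hs) / 2
      · simp
      · simp only [map_mul, map_sub, conjL_conjL, cD, conjL_const, Complex.conj_I, const_neg]
        linear_combination const Complex.I * r2
    · refine key ((1 - zC ^ 2) * conjL c + conjL b) ?_ hs ?_ ?_
      · exact ZField.add_mem (ZField.mul_mem hD mcc) mbb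
      · simp
      · simp only [map_mul, map_add, conjL_conjL, cD]
        linear_combination -r2
  · have ha0' : conjL a ≠ 0 := fun h0 => ha0 (by rw [← conjL_conjL a, h0, map_zero])
    refine key (const Complex.I / a) (ZField.div_mem (const_mem _ _) ha)
      (div_ne_zero (const_ne_zero Complex.I_ne_zero) ha0) ?_ ?_
    · rw [div_mul_cancel₀ _ ha0, conjL_const, Complex.conj_I, const_neg]
    · rw [map_mul, map_div₀, conjL_const, Complex.conj_I, const_neg]
      have r3' : b * conjL a = -((1 - zC ^ 2) * conjL c * a) :=
        mul_left_cancel₀ hD0 (by linear_combination -r3)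
      field_simp
      linear_combination const Complex.I * r3'

/-- Denominators are cleared and common factors removed by real polynomials only, which keeps the
shape of the matrix. Primitivity, in the form of a Bézout relation, is needed later to exclude zeros
of the norm on [-1, 1]. -/
theorem exists_qPoly_of_involution {g : Bir} (hz : baseChange g zC = zC) (h2 : g * g = 1)
    (h1 : g ≠ 1) : ∃ q : QPoly, q.a₁ = 0 ∧ q.norm ≠ 0 ∧ q.Acts g ∧
      ∃ u v w : Polynomial ℝ, u * q.a₂ + v * q.b₁ + w * q.b₂ = 1 := by
  obtain ⟨a, ha, c, hc, hca, hdet, h⟩ := exists_traceless hz h2 h1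
  obtain ⟨p₁, p₂, d, hd, ea⟩ := exists_mul_rz_eq_cz ha
  obtain ⟨r₁, r₂, d', hd', ec⟩ := exists_mul_rz_eq_cz hc
  have hdd := mul_ne_zero (rz_ne_zero hd) (rz_ne_zero hd')
  have hp₁ : rz p₁ = 0 := by
    have h3 := congrArg conjL ea
    rw [map_mul, hca, conjL_rz, conjL_cz] at h3
    rw [cz] at ea
    linear_combination -(h3 + ea) / 2
  have ea' : cz 0 (d' * p₂) = a * (rz d * rz d') := by
    rw [cz, rz_zero, rz_mul]
    rw [cz, hp₁] at ea
    linear_combination -rz d' * ea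
  have ec' : cz (d * r₁) (-(d * r₂)) = conjL c * (rz d * rz d') := by
    have h3 := congrArg conjL ec
    rw [map_mul, conjL_rz, conjL_cz] at h3
    rw [cz, rz_neg, rz_mul, rz_mul]
    linear_combination -rz d * h3
  have hnot : ¬(d' * p₂ = 0 ∧ d * r₁ = 0 ∧ -(d * r₂) = 0) := by
    rintro ⟨e1, e2, e3⟩
    rw [e1, cz, rz_zero] at ea'
    rw [e2, e3, cz, rz_zero] at ec'
    have ha0 : a = 0 := (mul_eq_zero.1 (by linear_combination -ea')).resolve_right hdd
    have hc0 : conjL c = 0 := (mul_eq_zero.1 (by linear_combination -ec')).resolve_right hdd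
    rw [ha0, hc0] at hdet
    simp at hdet
  obtain ⟨k, α, β₁, β₂, u, v, w, hk, e1, e2, e3, hb⟩ := exists_bezout_triple hnot
  have hk' := rz_ne_zero hk
  have hcz : ∀ p q, cz (k * p) (k * q) = rz k * cz p q := fun p q => by
    rw [cz, cz, rz_mul, rz_mul]; ring
  have e0 : (0 : Polynomial ℝ) = k * 0 := by ring
  rw [e1, e0, hcz] at ea'
  rw [e2, e3, hcz] at ec'
  set ν := rz k / (rz d * rz d') with hν
  have hν0 : ν ≠ 0 := div_ne_zero hk' hdd
  have fa : a = ν * cz 0 α := by rw [hν, div_mul_eq_mul_div, eq_div_iff hdd]; linear_combination -ea'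
  have fc : conjL c = ν * cz β₁ β₂ := by rw [hν, div_mul_eq_mul_div, eq_div_iff hdd]; linear_combination -ec'
  have fν : conjL ν = ν := by rw [hν, map_div₀, map_mul, conjL_rz, conjL_rz, conjL_rz]
  have fc' : c = ν * conjL (cz β₁ β₂) := by rw [← conjL_conjL c, fc, map_mul, fν]
  have fa' : -a = ν * conjL (cz 0 α) := by rw [← hca, fa, map_mul, fν]
  refine ⟨⟨0, α, β₁, β₂⟩, rfl, fun hn => hdet ?_, ⟨hz, mul_left_cancel₀ hν0 ?_⟩, u, v, w, hb⟩
  · have h3 := QPoly.det_eq ⟨0, α, β₁, β₂⟩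
    rw [hn, rz_zero] at h3
    rw [hca, fa', fc, fc', fa]
    linear_combination ν ^ 2 * h3
  · rw [fc, fc'] at h
    linear_combination h - baseChange g tC * fa' + tC * fa

/-! ### Nondegeneracy at the real points -/

/-- Where the norm vanishes the matrix has rank at most one, so the image (x', y') satisfies linear
equations that do not involve (x, y). -/
theorem linear_system_of_singular {x y x' y' A B₁ B₂ D : ℝ}
    (hA : A ^ 2 = (B₁ ^ 2 + B₂ ^ 2) * D)
    (hΔ : (B₁ * x - B₂ * y) ^ 2 + (-B₁ * y - B₂ * x - A) ^ 2 ≠ 0)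
    (h₁ : x' * ((B₁ * x - B₂ * y) ^ 2 + (-B₁ * y - B₂ * x - A) ^ 2) =
      (A * y + B₁ * D) * (B₁ * x - B₂ * y) + (A * x + B₂ * D) * (-B₁ * y - B₂ * x - A))
    (h₂ : y' * ((B₁ * x - B₂ * y) ^ 2 + (-B₁ * y - B₂ * x - A) ^ 2) =
      (A * y + B₁ * D) * (-B₁ * y - B₂ * x - A) - (A * x + B₂ * D) * (B₁ * x - B₂ * y)) :
    B₁ * x' - B₂ * y' = 0 ∧ B₁ * y' + B₂ * x' = -A := by
  constructor
  · refine mul_right_cancel₀ hΔ ?_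
    linear_combination B₁ * h₁ - B₂ * h₂ - (B₁ * x - B₂ * y) * hA
  · refine mul_right_cancel₀ hΔ ?_
    linear_combination B₁ * h₂ + B₂ * h₁ - (-B₁ * y - B₂ * x - A) * hA

theorem eq_of_linear_system {x y x' y' A B₁ B₂ : ℝ} (hB : B₁ ^ 2 + B₂ ^ 2 ≠ 0)
    (h : B₁ * x - B₂ * y = 0 ∧ B₁ * y + B₂ * x = -A)
    (h' : B₁ * x' - B₂ * y' = 0 ∧ B₁ * y' + B₂ * x' = -A) : x = x' ∧ y = y' := by
  obtain ⟨h1, h2⟩ := h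
  obtain ⟨h3, h4⟩ := h'
  constructor
  · exact mul_left_cancel₀ hB (by linear_combination B₁ * h1 + B₂ * h2 - B₁ * h3 - B₂ * h4)
  · exact mul_left_cancel₀ hB (by linear_combination B₁ * h2 - B₂ * h1 - B₁ * h4 + B₂ * h3)

namespace QPoly

variable {q : QPoly} {g : Bir}

theorem Acts.value_eq (hg : q.Acts g) (h0 : q.a₁ = 0) {p p' : Fin 3 → ℝ} (hp : p ∈ realPoints)
    (h : ∀ F : MvPolynomial (Fin 3) ℝ, HasValue p (g (toFun F)) (eval p' F))
    (hn : q.norm.eval (p 2) = 0)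
    (hΔ : (q.b₁.eval (p 2) * p 0 - q.b₂.eval (p 2) * p 1) ^ 2 +
      (-q.b₁.eval (p 2) * p 1 - q.b₂.eval (p 2) * p 0 - q.a₂.eval (p 2)) ^ 2 ≠ 0) :
    p' 2 = p 2 ∧ q.b₁.eval (p 2) * p' 0 - q.b₂.eval (p 2) * p' 1 = 0 ∧
      q.b₁.eval (p 2) * p' 1 + q.b₂.eval (p 2) * p' 0 = -q.a₂.eval (p 2) := by
  have hval := fun F => HasValue.toFun p F
  obtain ⟨ex, ey⟩ := hg.xS_yS
  have h1 := (h (X 0)).mul (hval (q.denRe ^ 2 + q.denIm ^ 2))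
  have h2 := (h (X 1)).mul (hval (q.denRe ^ 2 + q.denIm ^ 2))
  have h3 := h (X 2)
  have hz : g (toFun (X 2)) = toFun (X 2) := baseChange_zC_eq_iff.1 hg.1
  rw [hz] at h3
  have h4 := h3.unique hp (hval (X 2))
  have e1 := h1.unique hp (by
    change HasValue p (g xS * _) _
    rw [ex]; exact hval _)
  have e2 := h2.unique hp (by
    change HasValue p (g yS * _) _
    rw [ey]; exact hval _)
  rw [eval_X, eval_X] at h4
  rw [eval_norm, h0] at hn
  simp only [denRe, denIm, numRe, numIm, h0, map_add, map_sub, map_mul, map_neg, map_pow, map_one,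
    eval_X, eval_pz, Polynomial.eval_zero] at e1 e2 hn
  refine ⟨h4, linear_system_of_singular (D := 1 - p 2 ^ 2) (x := p 0) (y := p 1) ?_ hΔ ?_ ?_⟩
  · linear_combination hn
  · linear_combination e1
  · linear_combination e2

/-- An involution that is a bijection on the real points has no real singular fibre in
`[-1, 1]`. -/
theorem Acts.norm_ne_zero (hg : q.Acts g) (h0 : q.a₁ = 0) (hgR : g ∈ autReal)
    {u v w : Polynomial ℝ} (hb : u * q.a₂ + v * q.b₁ + w * q.b₂ = 1) {d e : Polynomial ℝ}
    (hd : q.norm = d * e ^ 2) (hd0 : ∀ x, d.eval x ≠ 0) {r : ℝ} (hr : r ∈ Set.Icc (-1 : ℝ) 1) :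
    q.norm.eval r ≠ 0 := by
  intro hn
  have hprim := congrArg (Polynomial.eval r) hb
  simp only [Polynomial.eval_add, Polynomial.eval_mul, Polynomial.eval_one] at hprim
  have hn' := hn
  rw [eval_norm, h0, Polynomial.eval_zero] at hn'
  by_cases hD : 1 - r ^ 2 = 0
  -- At a pole r = ±1 the norm is a₂², and its zero has order at least two because d has no real
  -- zero. Comparing derivatives gives b₁ = b₂ = 0, against primitivity.
  · have he : e.eval r = 0 := by
      rw [hd, Polynomial.eval_mul, Polynomial.eval_pow] at hn
      simpa [hd0 r] using hn
    have hα : q.a₂.eval r = 0 := by rw [hD] at hn'; nlinarith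
    have h1 := congrArg (fun f => (Polynomial.derivative f).eval r) hd
    simp only [norm, h0] at h1
    simp [he, hα, hD, Polynomial.derivative_pow] at h1
    have hB : q.b₁.eval r = 0 ∧ q.b₂.eval r = 0 := by
      have hr0 : r ≠ 0 := by rintro rfl; simp at hD
      have h2 : q.b₁.eval r ^ 2 + q.b₂.eval r ^ 2 = 0 := h1.resolve_right hr0
      constructor <;> nlinarith [sq_nonneg (q.b₁.eval r), sq_nonneg (q.b₂.eval r)]
    rw [hα, hB.1, hB.2] at hprim
    simp at hprim
  · have hDpos : 0 < 1 - r ^ 2 := by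
      rcases lt_or_gt_of_ne hD with h | h
      · nlinarith [hr.1, hr.2]
      · exact h
    obtain ⟨A, hA⟩ : ∃ A, A = q.a₂.eval r := ⟨_, rfl⟩
    obtain ⟨B₁, hB₁⟩ : ∃ B₁, B₁ = q.b₁.eval r := ⟨_, rfl⟩
    obtain ⟨B₂, hB₂⟩ : ∃ B₂, B₂ = q.b₂.eval r := ⟨_, rfl⟩
    rw [← hA, ← hB₁, ← hB₂] at hn' hprim
    have hB : B₁ ^ 2 + B₂ ^ 2 ≠ 0 := by
      intro hB
      have hA0 : A = 0 := by rw [hB] at hn'; nlinarith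
      have hB10 : B₁ = 0 := by nlinarith
      have hB20 : B₂ = 0 := by nlinarith
      rw [hA0, hB10, hB20] at hprim
      simp at hprim
    have hA0 : A ≠ 0 := by
      rintro rfl
      have : (B₁ ^ 2 + B₂ ^ 2) * (1 - r ^ 2) = 0 := by linarith
      exact (mul_ne_zero hB hD) this
    have hp : ∀ x y : ℝ, x ^ 2 + y ^ 2 = 1 - r ^ 2 → (![x, y, r] : Fin 3 → ℝ) ∈ realPoints :=
      fun x y h => by
        change x ^ 2 + y ^ 2 + r ^ 2 = 1
        linarith
    -- In this fibre the map is undefined only at (-B₂A, -B₁A)/(B₁² + B₂²). The opposite point and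
    -- its quarter turn are two distinct real points with the same image, against injectivity.
    have h1 := hp (B₂ * A / (B₁ ^ 2 + B₂ ^ 2)) (B₁ * A / (B₁ ^ 2 + B₂ ^ 2)) (by
      field_simp
      linear_combination (B₁ ^ 2 + B₂ ^ 2) * hn')
    have h2 := hp (-B₁ * A / (B₁ ^ 2 + B₂ ^ 2)) (B₂ * A / (B₁ ^ 2 + B₂ ^ 2)) (by
      field_simp
      linear_combination hn')
    obtain ⟨p₁, hp₁, hF₁⟩ := hgR.1.exists_image h1
    obtain ⟨p₂, hp₂, hF₂⟩ := hgR.1.exists_image h2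
    obtain ⟨z₁, l₁⟩ := hg.value_eq h0 h1 hF₁ hn (by
      change (q.b₁.eval r * _ - q.b₂.eval r * _) ^ 2 + (-q.b₁.eval r * _ - q.b₂.eval r * _ -
        q.a₂.eval r) ^ 2 ≠ 0
      rw [← hA, ← hB₁, ← hB₂]
      simp only [Matrix.cons_val]
      have e1 : (B₁ * (B₂ * A / (B₁ ^ 2 + B₂ ^ 2)) - B₂ * (B₁ * A / (B₁ ^ 2 + B₂ ^ 2))) ^ 2 +
        (-B₁ * (B₁ * A / (B₁ ^ 2 + B₂ ^ 2)) - B₂ * (B₂ * A / (B₁ ^ 2 + B₂ ^ 2)) - A) ^ 2 =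
        4 * A ^ 2 := by field_simp; ring
      rw [e1]
      positivity)
    obtain ⟨z₂, l₂⟩ := hg.value_eq h0 h2 hF₂ hn (by
      change (q.b₁.eval r * _ - q.b₂.eval r * _) ^ 2 + (-q.b₁.eval r * _ - q.b₂.eval r * _ -
        q.a₂.eval r) ^ 2 ≠ 0
      rw [← hA, ← hB₁, ← hB₂]
      simp only [Matrix.cons_val]
      have e1 : (B₁ * (-B₁ * A / (B₁ ^ 2 + B₂ ^ 2)) - B₂ * (B₂ * A / (B₁ ^ 2 + B₂ ^ 2))) ^ 2 +
        (-B₁ * (B₂ * A / (B₁ ^ 2 + B₂ ^ 2)) - B₂ * (-B₁ * A / (B₁ ^ 2 + B₂ ^ 2)) - A) ^ 2 =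
        2 * A ^ 2 := by field_simp; ring
      rw [e1]
      positivity)
    obtain ⟨hx, hy⟩ := eq_of_linear_system (by
      change q.b₁.eval r ^ 2 + q.b₂.eval r ^ 2 ≠ 0
      rwa [← hB₁, ← hB₂]) l₁ l₂
    have h12 : p₁ = p₂ := by
      funext i
      fin_cases i
      · exact hx
      · exact hy
      · exact z₁.trans z₂.symm
    subst h12
    have heq := HasValue.point_unique hgR h1 h2 hp₁ hF₁ hF₂
    have e0 : B₂ * A / (B₁ ^ 2 + B₂ ^ 2) = -B₁ * A / (B₁ ^ 2 + B₂ ^ 2) := congrFun heq 0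
    have e1 : B₁ * A / (B₁ ^ 2 + B₂ ^ 2) = B₂ * A / (B₁ ^ 2 + B₂ ^ 2) := congrFun heq 1
    rw [div_left_inj' hB] at e0 e1
    have e2 : B₂ = -B₁ := mul_right_cancel₀ hA0 e0
    have e3 : B₁ = B₂ := mul_right_cancel₀ hA0 e1
    apply hB
    have : B₁ = 0 := by linarith
    rw [← e3, this]
    ring

end QPoly

/-! ### Conjugation of involutions with proportional norms -/

namespace QPoly

/-- The product of the matrices. -/
def mul (q q' : QPoly) : QPoly where
  a₁ := q.a₁ * q'.a₁ - q.a₂ * q'.a₂ + (q.b₁ * q'.b₁ + q.b₂ * q'.b₂) * (1 - Polynomial.X ^ 2)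
  a₂ := q.a₁ * q'.a₂ + q.a₂ * q'.a₁ + (q.b₂ * q'.b₁ - q.b₁ * q'.b₂) * (1 - Polynomial.X ^ 2)
  b₁ := q.a₁ * q'.b₁ - q.a₂ * q'.b₂ + (q.b₁ * q'.a₁ + q.b₂ * q'.a₂)
  b₂ := q.a₁ * q'.b₂ + q.a₂ * q'.b₁ + (q.b₂ * q'.a₁ - q.b₁ * q'.a₂)

/-- The multiple of the matrix by a real polynomial. -/
def smul (c : Polynomial ℝ) (q : QPoly) : QPoly :=
  ⟨c * q.a₁, c * q.a₂, c * q.b₁, c * q.b₂⟩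

theorem norm_mul (q q' : QPoly) : (q.mul q').norm = q.norm * q'.norm := by
  simp only [norm, mul]; ring

theorem cz_smul (c p q : Polynomial ℝ) : cz (c * p) (c * q) = rz c * cz p q := by
  rw [cz, cz, rz_mul, rz_mul]; ring

theorem Acts.of_smul {c : Polynomial ℝ} (hc : c ≠ 0) {q : QPoly} {g : Bir}
    (h : (smul c q).Acts g) : q.Acts g := by
  refine ⟨h.1, mul_left_cancel₀ (rz_ne_zero hc) ?_⟩
  have h2 := h.2
  simp only [smul, cz_smul, map_mul, conjL_rz] at h2
  linear_combination h2

theorem mul_algebra {K : Type*} [Field K] {t T S a b a' b' c d c' d' D : K}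
    (h : S * (c * T + d) = a * T + b * D) (h' : T * (c' * t + d') = a' * t + b' * D) :
    S * ((c * a' + d * c') * t + (c * b' * D + d * d')) =
      (a * a' + b * c' * D) * t + (a * b' + b * d') * D := by
  linear_combination (c' * t + d') * h + (a - S * c) * h'

theorem Acts.mul {q q' : QPoly} {g h : Bir} (hg : q.Acts g) (hh : q'.Acts h) :
    (q.mul q').Acts (h * g) := by
  obtain ⟨hz, ht⟩ := hg
  obtain ⟨hz', ht'⟩ := hh
  refine ⟨by rw [baseChange_mul, hz, hz'], ?_⟩
  have h1 := congrArg (baseChange h) ht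
  simp only [map_mul, map_add, baseChange_of_mem hz' (cz_mem _ _),
    baseChange_of_mem hz' (conjL_cz_mem _ _), baseChange_of_mem hz' one_sub_zC_mem] at h1
  have h2 := mul_algebra h1 ht'
  have ea : cz (q.mul q').a₁ (q.mul q').a₂ = cz q.a₁ q.a₂ * cz q'.a₁ q'.a₂ +
      cz q.b₁ q.b₂ * conjL (cz q'.b₁ q'.b₂) * (1 - zC ^ 2) := by
    rw [conjL_cz]
    simp only [QPoly.mul, cz, rz_add, rz_sub, rz_mul, rz_one, rz_pow, rz_X]
    linear_combination (-rz q.a₂ * rz q'.a₂ + rz q.b₂ * rz q'.b₂ * (1 - zC ^ 2)) * const_I_sq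
  have eb : cz (q.mul q').b₁ (q.mul q').b₂ = cz q.a₁ q.a₂ * cz q'.b₁ q'.b₂ +
      cz q.b₁ q.b₂ * conjL (cz q'.a₁ q'.a₂) := by
    rw [conjL_cz]
    simp only [QPoly.mul, cz, rz_add, rz_sub, rz_mul]
    linear_combination (-rz q.a₂ * rz q'.b₂ + rz q.b₂ * rz q'.a₂) * const_I_sq
  have eD : conjL (1 - zC ^ 2) = 1 - zC ^ 2 := by simp
  rw [ea, eb, baseChange_mul]
  simp only [map_add, map_mul, conjL_conjL, eD]
  linear_combination h2

theorem exists_sign {p : Polynomial ℝ} (hp : ∀ x ∈ Set.Icc (-1 : ℝ) 1, p.eval x ≠ 0) :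
    ∃ s : ℝ, s ^ 2 = 1 ∧ ∀ x ∈ Set.Icc (-1 : ℝ) 1, 0 < s * p.eval x := by
  have key : ∀ p : Polynomial ℝ, (∀ x ∈ Set.Icc (-1 : ℝ) 1, p.eval x ≠ 0) → 0 < p.eval 0 →
      ∀ x ∈ Set.Icc (-1 : ℝ) 1, 0 < p.eval x := by
    intro p hp h0 x hx
    by_contra! hneg
    have h1 := isPreconnected_Icc.intermediate_value (a := x) (b := (0 : ℝ)) hx (by simp)
      p.continuous.continuousOn
    obtain ⟨y, hy, hy0⟩ := h1 ⟨hneg, h0.le⟩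
    exact hp y hy hy0
  rcases lt_or_gt_of_ne (hp 0 (by simp)) with h | h
  · refine ⟨-1, by norm_num, fun x hx => ?_⟩
    have := key (-p) (fun y hy => by simpa using hp y hy) (by simpa using h) x hx
    simpa using this
  · refine ⟨1, by norm_num, fun x hx => ?_⟩
    rw [one_mul]
    exact key p hp h x hx

/-- The form A² - |B|²D is Lorentzian: by the reversed Cauchy–Schwarz inequality the sum of two
timelike vectors in the same half of the cone is timelike. The hypothesis on c puts them in the same
half. -/
theorem sum_norm_pos {A A' B₁ B₂ B₁' B₂' D c : ℝ} (hD : 0 ≤ D)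
    (h : 0 < A ^ 2 - (B₁ ^ 2 + B₂ ^ 2) * D) (h' : 0 < A' ^ 2 - (B₁' ^ 2 + B₂' ^ 2) * D)
    (hc : 0 < c * (A * A')) :
    0 < (c * A' + A) ^ 2 - ((c * B₁' + B₁) ^ 2 + (c * B₂' + B₂) ^ 2) * D := by
  have h1 : ((B₁ ^ 2 + B₂ ^ 2) * D) * ((B₁' ^ 2 + B₂' ^ 2) * D) ≤ A ^ 2 * A' ^ 2 :=
    mul_le_mul (by linarith) (by linarith) (by positivity) (by positivity)
  have h2 : (c * ((B₁ * B₁' + B₂ * B₂') * D)) ^ 2 ≤ (c * (A * A')) ^ 2 := by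
    have h3 : (B₁ * B₁' + B₂ * B₂') ^ 2 ≤ (B₁ ^ 2 + B₂ ^ 2) * (B₁' ^ 2 + B₂' ^ 2) := by
      nlinarith [sq_nonneg (B₁ * B₂' - B₂ * B₁')]
    have h4 : ((B₁ * B₁' + B₂ * B₂') * D) ^ 2 ≤ A ^ 2 * A' ^ 2 := by
      have := mul_le_mul_of_nonneg_right h3 (sq_nonneg D)
      linarith
    have := mul_le_mul_of_nonneg_left h4 (sq_nonneg c)
    linarith
  have h5 := abs_le_of_sq_le_sq' h2 hc.le
  nlinarith [mul_nonneg (sq_nonneg c) h'.le, h5.2]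

/-- A traceless matrix M satisfies M² = -N. If M² = c²M'², then M(M + cM') = c(M + cM')M', so M +
cM' conjugates one map into the other, provided that its norm has no zero on [-1, 1]. -/
theorem exists_conj_of_norm_eq {q q' : QPoly} {g g' : Bir} (hg : q.Acts g) (hg' : q'.Acts g')
    (h0 : q.a₁ = 0) (h0' : q'.a₁ = 0) {c : Polynomial ℝ} (hn : q.norm = c ^ 2 * q'.norm)
    (hpos : ∀ r ∈ Set.Icc (-1 : ℝ) 1, 0 < q.norm.eval r) :
    ∃ k ∈ autRealOverPi, k * g * k⁻¹ = g' := by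
  have hc0 : ∀ r ∈ Set.Icc (-1 : ℝ) 1, c.eval r ≠ 0 := fun r hr h => by
    have := hpos r hr
    rw [hn, Polynomial.eval_mul, Polynomial.eval_pow, h] at this
    simp at this
  have hpos' : ∀ r ∈ Set.Icc (-1 : ℝ) 1, 0 < q'.norm.eval r := fun r hr => by
    have := hpos r hr
    rw [hn, Polynomial.eval_mul, Polynomial.eval_pow] at this
    exact pos_of_mul_pos_right this (sq_nonneg _)
  have hD : ∀ r ∈ Set.Icc (-1 : ℝ) 1, 0 ≤ 1 - r ^ 2 := fun r hr => by nlinarith [hr.1, hr.2]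
  have hα : ∀ q : QPoly, q.a₁ = 0 → ∀ r ∈ Set.Icc (-1 : ℝ) 1, 0 < q.norm.eval r →
      q.a₂.eval r ≠ 0 := fun q h0 r hr h h1 => by
    rw [eval_norm, h0, h1, Polynomial.eval_zero] at h
    have := mul_nonneg (add_nonneg (sq_nonneg (q.b₁.eval r)) (sq_nonneg (q.b₂.eval r))) (hD r hr)
    linarith
  -- Positivity of the norms keeps a₂ and a₂' from vanishing on [-1, 1], so c a₂ a₂' has constant
  -- sign there; replacing c by ±c makes it positive.
  obtain ⟨s, hs, hsign⟩ := exists_sign (p := c * (q.a₂ * q'.a₂)) fun r hr => by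
    rw [Polynomial.eval_mul, Polynomial.eval_mul]
    exact mul_ne_zero (hc0 r hr) (mul_ne_zero (hα q h0 r hr (hpos r hr))
      (hα q' h0' r hr (hpos' r hr)))
  set c' := Polynomial.C s * c with hc'
  have hn' : q.norm = c' ^ 2 * q'.norm := by
    rw [hc', mul_pow, ← Polynomial.C_pow, hs, Polynomial.C_1, one_mul, hn]
  let N : QPoly := ⟨0, c' * q'.a₂ + q.a₂, c' * q'.b₁ + q.b₁, c' * q'.b₂ + q.b₂⟩
  have hN : ∀ r ∈ Set.Icc (-1 : ℝ) 1, N.norm.eval r ≠ 0 := fun r hr => by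
    have h1 := hpos r hr
    have h2 := hpos' r hr
    have h3 := hsign r hr
    rw [eval_norm, h0, Polynomial.eval_zero] at h1
    rw [eval_norm, h0', Polynomial.eval_zero] at h2
    rw [Polynomial.eval_mul, Polynomial.eval_mul] at h3
    simp only [ne_eq, OfNat.ofNat_ne_zero, not_false_eq_true, zero_pow, zero_add] at h1 h2
    have h4 := sum_norm_pos (c := c'.eval r) (hD r hr) h1 h2
      (by rw [hc', Polynomial.eval_mul, Polynomial.eval_C, mul_assoc]; exact h3)
    rw [eval_norm]
    simp only [N, Polynomial.eval_add, Polynomial.eval_mul, Polynomial.eval_zero]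
    exact ne_of_gt (by linarith)
  have h00 : (0 : ℝ) ∈ Set.Icc (-1 : ℝ) 1 := by simp
  have hne : ∀ {p : Polynomial ℝ}, p.eval 0 ≠ 0 → p ≠ 0 := fun h hp => h (by rw [hp]; simp)
  obtain ⟨k, hk⟩ := exists_acts (hne (hN 0 h00))
  have hcc : c' ≠ 0 := by
    intro h
    have := hpos 0 h00
    rw [hn', h] at this
    simp at this
  have hmul : q.mul N = smul c' (N.mul q') := by
    have h1 := hn'
    rw [norm, norm, h0, h0'] at h1
    simp only [QPoly.mul, smul, N, h0, h0', QPoly.mk.injEq]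
    refine ⟨?_, ?_, ?_, ?_⟩
    · linear_combination -h1
    all_goals ring
  have h1 := hg.mul hk
  rw [hmul] at h1
  have h2 := Acts.unique (by
    rw [norm_mul]
    exact mul_ne_zero (hne (hN 0 h00)) (hne (hpos' 0 h00).ne')) (h1.of_smul hcc) (hk.mul hg')
  exact ⟨k, hk.mem_autRealOverPi hN, by rw [h2, mul_inv_cancel_right]⟩

end QPoly

/-! ### Every positive definite branch divisor occurs -/

/-- The zeros of X² - 2mX + p are conjugate and nonreal, and a hyperbolic translation with parameter
r moves them onto the imaginary axis. The equations say that 4(1 + rX)² - l(1 - r²)(1 - X²) equals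
k(X² - 2mX + p). -/
theorem exists_branch_parameters {m p : ℝ} (h : m ^ 2 < p) : ∃ r l k : ℝ, |r| < 1 ∧ 0 < l ∧
    l < 4 ∧ 0 < k ∧ 4 * r ^ 2 + l * (1 - r ^ 2) = k ∧ 8 * r = -(2 * m) * k ∧
    4 - l * (1 - r ^ 2) = k * p := by
  have hp : 0 < 1 + p := by nlinarith [sq_nonneg m]
  have hdisc : 0 < (1 + p) ^ 2 - (2 * m) ^ 2 := by nlinarith [sq_nonneg (m - 1), sq_nonneg (m + 1)]
  obtain ⟨s, hs0, hs⟩ : ∃ s : ℝ, 0 < s ∧ s ^ 2 = (1 + p) ^ 2 - (2 * m) ^ 2 :=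
    ⟨√_, Real.sqrt_pos.2 hdisc, Real.sq_sqrt hdisc.le⟩
  have hsum : 0 < 1 + p + s := by linarith
  -- The root of mr² + (1 + p)r + m = 0 with |r| < 1, written so that m = 0 is allowed.
  obtain ⟨r, hr⟩ : ∃ r, r = -(2 * m) / (1 + p + s) := ⟨_, rfl⟩
  have hr1 : |r| < 1 := by
    rw [hr, abs_div, abs_neg, abs_of_pos hsum, div_lt_one hsum]
    exact lt_of_lt_of_le (abs_lt_of_sq_lt_sq (by linarith) hp.le) (by linarith)
  have hrm : m * (1 + r ^ 2) = -(1 + p) * r := by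
    rw [hr]
    field_simp
    linear_combination m * hs
  have hr2 : r ^ 2 < 1 := (sq_lt_one_iff_abs_lt_one r).2 hr1
  have hprod : 0 < (p - r ^ 2) * (1 - p * r ^ 2) := by
    have h1 : m ^ 2 * (1 + r ^ 2) ^ 2 = (1 + p) ^ 2 * r ^ 2 := by
      rw [← mul_pow, hrm]; ring
    have h2 := mul_lt_mul_of_pos_right h (show 0 < (1 + r ^ 2) ^ 2 by positivity)
    nlinarith
  have hpr : r ^ 2 < p ∧ p * r ^ 2 < 1 := by
    rcases (mul_pos_iff.1 hprod) with ⟨h1, h2⟩ | ⟨h1, h2⟩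
    · exact ⟨by linarith, by linarith⟩
    · exfalso
      nlinarith [sq_nonneg r, sq_nonneg m]
  have h1r : 0 < 1 - r ^ 2 := by linarith
  -- Adding the first and the last equation gives k(1 + p) = 4(1 + r²); then l follows from the
  -- first.
  refine ⟨r, (4 * (1 + r ^ 2) / (1 + p) - 4 * r ^ 2) / (1 - r ^ 2), 4 * (1 + r ^ 2) / (1 + p),
    hr1, ?_, ?_, by positivity, ?_, ?_, ?_⟩
  · refine div_pos ?_ h1r
    rw [sub_pos, lt_div_iff₀ hp]
    nlinarith
  · rw [div_lt_iff₀ h1r, sub_lt_iff_lt_add, div_lt_iff₀ hp]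
    nlinarith
  · field_simp; ring
  · field_simp
    linear_combination 8 * hrm
  · field_simp; ring

theorem exists_kap_eq {l : ℝ} (h0 : 0 < l) (h4 : l < 4) :
    ∃ μ : ℂ, ‖μ‖ = 1 ∧ μ ≠ 1 ∧ μ ≠ -1 ∧ kap μ = l := by
  have h1 : 0 ≤ 1 - (l / 2 - 1) ^ 2 := by nlinarith
  refine ⟨⟨l / 2 - 1, √(1 - (l / 2 - 1) ^ 2)⟩, ?_, fun h => ?_, fun h => ?_, ?_⟩
  · rw [Complex.norm_def, Real.sqrt_eq_one, Complex.normSq_mk, Real.mul_self_sqrt h1]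
    ring
  · have := congrArg Complex.re h
    simp only [Complex.one_re] at this
    linarith
  · have := congrArg Complex.re h
    simp only [Complex.neg_re, Complex.one_re] at this
    linarith
  · rw [kap]; ring

/-- The matrix of the conjugate of `g₁'(μ)` by a boost. -/
def boostPoly (μ : ℂ) (r k : ℝ) : QPoly :=
  ⟨0, Polynomial.C (-2) * (1 + Polynomial.C r * Polynomial.X), Polynomial.C ((1 + μ.re) * k),
    Polynomial.C (-μ.im * k)⟩

theorem boost_algebra {K : Type*} [Field K] {T t G GT Z D k u i a b : K} (hk : k ≠ 0)
    (hT : T * u = k * t) (hG : GT * u = k * G) (hZ : (1 - Z) * u ^ 2 = k ^ 2 * D)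
    (h : GT * (a * T + 2 * i) = -2 * i * T + b * (1 - Z)) :
    G * (a * k * t + 2 * i * u) = -2 * i * u * t + b * k * D := by
  refine mul_left_cancel₀ hk ?_
  linear_combination u ^ 2 * h - GT * u * a * hT - (a * k * t + 2 * i * u) * hG +
    (-2 * i * u) * hT + b * hZ

theorem boost_base_algebra {K : Type*} [Field K] {Z z w r : K} (hr : 1 - r ^ 2 ≠ 0)
    (h : Z * (1 + r * z) = z + r) (h' : Z * (1 + r * w) = w + r) : w = z := by
  have h1 : Z * r - 1 ≠ 0 := fun h0 => hr (by linear_combination r * h - (1 + r * z) * h0)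
  exact mul_left_cancel₀ h1 (by linear_combination h' - h)

/-- The conjugated map fixes z because the translation is injective on the base. The matrix comes
from substituting the translated t and z into the formula of g and clearing 1 + rz; the identity 1 -
h(z)² = k²(1 - z²)/(1 + rz)² removes the remaining denominators. -/
theorem boostPoly_acts {μ : ℂ} (hμ : ‖μ‖ = 1) {r k : ℝ} (hr : |r| < 1) (hk : k ^ 2 = 1 - r ^ 2)
    {g h : Bir} (hg : IsG₁' μ g)
    (ht : baseChange h tC * (1 + const r * zC) = const k * tC)
    (hz : baseChange h zC * (1 + const r * zC) = zC + const r) :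
    (boostPoly μ r k).Acts (h * g * h⁻¹) := by
  have hr2 : r ^ 2 < 1 := (sq_lt_one_iff_abs_lt_one r).2 hr
  have hk0 : k ≠ 0 := by rintro rfl; norm_num at hk; linarith
  have hkc : const (k : ℂ) ≠ 0 := const_ne_zero (by exact_mod_cast hk0)
  have hkk : const (k : ℂ) ^ 2 = 1 - const (r : ℂ) ^ 2 := by
    rw [← const_pow, ← const_pow, ← const_one, ← const_sub]
    congr 1
    exact_mod_cast hk
  have hconj : ∀ w, baseChange (h * g * h⁻¹) (baseChange h w) = baseChange h (baseChange g w) :=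
    fun w => by rw [baseChange_mul, baseChange_mul, baseChange_inv_apply]
  obtain ⟨hgz, hgt⟩ := (isG₁'_iff_acts hμ).1 hg
  rw [g₁Poly_a, g₁Poly_b] at hgt
  have hz' := congrArg (baseChange (h * g * h⁻¹)) hz
  have ht' := congrArg (baseChange (h * g * h⁻¹)) ht
  simp only [map_mul, map_add, map_one, hconj, baseChange_const, hgz] at hz' ht'
  have hfix := boost_base_algebra (by rw [← hkk]; exact pow_ne_zero 2 hkc) hz hz'
  rw [hfix] at ht'
  have h1 := congrArg (baseChange h) hgt
  simp only [map_mul, map_add, map_one, map_neg, map_sub, map_pow, map_ofNat, baseChange_const,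
    conjL_const, Complex.conj_I, Complex.conj_conj, const_neg] at h1
  refine ⟨hfix, ?_⟩
  have ea : cz (boostPoly μ r k).a₁ (boostPoly μ r k).a₂ =
      -2 * const Complex.I * (1 + const r * zC) := by
    simp only [boostPoly, cz, rz_mul, rz_add, rz_zero, rz_one, rz_X, rz_C]
    push_cast
    rw [const_neg, const_two]
    ring
  have eb : cz (boostPoly μ r k).b₁ (boostPoly μ r k).b₂ =
      (1 + const (starRingEnd ℂ μ)) * const k := by
    rw [← g₁Poly_b]
    simp only [boostPoly, g₁Poly, cz, rz_C]
    push_cast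
    simp only [const_mul]
    ring
  rw [ea, eb]
  simp only [map_mul, map_add, map_one, map_neg, map_ofNat, conjL_const, conjL_zC,
    Complex.conj_I, Complex.conj_conj, Complex.conj_ofReal, const_neg]
  have h2 := boost_algebra (a := 1 + const μ) (b := 1 + const (starRingEnd ℂ μ))
    (i := const Complex.I) (Z := baseChange h zC ^ 2) (D := 1 - zC ^ 2) hkc ht ht'
    (by
      rw [sub_mul, ← mul_pow, hz, hkk]
      ring) (by linear_combination h1)
  linear_combination h2

theorem boostPoly_norm {μ : ℂ} (hμ : ‖μ‖ = 1) {r k : ℝ} (hk : k ^ 2 = 1 - r ^ 2) :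
    (boostPoly μ r k).norm = Polynomial.C 4 * (1 + Polynomial.C r * Polynomial.X) ^ 2 -
      Polynomial.C (kap μ * (1 - r ^ 2)) * (1 - Polynomial.X ^ 2) := by
  have h1 : Polynomial.C ((1 + μ.re) * k) ^ 2 + Polynomial.C (-μ.im * k) ^ 2 =
      Polynomial.C (kap μ * (1 - r ^ 2)) := by
    rw [← Polynomial.C_pow, ← Polynomial.C_pow, ← Polynomial.C_add, ← hk, kap]
    congr 1
    linear_combination k ^ 2 * re_sq_add_im_sq hμ
  have h2 : (Polynomial.C (-2) : Polynomial ℝ) ^ 2 = Polynomial.C 4 := by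
    rw [← Polynomial.C_pow]; norm_num
  simp only [QPoly.norm, boostPoly]
  rw [h1, mul_pow, h2]
  ring

/-- The norm of g is a positive definite quadratic times a square, and that quadratic is up to a
constant the norm of a boosted `g₁'(μ)`. Maps with such norms are conjugate over the base. -/
theorem exists_conj_isG₁' {g : Bir} (hg : g ∈ autRealOverPi) (h2 : orderOf g = 2)
    (hI : IsRationalCurve (fixIdeal g)) (hR : HasNoRealPoint (fixIdeal g)) :
    ∃ μ : ℂ, ‖μ‖ = 1 ∧ μ ≠ 1 ∧ μ ≠ -1 ∧ ∃ g₁ : Bir, IsG₁' μ g₁ ∧ ConjInAutRealPi g g₁ := by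
  have hgg : g * g = 1 := by rw [← sq, ← h2]; exact pow_orderOf_eq_one g
  have hg1 : g ≠ 1 := by
    rintro rfl
    simp at h2
  obtain ⟨q, h0, hn, hq, u, v, w, hb⟩ :=
    exists_qPoly_of_involution (baseChange_zC_eq_iff.2 hg.2) hgg hg1
  obtain ⟨m, p, e, hmp, hd⟩ := hq.exists_norm_eq h0 hn hI hR
  have hdpos : ∀ x, 0 < (Polynomial.X ^ 2 - Polynomial.C (2 * m) * Polynomial.X +
      Polynomial.C p).eval x := fun x => by
    simp only [Polynomial.eval_add, Polynomial.eval_sub, Polynomial.eval_mul, Polynomial.eval_pow,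
      Polynomial.eval_X, Polynomial.eval_C]
    nlinarith [sq_nonneg (x - m)]
  have hpos : ∀ r ∈ Set.Icc (-1 : ℝ) 1, 0 < q.norm.eval r := fun r hr =>
    lt_of_le_of_ne (QPoly.norm_nonneg hq h0 hR r)
      (hq.norm_ne_zero h0 hg.1.1 hb hd (fun x => (hdpos x).ne') hr).symm
  obtain ⟨r, l, k, hr, hl0, hl4, hk, e1, e2, e3⟩ := exists_branch_parameters hmp
  obtain ⟨μ, hμ, hμ1, hμm1, hkap⟩ := exists_kap_eq hl0 hl4
  have hr2 : r ^ 2 < 1 := (sq_lt_one_iff_abs_lt_one r).2 hr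
  have hκ : √(1 - r ^ 2) ^ 2 = 1 - r ^ 2 := Real.sq_sqrt (by linarith)
  obtain ⟨g₁, -, hg₁⟩ := exists_isG₁' hμ hμ1
  obtain ⟨h, hh, ht, hz⟩ := exists_boost hr hκ
  have hacts := boostPoly_acts hμ hr hκ hg₁ ht hz
  have hnorm : (boostPoly μ r √(1 - r ^ 2)).norm = Polynomial.C k *
      (Polynomial.X ^ 2 - Polynomial.C (2 * m) * Polynomial.X + Polynomial.C p) := by
    rw [boostPoly_norm hμ hκ, hkap]
    have f1 := congrArg (Polynomial.C : ℝ → Polynomial ℝ) e1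
    have f2 := congrArg (Polynomial.C : ℝ → Polynomial ℝ) e2
    have f3 := congrArg (Polynomial.C : ℝ → Polynomial ℝ) e3
    simp only [Polynomial.C_add, Polynomial.C_sub, Polynomial.C_mul, Polynomial.C_pow,
      Polynomial.C_1, Polynomial.C_neg] at f1 f2 f3 ⊢
    have c8 : (Polynomial.C 8 : Polynomial ℝ) = 2 * Polynomial.C 4 := by
      rw [← Polynomial.C_ofNat, ← Polynomial.C_mul]; norm_num
    rw [c8] at f2
    linear_combination Polynomial.X ^ 2 * f1 + Polynomial.X * f2 + f3
  -- The boosted involution has norm k times the quadratic, so the square root of the ratio of norms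
  -- is e/√k.
  obtain ⟨j, hj, hjg⟩ := QPoly.exists_conj_of_norm_eq hq hacts h0 rfl
    (c := Polynomial.C (1 / √k) * e) (by
      have : Polynomial.C (1 / √k) ^ 2 * Polynomial.C k = 1 := by
        rw [← Polynomial.C_pow, ← Polynomial.C_mul, div_pow, Real.sq_sqrt hk.le,
          one_pow, one_div_mul_cancel hk.ne', Polynomial.C_1]
      rw [hnorm, hd]
      linear_combination -(Polynomial.X ^ 2 - Polynomial.C (2 * m) * Polynomial.X +
        Polynomial.C p) * e ^ 2 * this) hpos
  refine ⟨μ, hμ, hμ1, hμm1, g₁, hg₁, h⁻¹ * j, mul_mem (inv_mem hh) hj.1, ?_⟩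
  have : h⁻¹ * j * g * (h⁻¹ * j)⁻¹ = h⁻¹ * (j * g * j⁻¹) * h := by group
  rw [this, hjg]
  group

end

end SphereBir

theorem mainTheorem11 :
    (∀ μ : ℂ, ‖μ‖ = 1 → μ ≠ 1 → μ ≠ -1 →
      ∃ g₁ g₂ : Bir,
        (∀ g : Bir, IsDelPezzoG₁ μ g ↔ g = g₁) ∧
        (∀ g : Bir, IsDelPezzoG₂ μ g ↔ g = g₂) ∧
        (∀ g : Bir, IsG₁' μ g ↔ g = g₁) ∧
        (∀ g : Bir, IsG₂' μ g ↔ g = g₂) ∧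
        orderOf g₁ = 2 ∧ orderOf g₂ = 2 ∧
        g₁ ∈ autRealOverPi ∧
        g₂ ∈ autRealPi ∧ g₂ ∉ autRealOverPi ∧
        ∃ c ∈ autReal, IsDelPezzoAut μ c ∧
          Carries c (conicBundle μ 0 0) (conicBundle μ 0 1) ∧
          Carries c (conicBundle μ 0 1) (conicBundle μ 0 0) ∧
          c * g₁ * c⁻¹ = g₂) ∧
    (∀ μ μ' : ℂ, ‖μ‖ = 1 → μ ≠ 1 → μ ≠ -1 → ‖μ'‖ = 1 → μ' ≠ 1 → μ' ≠ -1 →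
      ∀ g₁ g₁' g₂ g₂' : Bir, IsG₁' μ g₁ → IsG₁' μ' g₁' → IsG₂' μ g₂ → IsG₂' μ' g₂' →
        List.TFAE [ConjInAutRealPi g₁ g₁', ConjInAutRealPi g₂ g₂', μ' = μ ∨ μ' = μ⁻¹]) ∧
    (∀ g ∈ autRealOverPi, orderOf g = 2 →
      IsRationalCurve (fixIdeal g) → HasNoRealPoint (fixIdeal g) →
        ∃ μ : ℂ, ‖μ‖ = 1 ∧ μ ≠ 1 ∧ μ ≠ -1 ∧
          ∃ g₁ : Bir, IsG₁' μ g₁ ∧ ConjInAutRealPi g g₁) := by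
  refine ⟨fun μ hμ h1 hm1 => exists_automorphisms hμ h1 hm1,
    fun μ μ' hμ h1 hm1 hμ' h1' hm1' g₁ g₁' g₂ g₂' hg₁ hg₁' hg₂ hg₂' =>
      conj_tfae hμ h1 hm1 hμ' h1' hm1' hg₁ hg₁' hg₂ hg₂',
    fun g hg h2 hI hR => exists_conj_isG₁' hg h2 hI hR⟩
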